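/- **Setting.** Let $K$ be a compact Lie group with Lie algebra $\mathfrak k$ and a non-degenerate $\mathrm{Ad}$-invariant symmetric bilinear form $\langle\cdot,\cdot\rangle$ on $\mathfrak k$. Let $(e_i)$ be a basis of $\mathfrak k$ and $(e^i)$ the dual basis for the form ($e^i=e_i$ if $(e_i)$ is orthonormal), let $x^L,x^R$ be the left- and right-invariant vector fields with value $x\in\mathfrak k$ at the identity, let $x_M(m)=\frac{d}{dt}|_{t=0}\exp(-tx)\cdot m$ on a $K$-manifold $M$, and let $\phi=\frac1{12}\sum\langle e_i,[e_j,e_k]\rangle\,e^i\wedge e^j\wedge e^k\in\bigwedge^3\mathfrak k$, with induced trivector field $\phi_M$. A *Hamiltonian quasi-Poisson $K$-manifold* $(M,P,\phi_M,\mu)$ is a $K$-manifold with a $K$-invariant bivector field $P$ such that $[P,P]=\phi_M$ and a smooth map $\mu:M\to K$, equivariant for conjugation, such that $P(d(f\circ\mu),\cdot)=\sum_i\tfrac12\big((e_i^L+e_i^R)f\big)(\mu)\,(e^i)_M$ for all smooth $f$ on $K$. A *Hamiltonian Poisson $K$-manifold* $(N,P_0,\nu)$ is a $K$-manifold with a $K$-invariant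 bivector field $P_0$ such that $[P_0,P_0]=0$ and a smooth $\mathrm{Ad}$-equivariant map $\nu:N\to\mathfrak k\cong\mathfrak k^*$ with $P_0(d\langle\nu,x\rangle,\cdot)=x_N$ for all $x\in\mathfrak k$. Here $M$ and $N$ are finite-dimensional manifolds without boundary. Let $\mathcal K=(K\times\mathbb R^*)\sqcup(\mathfrak k\times\{0\})$ be the deformation to the normal cone of $1\in K$, a smooth manifold with projection $\pi_{\mathcal K}:\mathcal K\to\mathbb R$, with $K$ acting by conjugation on $K$ and by $\mathrm{Ad}$ on $\mathfrak k$. A *Poisson deformation* of $(M,P,\phi_M,\mu)$ to $(N,P_0,\nu)$ is a smooth $K$-manifold $Q$ with boundary, with a $K$-invariant smooth submersion $\pi:Q\to[0,1]$ such that $\partial Q$ lies over $\{0,1\}$, a smooth $K$-equivariant map $\tilde\mu:Q\to\mathcal K$ with $\pi_{\mathcal K}\circ\tilde\mu=\pi$, and smooth sections $\tilde P$ of $\bigwedge^2\ker d\pi$ and $\tilde\phi$ of $\bigwedge^3\ker d\pi$, such that for every $t\in(0,1]$ there is a $K$-equivariant diffeomorphism $M\to\pi^{-1}(t)$ carrying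 $(tP,t^2\phi_M,\mu)$ to the restriction of $(\tilde P,\tilde\phi,\tilde\mu)$, there is a $K$-equivariant diffeomorphism $N\to\pi^{-1}(0)$ carrying $(P_0,\nu)$ to the restriction of $(\tilde P,\tilde\mu)$, and $\tilde\phi=0$ on $\pi^{-1}(0)$. Let $G,H,H_1,H_2$ be compact Lie groups with such forms; products of groups carry the direct sum forms. Let $\psi=\frac12\sum_i e_i^1\wedge e^{i,2}\in\bigwedge^2(\mathfrak g\oplus\mathfrak g)$, where $(e_i)$, $(e^i)$ are dual bases of $\mathfrak g$ and the upper indices $1,2$ denote the two copies of $\mathfrak g$. **Theorem.** (1) *Internal fusion.* Let $(Q,\pi,\tilde P,\tilde\phi,\tilde\mu)$ be a Poisson deformation of a Hamiltonian quasi-Poisson $G\times G\times H$-manifold $(M,P,\phi_M,(\mu_1,\mu_2,\mu_3))$ to a Hamiltonian Poisson $G\times G\times H$-manifold $(N,P_0,(\nu_1,\nu_2,\nu_3))$. Let $G\times H$ act through $(g,h)\mapsto(g,g,h)$. Then $(M,P-\psi_M,(\mu_1\mu_2,\mu_3))$ is a Hamiltonian quasi-Poisson $G\times H$-manifold, $(N,P_0,(\nu_1+\nu_2,\nu_3))$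 is a Hamiltonian Poisson $G\times H$-manifold, and the same space $Q$ with the same $\pi$, equipped with $$\hat P=\tilde P-\pi\,\psi_Q,\qquad \hat\phi=\pi^2\,(\phi_{G\times H})_Q,\qquad \hat\mu=(m(\tilde\mu_1,\tilde\mu_2),\tilde\mu_3),$$ is a Poisson deformation of the former to the latter. Here $\phi_{G\times H}$ is the Cartan trivector $\phi$ of $G\times H$, and $m$ is multiplication in $G$ over $t\neq0$ and addition in $\mathfrak g$ over $t=0$. (2) *Fusion products.* For $i=1,2$ let $X_i=(M_i,P_i,\mu_i)$ be a Hamiltonian quasi-Poisson $G\times H_i$-manifold that admits a Poisson deformation to a Hamiltonian Poisson $G\times H_i$-manifold $Y_i=(N_i,P_{0,i},\nu_i)$. Then the fusion product $M_1\circledast M_2$, which is the $G\times(H_1\times H_2)$-manifold obtained by internal fusion from the $G\times G\times(H_1\times H_2)$-manifold $(M_1\times M_2,P_1+P_2)$, admits a Poisson deformation to $(N_1\times N_2,P_{0,1}+P_{0,2})$, with $G$ acting diagonally and with the sum of the $G$-moment maps and the two $H_i$-moment maps as moment map. -/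

import Mathlib

universe u

open scoped Manifold ContDiff Topology

noncomputable section

namespace QuasiPoisson

open Set

/-! ### Lie groups with an invariant form, and the deformation space -/

section Group

variable {E H : Type*} [NormedAddCommGroup E] [NormedSpace ℝ E] [TopologicalSpace H]

instance finiteDimensional_tangentSpace {M : Type*} [TopologicalSpace M] [ChartedSpace H M]
    [FiniteDimensional ℝ E] (I : ModelWithCorners ℝ E H) (m : M) :
    FiniteDimensional ℝ (TangentSpace I m) :=
  inferInstanceAs (FiniteDimensional ℝ E)

section Form

variable (J : ModelWithCorners ℝ E H) {K : Type*} [TopologicalSpace K] [ChartedSpace H K] [Group K]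

/-- The adjoint action of `k ∈ K` on the Lie algebra `𝔨 = T₁K`. -/
def Ad (k : K) : GroupLieAlgebra J K →L[ℝ] GroupLieAlgebra J K :=
  mfderiv J J (fun a : K => k * a * k⁻¹) 1

variable (K) in
/-- A non-degenerate `Ad`-invariant symmetric bilinear form on the Lie algebra of `K`. -/
structure InvariantForm where
  form : LinearMap.BilinForm ℝ (GroupLieAlgebra J K)
  symm : ∀ x y, form x y = form y x
  nondegenerate : form.Nondegenerate
  invariant : ∀ (k : K) (x y : GroupLieAlgebra J K), form (Ad J k x) (Ad J k y) = form x y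

variable {J}

variable (J K) in
/-- A basis `(e_i)` of the Lie algebra. -/
def lieBasis [FiniteDimensional ℝ E] :
    Module.Basis (Fin (Module.finrank ℝ (GroupLieAlgebra J K))) ℝ (GroupLieAlgebra J K) :=
  Module.finBasis ℝ (GroupLieAlgebra J K)

/-- The basis `(e^i)` dual to `(e_i)` for the invariant form: `⟨e^i, e_j⟩ = δ_ij`. All the tensors
below are built from `∑ e_i ⊗ e^i`, which does not depend on the basis and equals `∑ e_i ⊗ e_i` for
an orthonormal basis. -/
def InvariantForm.dualBasis [FiniteDimensional ℝ E] (B : InvariantForm J K) :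
    Module.Basis (Fin (Module.finrank ℝ (GroupLieAlgebra J K))) ℝ (GroupLieAlgebra J K) :=
  B.form.dualBasis B.nondegenerate (lieBasis J K)

end Form

/-- The deformation space `𝒦 = 𝒟(K, {1}) = (K × ℝ*) ⊔ (𝔨 × {0})` (deformation to the normal cone of
the identity in `K`), as a set: `unit k t` is the point `(k, t)` with `t ≠ 0` and `lie x` is the
point `(x, 0)`. Its topology and smooth structure are given below. -/
inductive DefSpace (J : ModelWithCorners ℝ E H) (K : Type*) [TopologicalSpace K]
    [ChartedSpace H K] [Group K]
  | unit (k : K) (t : ℝ) (ht : t ≠ 0)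
  | lie (x : GroupLieAlgebra J K)

namespace DefSpace

variable (J : ModelWithCorners ℝ E H) {K : Type*} [TopologicalSpace K] [ChartedSpace H K] [Group K]

/-- The charts of `𝒦` over `t ≠ 0`: charts of `K × ℝ*`. -/
def chartUnit (k : K) : PartialEquiv (DefSpace J K) (E × ℝ) where
  toFun
    | unit a t _ => (extChartAt J k a, t)
    | lie _ => (0, 0)
  invFun p := if h : p.2 ≠ 0 then unit ((extChartAt J k).symm p.1) p.2 h else lie 0
  source := {p | ∃ a t ht, p = unit a t ht ∧ a ∈ (extChartAt J k).source}
  target := {p | p.1 ∈ (extChartAt J k).target ∧ p.2 ≠ 0}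
  map_source' := by
    rintro _ ⟨a, t, ht, rfl, ha⟩
    exact ⟨(extChartAt J k).map_source ha, ht⟩
  map_target' := by
    rintro ⟨x, t⟩ ⟨hx, ht⟩
    exact ⟨(extChartAt J k).symm x, t, ht, by simp at ht; simp [ht], (extChartAt J k).map_target hx⟩
  left_inv' := by
    rintro _ ⟨a, t, ht, rfl, ha⟩
    simp only [ne_eq, ht, not_false_eq_true, dite_true, (extChartAt J k).left_inv ha]
  right_inv' := by
    rintro ⟨x, t⟩ ⟨hx, ht⟩
    simp only [ne_eq] at ht hx
    simp only [ne_eq, ht, not_false_eq_true, dite_true, (extChartAt J k).right_inv hx]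

variable (K) in
/-- The chart of `𝒦` around the fibre `𝔨 × {0}`. With `χ` the preferred chart of `K` at `1`, whose
differential at `1` is the identity of `𝔨`, its inverse is `(x, t) ↦ (χ⁻¹ (χ 1 + t x), t)` for
`t ≠ 0` and `(x, 0) ↦ (x, 0)`. Any other chart centred at `1`, such as the inverse of the exponential
map, defines the same smooth structure. -/
def chartLie : PartialEquiv (DefSpace J K) (E × ℝ) where
  toFun
    | unit a t _ => (t⁻¹ • (extChartAt J (1 : K) a - extChartAt J (1 : K) 1), t)
    | lie x => (x, 0)
  invFun p :=
    if h : p.2 ≠ 0 then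
      unit ((extChartAt J (1 : K)).symm (extChartAt J (1 : K) 1 + p.2 • p.1)) p.2 h
    else lie p.1
  source := {p | ∀ a t ht, p = unit a t ht → a ∈ (extChartAt J (1 : K)).source}
  target := {p | extChartAt J (1 : K) 1 + p.2 • p.1 ∈ (extChartAt J (1 : K)).target}
  map_source' := by
    have h1 := mem_extChartAt_target (I := J) (1 : K)
    generalize extChartAt J (1 : K) = χ at *
    rintro (⟨a, t, ht⟩ | x) h
    · simpa [smul_smul, ht] using χ.map_source (h a t ht rfl)
    · have h0 : ∀ y : E, χ 1 + (0 : ℝ) • y ∈ χ.target := fun y => by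
        rwa [zero_smul, add_zero]
      exact h0 x
  map_target' := by
    rintro ⟨x, t⟩ hx a s hs h
    by_cases ht : t = 0
    · simp [ht] at h
    · simp only [ne_eq, ht, not_false_eq_true, dite_true, unit.injEq] at h
      rw [← h.1]
      exact (extChartAt J (1 : K)).map_target hx
  left_inv' := by
    generalize extChartAt J (1 : K) = χ at *
    rintro (⟨a, t, ht⟩ | x) h
    · have := χ.left_inv (h a t ht rfl)
      simp [smul_smul, ht, this]
    · simp
  right_inv' := by
    generalize extChartAt J (1 : K) = χ at *
    rintro ⟨x, t⟩ hx
    by_cases ht : t = 0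
    · simp [ht]
    · simp only [mem_ofPred_eq] at hx
      simp [ht, χ.right_inv hx, smul_smul]

variable (K) in
/-- The atlas of `𝒦`. -/
def charts : Set (PartialEquiv (DefSpace J K) (E × ℝ)) :=
  insert (chartLie J K) (range (chartUnit J))

/-- The coordinate changes of `𝒦` are smooth. -/
lemma chart_compat [J.Boundaryless] [IsManifold J ∞ K]
    {e e' : PartialEquiv (DefSpace J K) (E × ℝ)} (he : e ∈ charts J K) (he' : e' ∈ charts J K) :
    IsOpen (e.symm.trans e').source ∧
      ContDiffOn ℝ ∞ (e.symm.trans e') (e.symm.trans e').source := by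
  have hne : IsOpen {p : E × ℝ | p.2 ≠ 0} := isOpen_ne_fun continuous_snd continuous_const
  have hO : ∀ k k' : K, IsOpen ((extChartAt J k).symm.trans (extChartAt J k')).source := by
    intro k k'
    exact (continuousOn_extChartAt_symm k).isOpen_inter_preimage
      (isOpen_extChartAt_target k) (isOpen_extChartAt_source k')
  have hC : ∀ k k' : K, ContDiffOn ℝ ∞ (fun x => extChartAt J k' ((extChartAt J k).symm x))
      ((extChartAt J k).symm.trans (extChartAt J k')).source :=
    fun k k' => contDiffOn_ext_coord_change k' k
  have hs : ContDiff ℝ ∞ (fun p : E × ℝ => extChartAt J (1 : K) 1 + p.2 • p.1) :=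
    contDiff_const.add (contDiff_snd.smul contDiff_fst)
  rcases he with rfl | ⟨k, rfl⟩ <;> rcases he' with rfl | ⟨k', rfl⟩
  · have hsrc : ((chartLie J K).symm.trans (chartLie J K)).source = (chartLie J K).target := by
      ext p
      simp only [PartialEquiv.trans_source, PartialEquiv.symm_source, mem_inter_iff, mem_preimage,
        and_iff_left_iff_imp]
      exact fun hp => (chartLie J K).map_target hp
    rw [hsrc]
    refine ⟨(isOpen_extChartAt_target (1 : K)).preimage hs.continuous, ?_⟩
    exact contDiffOn_id.congr fun p hp => (chartLie J K).right_inv hp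
  · have hsrc : ((chartLie J K).symm.trans (chartUnit J k')).source =
        {p | p.2 ≠ 0} ∩ (fun p : E × ℝ => extChartAt J (1 : K) 1 + p.2 • p.1) ⁻¹'
          ((extChartAt J (1 : K)).symm.trans (extChartAt J k')).source := by
      ext ⟨x, t⟩
      by_cases ht : t = 0 <;>
        simp [chartLie, chartUnit, PartialEquiv.trans_source, ht]
    rw [hsrc]
    refine ⟨hne.inter ((hO 1 k').preimage hs.continuous), ?_⟩
    refine ContDiffOn.congr (f := fun p : E × ℝ => (extChartAt J k' ((extChartAt J (1 : K)).symm
      (extChartAt J (1 : K) 1 + p.2 • p.1)), p.2)) (((hC 1 k').comp hs.contDiffOn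
        fun p hp => hp.2).prodMk contDiff_snd.contDiffOn) ?_
    rintro ⟨x, t⟩ ⟨ht, -⟩
    simp only [mem_ofPred_eq] at ht
    simp only [PartialEquiv.coe_trans, Function.comp_apply, chartLie, chartUnit,
      PartialEquiv.coe_symm_mk]
    simp only [ne_eq, ht, not_false_eq_true, dite_true]
  · have hsrc : ((chartUnit J k).symm.trans (chartLie J K)).source =
        {p | p.2 ≠ 0} ∩ (fun p : E × ℝ => p.1) ⁻¹'
          ((extChartAt J k).symm.trans (extChartAt J (1 : K))).source := by
      ext ⟨x, t⟩
      by_cases ht : t = 0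
      · simp [chartLie, chartUnit, PartialEquiv.trans_source, ht]
      · simp only [PartialEquiv.trans_source, PartialEquiv.symm_source, chartUnit, chartLie,
          PartialEquiv.coe_symm_mk, mem_inter_iff, mem_preimage, mem_ofPred_eq, ne_eq, ht,
          not_false_eq_true, dite_true, and_true, true_and, unit.injEq]
        exact and_congr_right fun _ =>
          ⟨fun h => h _ t ht ⟨rfl, rfl⟩, fun h a s hs hh => hh.1 ▸ h⟩
    rw [hsrc]
    refine ⟨hne.inter ((hO k 1).preimage continuous_fst), ?_⟩
    refine ContDiffOn.congr (f := fun p : E × ℝ => (p.2⁻¹ • (extChartAt J (1 : K)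
      ((extChartAt J k).symm p.1) - extChartAt J (1 : K) 1), p.2))
      (ContDiffOn.prodMk (ContDiffOn.smul (contDiffOn_snd.inv fun p hp => hp.1)
        (((hC k 1).comp contDiff_fst.contDiffOn fun p hp => hp.2).sub contDiffOn_const))
          contDiff_snd.contDiffOn) ?_
    rintro ⟨x, t⟩ ⟨ht, -⟩
    simp only [mem_ofPred_eq] at ht
    simp only [PartialEquiv.coe_trans, Function.comp_apply, chartLie, chartUnit,
      PartialEquiv.coe_symm_mk]
    simp only [ne_eq, ht, not_false_eq_true, dite_true]
  · have hsrc : ((chartUnit J k).symm.trans (chartUnit J k')).source =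
        {p | p.2 ≠ 0} ∩ (fun p : E × ℝ => p.1) ⁻¹'
          ((extChartAt J k).symm.trans (extChartAt J k')).source := by
      ext ⟨x, t⟩
      by_cases ht : t = 0 <;>
        simp [chartUnit, PartialEquiv.trans_source, ht]
    rw [hsrc]
    refine ⟨hne.inter ((hO k k').preimage continuous_fst), ?_⟩
    refine ContDiffOn.congr (f := fun p : E × ℝ => (extChartAt J k'
      ((extChartAt J k).symm p.1), p.2)) (((hC k k').comp contDiff_fst.contDiffOn
        fun p hp => hp.2).prodMk contDiff_snd.contDiffOn) ?_
    rintro ⟨x, t⟩ ⟨ht, -⟩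
    simp only [mem_ofPred_eq] at ht
    simp only [PartialEquiv.coe_trans, Function.comp_apply, chartUnit, PartialEquiv.coe_symm_mk]
    simp only [ne_eq, ht, not_false_eq_true, dite_true]

section Manifold

variable [J.Boundaryless] [IsManifold J ∞ K]

variable (K) in
/-- The manifold structure on `𝒦`, from its atlas. -/
def core : ChartedSpaceCore (E × ℝ) (DefSpace J K) where
  atlas := charts J K
  chartAt
    | unit a _ _ => chartUnit J a
    | lie _ => chartLie J K
  mem_chart_source := by
    rintro (⟨a, t, ht⟩ | x)
    · exact ⟨a, t, ht, rfl, mem_extChartAt_source a⟩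
    · intro a t ht h
      cases h
  chart_mem_atlas := by
    rintro (⟨a, t, ht⟩ | x)
    · exact mem_insert_of_mem _ (mem_range_self a)
    · exact mem_insert _ _
  open_source _ _ he he' := (chart_compat J he he').1
  continuousOn_toFun _ _ he he' := (chart_compat J he he').2.continuousOn

instance : TopologicalSpace (DefSpace J K) := (core J K).toTopologicalSpace

instance : ChartedSpace (E × ℝ) (DefSpace J K) := (core J K).toChartedSpace

instance : IsManifold 𝓘(ℝ, E × ℝ) ∞ (DefSpace J K) := by
  refine isManifold_of_contDiffOn _ _ _ fun e e' he he' => ?_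
  obtain ⟨_, ⟨c, rfl⟩, _, ⟨hc, rfl⟩, rfl⟩ := he
  obtain ⟨_, ⟨c', rfl⟩, _, ⟨hc', rfl⟩, rfl⟩ := he'
  have h := (chart_compat J hc hc').2
  rw [modelWithCornersSelf_coe, modelWithCornersSelf_coe_symm, range_id, inter_univ, preimage_id,
    Function.id_comp, Function.comp_id]
  exact h

end Manifold

variable {J}

/-- The projection `π_𝒦 : 𝒦 → ℝ`. -/
def proj : DefSpace J K → ℝ
  | unit _ t _ => t
  | lie _ => 0

/-- The action of `K` on `𝒦`: conjugation on `K`, the adjoint action on `𝔨`. -/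
def adjoint (k : K) : DefSpace J K → DefSpace J K
  | unit a t ht => unit (k * a * k⁻¹) t ht
  | lie x => lie (Ad J k x)

end DefSpace

end Group

section Product

variable {E₁ H₁ K₁ E₂ H₂ K₂ : Type*}
  [NormedAddCommGroup E₁] [NormedSpace ℝ E₁] [TopologicalSpace H₁] {J₁ : ModelWithCorners ℝ E₁ H₁}
  [TopologicalSpace K₁] [ChartedSpace H₁ K₁] [Group K₁]
  [NormedAddCommGroup E₂] [NormedSpace ℝ E₂] [TopologicalSpace H₂] {J₂ : ModelWithCorners ℝ E₂ H₂}
  [TopologicalSpace K₂] [ChartedSpace H₂ K₂] [Group K₂]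

/-- The element `(x, y)` of the Lie algebra `𝔨₁ ⊕ 𝔨₂` of `K₁ × K₂`. -/
def lieMk (x : GroupLieAlgebra J₁ K₁) (y : GroupLieAlgebra J₂ K₂) :
    GroupLieAlgebra (J₁.prod J₂) (K₁ × K₂) :=
  ((x : E₁), (y : E₂))

/-- The projection `𝔨₁ ⊕ 𝔨₂ → 𝔨₁`. -/
def lieFst : GroupLieAlgebra (J₁.prod J₂) (K₁ × K₂) →ₗ[ℝ] GroupLieAlgebra J₁ K₁ :=
  LinearMap.fst ℝ E₁ E₂

/-- The projection `𝔨₁ ⊕ 𝔨₂ → 𝔨₂`. -/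
def lieSnd : GroupLieAlgebra (J₁.prod J₂) (K₁ × K₂) →ₗ[ℝ] GroupLieAlgebra J₂ K₂ :=
  LinearMap.snd ℝ E₁ E₂

lemma Ad_prod [LieGroup J₁ ∞ K₁] [LieGroup J₂ ∞ K₂] (k : K₁ × K₂)
    (v : GroupLieAlgebra (J₁.prod J₂) (K₁ × K₂)) :
    Ad (J₁.prod J₂) k v = lieMk (Ad J₁ k.1 (lieFst v)) (Ad J₂ k.2 (lieSnd v)) := by
  have h₁ : MDifferentiableAt J₁ J₁ (fun a : K₁ => k.1 * a * k.1⁻¹) 1 :=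
    (((contMDiff_const (I' := J₁) (n := ∞)).mul contMDiff_id).mul
      contMDiff_const).mdifferentiable (by simp) 1
  have h₂ : MDifferentiableAt J₂ J₂ (fun a : K₂ => k.2 * a * k.2⁻¹) 1 :=
    (((contMDiff_const (I' := J₂) (n := ∞)).mul contMDiff_id).mul
      contMDiff_const).mdifferentiable (by simp) 1
  have h := mfderiv_prodMap (p := (1 : K₁ × K₂)) h₁ h₂
  exact congrArg (fun L : E₁ × E₂ →L[ℝ] E₁ × E₂ => L v) h

/-- The form `⟨·,·⟩₁ ⊕ ⟨·,·⟩₂` on the Lie algebra of `K₁ × K₂`. -/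
def InvariantForm.prod [LieGroup J₁ ∞ K₁] [LieGroup J₂ ∞ K₂] (B₁ : InvariantForm J₁ K₁)
    (B₂ : InvariantForm J₂ K₂) : InvariantForm (J₁.prod J₂) (K₁ × K₂) where
  form := B₁.form.compl₁₂ lieFst lieFst + B₂.form.compl₁₂ lieSnd lieSnd
  symm x y := by
    simp only [LinearMap.add_apply, LinearMap.compl₁₂_apply, B₁.symm (lieFst x), B₂.symm (lieSnd x)]
  nondegenerate := by
    constructor
    · intro x hx
      refine Prod.ext (B₁.nondegenerate.1 (lieFst x) fun y => ?_)
        (B₂.nondegenerate.1 (lieSnd x) fun y => ?_)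
      · have h : B₁.form (lieFst x) y + B₂.form (lieSnd x) 0 = 0 := hx (lieMk y 0)
        rwa [map_zero, add_zero] at h
      · have h : B₁.form (lieFst x) 0 + B₂.form (lieSnd x) y = 0 := hx (lieMk 0 y)
        rwa [map_zero, zero_add] at h
    · intro x hx
      refine Prod.ext (B₁.nondegenerate.2 (lieFst x) fun y => ?_)
        (B₂.nondegenerate.2 (lieSnd x) fun y => ?_)
      · have h : B₁.form y (lieFst x) + B₂.form 0 (lieSnd x) = 0 := hx (lieMk y 0)
        rwa [map_zero, LinearMap.zero_apply, add_zero] at h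
      · have h : B₁.form 0 (lieFst x) + B₂.form y (lieSnd x) = 0 := hx (lieMk 0 y)
        rwa [map_zero, LinearMap.zero_apply, zero_add] at h
  invariant k x y := by
    rw [Ad_prod, Ad_prod]
    change B₁.form (Ad J₁ k.1 (lieFst x)) (Ad J₁ k.1 (lieFst y)) +
      B₂.form (Ad J₂ k.2 (lieSnd x)) (Ad J₂ k.2 (lieSnd y)) = _
    rw [B₁.invariant, B₂.invariant]
    rfl

end Product

/-! ### Multivector fields -/

section MultiVector

variable {E H M : Type*} [NormedAddCommGroup E] [NormedSpace ℝ E] [TopologicalSpace H]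
  [TopologicalSpace M] [ChartedSpace H M]
  {E' H' M' : Type*} [NormedAddCommGroup E'] [NormedSpace ℝ E'] [TopologicalSpace H']
  [TopologicalSpace M'] [ChartedSpace H' M']

/-- The cotangent space `T*_m M`. -/
abbrev Covector (I : ModelWithCorners ℝ E H) (m : M) := TangentSpace I m →L[ℝ] ℝ

/-- `⋀^k T_m M`, as the space of alternating `k`-linear forms on `T*_m M`. -/
abbrev MultiVector (I : ModelWithCorners ℝ E H) (k : ℕ) (m : M) :=
  Covector I m [⋀^Fin k]→ₗ[ℝ] ℝ

/-- The differential of a function. -/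
def differential (I : ModelWithCorners ℝ E H) (f : M → ℝ) (m : M) : Covector I m :=
  mfderiv I 𝓘(ℝ, ℝ) f m

variable {I : ModelWithCorners ℝ E H} {I' : ModelWithCorners ℝ E' H'}

/-- `v₁ ∧ ⋯ ∧ v_k`, with `(v₁ ∧ ⋯ ∧ v_k)(α₁, …, α_k) = det (α_i (v_j))`. -/
def wedge {k : ℕ} {m : M} (v : Fin k → TangentSpace I m) : MultiVector I k m :=
  (Matrix.detRowAlternating (R := ℝ) (n := Fin k)).compLinearMap
    { toFun := fun α j => α (v j)
      map_add' := fun _ _ => rfl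
      map_smul' := fun _ _ => rfl }

/-- The map on multivectors induced by a linear map of tangent spaces:
`(L_* P)(α₁, …) = P(α₁ ∘ L, …)`. -/
def pushforward {k : ℕ} {m : M} {m' : M'} (L : TangentSpace I m →L[ℝ] TangentSpace I' m')
    (P : MultiVector I k m) : MultiVector I' k m' :=
  P.compLinearMap
    { toFun := fun α : Covector I' m' => α.comp L
      map_add' := fun _ _ => rfl
      map_smul' := fun _ _ => rfl }

/-- Smoothness of a multivector field: its values on the differentials of smooth functions are
smooth functions. -/
def IsSmoothField {k : ℕ} (P : ∀ m : M, MultiVector I k m) : Prop :=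
  ∀ f : Fin k → M → ℝ, (∀ i, ContMDiff I 𝓘(ℝ, ℝ) ∞ (f i)) →
    ContMDiff I 𝓘(ℝ, ℝ) ∞ (fun m => P m (fun i => differential I (f i) m))

/-- The bracket `{f, g} = P(df, dg)`. -/
def bracket (P : ∀ m : M, MultiVector I 2 m) (f g : M → ℝ) (m : M) : ℝ :=
  P m ![differential I f m, differential I g m]

/-- `T` is the Schouten bracket `[P, P]` of a bivector field `P`, that is
`½ [P, P](df, dg, dh) = {f, {g, h}} + {g, {h, f}} + {h, {f, g}}`. The normalisation is that of
`[u ∧ v, x ∧ y] = [u, x] ∧ v ∧ y - [u, y] ∧ v ∧ x - [v, x] ∧ u ∧ y + [v, y] ∧ u ∧ x`. -/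
def IsSchoutenSquare (P : ∀ m : M, MultiVector I 2 m) (T : ∀ m : M, MultiVector I 3 m) : Prop :=
  ∀ f g h : M → ℝ, ContMDiff I 𝓘(ℝ, ℝ) ∞ f → ContMDiff I 𝓘(ℝ, ℝ) ∞ g →
    ContMDiff I 𝓘(ℝ, ℝ) ∞ h → ∀ m,
      T m ![differential I f m, differential I g m, differential I h m] =
        2 * (bracket P f (bracket P g h) m + bracket P g (bracket P h f) m +
          bracket P h (bracket P f g) m)

end MultiVector

/-! ### Actions -/

section Action

variable {E H K : Type*} [NormedAddCommGroup E] [NormedSpace ℝ E] [TopologicalSpace H]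
  {J : ModelWithCorners ℝ E H} [TopologicalSpace K] [ChartedSpace H K] [Group K]
  {F H' M : Type*} [NormedAddCommGroup F] [NormedSpace ℝ F] [TopologicalSpace H']
  {I : ModelWithCorners ℝ F H'} [TopologicalSpace M] [ChartedSpace H' M]

/-- A smooth left action of `K` on `M`. -/
structure SmoothAction (J : ModelWithCorners ℝ E H) (K : Type*) [TopologicalSpace K]
    [ChartedSpace H K] [Group K] (I : ModelWithCorners ℝ F H') (M : Type*) [TopologicalSpace M]
    [ChartedSpace H' M] where
  act : K → M → M
  one_act : ∀ m, act 1 m = m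
  mul_act : ∀ k l m, act (k * l) m = act k (act l m)
  smooth : ContMDiff (J.prod I) I ∞ (fun p : K × M => act p.1 p.2)

/-- The fundamental vector field `x_M(m) = d/dt|₀ exp(-tx) · m`. -/
def SmoothAction.fundamental (A : SmoothAction J K I M) (x : GroupLieAlgebra J K) (m : M) :
    TangentSpace I m :=
  -(show F from mfderiv J I (fun k => A.act k m) 1 x)

variable [FiniteDimensional ℝ E]

/-- The trivector field `φ_M` of the Cartan trivector
`φ = (1/12) ∑ ⟨e_i, [e_j, e_k]⟩ e^i ∧ e^j ∧ e^k ∈ ⋀³ 𝔨`. -/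
def cartanField (B : InvariantForm J K) (A : SmoothAction J K I M) (m : M) : MultiVector I 3 m :=
  (1 / 12 : ℝ) • ∑ i, ∑ j, ∑ k,
    B.form (lieBasis J K i) ⁅lieBasis J K j, lieBasis J K k⁆ •
      wedge ![A.fundamental (B.dualBasis i) m, A.fundamental (B.dualBasis j) m,
        A.fundamental (B.dualBasis k) m]

/-- For a covector `ξ` at `k ∈ K`, the element `½ ∑ ξ(e_i^L + e_i^R) e^i` of `𝔨`, where `x^L` and
`x^R` are the left- and right-invariant vector fields with value `x` at the identity. -/
def InvariantForm.momentVector (B : InvariantForm J K) (k : K) (ξ : Covector J k) :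
    GroupLieAlgebra J K :=
  ∑ i, ((1 / 2 : ℝ) * (ξ (mfderiv J J (fun a : K => k * a) 1 (lieBasis J K i)) +
    ξ (mfderiv J J (fun a : K => a * k) 1 (lieBasis J K i)))) • B.dualBasis i

end Action

/-! ### Hamiltonian quasi-Poisson and Hamiltonian Poisson manifolds -/

section Hamiltonian

variable {E H K : Type*} [NormedAddCommGroup E] [NormedSpace ℝ E] [TopologicalSpace H]
  {J : ModelWithCorners ℝ E H} [TopologicalSpace K] [ChartedSpace H K] [Group K]
  {F H' M : Type*} [NormedAddCommGroup F] [NormedSpace ℝ F] [TopologicalSpace H']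
  {I : ModelWithCorners ℝ F H'} [TopologicalSpace M] [ChartedSpace H' M]

/-- The data `(P, μ)` on a `K`-manifold `M` of a Hamiltonian quasi-Poisson `K`-manifold. -/
structure QPSpace (J : ModelWithCorners ℝ E H) (K : Type*) [TopologicalSpace K]
    [ChartedSpace H K] [Group K] (I : ModelWithCorners ℝ F H') (M : Type*) [TopologicalSpace M]
    [ChartedSpace H' M] where
  action : SmoothAction J K I M
  bivector : ∀ m : M, MultiVector I 2 m
  moment : M → K

/-- The data `(P₀, ν)` on a `K`-manifold of a Hamiltonian Poisson `K`-manifold; the moment map takes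
values in `𝔨`, identified with `𝔨*` by the invariant form. -/
structure PSpace (J : ModelWithCorners ℝ E H) (K : Type*) [TopologicalSpace K]
    [ChartedSpace H K] [Group K] (I : ModelWithCorners ℝ F H') (M : Type*) [TopologicalSpace M]
    [ChartedSpace H' M] where
  action : SmoothAction J K I M
  bivector : ∀ m : M, MultiVector I 2 m
  moment : M → GroupLieAlgebra J K

/-- `(M, P, φ_M, μ)` is a Hamiltonian quasi-Poisson `K`-manifold: `P` is a `K`-invariant bivector
field with `[P, P] = φ_M`, and `μ : M → K` is a smooth map, equivariant for conjugation, with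
`P^♯(μ^* ξ) = (½ ∑ ξ(e_i^L + e_i^R) e^i)_M` for all covectors `ξ` of `K`. -/
structure QPSpace.IsHamiltonian [FiniteDimensional ℝ E] (B : InvariantForm J K)
    (X : QPSpace J K I M) : Prop where
  smooth_bivector : IsSmoothField X.bivector
  invariant : ∀ k m, X.bivector (X.action.act k m) =
    pushforward (mfderiv I I (X.action.act k) m) (X.bivector m)
  quasi_jacobi : IsSchoutenSquare X.bivector (cartanField B X.action)
  smooth_moment : ContMDiff I J ∞ X.moment
  equivariant : ∀ k m, X.moment (X.action.act k m) = k * X.moment m * k⁻¹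
  moment_condition : ∀ (m : M) (ξ : Covector J (X.moment m)) (α : Covector I m),
    X.bivector m ![ξ.comp (mfderiv I J X.moment m), α] =
      α (X.action.fundamental (B.momentVector (X.moment m) ξ) m)

/-- `(N, P₀, ν)` is a Hamiltonian Poisson `K`-manifold: `P₀` is a `K`-invariant Poisson bivector
field and `ν : N → 𝔨` is smooth and `Ad`-equivariant with `P₀^♯(d⟨ν, x⟩) = x_N` for all `x`. -/
structure PSpace.IsHamiltonian (B : InvariantForm J K) (Y : PSpace J K I M) : Prop where
  smooth_bivector : IsSmoothField Y.bivector
  invariant : ∀ k m, Y.bivector (Y.action.act k m) =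
    pushforward (mfderiv I I (Y.action.act k) m) (Y.bivector m)
  jacobi : IsSchoutenSquare Y.bivector (fun _ => 0)
  smooth_moment : ContMDiff (M' := E) I 𝓘(ℝ, E) ∞ Y.moment
  equivariant : ∀ k m, Y.moment (Y.action.act k m) = Ad J k (Y.moment m)
  moment_condition : ∀ (m : M) (x : GroupLieAlgebra J K) (α : Covector I m),
    Y.bivector m ![differential I (fun p => B.form (Y.moment p) x) m, α] =
      α (Y.action.fundamental x m)

end Hamiltonian

/-! ### Poisson deformations -/

section Deformation

/-- The half space `[0, ∞) × ℝⁿ` on which the total spaces of deformations are modelled. -/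
abbrev HalfSpace (n : ℕ) := ModelProd (EuclideanHalfSpace 1) (EuclideanSpace ℝ (Fin n))

/-- The model with boundary for manifolds modelled on `[0, ∞) × ℝⁿ`. -/
abbrev halfModel (n : ℕ) : ModelWithCorners ℝ
    (EuclideanSpace ℝ (Fin 1) × EuclideanSpace ℝ (Fin n)) (HalfSpace n) :=
  (𝓡∂ 1).prod (𝓡 n)

variable {E H K : Type*} [NormedAddCommGroup E] [NormedSpace ℝ E] [TopologicalSpace H]
  {J : ModelWithCorners ℝ E H} [TopologicalSpace K] [ChartedSpace H K] [Group K]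
  {n : ℕ} {Q : Type*} [TopologicalSpace Q]
  {F₁ H₁ M : Type*} [NormedAddCommGroup F₁] [NormedSpace ℝ F₁] [TopologicalSpace H₁]
  {I₁ : ModelWithCorners ℝ F₁ H₁} [TopologicalSpace M] [ChartedSpace H₁ M]
  {F₂ H₂ N : Type*} [NormedAddCommGroup F₂] [NormedSpace ℝ F₂] [TopologicalSpace H₂]
  {I₂ : ModelWithCorners ℝ F₂ H₂} [TopologicalSpace N] [ChartedSpace H₂ N]

/-- The data `(π, P̃, φ̃, μ̃)` on a `K`-manifold `Q` of a Poisson deformation. -/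
structure PoissonFamily (J : ModelWithCorners ℝ E H) (K : Type*) [TopologicalSpace K]
    [ChartedSpace H K] [Group K] (n : ℕ) (Q : Type*) [TopologicalSpace Q]
    [ChartedSpace (HalfSpace n) Q] where
  action : SmoothAction J K (halfModel n) Q
  proj : Q → Set.Icc (0 : ℝ) 1
  bivector : ∀ q : Q, MultiVector (halfModel n) 2 q
  trivector : ∀ q : Q, MultiVector (halfModel n) 3 q
  moment : Q → DefSpace J K

/-- `Φ` is a diffeomorphism of the manifold `M` onto the fibre `π⁻¹(t)`: a smooth embedding into `Q`
whose image is the fibre. -/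
structure IsFibreDiffeo (I₁ : ModelWithCorners ℝ F₁ H₁) (n : ℕ) [ChartedSpace (HalfSpace n) Q]
    (π : Q → Set.Icc (0 : ℝ) 1) (t : ℝ)
    (Φ : M → Q) : Prop where
  smooth : ContMDiff I₁ (halfModel n) ∞ Φ
  isEmbedding : Topology.IsEmbedding Φ
  immersion : ∀ m, Function.Injective (mfderiv I₁ (halfModel n) Φ m)
  range_eq : Set.range Φ = {q | (π q : ℝ) = t}

/-- `D` is a Poisson deformation of the Hamiltonian quasi-Poisson `K`-manifold `X = (M, P, φ_M, μ)`
to the Hamiltonian Poisson `K`-manifold `Y = (N, P₀, ν)`. -/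
structure IsPoissonDeformation [FiniteDimensional ℝ E] [J.Boundaryless] [LieGroup J ∞ K]
    [ChartedSpace (HalfSpace n) Q] (B : InvariantForm J K) (D : PoissonFamily J K n Q) (X : QPSpace J K I₁ M)
    (Y : PSpace J K I₂ N) : Prop where
  source_hamiltonian : X.IsHamiltonian B
  target_hamiltonian : Y.IsHamiltonian B
  /-- `π : Q → [0, 1]` is a smooth submersion, and `∂Q` lies over `{0, 1}`. -/
  submersion : Manifold.IsSubmersion (halfModel n) (𝓡∂ 1) ∞ D.proj
  interior : ∀ q, 0 < (D.proj q : ℝ) → (D.proj q : ℝ) < 1 → (halfModel n).IsInteriorPoint q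
  proj_invariant : ∀ k q, D.proj (D.action.act k q) = D.proj q
  smooth_moment : ContMDiff (halfModel n) 𝓘(ℝ, E × ℝ) ∞ D.moment
  moment_equivariant : ∀ k q, D.moment (D.action.act k q) = (D.moment q).adjoint k
  proj_moment : ∀ q, (D.moment q).proj = D.proj q
  smooth_bivector : IsSmoothField D.bivector
  /-- `P̃` is a section of `⋀² ker dπ`. -/
  bivector_vertical : ∀ q (α : Covector (halfModel n) q),
    D.bivector q ![differential (halfModel n) (fun p => (D.proj p : ℝ)) q, α] = 0
  smooth_trivector : IsSmoothField D.trivector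
  /-- `φ̃` is a section of `⋀³ ker dπ`. -/
  trivector_vertical : ∀ q (α β : Covector (halfModel n) q),
    D.trivector q ![differential (halfModel n) (fun p => (D.proj p : ℝ)) q, α, β] = 0
  /-- `(Q_t, P̃_t, φ̃_t, μ̃_t) ≅ (M, tP, t²φ_M, μ)` for `t ∈ (0, 1]`. -/
  fibre : ∀ (t : ℝ) (ht : 0 < t), t ≤ 1 → ∃ Φ : M → Q, IsFibreDiffeo I₁ n D.proj t Φ ∧
    (∀ k m, Φ (X.action.act k m) = D.action.act k (Φ m)) ∧
    (∀ m, D.bivector (Φ m) =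
      t • pushforward (mfderiv I₁ (halfModel n) Φ m) (X.bivector m)) ∧
    (∀ m, D.trivector (Φ m) =
      t ^ 2 • pushforward (mfderiv I₁ (halfModel n) Φ m) (cartanField B X.action m)) ∧
    ∀ m, D.moment (Φ m) = DefSpace.unit (X.moment m) t ht.ne'
  /-- `(Q₀, P̃₀, μ̃₀) ≅ (N, P₀, ν)`. -/
  fibre_zero : ∃ Φ : N → Q, IsFibreDiffeo I₂ n D.proj 0 Φ ∧
    (∀ k m, Φ (Y.action.act k m) = D.action.act k (Φ m)) ∧
    (∀ m, D.bivector (Φ m) = pushforward (mfderiv I₂ (halfModel n) Φ m) (Y.bivector m)) ∧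
    ∀ m, D.moment (Φ m) = DefSpace.lie (Y.moment m)
  /-- `φ̃₀ = 0`. -/
  trivector_zero : ∀ q, (D.proj q : ℝ) = 0 → D.trivector q = 0

end Deformation

/-- `X` admits a Poisson deformation to `Y`: there is one on some smooth (Hausdorff, second
countable) manifold with boundary. -/
def AdmitsPoissonDeformation {E H K : Type*} [NormedAddCommGroup E]
    [NormedSpace ℝ E] [TopologicalSpace H] {J : ModelWithCorners ℝ E H} [TopologicalSpace K]
    [ChartedSpace H K] [Group K] [FiniteDimensional ℝ E] [J.Boundaryless] [LieGroup J ∞ K]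
    {F₁ H₁ F₂ H₂ : Type*} {M N : Type u}
    [NormedAddCommGroup F₁] [NormedSpace ℝ F₁] [TopologicalSpace H₁]
    {I₁ : ModelWithCorners ℝ F₁ H₁} [TopologicalSpace M] [ChartedSpace H₁ M]
    [NormedAddCommGroup F₂] [NormedSpace ℝ F₂] [TopologicalSpace H₂]
    {I₂ : ModelWithCorners ℝ F₂ H₂} [TopologicalSpace N] [ChartedSpace H₂ N]
    (B : InvariantForm J K) (X : QPSpace J K I₁ M) (Y : PSpace J K I₂ N) : Prop :=
  ∃ (n : ℕ) (Q : Type u) (_ : TopologicalSpace Q) (_ : T2Space Q) (_ : SecondCountableTopology Q)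
    (_ : ChartedSpace (HalfSpace n) Q) (_ : IsManifold (halfModel n) ∞ Q)
    (D : PoissonFamily J K n Q), IsPoissonDeformation B D X Y

/-! ### Internal fusion and fusion products -/

section Fusion

variable {EG HG G EH HH H : Type*}
  [NormedAddCommGroup EG] [NormedSpace ℝ EG] [TopologicalSpace HG] {JG : ModelWithCorners ℝ EG HG}
  [TopologicalSpace G] [ChartedSpace HG G] [Group G]
  [NormedAddCommGroup EH] [NormedSpace ℝ EH] [TopologicalSpace HH] {JH : ModelWithCorners ℝ EH HH}
  [TopologicalSpace H] [ChartedSpace HH H] [Group H]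
  {F H' M : Type*} [NormedAddCommGroup F] [NormedSpace ℝ F] [TopologicalSpace H']
  {I : ModelWithCorners ℝ F H'} [TopologicalSpace M] [ChartedSpace H' M]

/-- The `G × H`-action `(g, h) · m = (g, g, h) · m` obtained from a `G × G × H`-action. -/
def SmoothAction.fuse (A : SmoothAction (JG.prod (JG.prod JH)) (G × G × H) I M) :
    SmoothAction (JG.prod JH) (G × H) I M where
  act k m := A.act (k.1, k.1, k.2) m
  one_act m := A.one_act m
  mul_act k l m := A.mul_act (k.1, k.1, k.2) (l.1, l.1, l.2) m
  smooth := A.smooth.comp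
    (((contMDiff_fst.comp contMDiff_fst).prodMk
      ((contMDiff_fst.comp contMDiff_fst).prodMk (contMDiff_snd.comp contMDiff_fst))).prodMk
      contMDiff_snd)

/-- The bivector field `ψ_M` of `ψ = ½ ∑ e_i¹ ∧ e^{i,2} ∈ ⋀²(𝔤 ⊕ 𝔤)`. -/
def psiField [FiniteDimensional ℝ EG] (B : InvariantForm JG G)
    (A : SmoothAction (JG.prod (JG.prod JH)) (G × G × H) I M) (m : M) : MultiVector I 2 m :=
  (1 / 2 : ℝ) • ∑ i, wedge ![A.fundamental (lieMk (lieBasis JG G i) 0) m,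
    A.fundamental (lieMk 0 (lieMk (B.dualBasis i) 0)) m]

/-- Internal fusion of a Hamiltonian quasi-Poisson `G × G × H`-manifold: the `G × H`-manifold
`(M, P - ψ_M, (μ₁ μ₂, μ₃))`. -/
def QPSpace.fuse [FiniteDimensional ℝ EG] (B : InvariantForm JG G)
    (X : QPSpace (JG.prod (JG.prod JH)) (G × G × H) I M) : QPSpace (JG.prod JH) (G × H) I M where
  action := X.action.fuse
  bivector m := X.bivector m - psiField B X.action m
  moment m := ((X.moment m).1 * (X.moment m).2.1, (X.moment m).2.2)

/-- The map `𝔤 ⊕ 𝔤 ⊕ 𝔥 → 𝔤 ⊕ 𝔥`, `(x, y, z) ↦ (x + y, z)`. -/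
def lieFuse (v : GroupLieAlgebra (JG.prod (JG.prod JH)) (G × G × H)) :
    GroupLieAlgebra (JG.prod JH) (G × H) :=
  lieMk (lieFst v + lieFst (lieSnd v)) (lieSnd (lieSnd v))

/-- The additive analogue of internal fusion: `(N, P₀, (ν₁ + ν₂, ν₃))`. -/
def PSpace.fuse (Y : PSpace (JG.prod (JG.prod JH)) (G × G × H) I M) :
    PSpace (JG.prod JH) (G × H) I M where
  action := Y.action.fuse
  bivector := Y.bivector
  moment m := lieFuse (Y.moment m)

/-- The fibrewise multiplication in the first two factors of `𝒟(G × G × H, {1}) = 𝒢 ×_ℝ 𝒢 ×_ℝ ℋ`: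
`((a, b, h), t) ↦ ((ab, h), t)` for `t ≠ 0` and `((x, y, z), 0) ↦ ((x + y, z), 0)`. -/
def DefSpace.fuse : DefSpace (JG.prod (JG.prod JH)) (G × G × H) → DefSpace (JG.prod JH) (G × H)
  | unit k t ht => unit (k.1 * k.2.1, k.2.2) t ht
  | lie v => lie (lieFuse v)

/-- Internal fusion of a Poisson deformation, on the same space and with the same `π`:
`P̂ = P̃ - t ψ_Q`, `φ̂ = t² (diag φ)_Q` and `μ̂ = (μ̃₁ μ̃₂, μ̃₃)`. Here `diag φ` is the Cartan
trivector of `G × H`, acting through the diagonal. -/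
def PoissonFamily.fuse [FiniteDimensional ℝ EG] [FiniteDimensional ℝ EH] [LieGroup JG ∞ G]
    [LieGroup JH ∞ H] (BG : InvariantForm JG G) (BH : InvariantForm JH H)
    {n : ℕ} {Q : Type*} [TopologicalSpace Q] [ChartedSpace (HalfSpace n) Q]
    (D : PoissonFamily (JG.prod (JG.prod JH)) (G × G × H) n Q) :
    PoissonFamily (JG.prod JH) (G × H) n Q where
  action := D.action.fuse
  proj := D.proj
  bivector q := D.bivector q - (D.proj q : ℝ) • psiField BG D.action q
  trivector q := (D.proj q : ℝ) ^ 2 • cartanField (BG.prod BH) D.action.fuse q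
  moment q := (D.moment q).fuse

end Fusion

section FusionProduct

variable {EG HG G E₁ HH₁ H₁ E₂ HH₂ H₂ : Type*}
  [NormedAddCommGroup EG] [NormedSpace ℝ EG] [TopologicalSpace HG] {JG : ModelWithCorners ℝ EG HG}
  [TopologicalSpace G] [ChartedSpace HG G] [Group G]
  [NormedAddCommGroup E₁] [NormedSpace ℝ E₁] [TopologicalSpace HH₁]
  {J₁ : ModelWithCorners ℝ E₁ HH₁} [TopologicalSpace H₁] [ChartedSpace HH₁ H₁] [Group H₁]
  [NormedAddCommGroup E₂] [NormedSpace ℝ E₂] [TopologicalSpace HH₂]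
  {J₂ : ModelWithCorners ℝ E₂ HH₂} [TopologicalSpace H₂] [ChartedSpace HH₂ H₂] [Group H₂]
  {F₁ B₁ M₁ F₂ B₂ M₂ : Type*} [NormedAddCommGroup F₁] [NormedSpace ℝ F₁] [TopologicalSpace B₁]
  {I₁ : ModelWithCorners ℝ F₁ B₁} [TopologicalSpace M₁] [ChartedSpace B₁ M₁]
  [NormedAddCommGroup F₂] [NormedSpace ℝ F₂] [TopologicalSpace B₂]
  {I₂ : ModelWithCorners ℝ F₂ B₂} [TopologicalSpace M₂] [ChartedSpace B₂ M₂]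

/-- The `G × G × (H₁ × H₂)`-action on `M₁ × M₂` for a `G × H₁`-manifold `M₁` and a
`G × H₂`-manifold `M₂`. -/
def SmoothAction.prod (A₁ : SmoothAction (JG.prod J₁) (G × H₁) I₁ M₁)
    (A₂ : SmoothAction (JG.prod J₂) (G × H₂) I₂ M₂) :
    SmoothAction (JG.prod (JG.prod (J₁.prod J₂))) (G × G × H₁ × H₂) (I₁.prod I₂) (M₁ × M₂) where
  act k m := (A₁.act (k.1, k.2.2.1) m.1, A₂.act (k.2.1, k.2.2.2) m.2)
  one_act m := Prod.ext (A₁.one_act m.1) (A₂.one_act m.2)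
  mul_act k l m := Prod.ext (A₁.mul_act (k.1, k.2.2.1) (l.1, l.2.2.1) m.1)
    (A₂.mul_act (k.2.1, k.2.2.2) (l.2.1, l.2.2.2) m.2)
  smooth := by
    have k1 := contMDiff_fst (I := JG.prod (JG.prod (J₁.prod J₂))) (J := I₁.prod I₂)
      (M := G × G × H₁ × H₂) (N := M₁ × M₂) (n := ∞)
    have k2 := contMDiff_snd (I := JG.prod (JG.prod (J₁.prod J₂))) (J := I₁.prod I₂)
      (M := G × G × H₁ × H₂) (N := M₁ × M₂) (n := ∞)
    have r1 := contMDiff_snd.comp k1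
    have r2 := contMDiff_snd.comp r1
    exact (A₁.smooth.comp (((contMDiff_fst.comp k1).prodMk (contMDiff_fst.comp r2)).prodMk
      (contMDiff_fst.comp k2))).prodMk
      (A₂.smooth.comp (((contMDiff_fst.comp r1).prodMk (contMDiff_snd.comp r2)).prodMk
      (contMDiff_snd.comp k2)))

/-- The bivector field `P₁ + P₂` on `M₁ × M₂`. -/
def prodBivector (P₁ : ∀ m : M₁, MultiVector I₁ 2 m) (P₂ : ∀ m : M₂, MultiVector I₂ 2 m)
    (m : M₁ × M₂) : MultiVector (I₁.prod I₂) 2 m :=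
  pushforward (m' := m) (I' := I₁.prod I₂)
      (mfderiv I₁ (I₁.prod I₂) (fun x => (x, m.2)) m.1) (P₁ m.1) +
    pushforward (m' := m) (I' := I₁.prod I₂)
      (mfderiv I₂ (I₁.prod I₂) (fun y => (m.1, y)) m.2) (P₂ m.2)

/-- The product of a quasi-Poisson `G × H₁`-manifold and a quasi-Poisson `G × H₂`-manifold, as a
`G × G × (H₁ × H₂)`-manifold. -/
def QPSpace.prod (X₁ : QPSpace (JG.prod J₁) (G × H₁) I₁ M₁)
    (X₂ : QPSpace (JG.prod J₂) (G × H₂) I₂ M₂) :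
    QPSpace (JG.prod (JG.prod (J₁.prod J₂))) (G × G × H₁ × H₂) (I₁.prod I₂) (M₁ × M₂) where
  action := X₁.action.prod X₂.action
  bivector := prodBivector X₁.bivector X₂.bivector
  moment m := ((X₁.moment m.1).1, (X₂.moment m.2).1, (X₁.moment m.1).2, (X₂.moment m.2).2)

/-- The product of a Poisson `G × H₁`-manifold and a Poisson `G × H₂`-manifold, as a
`G × G × (H₁ × H₂)`-manifold. -/
def PSpace.prod (Y₁ : PSpace (JG.prod J₁) (G × H₁) I₁ M₁)
    (Y₂ : PSpace (JG.prod J₂) (G × H₂) I₂ M₂) :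
    PSpace (JG.prod (JG.prod (J₁.prod J₂))) (G × G × H₁ × H₂) (I₁.prod I₂) (M₁ × M₂) where
  action := Y₁.action.prod Y₂.action
  bivector := prodBivector Y₁.bivector Y₂.bivector
  moment m := lieMk (lieFst (Y₁.moment m.1)) (lieMk (lieFst (Y₂.moment m.2))
    (lieMk (lieSnd (Y₁.moment m.1)) (lieSnd (Y₂.moment m.2))))

/-- The fusion product `M₁ ⊛ M₂`, a `G × (H₁ × H₂)`-manifold: the internal fusion of `M₁ × M₂`. -/
def QPSpace.fusionProduct [FiniteDimensional ℝ EG] (B : InvariantForm JG G)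
    (X₁ : QPSpace (JG.prod J₁) (G × H₁) I₁ M₁) (X₂ : QPSpace (JG.prod J₂) (G × H₂) I₂ M₂) :
    QPSpace (JG.prod (J₁.prod J₂)) (G × H₁ × H₂) (I₁.prod I₂) (M₁ × M₂) :=
  (X₁.prod X₂).fuse B

/-- The product `N₁ × N₂` with the diagonal `G`-action and the sum of the `G`-moment maps, a
`G × (H₁ × H₂)`-manifold. -/
def PSpace.diagonalProduct (Y₁ : PSpace (JG.prod J₁) (G × H₁) I₁ M₁)
    (Y₂ : PSpace (JG.prod J₂) (G × H₂) I₂ M₂) :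
    PSpace (JG.prod (J₁.prod J₂)) (G × H₁ × H₂) (I₁.prod I₂) (M₁ × M₂) :=
  (Y₁.prod Y₂).fuse

end FusionProduct

end QuasiPoisson

end

/-!
Internal fusion and fusion products of Poisson deformations.

*Internal fusion on a single space.* A bivector field `P` is handled through its bracket
`{f, g} = P(df, dg)` on smooth functions. Its Schouten square is the Jacobiator of that bracket, so
the quasi-Jacobi identity for `P - ψ_M` is an identity between derivations of the algebra `C^∞(M)`.
The square of `P - ψ_M` has three parts. The part of `P` is `φ_M` for `G × G × H`. The cross terms
vanish (`derivationBracket_cross`): `ψ_M` is a combination of wedge products of fundamental vector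
fields, and these are derivations of the invariant bracket of `P` (`SmoothAction.lieDeriv_bracket`).
The square of `ψ_M` is computed in `derivationBracket_jacobi` from the facts that the two copies of
`𝔤` commute and that `[x_M, y_M] = [x, y]_M`; it supplies the terms of the Cartan trivector that mix
the two copies of `𝔤`. Since the diagonal action has fundamental functionals `a₁ + a₂`, the pure and
the mixed terms together are the Cartan trivector of `G × H` for that action (`schouten_fuse`). For
the moment map condition (`moment_condition_fuse`), `f (μ₁ μ₂, μ₃)` has left and right derivatives in
`μ₁` and `μ₂` among which the two inner ones agree, and equivariance expresses `ψ_M` through them;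
the inner derivative then cancels. On the Poisson side nothing is to be twisted, as `ψ` enters with
the factor `t`.

*Internal fusion over `[0, 1]`.* On the total space `Q`, fundamental vector fields are tangent to the
fibres because `π` is invariant, so `P̃ - π ψ_Q` stays vertical, and on the fibre over `t` it
corresponds to `t P - t ψ_M`. What is left is the smoothness of the fused moment map, that is, of the
map of deformation spaces that is multiplication over `t ≠ 0` and addition over `t = 0`. It is
induced by a smooth map of groups preserving the identity, and every such induced map is smooth by
Hadamard's lemma (`exists_hadamard`, `DefSpace.contMDiff_map`). Together these facts give
`IsPoissonDeformation.fuse`.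

*Fusion products.* A fusion product is the internal fusion of a product, so it suffices to deform
products. The total space is the fibre product `Q₁ ×_[0,1] Q₂` (`FibreProduct`). The submersions
`πᵢ` have charts in which they are the boundary coordinate (`exists_isAdaptedChart`), and gluing two
of them along that coordinate gives the charts of the fibre product. It is a local retract of
`Q₁ × Q₂` (`FibreProduct.exists_retraction`), so smoothness may be tested there. The bivector field
`P̃₁ + P̃₂` is tangent to the fibre product because it is the image of a bivector on each fibre
(`IsPoissonDeformation.exists_bivector`), and its trivector is `π² φ_Q`. The product of Hamiltonian
spaces is Hamiltonian since the Schouten square of a product is the sum of the Schouten squares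
(`IsSchoutenSquare.prod`) and the Cartan trivector is additive. Hence the fibre product is a Poisson
deformation of the product (`IsPoissonDeformation.fibreProduct`), and its internal fusion is one of
the fusion product (`AdmitsPoissonDeformation.fusionProduct`).
-/

noncomputable section

namespace QuasiPoisson

open Set

set_option linter.unusedSectionVars false

/-! ### Multivectors -/

section MultiVectorAlgebra

variable {E H M : Type*} [NormedAddCommGroup E] [NormedSpace ℝ E] [TopologicalSpace H]
  [TopologicalSpace M] [ChartedSpace H M]
  {E' H' M' : Type*} [NormedAddCommGroup E'] [NormedSpace ℝ E'] [TopologicalSpace H']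
  [TopologicalSpace M'] [ChartedSpace H' M']
  {I : ModelWithCorners ℝ E H} {I' : ModelWithCorners ℝ E' H'}

instance t2Space_tangentSpace (m : M) : T2Space (TangentSpace I m) :=
  inferInstanceAs (T2Space E)

lemma wedge_two_apply {m : M} (u v : TangentSpace I m) (α β : Covector I m) :
    wedge ![u, v] ![α, β] = α u * β v - α v * β u := by
  change Matrix.det (Matrix.of fun i j => ![α, β] i (![u, v] j)) = _
  rw [Matrix.det_fin_two]
  simp

lemma wedge_three_apply {m : M} (u v w : TangentSpace I m) (α β γ : Covector I m) :
    wedge ![u, v, w] ![α, β, γ] =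
      α u * β v * γ w - α u * β w * γ v - α v * β u * γ w + α v * β w * γ u
        + α w * β u * γ v - α w * β v * γ u := by
  change Matrix.det (Matrix.of fun i j => ![α, β, γ] i (![u, v, w] j)) = _
  rw [Matrix.det_fin_three]
  simp

lemma pushforward_apply {k : ℕ} {m : M} {m' : M'}
    (L : TangentSpace I m →L[ℝ] TangentSpace I' m') (P : MultiVector I k m)
    (α : Fin k → Covector I' m') :
    pushforward L P α = P fun i => (α i).comp L := rfl

lemma pushforward_two_apply {m : M} {m' : M'}
    (L : TangentSpace I m →L[ℝ] TangentSpace I' m') (P : MultiVector I 2 m)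
    (α β : Covector I' m') :
    pushforward L P ![α, β] = P ![α.comp L, β.comp L] := by
  rw [pushforward_apply]
  congr 1
  ext i
  fin_cases i <;> rfl

lemma pushforward_three_apply {m : M} {m' : M'}
    (L : TangentSpace I m →L[ℝ] TangentSpace I' m') (P : MultiVector I 3 m)
    (α β γ : Covector I' m') :
    pushforward L P ![α, β, γ] = P ![α.comp L, β.comp L, γ.comp L] := by
  rw [pushforward_apply]
  congr 1
  ext i
  fin_cases i <;> rfl

lemma pushforward_sub {k : ℕ} {m : M} {m' : M'}
    (L : TangentSpace I m →L[ℝ] TangentSpace I' m') (P P' : MultiVector I k m) :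
    pushforward L (P - P') = pushforward L P - pushforward L P' := rfl

lemma pushforward_smul {k : ℕ} {m : M} {m' : M'}
    (L : TangentSpace I m →L[ℝ] TangentSpace I' m') (c : ℝ) (P : MultiVector I k m) :
    pushforward L (c • P) = c • pushforward L P := rfl

lemma multiVector_two_ext {m : M} {P P' : MultiVector I 2 m}
    (h : ∀ α β, P ![α, β] = P' ![α, β]) : P = P' := by
  ext α
  have : α = ![α 0, α 1] := by ext i; fin_cases i <;> rfl
  rw [this, h]

lemma multiVector_three_ext {m : M} {P P' : MultiVector I 3 m}
    (h : ∀ α β γ, P ![α, β, γ] = P' ![α, β, γ]) : P = P' := by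
  ext α
  have : α = ![α 0, α 1, α 2] := by ext i; fin_cases i <;> rfl
  rw [this, h]

lemma vec2_update_zero {α : Type*} [DecidableEq (Fin 2)] (a b c : α) :
    Function.update ![a, b] 0 c = ![c, b] := by
  ext i; fin_cases i <;> simp [Function.update]

lemma vec2_update_one {α : Type*} [DecidableEq (Fin 2)] (a b c : α) :
    Function.update ![a, b] 1 c = ![a, c] := by
  ext i; fin_cases i <;> simp [Function.update]

namespace MultiVector

variable {m : M} (P : MultiVector I 2 m)

lemma two_add_left (α α' β : Covector I m) :
    P ![α + α', β] = P ![α, β] + P ![α', β] := by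
  have h := P.map_update_add ![0, β] 0 α α'
  simp only [vec2_update_zero] at h
  exact h

lemma two_add_right (α β β' : Covector I m) :
    P ![α, β + β'] = P ![α, β] + P ![α, β'] := by
  have h := P.map_update_add ![α, 0] 1 β β'
  simp only [vec2_update_one] at h
  exact h

lemma two_smul_left (c : ℝ) (α β : Covector I m) :
    P ![c • α, β] = c * P ![α, β] := by
  have h := P.map_update_smul ![0, β] 0 c α
  simp only [vec2_update_zero] at h
  exact h

lemma two_smul_right (c : ℝ) (α β : Covector I m) :
    P ![α, c • β] = c * P ![α, β] := by
  have h := P.map_update_smul ![α, 0] 1 c β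
  simp only [vec2_update_one] at h
  exact h

lemma two_swap (α β : Covector I m) : P ![α, β] = -P ![β, α] := by
  have := P.map_swap ![β, α] (i := 0) (j := 1) (by decide)
  rw [← this]
  congr 1
  ext i
  fin_cases i <;> rfl

/-- A bivector as a bilinear form on covectors. -/
def toBilin : LinearMap.BilinForm ℝ (Covector I m) :=
  LinearMap.mk₂ ℝ (fun α β => P ![α, β]) P.two_add_left P.two_smul_left P.two_add_right
    P.two_smul_right

lemma toBilin_apply (α β : Covector I m) : P.toBilin α β = P ![α, β] := rfl

/-- In a basis `v` of the tangent space, a bivector is `∑ c_ij v_i ⊗ v_j`. -/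
lemma exists_coeff [FiniteDimensional ℝ E] :
    ∃ (d : ℕ) (v : Fin d → TangentSpace I m) (c : Fin d → Fin d → ℝ),
      (∀ i j, c i j = -c j i) ∧
      ∀ α β : Covector I m, P ![α, β] = ∑ i, ∑ j, c i j * (α (v i) * β (v j)) := by
  let b := Module.finBasis ℝ (TangentSpace I m)
  let δ : ∀ _ : Fin _, Covector I m := fun i => LinearMap.toContinuousLinearMap (b.coord i)
  have key : ∀ α : Covector I m, α = ∑ i, α (b i) • δ i := by
    intro α
    ext x
    conv_lhs => rw [← b.sum_repr x]
    simp only [map_sum, map_smul, smul_eq_mul, sum_apply, smul_apply]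
    refine Finset.sum_congr rfl fun i _ => ?_
    rw [mul_comm]
    rfl
  refine ⟨_, b, fun i j => P ![δ i, δ j], fun i j => P.two_swap _ _, fun α β => ?_⟩
  conv_lhs => rw [← toBilin_apply, key α, key β]
  simp only [map_sum, map_smul, LinearMap.sum_apply, LinearMap.smul_apply, smul_eq_mul,
    toBilin_apply]
  simp only [Finset.mul_sum]
  rw [Finset.sum_comm]
  refine Finset.sum_congr rfl fun i _ => Finset.sum_congr rfl fun j _ => ?_
  ring

end MultiVector

lemma pushforward_comp {E'' H'' M'' : Type*} [NormedAddCommGroup E''] [NormedSpace ℝ E'']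
    [TopologicalSpace H''] [TopologicalSpace M''] [ChartedSpace H'' M'']
    {I'' : ModelWithCorners ℝ E'' H''} {k : ℕ} {m : M} {m' : M'} {m'' : M''}
    (L' : TangentSpace I' m' →L[ℝ] TangentSpace I'' m'')
    (L : TangentSpace I m →L[ℝ] TangentSpace I' m') (P : MultiVector I k m) :
    pushforward L' (pushforward L P) = pushforward (L'.comp L) P := rfl

/-- Multivectors are pushed forward injectively by injective maps: covectors extend along them. -/
lemma pushforward_injective [FiniteDimensional ℝ E] [FiniteDimensional ℝ E'] {k : ℕ} {m : M}
    {m' : M'} {L : TangentSpace I m →L[ℝ] TangentSpace I' m'} (hL : Function.Injective L) :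
    Function.Injective (pushforward L : MultiVector I k m → MultiVector I' k m') := by
  obtain ⟨g, hg⟩ := LinearMap.exists_leftInverse_of_injective L.toLinearMap
    (LinearMap.ker_eq_bot.2 hL)
  let R : TangentSpace I' m' →L[ℝ] TangentSpace I m := LinearMap.toContinuousLinearMap g
  intro P P' h
  ext α
  have := congrArg (fun Q : MultiVector I' k m' => Q fun i => (α i).comp R) h
  simp only [pushforward_apply] at this
  convert this using 2 <;>
  · ext i x
    exact congrArg (α i) (LinearMap.congr_fun hg x : g (L x) = x).symm

end MultiVectorAlgebra

/-! ### The Lie algebra and its invariant form -/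

section InvariantFormAlgebra

variable {E H : Type*} [NormedAddCommGroup E] [NormedSpace ℝ E] [TopologicalSpace H]
  {J : ModelWithCorners ℝ E H} {K : Type*} [TopologicalSpace K] [ChartedSpace H K] [Group K]
  {F H' M : Type*} [NormedAddCommGroup F] [NormedSpace ℝ F] [TopologicalSpace H']
  {I : ModelWithCorners ℝ F H'} [TopologicalSpace M] [ChartedSpace H' M]
  [FiniteDimensional ℝ E]

namespace InvariantForm

variable (B : InvariantForm J K)

/-- The vector `a♯` with `⟨a♯, x⟩ = a x`. -/
def sharp (a : GroupLieAlgebra J K →ₗ[ℝ] ℝ) : GroupLieAlgebra J K :=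
  ∑ i, a (lieBasis J K i) • B.dualBasis i

lemma form_dualBasis (i j) : B.form (B.dualBasis i) (lieBasis J K j) = if j = i then 1 else 0 :=
  LinearMap.BilinForm.apply_dualBasis_left B.nondegenerate _ _ _

@[simp]
lemma form_sharp (a : GroupLieAlgebra J K →ₗ[ℝ] ℝ) (x : GroupLieAlgebra J K) :
    B.form (B.sharp a) x = a x := by
  have : B.form (B.sharp a) = a := by
    refine (lieBasis J K).ext fun j => ?_
    simp [sharp, form_dualBasis]
  rw [this]

@[simp]
lemma form_sharp_right (a : GroupLieAlgebra J K →ₗ[ℝ] ℝ) (x : GroupLieAlgebra J K) :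
    B.form x (B.sharp a) = a x := by
  rw [B.symm, form_sharp]

variable {B} in
lemma ext_form {x y : GroupLieAlgebra J K} (h : ∀ z, B.form x z = B.form y z) : x = y := by
  rw [← sub_eq_zero]
  refine B.nondegenerate.1 _ fun z => ?_
  rw [map_sub, LinearMap.sub_apply, h, sub_self]

lemma eq_sharp {a : GroupLieAlgebra J K →ₗ[ℝ] ℝ} {x : GroupLieAlgebra J K}
    (h : ∀ z, B.form x z = a z) : x = B.sharp a :=
  ext_form (B := B) fun z => by rw [h, form_sharp]

lemma sharp_add (a b : GroupLieAlgebra J K →ₗ[ℝ] ℝ) : B.sharp (a + b) = B.sharp a + B.sharp b :=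
  (B.eq_sharp fun z => by simp).symm

lemma sharp_smul (r : ℝ) (a : GroupLieAlgebra J K →ₗ[ℝ] ℝ) : B.sharp (r • a) = r • B.sharp a :=
  (B.eq_sharp fun z => by simp).symm

lemma sharp_eq_sum_dualBasis (a : GroupLieAlgebra J K →ₗ[ℝ] ℝ) :
    B.sharp a = ∑ i, a (B.dualBasis i) • lieBasis J K i := by
  refine (B.eq_sharp fun z => ?_).symm
  have : LinearMap.flip B.form (∑ i, a (B.dualBasis i) • lieBasis J K i) = a := by
    refine B.dualBasis.ext fun j => ?_
    simp [form_dualBasis]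
  rw [B.symm]
  exact LinearMap.congr_fun this z

lemma sum_mul_dualBasis (a b : GroupLieAlgebra J K →ₗ[ℝ] ℝ) :
    ∑ i, a (lieBasis J K i) * b (B.dualBasis i) = B.form (B.sharp a) (B.sharp b) := by
  rw [form_sharp_right, sharp, map_sum]
  simp

end InvariantForm

variable [LieGroup J ∞ K]

lemma lieGroup_minSmoothness (J : ModelWithCorners ℝ E H) (K : Type*) [TopologicalSpace K]
    [ChartedSpace H K] [Group K] [LieGroup J ∞ K] : LieGroup J (minSmoothness ℝ 3) K := by
  simp only [minSmoothness_of_isRCLikeNormedField]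
  exact LieGroup.of_le (n := ∞) ENat.LEInfty.out

variable (J K) in
/-- The Lie bracket as a bilinear map. -/
def lieBilin : GroupLieAlgebra J K →ₗ[ℝ] GroupLieAlgebra J K →ₗ[ℝ] GroupLieAlgebra J K :=
  have := lieGroup_minSmoothness J K
  LinearMap.mk₂ ℝ (fun x y => ⁅x, y⁆) (fun _ _ _ => add_lie _ _ _) (fun _ _ _ => smul_lie _ _ _)
    (fun _ _ _ => lie_add _ _ _) (fun _ _ _ => lie_smul _ _ _)

lemma lieBilin_apply (x y : GroupLieAlgebra J K) : lieBilin J K x y = ⁅x, y⁆ := rfl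

lemma lieBilin_swap (x y : GroupLieAlgebra J K) : lieBilin J K x y = - lieBilin J K y x := by
  have := lieGroup_minSmoothness J K
  exact (lie_skew x y).symm

end InvariantFormAlgebra

/-! ### Calculus on products of manifolds -/

section Calculus

/-- Partial derivatives of a function of two variables commute. -/
lemma fderiv_fderiv_comm {E F : Type*} [NormedAddCommGroup E] [NormedSpace ℝ E]
    [NormedAddCommGroup F] [NormedSpace ℝ F] {f : E × F → ℝ} {x : E} {y : F}
    (hf : ContDiffAt ℝ ∞ f (x, y)) (v : E) (w : F) :
    fderiv ℝ (fun x' => fderiv ℝ (fun y' => f (x', y')) y w) x v =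
      fderiv ℝ (fun y' => fderiv ℝ (fun x' => f (x', y')) x v) y w := by
  have hd : ∀ᶠ p in 𝓝 (x, y), DifferentiableAt ℝ f p :=
    ((hf.of_le (m := 1) ENat.LEInfty.out).eventually (by simp)).mono
      fun p hp => hp.differentiableAt (by simp)
  have hd2 : DifferentiableAt ℝ (fderiv ℝ f) (x, y) :=
    (hf.fderiv_right (m := 1)
      (by exact_mod_cast (ENat.LEInfty.out : (2 : ℕ∞ω) ≤ ∞))).differentiableAt (by simp)
  have h1 : (fun x' => fderiv ℝ (fun y' => f (x', y')) y w) =ᶠ[𝓝 x]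
      fun x' => fderiv ℝ f (x', y) (0, w) := by
    have : Filter.Tendsto (fun x' : E => (x', y)) (𝓝 x) (𝓝 (x, y)) :=
      (Continuous.prodMk_left y).tendsto x
    filter_upwards [this.eventually hd] with x' hx'
    have := (HasFDerivAt.comp (f := fun y' => (x', y')) y hx'.hasFDerivAt
      (hasFDerivAt_prodMk_right x' y)).fderiv
    exact DFunLike.congr_fun this w
  have h2 : (fun y' => fderiv ℝ (fun x' => f (x', y')) x v) =ᶠ[𝓝 y]
      fun y' => fderiv ℝ f (x, y') (v, 0) := by
    have : Filter.Tendsto (fun y' : F => (x, y')) (𝓝 y) (𝓝 (x, y)) :=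
      (Continuous.prodMk_right x).tendsto y
    filter_upwards [this.eventually hd] with y' hy'
    have := (HasFDerivAt.comp (f := fun x' => (x', y')) x hy'.hasFDerivAt
      (hasFDerivAt_prodMk_left x y')).fderiv
    exact DFunLike.congr_fun this v
  rw [h1.fderiv_eq, h2.fderiv_eq]
  have e1 : fderiv ℝ (fun x' => fderiv ℝ f (x', y) (0, w)) x v =
      fderiv ℝ (fderiv ℝ f) (x, y) (v, 0) (0, w) := by
    have := ((HasFDerivAt.comp (f := fun x' => (x', y)) x hd2.hasFDerivAt
      (hasFDerivAt_prodMk_left x y)).clm_apply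
      (hasFDerivAt_const ((0 : E), w) x)).fderiv
    have := DFunLike.congr_fun this v
    simpa using this
  have e2 : fderiv ℝ (fun y' => fderiv ℝ f (x, y') (v, 0)) y w =
      fderiv ℝ (fderiv ℝ f) (x, y) (0, w) (v, 0) := by
    have := ((HasFDerivAt.comp (f := fun y' => (x, y')) y hd2.hasFDerivAt
      (hasFDerivAt_prodMk_right x y)).clm_apply
      (hasFDerivAt_const (v, (0 : F)) y)).fderiv
    have := DFunLike.congr_fun this w
    simpa using this
  rw [e1, e2]
  exact (hf.isSymmSndFDerivAt (by simp; exact ENat.LEInfty.out)).eq _ _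

variable {E H M : Type*} [NormedAddCommGroup E] [NormedSpace ℝ E] [TopologicalSpace H]
  [TopologicalSpace M] [ChartedSpace H M] {I : ModelWithCorners ℝ E H}
  {E' H' M' : Type*} [NormedAddCommGroup E'] [NormedSpace ℝ E'] [TopologicalSpace H']
  [TopologicalSpace M'] [ChartedSpace H' M'] {I' : ModelWithCorners ℝ E' H'}

/-- At an interior point, the differential of a function is its Fréchet derivative in the
preferred chart. -/
lemma differential_eq_fderiv_chart {f : M → ℝ} {m : M} (hm : I.IsInteriorPoint m)
    (hf : MDifferentiableAt I 𝓘(ℝ, ℝ) f m) :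
    differential I f m = fderiv ℝ (f ∘ (extChartAt I m).symm) (extChartAt I m m) := by
  have h : HasFDerivWithinAt (f ∘ (extChartAt I m).symm)
      (show E →L[ℝ] ℝ from mfderiv I 𝓘(ℝ, ℝ) f m) (range I) (extChartAt I m m) :=
    hf.hasMFDerivAt.2
  exact (h.hasFDerivAt (range_mem_nhds_isInteriorPoint hm)).fderiv.symm

/-! ### Differentials of functions -/

lemma differential_comp {f : M' → ℝ} {g : M → M'} {m : M}
    (hf : MDifferentiableAt I' 𝓘(ℝ, ℝ) f (g m)) (hg : MDifferentiableAt I I' g m) :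
    differential I (fun x => f (g x)) m = (differential I' f (g m)).comp (mfderiv I I' g m) :=
  mfderiv_comp m hf hg

lemma differential_comp_of_eq {f : M' → ℝ} {g : M → M'} {m : M} {m' : M'}
    (hf : MDifferentiableAt I' 𝓘(ℝ, ℝ) f m') (hg : MDifferentiableAt I I' g m) (h : g m = m') :
    differential I (fun x => f (g x)) m = (differential I' f m').comp (mfderiv I I' g m) :=
  by subst h; exact mfderiv_comp m hf hg

lemma differential_congr {f g : M → ℝ} {m : M} (h : f =ᶠ[𝓝 m] g) :
    differential I f m = differential I g m := h.mfderiv_eq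

lemma differential_const (c : ℝ) (m : M) : differential I (fun _ : M => c) m = 0 :=
  mfderiv_const

section Leibniz

variable {f g : M → ℝ} {m : M}

lemma differential_add (hf : MDifferentiableAt I 𝓘(ℝ, ℝ) f m)
    (hg : MDifferentiableAt I 𝓘(ℝ, ℝ) g m) :
    differential I (fun x => f x + g x) m = differential I f m + differential I g m :=
  mfderiv_add hf hg

lemma differential_mul (hf : MDifferentiableAt I 𝓘(ℝ, ℝ) f m)
    (hg : MDifferentiableAt I 𝓘(ℝ, ℝ) g m) :
    differential I (fun x => f x * g x) m = f m • differential I g m + g m • differential I f m :=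
  (hf.hasMFDerivAt.mul hg.hasMFDerivAt).mfderiv

lemma differential_const_mul (c : ℝ) (hf : MDifferentiableAt I 𝓘(ℝ, ℝ) f m) :
    differential I (fun x => c * f x) m = c • differential I f m := by
  rw [differential_mul mdifferentiableAt_const hf, differential_const, smul_zero, add_zero]

lemma differential_neg : differential I (fun x => -f x) m = -differential I f m :=
  mfderiv_neg

lemma mdifferentiableAt_finset_sum {ι : Type*} (s : Finset ι) {f : ι → M → ℝ}
    (hf : ∀ i, MDifferentiableAt I 𝓘(ℝ, ℝ) (f i) m) :
    MDifferentiableAt I 𝓘(ℝ, ℝ) (fun x => ∑ i ∈ s, f i x) m := by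
  classical
  induction s using Finset.induction_on with
  | empty => simpa using mdifferentiableAt_const
  | insert a s ha ih =>
    simp only [Finset.sum_insert ha]
    exact (hf a).add ih

lemma differential_sum {ι : Type*} (s : Finset ι) {f : ι → M → ℝ}
    (hf : ∀ i, MDifferentiableAt I 𝓘(ℝ, ℝ) (f i) m) :
    differential I (fun x => ∑ i ∈ s, f i x) m = ∑ i ∈ s, differential I (f i) m := by
  classical
  induction s using Finset.induction_on with
  | empty => simpa using differential_const 0 m
  | insert a s ha ih =>
    simp only [Finset.sum_insert ha]
    rw [differential_add (hf a) (mdifferentiableAt_finset_sum s hf), ih]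

end Leibniz

/-- Partial derivatives of smooth functions are smooth in the other variable. -/
theorem contMDiff_differential_snd [IsManifold I ∞ M] [IsManifold I' ∞ M'] {f : M × M' → ℝ}
    (hf : ContMDiff (I.prod I') 𝓘(ℝ, ℝ) ∞ f) (m' : M') (w : TangentSpace I' m') :
    ContMDiff I 𝓘(ℝ, ℝ) ∞ fun x => differential I' (fun y => f (x, y)) m' w := by
  have : IsManifold I' 1 M' := IsManifold.of_le (n := ∞) ENat.LEInfty.out
  have : IsManifold I 1 M := IsManifold.of_le (n := ∞) ENat.LEInfty.out
  intro x
  have h := ContMDiffAt.mfderiv (n := ∞) (m := ∞) (fun x y => f (x, y)) (fun _ : M => m')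
    (x₀ := x) (I := I') (I' := 𝓘(ℝ, ℝ)) (hf (x, m')) contMDiffAt_const (by simp)
  have h2 := h.clm_apply (contMDiffAt_const (c := (show E' from w)))
  refine h2.congr_of_eventuallyEq (Filter.Eventually.of_forall fun x' => ?_)
  have e := inTangentCoordinates_eq (I := I') (I' := 𝓘(ℝ, ℝ)) (fun _ : M => m')
    (fun x => f (x, m')) (fun x => mfderiv I' 𝓘(ℝ, ℝ) (fun y => f (x, y)) m') (x₀ := x) (x := x')
    (mem_chart_source _ _) (by rw [chartAt_self_eq]; exact mem_univ _)
  rw [tangentBundleCore_coordChange_model_space] at e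
  refine Eq.trans ?_ (DFunLike.congr_fun e (show E' from w)).symm
  exact congrArg (mfderiv I' 𝓘(ℝ, ℝ) (fun y => f (x', y)) m')
    ((tangentBundleCore I' M').coordChange_self (achart H' m') m' (mem_chart_source _ _) w).symm

lemma contMDiff_differential_fst [IsManifold I ∞ M] [IsManifold I' ∞ M'] {f : M × M' → ℝ}
    (hf : ContMDiff (I.prod I') 𝓘(ℝ, ℝ) ∞ f) (m : M) (v : TangentSpace I m) :
    ContMDiff I' 𝓘(ℝ, ℝ) ∞ fun y => differential I (fun x => f (x, y)) m v :=
  contMDiff_differential_snd (f := fun p : M' × M => f (p.2, p.1))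
    (hf.comp (contMDiff_snd.prodMk contMDiff_fst)) m v

/-- Partial derivatives on a product of manifolds commute. -/
theorem differential_differential_comm [IsManifold I ∞ M] [IsManifold I' ∞ M']
    {f : M × M' → ℝ} (hf : ContMDiff (I.prod I') 𝓘(ℝ, ℝ) ∞ f) {m : M} {m' : M'}
    (hm : I.IsInteriorPoint m) (hm' : I'.IsInteriorPoint m')
    (v : TangentSpace I m) (w : TangentSpace I' m') :
    differential I (fun x => differential I' (fun y => f (x, y)) m' w) m v =
      differential I' (fun y => differential I (fun x => f (x, y)) m v) m' w := by
  have h1 : MDifferentiableAt I 𝓘(ℝ, ℝ) (fun x => differential I' (fun y => f (x, y)) m' w) m :=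
    (contMDiff_differential_snd hf m' w).mdifferentiable (by simp) m
  have h2 : MDifferentiableAt I' 𝓘(ℝ, ℝ) (fun y => differential I (fun x => f (x, y)) m v) m' :=
    (contMDiff_differential_fst hf m v).mdifferentiable (by simp) m'
  set φ := extChartAt I m
  set φ' := extChartAt I' m'
  have hs1 : ∀ y, MDifferentiableAt I 𝓘(ℝ, ℝ) (fun x => f (x, y)) m := fun y =>
    (hf.comp (contMDiff_id.prodMk contMDiff_const)).mdifferentiable (by simp) m
  have hs2 : ∀ x, MDifferentiableAt I' 𝓘(ℝ, ℝ) (fun y => f (x, y)) m' := fun x =>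
    (hf.comp (contMDiff_const.prodMk contMDiff_id)).mdifferentiable (by simp) m'
  rw [differential_eq_fderiv_chart hm h1, differential_eq_fderiv_chart hm' h2]
  have e1 : (fun x => differential I' (fun y => f (x, y)) m' w) ∘ φ.symm =
      fun x => fderiv ℝ (fun y => f (φ.symm x, φ'.symm y)) (φ' m') w := by
    ext x
    exact DFunLike.congr_fun (differential_eq_fderiv_chart hm' (hs2 (φ.symm x))) w
  have e2 : (fun y => differential I (fun x => f (x, y)) m v) ∘ φ'.symm =
      fun y => fderiv ℝ (fun x => f (φ.symm x, φ'.symm y)) (φ m) v := by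
    ext y
    exact DFunLike.congr_fun (differential_eq_fderiv_chart hm (hs1 (φ'.symm y))) v
  rw [e1, e2]
  refine fderiv_fderiv_comm (f := fun p : E × E' => f (φ.symm p.1, φ'.symm p.2)) ?_ v w
  have := (contMDiffAt_iff.1 (hf (m, m'))).2
  refine this.contDiffAt ?_
  rw [ModelWithCorners.range_prod, extChartAt_prod]
  exact prod_mem_nhds (range_mem_nhds_isInteriorPoint hm) (range_mem_nhds_isInteriorPoint hm')

/-- The derivative along the diagonal is the sum of the two partial derivatives. -/
lemma differential_diag {f : M × M → ℝ} {m : M}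
    (hf : MDifferentiableAt (I.prod I) 𝓘(ℝ, ℝ) f (m, m)) :
    differential I (fun x => f (x, x)) m =
      differential I (fun x => f (x, m)) m + differential I (fun x => f (m, x)) m := by
  rw [differential_comp (f := f) (g := fun x => (x, x)) hf
    (mdifferentiableAt_id.prodMk mdifferentiableAt_id)]
  ext v
  have h1 : mfderiv I (I.prod I) (fun x : M => (x, x)) m v = (v, v) := by
    have := (mdifferentiableAt_id (I := I) (x := m)).mfderiv_prod (mdifferentiableAt_id (I := I))
    rw [mfderiv_id] at this
    exact DFunLike.congr_fun this v
  have h2 := mfderiv_prod_eq_add_apply hf (v := (show E × E from (v, v)))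
  exact (congrArg (differential (I.prod I) f (m, m)) h1).trans h2

/-- The preferred chart at a point has the identity as its differential there. -/
lemma mfderiv_extChartAt_self [IsManifold I 1 M] {m : M} (v : TangentSpace I m) :
    mfderiv I 𝓘(ℝ, E) (extChartAt I m) m v = v := by
  rw [(mdifferentiableAt_extChartAt (mem_chart_source H m)).mfderiv]
  exact tangentCoordChange_self (I := I) (v := (show E from v)) (mem_extChartAt_source m)

/-! ### Bump functions -/

section Bump

variable [FiniteDimensional ℝ E] [T2Space M] [IsManifold I ∞ M]

/-- A function that is smooth near a point agrees near that point with a smooth function. -/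
lemma exists_contMDiff_eventuallyEq {f : M → ℝ} {U : Set M} (hU : IsOpen U) {m : M} (hm : m ∈ U)
    (hf : ContMDiffOn I 𝓘(ℝ, ℝ) ∞ f U) :
    ∃ g : M → ℝ, ContMDiff I 𝓘(ℝ, ℝ) ∞ g ∧ g =ᶠ[𝓝 m] f := by
  obtain ⟨ρ, -, hρ⟩ := (SmoothBumpFunction.nhds_basis_tsupport (I := I) m).mem_iff.1
    (hU.mem_nhds hm)
  refine ⟨fun x => ρ x * f x, contMDiff_of_tsupport fun x hx => ?_, ?_⟩
  · have hx' : x ∈ U := hρ (tsupport_mul_subset_left hx)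
    exact ρ.contMDiffAt.mul ((hf x hx').contMDiffAt (hU.mem_nhds hx'))
  · filter_upwards [ρ.eventuallyEq_one] with x hx
    simp [hx]

/-- Every covector is the differential of a smooth function. -/
lemma exists_differential_eq {m : M} (α : Covector I m) :
    ∃ f : M → ℝ, ContMDiff I 𝓘(ℝ, ℝ) ∞ f ∧ differential I f m = α := by
  have : IsManifold I 1 M := IsManifold.of_le (n := ∞) ENat.LEInfty.out
  let a : E →L[ℝ] ℝ := α
  have ha : ContMDiff 𝓘(ℝ, E) 𝓘(ℝ, ℝ) ∞ a := a.contMDiff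
  obtain ⟨f, hf, hfa⟩ := exists_contMDiff_eventuallyEq (f := fun x => a (extChartAt I m x))
    (chartAt H m).open_source (mem_chart_source H m)
    (ha.comp_contMDiffOn contMDiffOn_extChartAt)
  refine ⟨f, hf, ?_⟩
  rw [differential_congr hfa, differential_comp (f := a) (g := extChartAt I m)
    (ha.mdifferentiable (by simp) _) (mdifferentiableAt_extChartAt (mem_chart_source H m))]
  ext v
  have h1 : mfderiv I 𝓘(ℝ, E) (extChartAt I m) m v = v := mfderiv_extChartAt_self v
  have h3 : fderiv ℝ a (extChartAt I m m) = a := a.fderiv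
  have h2 : differential 𝓘(ℝ, E) a (extChartAt I m m) = a :=
    Eq.trans (mfderiv_eq_fderiv (f := a) (x := extChartAt I m m)) h3
  rw [ContinuousLinearMap.comp_apply, h2]
  exact congrArg a h1

end Bump

end Calculus

/-! ### The Lie bracket of vector fields -/

section LieBracket

open VectorField

variable {E H M : Type*} [NormedAddCommGroup E] [NormedSpace ℝ E] [TopologicalSpace H]
  [TopologicalSpace M] [ChartedSpace H M] {I : ModelWithCorners ℝ E H} [I.Boundaryless]
  [IsManifold I ∞ M] [CompleteSpace E]

/-- The Lie bracket of vector fields is the commutator of derivations. -/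
theorem differential_mlieBracket {V W : ∀ m : M, TangentSpace I m} {m : M}
    (hV : MDifferentiableAt I I.tangent (fun x => (⟨x, V x⟩ : TangentBundle I M)) m)
    (hW : MDifferentiableAt I I.tangent (fun x => (⟨x, W x⟩ : TangentBundle I M)) m)
    {f : M → ℝ} (hf : ContMDiff I 𝓘(ℝ, ℝ) ∞ f)
    (hVf : MDifferentiableAt I 𝓘(ℝ, ℝ) (fun x => differential I f x (V x)) m)
    (hWf : MDifferentiableAt I 𝓘(ℝ, ℝ) (fun x => differential I f x (W x)) m) :
    differential I f m (mlieBracket I V W m) =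
      differential I (fun x => differential I f x (W x)) m (V m) -
        differential I (fun x => differential I f x (V x)) m (W m) := by
  have : IsManifold I 2 M := IsManifold.of_le (n := ∞) ENat.LEInfty.out
  have : IsManifold I 1 M := IsManifold.of_le (n := ∞) ENat.LEInfty.out
  have hm : I.IsInteriorPoint m := BoundarylessManifold.isInteriorPoint
  set φ := extChartAt I m with hφ
  set y₀ := φ m with hy₀
  set g : E → ℝ := f ∘ φ.symm with hg
  -- the representation of a vector field in the preferred chart at `m`
  let P : (∀ m : M, TangentSpace I m) → E → E := fun V =>
    mpullbackWithin 𝓘(ℝ, E) I φ.symm V (range I)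
  have hnhds : φ.target ∈ 𝓝 y₀ := extChartAt_target_mem_nhds m
  have hφs : ∀ y ∈ φ.target, MDifferentiableWithinAt 𝓘(ℝ, E) I φ.symm (range I) y := fun y hy =>
    (contMDiffWithinAt_extChartAt_symm_range (n := 1) m hy).mdifferentiableWithinAt (by simp)
  have hgc : ContDiffAt ℝ ∞ g y₀ := by
    have := (contMDiffAt_iff.1 (hf m)).2
    rw [I.range_eq_univ] at this
    exact this.contDiffAt Filter.univ_mem
  have key : ∀ (V : ∀ m : M, TangentSpace I m), ∀ y ∈ φ.target,
      fderiv ℝ g y (P V y) = differential I f (φ.symm y) (V (φ.symm y)) := by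
    intro V y hy
    have hinv := isInvertible_mfderivWithin_extChartAt_symm (I := I) (x := m) hy
    have h1 : mfderivWithin 𝓘(ℝ, E) 𝓘(ℝ, ℝ) g (range I) y =
        (differential I f (φ.symm y)).comp (mfderivWithin 𝓘(ℝ, E) I φ.symm (range I) y) :=
      mfderiv_comp_mfderivWithin y (hf.mdifferentiable (by simp) _) (hφs y hy)
        (I.uniqueMDiffOn _ (extChartAt_target_subset_range m hy))
    have h2 : fderiv ℝ g y = mfderivWithin 𝓘(ℝ, E) 𝓘(ℝ, ℝ) g (range I) y := by
      rw [I.range_eq_univ, mfderivWithin_univ, mfderiv_eq_fderiv]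
    rw [h2, h1]
    exact congrArg (differential I f (φ.symm y)) (hinv.inverse_apply_eq.1 rfl).symm
  have hP0 : ∀ V : ∀ m : M, TangentSpace I m, P V y₀ = (show E from V m) := by
    intro V
    have hinv := isInvertible_mfderivWithin_extChartAt_symm (I := I) (x := m) (y := y₀)
      (mem_extChartAt_target m)
    have hid : ∀ v : E, mfderivWithin 𝓘(ℝ, E) I φ.symm (range I) y₀ v = v := by
      intro v
      have h1 := mfderivWithin_extChartAt_symm_comp_mfderiv_extChartAt' (I := I)
        (mem_extChartAt_source (I := I) m)
      have h2 : mfderiv I 𝓘(ℝ, E) (extChartAt I m) m v = v := mfderiv_extChartAt_self v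
      have h3 := DFunLike.congr_fun h1 v
      exact (congrArg (mfderivWithin 𝓘(ℝ, E) I φ.symm (range I) y₀) h2).symm.trans h3
    have hV : ∀ m' : M, m' = m → (show E from V m') = (show E from V m) := by
      rintro _ rfl
      rfl
    refine hinv.inverse_apply_eq.2 ?_
    exact (hV _ (extChartAt_to_inv m)).trans (hid _).symm
  have hPd : ∀ V : ∀ m : M, TangentSpace I m,
      MDifferentiableAt I I.tangent (fun x => (⟨x, V x⟩ : TangentBundle I M)) m →
        DifferentiableAt ℝ (P V) y₀ := by
    intro V hV
    have := MDifferentiableWithinAt.differentiableWithinAt_mpullbackWithin_vectorField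
      (mdifferentiableWithinAt_univ.2 hV)
    rw [preimage_univ, univ_inter] at this
    exact this.differentiableAt (by rw [I.range_eq_univ]; exact Filter.univ_mem)
  have hgd : DifferentiableAt ℝ (fderiv ℝ g) y₀ :=
    (hgc.fderiv_right (m := 1)
      (by exact_mod_cast (ENat.LEInfty.out : (2 : ℕ∞ω) ≤ ∞))).differentiableAt (by simp)
  have hcomm : ∀ (V W : ∀ m : M, TangentSpace I m),
      MDifferentiableAt I I.tangent (fun x => (⟨x, W x⟩ : TangentBundle I M)) m →
      MDifferentiableAt I 𝓘(ℝ, ℝ) (fun x => differential I f x (W x)) m →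
      differential I (fun x => differential I f x (W x)) m (V m) =
        fderiv ℝ (fderiv ℝ g) y₀ (P V y₀) (P W y₀) +
          fderiv ℝ g y₀ (fderiv ℝ (P W) y₀ (P V y₀)) := by
    intro V W hW hWf
    have h1 : (fun x => differential I f x (W x)) ∘ φ.symm =ᶠ[𝓝 y₀]
        fun y => fderiv ℝ g y (P W y) := by
      filter_upwards [hnhds] with y hy using (key W y hy).symm
    have h2 : HasFDerivAt (fun y => fderiv ℝ g y (P W y)) _ y₀ :=
      hgd.hasFDerivAt.clm_apply (hPd W hW).hasFDerivAt
    rw [differential_eq_fderiv_chart hm hWf]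
    refine (congrArg (fun L : E →L[ℝ] ℝ => L (show E from V m)) h1.fderiv_eq).trans ?_
    rw [h2.fderiv, ← hP0 V]
    simp [add_comm]
  rw [hcomm V W hW hWf, hcomm W V hV hVf]
  have hsymm := (hgc.isSymmSndFDerivAt (by simp; exact ENat.LEInfty.out)).eq (P V y₀) (P W y₀)
  have hbr : (show E from mlieBracket I V W m) =
      fderiv ℝ (P W) y₀ (P V y₀) - fderiv ℝ (P V) y₀ (P W y₀) := by
    have hinv := isInvertible_mfderiv_extChartAt (I := I) (mem_extChartAt_source (I := I) m)
    refine hinv.inverse_apply_eq.2 ?_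
    refine Eq.trans ?_ (mfderiv_extChartAt_self (I := I) (m := m) _).symm
    have e : φ.symm ⁻¹' univ ∩ range I = univ := by
      rw [preimage_univ, univ_inter, I.range_eq_univ]
    change lieBracketWithin ℝ (P V) (P W) (φ.symm ⁻¹' univ ∩ range I) y₀ = _
    rw [e, lieBracketWithin_univ]
    rfl
  have h3 : differential I f m (mlieBracket I V W m) =
      fderiv ℝ g y₀ (show E from mlieBracket I V W m) :=
    congrArg (fun L : E →L[ℝ] ℝ => L (show E from mlieBracket I V W m))
      (differential_eq_fderiv_chart hm (hf.mdifferentiable (by simp) m))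
  refine h3.trans ((congrArg (fderiv ℝ g y₀) hbr).trans ?_)
  rw [hsymm, map_sub]
  ring

end LieBracket

/-! ### Lie groups and their adjoint action -/

section LieGroup

variable {E H : Type*} [NormedAddCommGroup E] [NormedSpace ℝ E] [TopologicalSpace H]
  {J : ModelWithCorners ℝ E H} {K : Type*} [TopologicalSpace K] [ChartedSpace H K] [Group K]
  [LieGroup J ∞ K]

variable (J K) in
lemma isManifold_of_lieGroup : IsManifold J ∞ K := LieGroup.toContMDiffMul.toIsManifold

/-- A Lie group is Hausdorff: its model space embeds into a normed space, so its points are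
closed. -/
lemma t2Space_of_lieGroup (J : ModelWithCorners ℝ E H) (K : Type*) [TopologicalSpace K]
    [ChartedSpace H K] [Group K] [LieGroup J ∞ K] : T2Space K := by
  have := topologicalGroup_of_lieGroup J ∞ (G := K)
  have := J.t1Space K
  infer_instance

lemma mdifferentiableAt_mul_left (k a : K) : MDifferentiableAt J J (fun l : K => k * l) a :=
  (contMDiff_mul_left (I := J) (n := ∞) (a := k)).mdifferentiable (by simp) a

lemma mdifferentiableAt_conj (k a : K) : MDifferentiableAt J J (fun l : K => k * l * k⁻¹) a :=
  ((contMDiff_const.mul contMDiff_id).mul contMDiff_const :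
    ContMDiff J J ∞ (fun l : K => k * l * k⁻¹)).mdifferentiable (by simp) a

variable (J) in
/-- The second derivative `x^L y^L f` at the identity, for left-invariant vector fields. -/
def leftDeriv₂ (f : K → ℝ) (x y : GroupLieAlgebra J K) : ℝ :=
  differential J (fun k => differential J (fun l => f (k * l)) 1 y) 1 x

lemma differential_mul_left {f : K → ℝ} (hf : ContMDiff J 𝓘(ℝ, ℝ) ∞ f) (k : K)
    (y : GroupLieAlgebra J K) :
    differential J (fun l => f (k * l)) 1 y = differential J f k (mulInvariantVectorField y k) := by
  rw [differential_comp_of_eq (hf.mdifferentiable (by simp) k) (mdifferentiableAt_mul_left k 1)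
    (mul_one k)]
  rfl

lemma contMDiff_comp_mul {f : K → ℝ} (hf : ContMDiff J 𝓘(ℝ, ℝ) ∞ f) :
    ContMDiff (J.prod J) 𝓘(ℝ, ℝ) ∞ fun p : K × K => f (p.1 * p.2) :=
  hf.comp (contMDiff_fst.mul contMDiff_snd)

variable [FiniteDimensional ℝ E] [J.Boundaryless]

/-- At the identity, `[x, y] f = x^L y^L f - y^L x^L f`. -/
theorem differential_bracket {f : K → ℝ} (hf : ContMDiff J 𝓘(ℝ, ℝ) ∞ f)
    (x y : GroupLieAlgebra J K) :
    differential J f 1 ⁅x, y⁆ = leftDeriv₂ J f x y - leftDeriv₂ J f y x := by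
  have := isManifold_of_lieGroup J K
  have := lieGroup_minSmoothness J K
  have : CompleteSpace E := FiniteDimensional.complete ℝ E
  have hd : ∀ y : GroupLieAlgebra J K, MDifferentiableAt J 𝓘(ℝ, ℝ)
      (fun k => differential J f k (mulInvariantVectorField y k)) 1 := by
    intro y
    have := contMDiff_differential_snd (contMDiff_comp_mul hf) 1 y
    simp only [differential_mul_left hf] at this
    exact this.mdifferentiable (by simp) 1
  have h := differential_mlieBracket (m := (1 : K)) (mdifferentiableAt_mulInvariantVectorField x)
    (mdifferentiableAt_mulInvariantVectorField y) hf (hd x) (hd y)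
  rw [GroupLieAlgebra.bracket_def, h]
  have h1 : ∀ v : GroupLieAlgebra J K, mulInvariantVectorField v (1 : K) = v := by
    intro v
    have e : (fun a : K => 1 * a) = id := by ext; simp
    have := (mfderiv_id (I := J) (x := (1 : K)))
    rw [← e] at this
    exact DFunLike.congr_fun this v
  simp only [h1, leftDeriv₂, differential_mul_left hf]

/-- Two elements of the Lie algebra agree if all smooth functions have the same derivatives along
them. -/
lemma lieAlgebra_ext {x y : GroupLieAlgebra J K}
    (h : ∀ f : K → ℝ, ContMDiff J 𝓘(ℝ, ℝ) ∞ f → differential J f 1 x = differential J f 1 y) :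
    x = y := by
  have := isManifold_of_lieGroup J K
  have := t2Space_of_lieGroup J K
  refine (lieBasis J K).ext_elem fun i => ?_
  obtain ⟨f, hf, hα⟩ := exists_differential_eq (I := J) (m := (1 : K))
    (LinearMap.toContinuousLinearMap ((lieBasis J K).coord i))
  have := h f hf
  rw [hα] at this
  exact this

lemma differential_inv {f : K → ℝ} (hf : ContMDiff J 𝓘(ℝ, ℝ) ∞ f) (x : GroupLieAlgebra J K) :
    differential J (fun k => f k⁻¹) 1 x = -differential J f 1 x := by
  have h := differential_diag (I := J) (f := fun p : K × K => f (p.1 * p.2⁻¹)) (m := 1)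
    ((hf.comp (contMDiff_fst.mul contMDiff_snd.inv)).mdifferentiable (by simp) _)
  simp only [mul_inv_cancel, inv_one, mul_one, one_mul, differential_const] at h
  have := DFunLike.congr_fun h x
  simp only [zero_apply, add_apply] at this
  linarith

lemma differential_Ad {f : K → ℝ} (hf : ContMDiff J 𝓘(ℝ, ℝ) ∞ f) (k : K)
    (y : GroupLieAlgebra J K) :
    differential J f 1 (Ad J k y) = differential J (fun a => f (k * a * k⁻¹)) 1 y := by
  rw [differential_comp_of_eq (hf.mdifferentiable (by simp) 1) (mdifferentiableAt_conj k 1)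
    (by simp : k * 1 * k⁻¹ = 1)]
  rfl

lemma contMDiff_Ad (α : Covector J (1 : K)) (y : GroupLieAlgebra J K) :
    ContMDiff J 𝓘(ℝ, ℝ) ∞ fun k : K => α (Ad J k y) := by
  have := isManifold_of_lieGroup J K
  have := t2Space_of_lieGroup J K
  obtain ⟨f, hf, rfl⟩ := exists_differential_eq (I := J) (m := (1 : K)) α
  simp only [differential_Ad hf]
  exact contMDiff_differential_snd (f := fun p : K × K => f (p.1 * p.2 * p.1⁻¹))
    (hf.comp ((contMDiff_fst.mul contMDiff_snd).mul contMDiff_fst.inv)) 1 y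

/-- The derivative of the adjoint action is the Lie bracket. -/
theorem differential_Ad_apply (α : Covector J (1 : K)) (x y : GroupLieAlgebra J K) :
    differential J (fun k : K => α (Ad J k y)) 1 x = α ⁅x, y⁆ := by
  have := isManifold_of_lieGroup J K
  have := t2Space_of_lieGroup J K
  have hint : J.IsInteriorPoint (1 : K) := BoundarylessManifold.isInteriorPoint
  obtain ⟨f, hf, rfl⟩ := exists_differential_eq (I := J) (m := (1 : K)) α
  simp only [differential_Ad hf]
  -- the two occurrences of `k` in `k * a * k⁻¹` are differentiated separately
  have hG : ContMDiff ((J.prod J).prod J) 𝓘(ℝ, ℝ) ∞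
      fun p : (K × K) × K => f (p.1.1 * p.2 * p.1.2⁻¹) :=
    hf.comp (((contMDiff_fst.comp contMDiff_fst).mul contMDiff_snd).mul
      (contMDiff_snd.comp contMDiff_fst).inv)
  have hH := contMDiff_differential_snd hG 1 y
  have h := differential_diag (I := J) (m := 1) (hH.mdifferentiable (by simp) _)
  simp only [inv_one, mul_one, one_mul] at h
  rw [h, differential_bracket hf, add_apply, sub_eq_add_neg]
  congr 1
  have hmul : ContMDiff (J.prod J) 𝓘(ℝ, ℝ) ∞ fun p : K × K => f (p.2 * p.1⁻¹) :=
    hf.comp (contMDiff_snd.mul contMDiff_fst.inv)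
  rw [differential_differential_comm hmul hint hint, leftDeriv₂]
  have h3 : ∀ a : K, differential J (fun k => f (a * k⁻¹)) 1 x =
      -differential J (fun k => f (a * k)) 1 x := fun a =>
    differential_inv (f := fun k => f (a * k)) (hf.comp contMDiff_mul_left) x
  simp only [h3]
  rw [differential_neg]
  rfl

/-- An `Ad`-invariant form is `ad`-invariant. -/
theorem InvariantForm.form_lie (B : InvariantForm J K) (x y z : GroupLieAlgebra J K) :
    B.form ⁅x, y⁆ z + B.form y ⁅x, z⁆ = 0 := by
  let b := lieBasis J K
  let δ : ∀ _ : Fin _, Covector J (1 : K) := fun i => LinearMap.toContinuousLinearMap (b.coord i)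
  -- in coordinates, the form is a combination of products of functionals, which reduces the claim
  -- to the derivative of `k ↦ α (Ad_k x)` and the Leibniz rule
  have hB : ∀ u v, B.form u v = ∑ i, ∑ j, B.form (b i) (b j) * (δ i u * δ j v) := by
    intro u v
    conv_lhs => rw [← b.sum_repr u, ← b.sum_repr v]
    simp only [map_sum, map_smul, LinearMap.sum_apply, LinearMap.smul_apply, smul_eq_mul,
      Finset.mul_sum]
    rw [Finset.sum_comm]
    refine Finset.sum_congr rfl fun i _ => Finset.sum_congr rfl fun j _ => ?_
    change _ = _ * (b.repr u i * b.repr v j)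
    ring
  have hs : ∀ i (u : GroupLieAlgebra J K), MDifferentiableAt J 𝓘(ℝ, ℝ)
      (fun k : K => δ i (Ad J k u)) 1 := fun i u =>
    (contMDiff_Ad (δ i) u).mdifferentiable (by simp) 1
  have h1 : differential J (fun k : K => B.form (Ad J k y) (Ad J k z)) 1 x = 0 := by
    simp only [B.invariant, differential_const, zero_apply]
  have hone : ∀ u : GroupLieAlgebra J K, Ad J (1 : K) u = u := fun u =>
    lieAlgebra_ext fun f hf => by simp [differential_Ad hf]
  have hp : ∀ i j, MDifferentiableAt J 𝓘(ℝ, ℝ)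
      (fun k : K => δ i (Ad J k y) * δ j (Ad J k z)) 1 := fun i j => (hs i y).mul (hs j z)
  have hq : ∀ i j, MDifferentiableAt J 𝓘(ℝ, ℝ)
      (fun k : K => B.form (b i) (b j) * (δ i (Ad J k y) * δ j (Ad J k z))) 1 :=
    fun i j => mdifferentiableAt_const.mul (hp i j)
  have h2 : ∀ i j, differential J
      (fun k : K => B.form (b i) (b j) * (δ i (Ad J k y) * δ j (Ad J k z))) 1 x =
      B.form (b i) (b j) * (δ i y * δ j ⁅x, z⁆ + δ j z * δ i ⁅x, y⁆) := by
    intro i j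
    rw [differential_const_mul _ (hp i j), differential_mul (hs i y) (hs j z),
      hone, hone]
    simp only [smul_apply, add_apply, smul_eq_mul]
    rw [differential_Ad_apply, differential_Ad_apply]
  have h3 : differential J (fun k : K => ∑ i, ∑ j,
      B.form (b i) (b j) * (δ i (Ad J k y) * δ j (Ad J k z))) 1 x = 0 := by
    rw [← h1]
    exact congrArg (fun F : K → ℝ => differential J F 1 x) (funext fun k => (hB _ _).symm)
  rw [differential_sum _ fun i => mdifferentiableAt_finset_sum _ fun j => hq i j,
    sum_apply] at h3
  have h4 : ∀ i, differential J (fun k : K => ∑ j,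
      B.form (b i) (b j) * (δ i (Ad J k y) * δ j (Ad J k z))) 1 x =
      ∑ j, B.form (b i) (b j) * (δ i y * δ j ⁅x, z⁆ + δ j z * δ i ⁅x, y⁆) := by
    intro i
    rw [differential_sum _ fun j => hq i j, sum_apply]
    exact Finset.sum_congr rfl fun j _ => h2 i j
  rw [Finset.sum_congr rfl fun i _ => h4 i] at h3
  rw [hB, hB, ← Finset.sum_add_distrib, ← h3]
  refine Finset.sum_congr rfl fun i _ => ?_
  rw [← Finset.sum_add_distrib]
  refine Finset.sum_congr rfl fun j _ => ?_
  ring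

end LieGroup

/-! ### The Cartan trivector -/

section Cartan

variable {E H : Type*} [NormedAddCommGroup E] [NormedSpace ℝ E] [TopologicalSpace H]
  {J : ModelWithCorners ℝ E H} {K : Type*} [TopologicalSpace K] [ChartedSpace H K] [Group K]
  [FiniteDimensional ℝ E]

/-- The trilinear form `(a, b, c) ↦ ⟨a♯, [b♯, c♯]⟩` on `𝔨*`. It is alternating, and the Cartan
trivector takes half its value on `a, b, c`. -/
def InvariantForm.cartan (B : InvariantForm J K) (a b c : GroupLieAlgebra J K →ₗ[ℝ] ℝ) : ℝ :=
  B.form (B.sharp a) ⁅B.sharp b, B.sharp c⁆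

variable [LieGroup J ∞ K]

namespace InvariantForm

variable (B : InvariantForm J K) (a a' b b' c c' : GroupLieAlgebra J K →ₗ[ℝ] ℝ)

lemma cartan_eq_lieBilin :
    B.cartan a b c = B.form (B.sharp a) (lieBilin J K (B.sharp b) (B.sharp c)) := rfl

lemma cartan_swap : B.cartan a b c = -B.cartan a c b := by
  rw [cartan_eq_lieBilin, lieBilin_swap, map_neg]
  rfl

/-- Cyclic invariance, a consequence of the `ad`-invariance of the form. -/
lemma cartan_rotate [J.Boundaryless] : B.cartan a b c = B.cartan b c a := by
  have h := B.form_lie (B.sharp c) (B.sharp b) (B.sharp a)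
  rw [cartan_eq_lieBilin, lieBilin_swap, map_neg, lieBilin_apply, B.symm, cartan]
  linarith

lemma cartan_add_left : B.cartan (a + a') b c = B.cartan a b c + B.cartan a' b c := by
  simp only [cartan_eq_lieBilin, sharp_add, map_add, LinearMap.add_apply]

lemma cartan_add_middle : B.cartan a (b + b') c = B.cartan a b c + B.cartan a b' c := by
  simp only [cartan_eq_lieBilin, sharp_add, map_add, LinearMap.add_apply]

lemma cartan_add_right : B.cartan a b (c + c') = B.cartan a b c + B.cartan a b c' := by
  simp only [cartan_eq_lieBilin, sharp_add, map_add]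

lemma sum_form_lie :
    ∑ i, ∑ j, ∑ k, B.form (lieBasis J K i) ⁅lieBasis J K j, lieBasis J K k⁆ *
      (a (B.dualBasis i) * b (B.dualBasis j) * c (B.dualBasis k)) = B.cartan a b c := by
  simp only [cartan_eq_lieBilin, sharp_eq_sum_dualBasis, map_sum, map_smul, LinearMap.sum_apply,
    LinearMap.smul_apply, smul_eq_mul, Finset.mul_sum, lieBilin_apply]
  refine (Finset.sum_comm.trans ?_)
  rw [Finset.sum_comm_cycle]
  refine Finset.sum_congr rfl fun i _ => Finset.sum_congr rfl fun j _ =>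
    Finset.sum_congr rfl fun k _ => ?_
  ring

lemma sum_apply_lie :
    ∑ i, ∑ j, a ⁅lieBasis J K i, lieBasis J K j⁆ * (b (B.dualBasis i) * c (B.dualBasis j)) =
      B.cartan a b c := by
  rw [cartan_eq_lieBilin, form_sharp]
  simp only [sharp_eq_sum_dualBasis, map_sum, map_smul, LinearMap.sum_apply,
    LinearMap.smul_apply, smul_eq_mul, Finset.mul_sum, lieBilin_apply]
  rw [Finset.sum_comm]
  refine Finset.sum_congr rfl fun i _ => Finset.sum_congr rfl fun j _ => ?_
  ring

lemma sum_apply_lie_dualBasis :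
    ∑ i, ∑ j, a ⁅B.dualBasis i, B.dualBasis j⁆ * (b (lieBasis J K i) * c (lieBasis J K j)) =
      B.cartan a b c := by
  rw [cartan_eq_lieBilin, form_sharp]
  simp only [sharp, map_sum, map_smul, LinearMap.sum_apply,
    LinearMap.smul_apply, smul_eq_mul, Finset.mul_sum, lieBilin_apply]
  rw [Finset.sum_comm]
  refine Finset.sum_congr rfl fun i _ => Finset.sum_congr rfl fun j _ => ?_
  ring

end InvariantForm

end Cartan

/-! ### Actions and their fundamental vector fields -/

section ActionCalculus

variable {E H : Type*} [NormedAddCommGroup E] [NormedSpace ℝ E] [TopologicalSpace H]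
  {J : ModelWithCorners ℝ E H} {K : Type*} [TopologicalSpace K] [ChartedSpace H K] [Group K]
  {F H' M : Type*} [NormedAddCommGroup F] [NormedSpace ℝ F] [TopologicalSpace H']
  {I : ModelWithCorners ℝ F H'} [TopologicalSpace M] [ChartedSpace H' M]

lemma mfderiv_comp_apply_model {X H'' Y : Type*} [NormedAddCommGroup X] [NormedSpace ℝ X]
    [TopologicalSpace H''] {I'' : ModelWithCorners ℝ X H''} [TopologicalSpace Y]
    [ChartedSpace H'' Y] {g : M → Y} {f : K → M} {x : K} {y : M}
    (hg : MDifferentiableAt I I'' g y) (hf : MDifferentiableAt J I f x) (h : f x = y)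
    (v : TangentSpace J x) :
    (show X from mfderiv J I'' (fun a => g (f a)) x v) =
      mfderiv I I'' g y (mfderiv J I f x v) := by
  subst h
  exact DFunLike.congr_fun (mfderiv_comp x hg hf) v

namespace SmoothAction

variable (A : SmoothAction J K I M)

/-- The linear map `x ↦ x_M(m)`. -/
def fundamentalMap (m : M) : GroupLieAlgebra J K →L[ℝ] TangentSpace I m :=
  -(show E →L[ℝ] F from mfderiv J I (fun k => A.act k m) 1)

/-- The functional `x ↦ α(x_M(m))` on the Lie algebra. -/
def orbit (m : M) (α : Covector I m) : GroupLieAlgebra J K →ₗ[ℝ] ℝ :=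
  (α.comp (A.fundamentalMap m)).toLinearMap

@[simp]
lemma orbit_apply (m : M) (α : Covector I m) (x : GroupLieAlgebra J K) :
    A.orbit m α x = α (A.fundamental x m) := rfl

lemma smooth_act (k : K) : ContMDiff I I ∞ (A.act k) :=
  A.smooth.comp (contMDiff_const.prodMk contMDiff_id)

lemma smooth_orbit (m : M) : ContMDiff J I ∞ (fun k => A.act k m) :=
  A.smooth.comp (contMDiff_id.prodMk contMDiff_const)

lemma contMDiff_comp_act {f : M → ℝ} (hf : ContMDiff I 𝓘(ℝ, ℝ) ∞ f) :
    ContMDiff (J.prod I) 𝓘(ℝ, ℝ) ∞ fun p : K × M => f (A.act p.1 p.2) :=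
  hf.comp A.smooth

lemma differential_fundamental {f : M → ℝ} {m : M} (hf : MDifferentiableAt I 𝓘(ℝ, ℝ) f m)
    (x : GroupLieAlgebra J K) :
    differential I f m (A.fundamental x m) = -differential J (fun k => f (A.act k m)) 1 x := by
  rw [differential_comp_of_eq hf ((A.smooth_orbit m).mdifferentiable (by simp) 1) (A.one_act m)]
  exact map_neg (differential I f m) _

/-- The Lie derivative of a function along a fundamental vector field. -/
def lieDeriv (x : GroupLieAlgebra J K) (f : M → ℝ) (m : M) : ℝ :=
  differential I f m (A.fundamental x m)

lemma lieDeriv_eq {f : M → ℝ} (hf : ContMDiff I 𝓘(ℝ, ℝ) ∞ f) (x : GroupLieAlgebra J K) (m : M) :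
    A.lieDeriv x f m = -differential J (fun k => f (A.act k m)) 1 x :=
  A.differential_fundamental (hf.mdifferentiable (by simp) m) x

lemma differential_act_comp {f : M → ℝ} (hf : ContMDiff I 𝓘(ℝ, ℝ) ∞ f) (k : K) (m : M) :
    differential I (fun p => f (A.act k p)) m =
      (differential I f (A.act k m)).comp (mfderiv I I (A.act k) m) :=
  differential_comp (hf.mdifferentiable (by simp) _) ((A.smooth_act k).mdifferentiable (by simp) m)

/-- An invariant bivector field gives an invariant bracket. -/
lemma bracket_act {P : ∀ m : M, MultiVector I 2 m}
    (hP : ∀ k m, P (A.act k m) = pushforward (mfderiv I I (A.act k) m) (P m))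
    {f g : M → ℝ} (hf : ContMDiff I 𝓘(ℝ, ℝ) ∞ f) (hg : ContMDiff I 𝓘(ℝ, ℝ) ∞ g) (k : K) (m : M) :
    bracket P f g (A.act k m) = bracket P (fun p => f (A.act k p)) (fun p => g (A.act k p)) m := by
  rw [bracket, bracket, hP, pushforward_two_apply, differential_act_comp A hf,
    differential_act_comp A hg]

variable [LieGroup J ∞ K]

/-- The vector field `x_M` is carried to `(Ad_k x)_M` by the action of `k`. -/
lemma mfderiv_act_fundamental (k : K) (m : M) (x : GroupLieAlgebra J K) :
    mfderiv I I (A.act k) m (A.fundamental x m) = A.fundamental (Ad J k x) (A.act k m) := by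
  have h1 := mfderiv_comp_apply_model (J := J) (I := I) (I'' := I) (x := (1 : K))
    (g := A.act k) (f := fun a => A.act a m) ((A.smooth_act k).mdifferentiable (by simp) m)
    ((A.smooth_orbit m).mdifferentiable (by simp) 1) (A.one_act m) x
  have h2 := mfderiv_comp_apply_model (J := J) (I := J) (I'' := I) (x := (1 : K))
    (g := fun a => A.act a (A.act k m)) (f := fun a => k * a * k⁻¹)
    ((A.smooth_orbit (A.act k m)).mdifferentiable (by simp) 1) (mdifferentiableAt_conj k 1)
    (by simp : k * 1 * k⁻¹ = 1) x
  have e : (fun a => A.act k (A.act a m)) =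
      fun a => A.act (k * a * k⁻¹) (A.act k m) := by
    ext a
    simp only [← A.mul_act, mul_assoc, inv_mul_cancel, mul_one]
  rw [e] at h1
  have h := h1.symm.trans h2
  have hx := congrArg (fun v : F => -v) h
  exact (map_neg (show F →L[ℝ] F from mfderiv I I (A.act k) m) _).trans hx

variable [IsManifold I ∞ M]

lemma smooth_lieDeriv {f : M → ℝ} (hf : ContMDiff I 𝓘(ℝ, ℝ) ∞ f) (x : GroupLieAlgebra J K) :
    ContMDiff I 𝓘(ℝ, ℝ) ∞ (A.lieDeriv x f) := by
  have := isManifold_of_lieGroup J K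
  refine (contMDiff_differential_fst (A.contMDiff_comp_act hf) 1 x).neg.congr fun m => ?_
  exact A.lieDeriv_eq hf x m

variable [FiniteDimensional ℝ E] [J.Boundaryless]

/-- Fundamental vector fields satisfy `[x_M, y_M] = [x, y]_M`. -/
theorem lieDeriv_lieDeriv_sub {f : M → ℝ} (hf : ContMDiff I 𝓘(ℝ, ℝ) ∞ f)
    (x y : GroupLieAlgebra J K) (m : M) :
    A.lieDeriv x (A.lieDeriv y f) m - A.lieDeriv y (A.lieDeriv x f) m =
      A.lieDeriv ⁅x, y⁆ f m := by
  have := isManifold_of_lieGroup J K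
  have hint : J.IsInteriorPoint (1 : K) := BoundarylessManifold.isInteriorPoint
  have hF : ContMDiff J 𝓘(ℝ, ℝ) ∞ fun k => f (A.act k m) := hf.comp (A.smooth_orbit m)
  have key : ∀ x y : GroupLieAlgebra J K, A.lieDeriv x (A.lieDeriv y f) m =
      leftDeriv₂ J (fun k => f (A.act k m)) y x := by
    intro x y
    rw [A.lieDeriv_eq (A.smooth_lieDeriv hf y) x m]
    simp only [A.lieDeriv_eq hf y, ← A.mul_act]
    rw [differential_neg, leftDeriv₂]
    have h := differential_differential_comm (I := J) (I' := J)
      (f := fun p : K × K => f (A.act (p.2 * p.1) m))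
      (hF.comp (contMDiff_snd.mul contMDiff_fst)) hint hint x y
    rw [← h]
    exact neg_neg _
  rw [key, key, A.lieDeriv_eq hf, differential_bracket hF]
  ring

omit [FiniteDimensional ℝ E] in
/-- The fundamental vector fields are derivations of an invariant bracket. -/
theorem lieDeriv_bracket [FiniteDimensional ℝ F] {P : ∀ m : M, MultiVector I 2 m}
    (hP : ∀ k m, P (A.act k m) = pushforward (mfderiv I I (A.act k) m) (P m))
    (hPs : IsSmoothField P)
    {f g : M → ℝ} (hf : ContMDiff I 𝓘(ℝ, ℝ) ∞ f) (hg : ContMDiff I 𝓘(ℝ, ℝ) ∞ g)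
    (x : GroupLieAlgebra J K) {m : M} (hm : I.IsInteriorPoint m) :
    A.lieDeriv x (bracket P f g) m =
      bracket P (A.lieDeriv x f) g m + bracket P f (A.lieDeriv x g) m := by
  have := isManifold_of_lieGroup J K
  have hint : J.IsInteriorPoint (1 : K) := BoundarylessManifold.isInteriorPoint
  have hb : ContMDiff I 𝓘(ℝ, ℝ) ∞ (bracket P f g) := by
    refine (hPs ![f, g] (by intro i; fin_cases i <;> assumption)).congr fun m => ?_
    refine congrArg (P m) ?_
    ext i
    fin_cases i <;> rfl
  -- by invariance, `{f, g}(k m) = {f ∘ k, g ∘ k}(m)`, where `P` is only evaluated at `m`: in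
  -- coordinates this is a combination of products of derivatives, with coefficients free of `k`
  obtain ⟨d, v, c, -, hc⟩ := (P m).exists_coeff
  rw [A.lieDeriv_eq hb]
  simp only [A.bracket_act hP hf hg]
  simp only [bracket, hc]
  have hs : ∀ {f : M → ℝ} (_ : ContMDiff I 𝓘(ℝ, ℝ) ∞ f) (v : TangentSpace I m),
      MDifferentiableAt J 𝓘(ℝ, ℝ) (fun k => differential I (fun p => f (A.act k p)) m v) 1 :=
    fun hf v => (contMDiff_differential_snd (A.contMDiff_comp_act hf) m v).mdifferentiable
      (by simp) 1
  -- the derivative along `x` of the covector `d(f ∘ k)` at `m`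
  have hd : ∀ {f : M → ℝ} (_ : ContMDiff I 𝓘(ℝ, ℝ) ∞ f) (v : TangentSpace I m),
      differential J (fun k => differential I (fun p => f (A.act k p)) m v) 1 x =
        -differential I (A.lieDeriv x f) m v := by
    intro f hf v
    rw [differential_differential_comm (A.contMDiff_comp_act hf) hint hm x v]
    have : A.lieDeriv x f = fun m => -differential J (fun k => f (A.act k m)) 1 x :=
      funext fun m => A.lieDeriv_eq hf x m
    rw [this, differential_neg]
    exact (neg_neg _).symm
  have hone : ∀ f : M → ℝ, (fun p => f (A.act 1 p)) = f := fun f => funext fun p => by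
    rw [A.one_act]
  have hp : ∀ i j, MDifferentiableAt J 𝓘(ℝ, ℝ) (fun k =>
      differential I (fun p => f (A.act k p)) m (v i) *
        differential I (fun p => g (A.act k p)) m (v j)) 1 := fun i j => (hs hf _).mul (hs hg _)
  have hq : ∀ i j, MDifferentiableAt J 𝓘(ℝ, ℝ) (fun k => c i j *
      (differential I (fun p => f (A.act k p)) m (v i) *
        differential I (fun p => g (A.act k p)) m (v j))) 1 := fun i j =>
    mdifferentiableAt_const.mul (hp i j)
  rw [differential_sum _ fun i => mdifferentiableAt_finset_sum _ fun j => hq i j, sum_apply,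
    ← Finset.sum_neg_distrib, ← Finset.sum_add_distrib]
  refine Finset.sum_congr rfl fun i _ => ?_
  rw [differential_sum _ fun j => hq i j, sum_apply, ← Finset.sum_neg_distrib,
    ← Finset.sum_add_distrib]
  refine Finset.sum_congr rfl fun j _ => ?_
  rw [differential_const_mul _ (hp i j), differential_mul (hs hf _) (hs hg _), hone, hone]
  simp only [smul_apply, add_apply, smul_eq_mul]
  rw [hd hf, hd hg]
  ring

end SmoothAction

variable [FiniteDimensional ℝ E] [LieGroup J ∞ K] [J.Boundaryless]

omit [FiniteDimensional ℝ E] [LieGroup J ∞ K] [J.Boundaryless] in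
lemma multiVector_sum_apply {ι : Type*} (s : Finset ι) {k : ℕ} {m : M}
    (P : ι → MultiVector I k m) (α : Fin k → Covector I m) :
    (∑ i ∈ s, P i) α = ∑ i ∈ s, P i α := by
  classical
  induction s using Finset.induction_on with
  | empty => rfl
  | insert a s ha ih => rw [Finset.sum_insert ha, Finset.sum_insert ha, ← ih]; rfl

/-- The Cartan trivector field in terms of the functionals of three covectors. -/
theorem cartanField_apply (B : InvariantForm J K) (A : SmoothAction J K I M) (m : M)
    (α β γ : Covector I m) :
    cartanField B A m ![α, β, γ] =
      1 / 2 * B.cartan (A.orbit m α) (A.orbit m β) (A.orbit m γ) := by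
  have h : cartanField B A m ![α, β, γ] = (1 / 12 : ℝ) *
      ∑ i, ∑ j, ∑ k, B.form (lieBasis J K i) ⁅lieBasis J K j, lieBasis J K k⁆ *
        wedge ![A.fundamental (B.dualBasis i) m, A.fundamental (B.dualBasis j) m,
          A.fundamental (B.dualBasis k) m] ![α, β, γ] := by
    simp only [cartanField, AlternatingMap.smul_apply, multiVector_sum_apply, smul_eq_mul]
  rw [h]
  set a := A.orbit m α with ha
  set b := A.orbit m β with hb
  set c := A.orbit m γ with hc
  have hexp : ∀ i j k, B.form (lieBasis J K i) ⁅lieBasis J K j, lieBasis J K k⁆ *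
        wedge ![A.fundamental (B.dualBasis i) m, A.fundamental (B.dualBasis j) m,
          A.fundamental (B.dualBasis k) m] ![α, β, γ] =
      (B.form (lieBasis J K i) ⁅lieBasis J K j, lieBasis J K k⁆ *
        (a (B.dualBasis i) * b (B.dualBasis j) * c (B.dualBasis k))
      - B.form (lieBasis J K i) ⁅lieBasis J K j, lieBasis J K k⁆ *
        (a (B.dualBasis i) * c (B.dualBasis j) * b (B.dualBasis k))
      - B.form (lieBasis J K i) ⁅lieBasis J K j, lieBasis J K k⁆ *
        (b (B.dualBasis i) * a (B.dualBasis j) * c (B.dualBasis k))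
      + B.form (lieBasis J K i) ⁅lieBasis J K j, lieBasis J K k⁆ *
        (c (B.dualBasis i) * a (B.dualBasis j) * b (B.dualBasis k))
      + B.form (lieBasis J K i) ⁅lieBasis J K j, lieBasis J K k⁆ *
        (b (B.dualBasis i) * c (B.dualBasis j) * a (B.dualBasis k))
      - B.form (lieBasis J K i) ⁅lieBasis J K j, lieBasis J K k⁆ *
        (c (B.dualBasis i) * b (B.dualBasis j) * a (B.dualBasis k))) := by
    intro i j k
    rw [wedge_three_apply]
    simp only [ha, hb, hc, SmoothAction.orbit_apply]
    ring
  -- the six terms of the determinant agree up to sign, whence the factor `6 / 12 = 1 / 2`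
  simp only [hexp, Finset.sum_add_distrib, Finset.sum_sub_distrib, B.sum_form_lie]
  rw [B.cartan_swap a c b, B.cartan_swap b a c, B.cartan_swap c b a, ← B.cartan_rotate a b c,
    B.cartan_rotate c a b]
  ring

end ActionCalculus

/-! ### Fusion in the algebra of smooth functions -/

section FusionAlgebra

variable {R 𝒜 ι : Type*} [CommRing R] [CommRing 𝒜] [Algebra R 𝒜] [Fintype ι]

/-- The bracket of the bivector `∑ X_i ∧ Y_i`. -/
def derivationBracket (X Y : ι → Derivation R 𝒜 𝒜) (f g : 𝒜) : 𝒜 :=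
  ∑ i, (X i f * Y i g - Y i f * X i g)

/-- If the `X_i` and `Y_i` are derivations of a bracket, then that bracket has vanishing Schouten
bracket with `∑ X_i ∧ Y_i`. -/
theorem derivationBracket_cross {b : 𝒜 → Derivation R 𝒜 𝒜} (hb : ∀ f g, b f g = -b g f)
    {X Y : ι → Derivation R 𝒜 𝒜}
    (hX : ∀ i f g, X i (b f g) = b (X i f) g + b f (X i g))
    (hY : ∀ i f g, Y i (b f g) = b (Y i f) g + b f (Y i g)) (f g h : 𝒜) :
    (b f (derivationBracket X Y g h) + derivationBracket X Y f (b g h)) +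
      (b g (derivationBracket X Y h f) + derivationBracket X Y g (b h f)) +
      (b h (derivationBracket X Y f g) + derivationBracket X Y h (b f g)) = 0 := by
  simp only [derivationBracket, map_sum, ← Finset.sum_add_distrib]
  refine Finset.sum_eq_zero fun i _ => ?_
  simp only [map_sub, Derivation.leibniz, smul_eq_mul, hX, hY]
  rw [hb (X i g) h, hb (X i h) f, hb (X i f) g, hb (Y i g) h, hb (Y i h) f, hb (Y i f) g]
  ring

lemma derivationBracket_sub_smul (X Y : ι → Derivation R 𝒜 𝒜) (c : R) (f u v : 𝒜) :
    derivationBracket X Y f (u - c • v) =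
      derivationBracket X Y f u - c • derivationBracket X Y f v := by
  simp only [derivationBracket, Finset.smul_sum]
  rw [← Finset.sum_sub_distrib]
  refine Finset.sum_congr rfl fun i _ => ?_
  simp only [map_sub, Derivation.map_smul]
  simp only [Algebra.smul_def]
  ring

/-- The double bracket for `b - c D`, where `D` is the bracket of the derivations, expanded in
powers of `c`. -/
lemma derivationBracket_deformed (b : 𝒜 → Derivation R 𝒜 𝒜) (X Y : ι → Derivation R 𝒜 𝒜) (c : R)
    (f g h : 𝒜) :
    b f (b g h - c • derivationBracket X Y g h) -
        c • derivationBracket X Y f (b g h - c • derivationBracket X Y g h) =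
      b f (b g h) - c • (b f (derivationBracket X Y g h) + derivationBracket X Y f (b g h)) +
        c • c • derivationBracket X Y f (derivationBracket X Y g h) := by
  rw [derivationBracket_sub_smul, map_sub, Derivation.map_smul]
  module

/-- The determinant of the three derivations `U, V, W` on three functions, written as a sum over
cyclic permutations of the functions. -/
def derivationDet (U : 𝒜 → 𝒜) (V W : Derivation R 𝒜 𝒜) (f g h : 𝒜) : 𝒜 :=
  U f * (V g * W h - W g * V h) + U g * (V h * W f - W h * V f) + U h * (V f * W g - W f * V g)

/-- The Schouten square of `∑ X_i ∧ Y_i` when all `X_i` commute with all `Y_j`. -/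
theorem derivationBracket_jacobi {X Y : ι → Derivation R 𝒜 𝒜}
    (hXY : ∀ i j f, Y i (X j f) = X j (Y i f)) (f g h : 𝒜) :
    2 * (derivationBracket X Y f (derivationBracket X Y g h) +
      derivationBracket X Y g (derivationBracket X Y h f) +
      derivationBracket X Y h (derivationBracket X Y f g)) =
    ∑ i, ∑ j, (derivationDet (fun f => X i (X j f) - X j (X i f)) (Y i) (Y j) f g h +
      derivationDet (fun f => Y i (Y j f) - Y j (Y i f)) (X i) (X j) f g h) := by
  have key : ∀ f g h, derivationBracket X Y f (derivationBracket X Y g h) =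
      ∑ i, ∑ j, (X i f * Y i (X j g * Y j h - Y j g * X j h) -
        Y i f * X i (X j g * Y j h - Y j g * X j h)) := by
    intro f g h
    unfold derivationBracket
    refine Finset.sum_congr rfl fun i _ => ?_
    rw [map_sum, map_sum, Finset.mul_sum, Finset.mul_sum, ← Finset.sum_sub_distrib]
  -- the double sum equals half of its symmetrisation in `i` and `j`
  have symmetrise : ∀ {N S : ι → ι → 𝒜}, (∀ i j, N i j + N j i = S i j) →
      2 * ∑ i, ∑ j, N i j = ∑ i, ∑ j, S i j := by
    intro N S h
    rw [two_mul]
    nth_rewrite 2 [Finset.sum_comm]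
    simp only [← Finset.sum_add_distrib, h]
  rw [key, key, key]
  simp only [← Finset.sum_add_distrib]
  refine symmetrise fun i j => ?_
  simp only [derivationDet, map_sub, Derivation.leibniz, smul_eq_mul, hXY]
  ring

end FusionAlgebra

/-! ### Derivations of the algebra of smooth functions -/

section FusionBracket

variable {E H : Type*} [NormedAddCommGroup E] [NormedSpace ℝ E] [TopologicalSpace H]
  {J : ModelWithCorners ℝ E H} {K : Type*} [TopologicalSpace K] [ChartedSpace H K] [Group K]
  {F H' M : Type*} [NormedAddCommGroup F] [NormedSpace ℝ F] [TopologicalSpace H']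
  {I : ModelWithCorners ℝ F H'} [TopologicalSpace M] [ChartedSpace H' M]

lemma mdifferentiableAt_of_contMDiff {f : M → ℝ} (hf : ContMDiff I 𝓘(ℝ, ℝ) ∞ f) (m : M) :
    MDifferentiableAt I 𝓘(ℝ, ℝ) f m := hf.mdifferentiable (by simp) m

lemma IsSmoothField.contMDiff_two {P : ∀ m : M, MultiVector I 2 m} (hP : IsSmoothField P)
    {f g : M → ℝ} (hf : ContMDiff I 𝓘(ℝ, ℝ) ∞ f) (hg : ContMDiff I 𝓘(ℝ, ℝ) ∞ g) :
    ContMDiff I 𝓘(ℝ, ℝ) ∞ (bracket P f g) := by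
  refine (hP ![f, g] (by intro i; fin_cases i <;> assumption)).congr fun m => ?_
  refine congrArg (P m) ?_
  ext i
  fin_cases i <;> rfl

lemma isSmoothField_two {P : ∀ m : M, MultiVector I 2 m}
    (h : ∀ f g : M → ℝ, ContMDiff I 𝓘(ℝ, ℝ) ∞ f → ContMDiff I 𝓘(ℝ, ℝ) ∞ g →
      ContMDiff I 𝓘(ℝ, ℝ) ∞ (bracket P f g)) : IsSmoothField P := by
  intro f hf
  refine (h (f 0) (f 1) (hf 0) (hf 1)).congr fun m => congrArg (P m) ?_
  ext i
  fin_cases i <;> rfl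

lemma isSmoothField_three {P : ∀ m : M, MultiVector I 3 m}
    (h : ∀ f g h : M → ℝ, ContMDiff I 𝓘(ℝ, ℝ) ∞ f → ContMDiff I 𝓘(ℝ, ℝ) ∞ g →
      ContMDiff I 𝓘(ℝ, ℝ) ∞ h → ContMDiff I 𝓘(ℝ, ℝ) ∞
        fun m => P m ![differential I f m, differential I g m, differential I h m]) :
    IsSmoothField P := by
  intro f hf
  refine (h (f 0) (f 1) (f 2) (hf 0) (hf 1) (hf 2)).congr fun m => congrArg (P m) ?_
  ext i
  fin_cases i <;> rfl

/-- The bracket `{f, ·}` of a smooth bivector field, as a derivation of the smooth functions. -/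
def bracketDerivation {P : ∀ m : M, MultiVector I 2 m} (hP : IsSmoothField P)
    (f : C^∞⟮I, M; ℝ⟯) : Derivation ℝ C^∞⟮I, M; ℝ⟯ C^∞⟮I, M; ℝ⟯ :=
  Derivation.mk'
    { toFun := fun g => ⟨bracket P f g, hP.contMDiff_two f.contMDiff g.contMDiff⟩
      map_add' := fun g h => by
        ext m
        have : differential I (fun x => g x + h x) m = _ := differential_add
          (mdifferentiableAt_of_contMDiff g.contMDiff m)
          (mdifferentiableAt_of_contMDiff h.contMDiff m)
        change P m ![_, differential I (fun x => g x + h x) m] = P m _ + P m _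
        rw [this, MultiVector.two_add_right]
      map_smul' := fun c g => by
        ext m
        have : differential I (fun x => c * g x) m = _ := differential_const_mul c
          (mdifferentiableAt_of_contMDiff g.contMDiff m)
        change P m ![_, differential I (fun x => c * g x) m] = c * P m _
        rw [this, MultiVector.two_smul_right] }
    fun g h => by
      ext m
      have : differential I (fun x => g x * h x) m = _ := differential_mul
        (mdifferentiableAt_of_contMDiff g.contMDiff m)
        (mdifferentiableAt_of_contMDiff h.contMDiff m)
      change P m ![_, differential I (fun x => g x * h x) m] = g m * P m _ + h m * P m _
      rw [this, MultiVector.two_add_right, MultiVector.two_smul_right, MultiVector.two_smul_right]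

variable [IsManifold I ∞ M] [LieGroup J ∞ K]

/-- The Lie derivative along a fundamental vector field, as a derivation of the smooth functions. -/
def SmoothAction.derivation (A : SmoothAction J K I M) (x : GroupLieAlgebra J K) :
    Derivation ℝ C^∞⟮I, M; ℝ⟯ C^∞⟮I, M; ℝ⟯ :=
  Derivation.mk'
    { toFun := fun g => ⟨A.lieDeriv x g, A.smooth_lieDeriv g.contMDiff x⟩
      map_add' := fun g h => by
        ext m
        have : differential I (fun x => g x + h x) m = _ := differential_add
          (mdifferentiableAt_of_contMDiff g.contMDiff m)
          (mdifferentiableAt_of_contMDiff h.contMDiff m)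
        change differential I (fun x => g x + h x) m _ =
          differential I g m _ + differential I h m _
        rw [this]
        rfl
      map_smul' := fun c g => by
        ext m
        have : differential I (fun x => c * g x) m = _ := differential_const_mul c
          (mdifferentiableAt_of_contMDiff g.contMDiff m)
        change differential I (fun x => c * g x) m _ = c * differential I g m _
        rw [this]
        rfl }
    fun g h => by
      ext m
      have : differential I (fun x => g x * h x) m = _ := differential_mul
        (mdifferentiableAt_of_contMDiff g.contMDiff m)
        (mdifferentiableAt_of_contMDiff h.contMDiff m)
      change differential I (fun x => g x * h x) m _ =
        g m * differential I h m _ + h m * differential I g m _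
      rw [this]
      rfl

end FusionBracket

/-! ### The Lie algebra of a product -/

section ProductLie

variable {E₁ H₁ K₁ E₂ H₂ K₂ : Type*}
  [NormedAddCommGroup E₁] [NormedSpace ℝ E₁] [TopologicalSpace H₁] {J₁ : ModelWithCorners ℝ E₁ H₁}
  [TopologicalSpace K₁] [ChartedSpace H₁ K₁] [Group K₁]
  [NormedAddCommGroup E₂] [NormedSpace ℝ E₂] [TopologicalSpace H₂] {J₂ : ModelWithCorners ℝ E₂ H₂}
  [TopologicalSpace K₂] [ChartedSpace H₂ K₂] [Group K₂]

variable (J₁ K₁ J₂ K₂) in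
/-- The inclusion `𝔨₁ → 𝔨₁ ⊕ 𝔨₂`. -/
def lieInl : GroupLieAlgebra J₁ K₁ →ₗ[ℝ] GroupLieAlgebra (J₁.prod J₂) (K₁ × K₂) :=
  LinearMap.inl ℝ E₁ E₂

variable (J₁ K₁ J₂ K₂) in
/-- The inclusion `𝔨₂ → 𝔨₁ ⊕ 𝔨₂`. -/
def lieInr : GroupLieAlgebra J₂ K₂ →ₗ[ℝ] GroupLieAlgebra (J₁.prod J₂) (K₁ × K₂) :=
  LinearMap.inr ℝ E₁ E₂

lemma lie_prod_ext {v w : GroupLieAlgebra (J₁.prod J₂) (K₁ × K₂)} (h₁ : lieFst v = lieFst w)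
    (h₂ : lieSnd v = lieSnd w) : v = w := Prod.ext h₁ h₂

lemma lieMk_eq_add (x : GroupLieAlgebra J₁ K₁) (y : GroupLieAlgebra J₂ K₂) :
    lieMk x y = lieInl K₁ K₂ J₁ J₂ x + lieInr K₁ K₂ J₁ J₂ y :=
  Prod.ext (add_zero _).symm (zero_add _).symm

variable [LieGroup J₁ ∞ K₁] [LieGroup J₂ ∞ K₂]

lemma differential_comp_fst {f : K₁ → ℝ} (hf : ContMDiff J₁ 𝓘(ℝ, ℝ) ∞ f)
    (v : GroupLieAlgebra (J₁.prod J₂) (K₁ × K₂)) :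
    differential (J₁.prod J₂) (fun k : K₁ × K₂ => f k.1) 1 v = differential J₁ f 1 (lieFst v) := by
  rw [differential_comp (I := J₁.prod J₂) (f := f) (g := Prod.fst) (m := (1 : K₁ × K₂))
    (mdifferentiableAt_of_contMDiff hf _) mdifferentiableAt_fst]
  have : mfderiv (J₁.prod J₂) J₁ (Prod.fst : K₁ × K₂ → K₁) 1 = _ := mfderiv_fst
  exact congrArg (differential J₁ f 1) (DFunLike.congr_fun this v)

lemma differential_comp_snd {f : K₂ → ℝ} (hf : ContMDiff J₂ 𝓘(ℝ, ℝ) ∞ f)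
    (v : GroupLieAlgebra (J₁.prod J₂) (K₁ × K₂)) :
    differential (J₁.prod J₂) (fun k : K₁ × K₂ => f k.2) 1 v = differential J₂ f 1 (lieSnd v) := by
  rw [differential_comp (I := J₁.prod J₂) (f := f) (g := Prod.snd) (m := (1 : K₁ × K₂))
    (mdifferentiableAt_of_contMDiff hf _) mdifferentiableAt_snd]
  have : mfderiv (J₁.prod J₂) J₂ (Prod.snd : K₁ × K₂ → K₂) 1 = _ := mfderiv_snd
  exact congrArg (differential J₂ f 1) (DFunLike.congr_fun this v)

lemma leftDeriv₂_comp_fst [J₁.Boundaryless] {f : K₁ → ℝ} (hf : ContMDiff J₁ 𝓘(ℝ, ℝ) ∞ f)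
    (v w : GroupLieAlgebra (J₁.prod J₂) (K₁ × K₂)) :
    leftDeriv₂ (J₁.prod J₂) (fun k : K₁ × K₂ => f k.1) v w =
      leftDeriv₂ J₁ f (lieFst v) (lieFst w) := by
  have := isManifold_of_lieGroup J₁ K₁
  have h : ∀ k : K₁ × K₂, differential (J₁.prod J₂) (fun l : K₁ × K₂ => f (k * l).1) 1 w =
      differential J₁ (fun l => f (k.1 * l)) 1 (lieFst w) := fun k =>
    differential_comp_fst (f := fun l => f (k.1 * l)) (hf.comp contMDiff_mul_left) w
  simp only [leftDeriv₂, h]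
  exact differential_comp_fst (f := fun k => differential J₁ (fun l => f (k * l)) 1 (lieFst w))
    (contMDiff_differential_snd (contMDiff_comp_mul hf) 1 _) v

lemma leftDeriv₂_comp_snd [J₂.Boundaryless] {f : K₂ → ℝ} (hf : ContMDiff J₂ 𝓘(ℝ, ℝ) ∞ f)
    (v w : GroupLieAlgebra (J₁.prod J₂) (K₁ × K₂)) :
    leftDeriv₂ (J₁.prod J₂) (fun k : K₁ × K₂ => f k.2) v w =
      leftDeriv₂ J₂ f (lieSnd v) (lieSnd w) := by
  have := isManifold_of_lieGroup J₂ K₂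
  have h : ∀ k : K₁ × K₂, differential (J₁.prod J₂) (fun l : K₁ × K₂ => f (k * l).2) 1 w =
      differential J₂ (fun l => f (k.2 * l)) 1 (lieSnd w) := fun k =>
    differential_comp_snd (f := fun l => f (k.2 * l)) (hf.comp contMDiff_mul_left) w
  simp only [leftDeriv₂, h]
  exact differential_comp_snd (f := fun k => differential J₂ (fun l => f (k * l)) 1 (lieSnd w))
    (contMDiff_differential_snd (contMDiff_comp_mul hf) 1 _) v

variable [FiniteDimensional ℝ E₁] [FiniteDimensional ℝ E₂] [J₁.Boundaryless] [J₂.Boundaryless]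

/-- The bracket of a product of Lie groups is taken componentwise. -/
theorem lieFst_lie (v w : GroupLieAlgebra (J₁.prod J₂) (K₁ × K₂)) :
    lieFst ⁅v, w⁆ = ⁅lieFst v, lieFst w⁆ := by
  refine lieAlgebra_ext fun f hf => ?_
  rw [← differential_comp_fst hf, differential_bracket (f := fun k : K₁ × K₂ => f k.1)
    (hf.comp contMDiff_fst), differential_bracket hf, leftDeriv₂_comp_fst hf,
    leftDeriv₂_comp_fst hf]

theorem lieSnd_lie (v w : GroupLieAlgebra (J₁.prod J₂) (K₁ × K₂)) :
    lieSnd ⁅v, w⁆ = ⁅lieSnd v, lieSnd w⁆ := by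
  refine lieAlgebra_ext fun f hf => ?_
  rw [← differential_comp_snd hf, differential_bracket (f := fun k : K₁ × K₂ => f k.2)
    (hf.comp contMDiff_snd), differential_bracket hf, leftDeriv₂_comp_snd hf,
    leftDeriv₂_comp_snd hf]

lemma lieInl_lie (x y : GroupLieAlgebra J₁ K₁) :
    ⁅lieInl K₁ K₂ J₁ J₂ x, lieInl K₁ K₂ J₁ J₂ y⁆ = lieInl K₁ K₂ J₁ J₂ ⁅x, y⁆ := by
  refine lie_prod_ext ?_ ?_
  · rw [lieFst_lie]; rfl
  · rw [lieSnd_lie]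
    exact LinearMap.map_zero₂ (lieBilin J₂ K₂) _

lemma lieInr_lie (x y : GroupLieAlgebra J₂ K₂) :
    ⁅lieInr K₁ K₂ J₁ J₂ x, lieInr K₁ K₂ J₁ J₂ y⁆ = lieInr K₁ K₂ J₁ J₂ ⁅x, y⁆ := by
  refine lie_prod_ext ?_ ?_
  · rw [lieFst_lie]
    exact LinearMap.map_zero₂ (lieBilin J₁ K₁) _
  · rw [lieSnd_lie]; rfl

lemma lieInl_lie_lieInr (x : GroupLieAlgebra J₁ K₁) (y : GroupLieAlgebra J₂ K₂) :
    ⁅lieInl K₁ K₂ J₁ J₂ x, lieInr K₁ K₂ J₁ J₂ y⁆ = 0 := by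
  refine lie_prod_ext ?_ ?_
  · rw [lieFst_lie]
    exact (map_zero (lieBilin J₁ K₁ _)).trans (map_zero _).symm
  · rw [lieSnd_lie]
    exact (LinearMap.map_zero₂ (lieBilin J₂ K₂) _).trans (map_zero _).symm

namespace InvariantForm

variable (B₁ : InvariantForm J₁ K₁) (B₂ : InvariantForm J₂ K₂)
  (a b c : GroupLieAlgebra (J₁.prod J₂) (K₁ × K₂) →ₗ[ℝ] ℝ)

lemma prod_form (v w : GroupLieAlgebra (J₁.prod J₂) (K₁ × K₂)) :
    (B₁.prod B₂).form v w = B₁.form (lieFst v) (lieFst w) + B₂.form (lieSnd v) (lieSnd w) := rfl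

lemma lieFst_sharp_prod :
    lieFst ((B₁.prod B₂).sharp a) = B₁.sharp (a ∘ₗ lieInl K₁ K₂ J₁ J₂) := by
  refine B₁.eq_sharp fun z => ?_
  have h := (B₁.prod B₂).form_sharp a (lieInl K₁ K₂ J₁ J₂ z)
  have h0 : lieSnd (lieInl K₁ K₂ J₁ J₂ z) = 0 := rfl
  rw [prod_form, h0, map_zero, add_zero] at h
  exact h

lemma lieSnd_sharp_prod :
    lieSnd ((B₁.prod B₂).sharp a) = B₂.sharp (a ∘ₗ lieInr K₁ K₂ J₁ J₂) := by
  refine B₂.eq_sharp fun z => ?_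
  have h := (B₁.prod B₂).form_sharp a (lieInr K₁ K₂ J₁ J₂ z)
  have h0 : lieFst (lieInr K₁ K₂ J₁ J₂ z) = 0 := rfl
  rw [prod_form, h0, map_zero, zero_add] at h
  exact h

/-- The Cartan trivector of a product is the sum of the Cartan trivectors of the factors. -/
theorem cartan_prod :
    (B₁.prod B₂).cartan a b c =
      B₁.cartan (a ∘ₗ lieInl K₁ K₂ J₁ J₂) (b ∘ₗ lieInl K₁ K₂ J₁ J₂) (c ∘ₗ lieInl K₁ K₂ J₁ J₂) +
      B₂.cartan (a ∘ₗ lieInr K₁ K₂ J₁ J₂) (b ∘ₗ lieInr K₁ K₂ J₁ J₂)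
        (c ∘ₗ lieInr K₁ K₂ J₁ J₂) := by
  rw [cartan, prod_form, lieFst_lie, lieSnd_lie]
  simp only [lieFst_sharp_prod, lieSnd_sharp_prod]
  rfl

end InvariantForm

end ProductLie

/-! ### The fusion bivector field -/

section Fusion

variable {EG HG G EH HH H : Type*}
  [NormedAddCommGroup EG] [NormedSpace ℝ EG] [TopologicalSpace HG] {JG : ModelWithCorners ℝ EG HG}
  [TopologicalSpace G] [ChartedSpace HG G] [Group G]
  [NormedAddCommGroup EH] [NormedSpace ℝ EH] [TopologicalSpace HH] {JH : ModelWithCorners ℝ EH HH}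
  [TopologicalSpace H] [ChartedSpace HH H] [Group H]
  {F H' M : Type*} [NormedAddCommGroup F] [NormedSpace ℝ F] [TopologicalSpace H']
  {I : ModelWithCorners ℝ F H'} [TopologicalSpace M] [ChartedSpace H' M]

variable (JG G JH H) in
/-- The inclusion of `𝔤` as the first summand of `𝔤 ⊕ 𝔤 ⊕ 𝔥`. -/
def lieIn₁ : GroupLieAlgebra JG G →ₗ[ℝ] GroupLieAlgebra (JG.prod (JG.prod JH)) (G × G × H) :=
  lieInl G (G × H) JG (JG.prod JH)

variable (JG G JH H) in
/-- The inclusion of `𝔤` as the second summand of `𝔤 ⊕ 𝔤 ⊕ 𝔥`. -/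
def lieIn₂ : GroupLieAlgebra JG G →ₗ[ℝ] GroupLieAlgebra (JG.prod (JG.prod JH)) (G × G × H) :=
  lieInr G (G × H) JG (JG.prod JH) ∘ₗ lieInl G H JG JH

variable (JG G JH H) in
/-- The inclusion of `𝔥` as the third summand of `𝔤 ⊕ 𝔤 ⊕ 𝔥`. -/
def lieIn₃ : GroupLieAlgebra JH H →ₗ[ℝ] GroupLieAlgebra (JG.prod (JG.prod JH)) (G × G × H) :=
  lieInr G (G × H) JG (JG.prod JH) ∘ₗ lieInr G H JG JH

/-- The differential `(x, z) ↦ (x, x, z)` of the diagonal inclusion of groups. -/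
def lieDiag (v : GroupLieAlgebra (JG.prod JH) (G × H)) :
    GroupLieAlgebra (JG.prod (JG.prod JH)) (G × G × H) :=
  lieMk (lieFst v) (lieMk (lieFst v) (lieSnd v))

lemma lieDiag_lieInl (x : GroupLieAlgebra JG G) :
    lieDiag (lieInl G H JG JH x) = lieIn₁ G H JG JH x + lieIn₂ G H JG JH x :=
  Prod.ext (add_zero (show EG from x)).symm
    (Prod.ext (zero_add (show EG from x)).symm (zero_add (0 : EH)).symm)

lemma mfderiv_diag (v : GroupLieAlgebra (JG.prod JH) (G × H)) :
    mfderiv (JG.prod JH) (JG.prod (JG.prod JH)) (fun k : G × H => (k.1, k.1, k.2)) 1 v =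
      lieDiag v := by
  have h1 : MDifferentiableAt (JG.prod JH) JG (fun k : G × H => k.1) 1 := mdifferentiableAt_fst
  have h2 : MDifferentiableAt (JG.prod JH) JH (fun k : G × H => k.2) 1 := mdifferentiableAt_snd
  have e := h1.mfderiv_prod (h1.prodMk h2)
  rw [h1.mfderiv_prod h2] at e
  have e1 : mfderiv (JG.prod JH) JG (fun k : G × H => k.1) 1 = _ := mfderiv_fst
  have e2 : mfderiv (JG.prod JH) JH (fun k : G × H => k.2) 1 = _ := mfderiv_snd
  rw [e1, e2] at e
  exact DFunLike.congr_fun e v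

namespace SmoothAction

variable (A : SmoothAction (JG.prod (JG.prod JH)) (G × G × H) I M)

lemma fuse_fundamental (v : GroupLieAlgebra (JG.prod JH) (G × H)) (m : M) :
    A.fuse.fundamental v m = A.fundamental (lieDiag v) m := by
  have hd : ContMDiff (JG.prod JH) (JG.prod (JG.prod JH)) ∞ (fun k : G × H => (k.1, k.1, k.2)) :=
    contMDiff_fst.prodMk (contMDiff_fst.prodMk contMDiff_snd)
  have h := mfderiv_comp_apply_model (J := JG.prod JH) (I := JG.prod (JG.prod JH)) (I'' := I)
    (x := (1 : G × H)) (y := 1) (g := fun k => A.act k m) (f := fun k : G × H => (k.1, k.1, k.2))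
    ((A.smooth_orbit m).mdifferentiable (by simp) 1) (hd.mdifferentiable (by simp) 1) rfl v
  rw [mfderiv_diag] at h
  exact congrArg (fun v : F => -v) h

lemma orbit_fuse_lieInl (m : M) (α : Covector I m) :
    A.fuse.orbit m α ∘ₗ lieInl G H JG JH =
      A.orbit m α ∘ₗ lieIn₁ G H JG JH + A.orbit m α ∘ₗ lieIn₂ G H JG JH := by
  ext x
  refine (congrArg α (A.fuse_fundamental _ m)).trans ?_
  rw [lieDiag_lieInl]
  exact map_add (A.orbit m α) _ _

lemma orbit_fuse_lieInr (m : M) (α : Covector I m) :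
    A.fuse.orbit m α ∘ₗ lieInr G H JG JH = A.orbit m α ∘ₗ lieIn₃ G H JG JH := by
  ext x
  exact congrArg α (A.fuse_fundamental _ m)

end SmoothAction

variable [FiniteDimensional ℝ EG] (B : InvariantForm JG G)
  (A : SmoothAction (JG.prod (JG.prod JH)) (G × G × H) I M)

lemma psiField_apply_sum (m : M) (α β : Covector I m) :
    psiField B A m ![α, β] = 1 / 2 * ∑ i,
      (A.orbit m α (lieIn₁ G H JG JH (lieBasis JG G i)) *
          A.orbit m β (lieIn₂ G H JG JH (B.dualBasis i)) -
        A.orbit m α (lieIn₂ G H JG JH (B.dualBasis i)) *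
          A.orbit m β (lieIn₁ G H JG JH (lieBasis JG G i))) := by
  have h : psiField B A m ![α, β] = (1 / 2 : ℝ) *
      ∑ i, wedge ![A.fundamental (lieMk (lieBasis JG G i) 0) m,
        A.fundamental (lieMk 0 (lieMk (B.dualBasis i) 0)) m] ![α, β] := by
    simp only [psiField, AlternatingMap.smul_apply, multiVector_sum_apply, smul_eq_mul]
  rw [h]
  simp only [wedge_two_apply]
  rfl

/-- The bivector field `ψ_M` in terms of the functionals of two covectors. -/
theorem psiField_apply (m : M) (α β : Covector I m) :
    psiField B A m ![α, β] = 1 / 2 *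
      (B.form (B.sharp (A.orbit m α ∘ₗ lieIn₁ G H JG JH))
          (B.sharp (A.orbit m β ∘ₗ lieIn₂ G H JG JH)) -
        B.form (B.sharp (A.orbit m β ∘ₗ lieIn₁ G H JG JH))
          (B.sharp (A.orbit m α ∘ₗ lieIn₂ G H JG JH))) := by
  rw [psiField_apply_sum, ← B.sum_mul_dualBasis, ← B.sum_mul_dualBasis, ← Finset.sum_sub_distrib]
  refine congrArg _ (Finset.sum_congr rfl fun i _ => ?_)
  simp only [LinearMap.comp_apply]
  ring

end Fusion

section Equivariant

variable {E H : Type*} [NormedAddCommGroup E] [NormedSpace ℝ E] [TopologicalSpace H]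
  {J : ModelWithCorners ℝ E H} {K : Type*} [TopologicalSpace K] [ChartedSpace H K] [Group K]
  {F H' M : Type*} [NormedAddCommGroup F] [NormedSpace ℝ F] [TopologicalSpace H']
  {I : ModelWithCorners ℝ F H'} [TopologicalSpace M] [ChartedSpace H' M]
  {F₂ H₂ M₂ : Type*} [NormedAddCommGroup F₂] [NormedSpace ℝ F₂] [TopologicalSpace H₂]
  {I₂ : ModelWithCorners ℝ F₂ H₂} [TopologicalSpace M₂] [ChartedSpace H₂ M₂]
  (A : SmoothAction J K I M) (A₂ : SmoothAction J K I₂ M₂)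

lemma mfderiv_fundamental_of_equivariant {Φ : M → M₂} (hΦ : ContMDiff I I₂ ∞ Φ)
    (h : ∀ k m, Φ (A.act k m) = A₂.act k (Φ m)) (x : GroupLieAlgebra J K) (m : M) :
    mfderiv I I₂ Φ m (A.fundamental x m) = A₂.fundamental x (Φ m) := by
  have h1 := mfderiv_comp_apply_model (J := J) (I := I) (I'' := I₂) (x := (1 : K))
    (g := Φ) (f := fun a => A.act a m) (hΦ.mdifferentiable (by simp) m)
    ((A.smooth_orbit m).mdifferentiable (by simp) 1) (A.one_act m) x
  have e : (fun a => Φ (A.act a m)) = fun a => A₂.act a (Φ m) := funext fun a => h a m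
  rw [e] at h1
  have hx := congrArg (fun v : F₂ => -v) h1.symm
  exact (map_neg (show F →L[ℝ] F₂ from mfderiv I I₂ Φ m) _).trans hx

/-- The functionals of covectors pull back along equivariant maps; this is all that is needed to
compare bivector and trivector fields built from an action. -/
lemma orbit_comp_of_equivariant {Φ : M → M₂} (hΦ : ContMDiff I I₂ ∞ Φ)
    (h : ∀ k m, Φ (A.act k m) = A₂.act k (Φ m)) (m : M) (α : Covector I₂ (Φ m)) :
    A.orbit m (α.comp (mfderiv I I₂ Φ m)) = A₂.orbit (Φ m) α := by
  ext x
  exact congrArg α (mfderiv_fundamental_of_equivariant A A₂ hΦ h x m)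

lemma cartanField_of_equivariant [FiniteDimensional ℝ E] [LieGroup J ∞ K] [J.Boundaryless]
    (B : InvariantForm J K) {Φ : M → M₂} (hΦ : ContMDiff I I₂ ∞ Φ)
    (h : ∀ k m, Φ (A.act k m) = A₂.act k (Φ m)) (m : M) :
    cartanField B A₂ (Φ m) = pushforward (mfderiv I I₂ Φ m) (cartanField B A m) := by
  refine multiVector_three_ext fun α β γ => ?_
  rw [pushforward_three_apply, cartanField_apply, cartanField_apply,
    orbit_comp_of_equivariant A A₂ hΦ h, orbit_comp_of_equivariant A A₂ hΦ h,
    orbit_comp_of_equivariant A A₂ hΦ h]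

/-- The functionals `a` and `a ∘ Ad_k` correspond to vectors related by `Ad_k`. -/
lemma InvariantForm.form_sharp_comp_Ad [FiniteDimensional ℝ E] (B : InvariantForm J K) (k : K)
    (a b : GroupLieAlgebra J K →ₗ[ℝ] ℝ) :
    B.form (B.sharp (a ∘ₗ (Ad J k).toLinearMap)) (B.sharp (b ∘ₗ (Ad J k).toLinearMap)) =
      B.form (B.sharp a) (B.sharp b) := by
  have hinj : Function.Injective (Ad J k).toLinearMap := by
    intro x y hxy
    refine InvariantForm.ext_form (B := B) fun z => ?_
    have hxy' : Ad J k x = Ad J k y := hxy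
    rw [← B.invariant k, hxy', B.invariant]
  have hsurj := LinearMap.surjective_of_injective hinj
  have key : ∀ a : GroupLieAlgebra J K →ₗ[ℝ] ℝ,
      Ad J k (B.sharp (a ∘ₗ (Ad J k).toLinearMap)) = B.sharp a := by
    intro a
    refine B.eq_sharp fun z => ?_
    obtain ⟨y, rfl⟩ := hsurj z
    exact (B.invariant k _ y).trans (B.form_sharp _ y)
  rw [← key a, ← key b, B.invariant]

end Equivariant

section FusionEquivariant

variable {EG HG G EH HH H : Type*}
  [NormedAddCommGroup EG] [NormedSpace ℝ EG] [TopologicalSpace HG] {JG : ModelWithCorners ℝ EG HG}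
  [TopologicalSpace G] [ChartedSpace HG G] [Group G]
  [NormedAddCommGroup EH] [NormedSpace ℝ EH] [TopologicalSpace HH] {JH : ModelWithCorners ℝ EH HH}
  [TopologicalSpace H] [ChartedSpace HH H] [Group H]
  {F H' M : Type*} [NormedAddCommGroup F] [NormedSpace ℝ F] [TopologicalSpace H']
  {I : ModelWithCorners ℝ F H'} [TopologicalSpace M] [ChartedSpace H' M]
  {F₂ H₂ M₂ : Type*} [NormedAddCommGroup F₂] [NormedSpace ℝ F₂] [TopologicalSpace H₂]
  {I₂ : ModelWithCorners ℝ F₂ H₂} [TopologicalSpace M₂] [ChartedSpace H₂ M₂]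
  [FiniteDimensional ℝ EG] (B : InvariantForm JG G)
  (A : SmoothAction (JG.prod (JG.prod JH)) (G × G × H) I M)
  (A₂ : SmoothAction (JG.prod (JG.prod JH)) (G × G × H) I₂ M₂)

/-- Equivariant maps relate the fields `ψ_M`. -/
lemma psiField_of_equivariant {Φ : M → M₂} (hΦ : ContMDiff I I₂ ∞ Φ)
    (h : ∀ k m, Φ (A.act k m) = A₂.act k (Φ m)) (m : M) :
    psiField B A₂ (Φ m) = pushforward (mfderiv I I₂ Φ m) (psiField B A m) := by
  refine multiVector_two_ext fun α β => ?_
  rw [pushforward_two_apply, psiField_apply, psiField_apply,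
    orbit_comp_of_equivariant A A₂ hΦ h, orbit_comp_of_equivariant A A₂ hΦ h]

variable [LieGroup JG ∞ G] [LieGroup JH ∞ H]

/-- The bivector field `ψ_M` is invariant under the diagonal action. -/
theorem psiField_invariant (k : G × H) (m : M) :
    psiField B A (A.fuse.act k m) =
      pushforward (mfderiv I I (A.fuse.act k) m) (psiField B A m) := by
  refine multiVector_two_ext fun α β => ?_
  have key : ∀ α : Covector I (A.fuse.act k m),
      A.orbit m (α.comp (mfderiv I I (A.fuse.act k) m)) =
        A.orbit (A.fuse.act k m) α ∘ₗ
          (Ad (JG.prod (JG.prod JH)) (k.1, k.1, k.2)).toLinearMap := by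
    intro α
    ext x
    exact congrArg α (A.mfderiv_act_fundamental (k.1, k.1, k.2) m x)
  have c1 : (Ad (JG.prod (JG.prod JH)) (k.1, k.1, k.2)).toLinearMap ∘ₗ lieIn₁ G H JG JH =
      lieIn₁ G H JG JH ∘ₗ (Ad JG k.1).toLinearMap := by
    ext x
    refine (Ad_prod (k.1, k.1, k.2) (lieIn₁ G H JG JH x)).trans (Prod.ext rfl ?_)
    exact map_zero (Ad (JG.prod JH) k)
  have c2 : (Ad (JG.prod (JG.prod JH)) (k.1, k.1, k.2)).toLinearMap ∘ₗ lieIn₂ G H JG JH =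
      lieIn₂ G H JG JH ∘ₗ (Ad JG k.1).toLinearMap := by
    ext x
    refine (Ad_prod (k.1, k.1, k.2) (lieIn₂ G H JG JH x)).trans (Prod.ext ?_ ?_)
    · exact map_zero (Ad JG k.1)
    · refine (Ad_prod k (lieInl G H JG JH x)).trans (Prod.ext rfl ?_)
      exact map_zero (Ad JH k.2)
  rw [pushforward_two_apply, psiField_apply, psiField_apply]
  simp only [key, LinearMap.comp_assoc, c1, c2]
  simp only [← LinearMap.comp_assoc, B.form_sharp_comp_Ad]

end FusionEquivariant

/-! ### The Schouten square of a fused bivector field -/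

section FusionHamiltonian

variable {EG HG G EH HH H : Type*}
  [NormedAddCommGroup EG] [NormedSpace ℝ EG] [TopologicalSpace HG] {JG : ModelWithCorners ℝ EG HG}
  [TopologicalSpace G] [ChartedSpace HG G] [Group G]
  [NormedAddCommGroup EH] [NormedSpace ℝ EH] [TopologicalSpace HH] {JH : ModelWithCorners ℝ EH HH}
  [TopologicalSpace H] [ChartedSpace HH H] [Group H]
  {F H' M : Type*} [NormedAddCommGroup F] [NormedSpace ℝ F] [TopologicalSpace H']
  {I : ModelWithCorners ℝ F H'} [TopologicalSpace M] [ChartedSpace H' M]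
  [FiniteDimensional ℝ EG] [LieGroup JG ∞ G] [LieGroup JH ∞ H] [IsManifold I ∞ M]
  (B : InvariantForm JG G) (A : SmoothAction (JG.prod (JG.prod JH)) (G × G × H) I M)

/-- The derivations of `C^∞(M)` given by the first factor `G`, along the basis `(e_i)`. -/
def fusionLeft (i : Fin (Module.finrank ℝ (GroupLieAlgebra JG G))) :
    Derivation ℝ C^∞⟮I, M; ℝ⟯ C^∞⟮I, M; ℝ⟯ :=
  A.derivation (lieIn₁ G H JG JH (lieBasis JG G i))

/-- The derivations of `C^∞(M)` given by the second factor `G`, along the basis `(e^i)`. -/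
def fusionRight (i : Fin (Module.finrank ℝ (GroupLieAlgebra JG G))) :
    Derivation ℝ C^∞⟮I, M; ℝ⟯ C^∞⟮I, M; ℝ⟯ :=
  A.derivation (lieIn₂ G H JG JH (B.dualBasis i))

/-- Evaluation of smooth functions at a point. -/
def evalAt (m : M) : C^∞⟮I, M; ℝ⟯ →+* ℝ :=
  (Pi.evalRingHom _ m).comp ContMDiffMap.coeFnRingHom

lemma evalAt_apply (m : M) (f : C^∞⟮I, M; ℝ⟯) : evalAt m f = f m := rfl

lemma bracket_psiField (f g : C^∞⟮I, M; ℝ⟯) (m : M) :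
    bracket (psiField B A) f g m =
      1 / 2 * derivationBracket (fusionLeft A) (fusionRight B A) f g m := by
  rw [bracket, psiField_apply_sum, ← evalAt_apply m, derivationBracket, map_sum]
  simp only [map_sub, map_mul]
  rfl

lemma isSmoothField_psiField : IsSmoothField (psiField B A) := by
  refine isSmoothField_two fun f g hf hg => ?_
  have h := fun m => bracket_psiField B A ⟨f, hf⟩ ⟨g, hg⟩ m
  exact (contMDiff_const.mul (derivationBracket (fusionLeft A) (fusionRight B A)
    ⟨f, hf⟩ ⟨g, hg⟩).contMDiff).congr h

variable [JG.Boundaryless] [JH.Boundaryless] [FiniteDimensional ℝ EH]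

lemma derivation_comm {f : C^∞⟮I, M; ℝ⟯}
    {x y : GroupLieAlgebra (JG.prod (JG.prod JH)) (G × G × H)} :
    A.derivation x (A.derivation y f) - A.derivation y (A.derivation x f) =
      A.derivation ⁅x, y⁆ f := by
  ext m
  exact A.lieDeriv_lieDeriv_sub f.contMDiff x y m

/-- The two copies of `𝔤` commute, and so do their fundamental vector fields. -/
lemma fusionRight_fusionLeft (i j) (f : C^∞⟮I, M; ℝ⟯) :
    fusionRight B A i (fusionLeft A j f) = fusionLeft A j (fusionRight B A i f) := by
  have h : A.derivation (lieIn₁ G H JG JH (lieBasis JG G j))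
      (A.derivation (lieIn₂ G H JG JH (B.dualBasis i)) f) -
    A.derivation (lieIn₂ G H JG JH (B.dualBasis i))
      (A.derivation (lieIn₁ G H JG JH (lieBasis JG G j)) f) = _ := derivation_comm A
  have h0 : ⁅lieIn₁ G H JG JH (lieBasis JG G j), lieIn₂ G H JG JH (B.dualBasis i)⁆ = 0 :=
    lieInl_lie_lieInr _ _
  rw [h0] at h
  have h1 : A.derivation (0 : GroupLieAlgebra (JG.prod (JG.prod JH)) (G × G × H)) f = 0 := by
    ext m
    have : A.fundamental (0 : GroupLieAlgebra (JG.prod (JG.prod JH)) (G × G × H)) m = 0 :=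
      map_zero (A.fundamentalMap m)
    change differential I f m (A.fundamental 0 m) = 0
    rw [this]
    exact map_zero (differential I f m)
  rw [h1, sub_eq_zero] at h
  exact h.symm

variable (f g h : C^∞⟮I, M; ℝ⟯) (m : M)

/-- The functional on `𝔤` given by the first factor `G` and the differential of a function. -/
def leftFunctional (f : M → ℝ) (m : M) : GroupLieAlgebra JG G →ₗ[ℝ] ℝ :=
  A.orbit m (differential I f m) ∘ₗ lieIn₁ G H JG JH

/-- The functional on `𝔤` given by the second factor `G` and the differential of a function. -/
def rightFunctional (f : M → ℝ) (m : M) : GroupLieAlgebra JG G →ₗ[ℝ] ℝ :=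
  A.orbit m (differential I f m) ∘ₗ lieIn₂ G H JG JH

/-- The first half of the Schouten square of `ψ_M`: the brackets `[e_i, e_j]` in the first copy of
`𝔤` give the terms of the Cartan trivector with one left and two right arguments. -/
lemma sum_derivationDet_left :
    evalAt m (∑ i, ∑ j, derivationDet (fun f => fusionLeft A i (fusionLeft A j f) -
        fusionLeft A j (fusionLeft A i f)) (fusionRight B A i) (fusionRight B A j) f g h) =
      2 * (B.cartan (leftFunctional A f m) (rightFunctional A g m) (rightFunctional A h m) +
        B.cartan (leftFunctional A g m) (rightFunctional A h m) (rightFunctional A f m) +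
        B.cartan (leftFunctional A h m) (rightFunctional A f m) (rightFunctional A g m)) := by
  have hc : ∀ i j (f : C^∞⟮I, M; ℝ⟯), evalAt m (fusionLeft A i (fusionLeft A j f) -
      fusionLeft A j (fusionLeft A i f)) =
      leftFunctional A f m ⁅lieBasis JG G i, lieBasis JG G j⁆ := by
    intro i j f
    have h1 : ⁅lieIn₁ G H JG JH (lieBasis JG G i), lieIn₁ G H JG JH (lieBasis JG G j)⁆ =
      lieIn₁ G H JG JH ⁅lieBasis JG G i, lieBasis JG G j⁆ := lieInl_lie _ _
    have h2 : fusionLeft A i (fusionLeft A j f) - fusionLeft A j (fusionLeft A i f) = _ :=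
      derivation_comm A
    rw [h2, h1]
    rfl
  have hr : ∀ i (f : C^∞⟮I, M; ℝ⟯), evalAt m (fusionRight B A i f) =
      rightFunctional A f m (B.dualBasis i) := fun i f => rfl
  simp only [map_sum, derivationDet, map_add, map_mul, map_sub]
  simp only [← map_sub, hc, hr]
  have e : ∀ f g h : C^∞⟮I, M; ℝ⟯, ∑ i, ∑ j,
      leftFunctional A f m ⁅lieBasis JG G i, lieBasis JG G j⁆ *
        (rightFunctional A g m (B.dualBasis i) * rightFunctional A h m (B.dualBasis j) -
          rightFunctional A h m (B.dualBasis i) * rightFunctional A g m (B.dualBasis j)) =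
      2 * B.cartan (leftFunctional A f m) (rightFunctional A g m) (rightFunctional A h m) := by
    intro f g h
    simp only [mul_sub, Finset.sum_sub_distrib, B.sum_apply_lie]
    rw [B.cartan_swap (leftFunctional A f m) (rightFunctional A h m)]
    ring
  have e' := e f g h
  have e'' := e g h f
  have e''' := e h f g
  simp only [Finset.sum_add_distrib]
  rw [mul_add, mul_add, ← e', ← e'', ← e''']
  simp only [mul_comm (rightFunctional A _ m (B.dualBasis _))
    (rightFunctional A _ m (B.dualBasis _))]

/-- The second half of the Schouten square of `ψ_M`: the brackets `[e^i, e^j]` in the second copy of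
`𝔤` give the terms of the Cartan trivector with one right and two left arguments. -/
lemma sum_derivationDet_right :
    evalAt m (∑ i, ∑ j, derivationDet (fun f => fusionRight B A i (fusionRight B A j f) -
        fusionRight B A j (fusionRight B A i f)) (fusionLeft A i) (fusionLeft A j) f g h) =
      2 * (B.cartan (rightFunctional A f m) (leftFunctional A g m) (leftFunctional A h m) +
        B.cartan (rightFunctional A g m) (leftFunctional A h m) (leftFunctional A f m) +
        B.cartan (rightFunctional A h m) (leftFunctional A f m) (leftFunctional A g m)) := by
  have hc : ∀ i j (f : C^∞⟮I, M; ℝ⟯), evalAt m (fusionRight B A i (fusionRight B A j f) -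
      fusionRight B A j (fusionRight B A i f)) =
      rightFunctional A f m ⁅B.dualBasis i, B.dualBasis j⁆ := by
    intro i j f
    have h1 : ⁅lieIn₂ G H JG JH (B.dualBasis i), lieIn₂ G H JG JH (B.dualBasis j)⁆ =
      lieIn₂ G H JG JH ⁅B.dualBasis i, B.dualBasis j⁆ :=
        (lieInr_lie _ _).trans (congrArg _ (lieInl_lie _ _))
    have h2 : fusionRight B A i (fusionRight B A j f) -
        fusionRight B A j (fusionRight B A i f) = _ :=
      derivation_comm A
    rw [h2, h1]
    rfl
  have hr : ∀ i (f : C^∞⟮I, M; ℝ⟯), evalAt m (fusionLeft A i f) =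
      leftFunctional A f m (lieBasis JG G i) := fun i f => rfl
  simp only [map_sum, derivationDet, map_add, map_mul, map_sub]
  simp only [← map_sub, hc, hr]
  have e : ∀ f g h : C^∞⟮I, M; ℝ⟯, ∑ i, ∑ j,
      rightFunctional A f m ⁅B.dualBasis i, B.dualBasis j⁆ *
        (leftFunctional A g m (lieBasis JG G i) * leftFunctional A h m (lieBasis JG G j) -
          leftFunctional A h m (lieBasis JG G i) * leftFunctional A g m (lieBasis JG G j)) =
      2 * B.cartan (rightFunctional A f m) (leftFunctional A g m) (leftFunctional A h m) := by
    intro f g h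
    simp only [mul_sub, Finset.sum_sub_distrib, B.sum_apply_lie_dualBasis]
    rw [B.cartan_swap (rightFunctional A f m) (leftFunctional A h m)]
    ring
  have e' := e f g h
  have e'' := e g h f
  have e''' := e h f g
  simp only [Finset.sum_add_distrib]
  rw [mul_add, mul_add, ← e', ← e'', ← e''']
  simp only [mul_comm (leftFunctional A _ m (lieBasis JG G _))
    (leftFunctional A _ m (lieBasis JG G _))]

lemma bracket_sub {P P' : ∀ m : M, MultiVector I 2 m} (f g : M → ℝ) (m : M) :
    bracket (fun m => P m - P' m) f g m = bracket P f g m - bracket P' f g m := rfl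

variable [FiniteDimensional ℝ F]

/-- Fusion changes the Schouten square by the mixed terms of the Cartan trivector. -/
theorem schouten_fuse (BH : InvariantForm JH H) {P : ∀ m : M, MultiVector I 2 m}
    [BoundarylessManifold I M]
    (hP : IsSmoothField P)
    (hinv : ∀ k m, P (A.act k m) = pushforward (mfderiv I I (A.act k) m) (P m))
    (hJ : IsSchoutenSquare P (cartanField (B.prod (B.prod BH)) A)) :
    IsSchoutenSquare (fun m => P m - psiField B A m) (cartanField (B.prod BH) A.fuse) := by
  intro f₀ g₀ h₀ hf hg hh m
  obtain ⟨f, rfl⟩ : ∃ f : C^∞⟮I, M; ℝ⟯, ⇑f = f₀ := ⟨⟨f₀, hf⟩, rfl⟩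
  obtain ⟨g, rfl⟩ : ∃ f : C^∞⟮I, M; ℝ⟯, ⇑f = g₀ := ⟨⟨g₀, hg⟩, rfl⟩
  obtain ⟨h, rfl⟩ : ∃ f : C^∞⟮I, M; ℝ⟯, ⇑f = h₀ := ⟨⟨h₀, hh⟩, rfl⟩
  let b := bracketDerivation hP
  let ψ := derivationBracket (fusionLeft A) (fusionRight B A)
  have hb : ∀ f g, b f g = -b g f := fun f g => by
    ext m
    exact (P m).two_swap _ _
  have hbr : ∀ f g : C^∞⟮I, M; ℝ⟯, bracket (fun m => P m - psiField B A m) f g =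
      (b f g - (1 / 2 : ℝ) • ψ f g : C^∞⟮I, M; ℝ⟯) := by
    intro f g
    ext m
    rw [bracket_sub, bracket_psiField]
    rfl
  have hder : ∀ x (f g : C^∞⟮I, M; ℝ⟯), A.derivation x (b f g) =
      b (A.derivation x f) g + b f (A.derivation x g) := by
    intro x f g
    ext m
    exact A.lieDeriv_bracket hinv hP f.contMDiff g.contMDiff x
      BoundarylessManifold.isInteriorPoint
  -- the cross terms `[P, ψ_M]` vanish, since fundamental vector fields are derivations of `P`
  have hcross := congrArg (evalAt m) (derivationBracket_cross hb (X := fusionLeft A)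
    (Y := fusionRight B A) (fun i f g => hder _ f g) (fun i f g => hder _ f g) f g h)
  -- the Schouten square of `ψ_M`
  have hψ := congrArg (evalAt m) (derivationBracket_jacobi (fusionRight_fusionLeft B A) f g h)
  simp only [Finset.sum_add_distrib] at hψ
  rw [map_add, sum_derivationDet_left, sum_derivationDet_right] at hψ
  have hJ' := hJ f g h f.contMDiff g.contMDiff h.contMDiff m
  rw [cartanField_apply, InvariantForm.cartan_prod, InvariantForm.cartan_prod] at hJ'
  rw [cartanField_apply, InvariantForm.cartan_prod]
  simp only [A.orbit_fuse_lieInl, A.orbit_fuse_lieInr, B.cartan_add_left, B.cartan_add_middle,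
    B.cartan_add_right]
  have hlin : ∀ f g h : C^∞⟮I, M; ℝ⟯,
      bracket (fun m => P m - psiField B A m) f
        (bracket (fun m => P m - psiField B A m) g h) m =
      evalAt m (b f (b g h)) - 1 / 2 * evalAt m (b f (ψ g h) + ψ f (b g h)) +
        1 / 2 * (1 / 2 * evalAt m (ψ f (ψ g h))) := by
    intro f g h
    rw [hbr g h, hbr f, derivationBracket_deformed]
    rfl
  rw [hlin, hlin, hlin]
  simp only [map_add, map_mul, map_ofNat, map_zero] at hcross hψ ⊢
  have hJb : ∀ f g h : C^∞⟮I, M; ℝ⟯, bracket P f (bracket P g h) m = evalAt m (b f (b g h)) :=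
    fun f g h => rfl
  rw [hJb, hJb, hJb] at hJ'
  set a₁ := leftFunctional A f m
  set b₁ := leftFunctional A g m
  set c₁ := leftFunctional A h m
  set a₂ := rightFunctional A f m
  set b₂ := rightFunctional A g m
  set c₂ := rightFunctional A h m
  set T₃ := BH.cartan (A.orbit m (differential I f m) ∘ₗ lieIn₃ G H JG JH)
    (A.orbit m (differential I g m) ∘ₗ lieIn₃ G H JG JH)
    (A.orbit m (differential I h m) ∘ₗ lieIn₃ G H JG JH)
  have hJ'' : 1 / 2 * (B.cartan a₁ b₁ c₁ + (B.cartan a₂ b₂ c₂ + T₃)) = _ := hJ'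
  change 1 / 2 * (B.cartan a₁ b₁ c₁ + B.cartan a₁ b₁ c₂ + (B.cartan a₁ b₂ c₁ + B.cartan a₁ b₂ c₂) +
    (B.cartan a₂ b₁ c₁ + B.cartan a₂ b₁ c₂ + (B.cartan a₂ b₂ c₁ + B.cartan a₂ b₂ c₂)) + T₃) = _
  -- the fused functionals are the sums `a₁ + a₂`, `b₁ + b₂`, `c₁ + c₂`: the two pure terms of the
  -- expansion come from `P`, and the six mixed ones from `ψ_M`, up to cyclic permutation
  have r1 := B.cartan_rotate a₁ b₂ c₁
  have r2 := B.cartan_rotate a₂ b₁ c₂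
  have r3 := B.cartan_rotate c₁ a₂ b₂
  have r4 := B.cartan_rotate c₂ a₁ b₁
  linarith

end FusionHamiltonian

/-! ### Moment maps under fusion -/

section MomentFunctional

variable {E H : Type*} [NormedAddCommGroup E] [NormedSpace ℝ E] [TopologicalSpace H]
  {J : ModelWithCorners ℝ E H} {K : Type*} [TopologicalSpace K] [ChartedSpace H K] [Group K]
  {F H' M : Type*} [NormedAddCommGroup F] [NormedSpace ℝ F] [TopologicalSpace H']
  {I : ModelWithCorners ℝ F H'} [TopologicalSpace M] [ChartedSpace H' M]

variable (J) in
/-- The functional `x ↦ (x^L f)(k)`. -/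
def leftFun (f : K → ℝ) (k : K) : GroupLieAlgebra J K →ₗ[ℝ] ℝ :=
  (differential J (fun l => f (k * l)) 1).toLinearMap

variable (J) in
/-- The functional `x ↦ (x^R f)(k)`. -/
def rightFun (f : K → ℝ) (k : K) : GroupLieAlgebra J K →ₗ[ℝ] ℝ :=
  (differential J (fun l => f (l * k)) 1).toLinearMap

variable [LieGroup J ∞ K] {f : K → ℝ} (hf : ContMDiff J 𝓘(ℝ, ℝ) ∞ f)

include hf

lemma contMDiff_comp_left_mul (k : K) : ContMDiff J 𝓘(ℝ, ℝ) ∞ (fun l => f (k * l)) :=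
  hf.comp contMDiff_mul_left

lemma contMDiff_comp_right_mul (k : K) : ContMDiff J 𝓘(ℝ, ℝ) ∞ (fun l => f (l * k)) :=
  hf.comp contMDiff_mul_right

/-- The vector `∑ ½ ((e_i^L + e_i^R) f)(k) e^i` of the moment map condition. -/
lemma momentVector_differential [FiniteDimensional ℝ E] (B : InvariantForm J K) (k : K) :
    B.momentVector k (differential J f k) =
      B.sharp ((1 / 2 : ℝ) • (leftFun J f k + rightFun J f k)) := by
  have h1 : ∀ x : GroupLieAlgebra J K, differential J f k (mfderiv J J (fun a : K => k * a) 1 x) =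
      leftFun J f k x := fun x => (differential_mul_left hf k x).symm
  have h2 : ∀ x : GroupLieAlgebra J K, differential J f k (mfderiv J J (fun a : K => a * k) 1 x) =
      rightFun J f k x := by
    intro x
    have h := differential_comp_of_eq (I := J) (I' := J) (f := f) (g := fun l => l * k) (m := 1)
      (hf.mdifferentiable (by simp) k)
      ((contMDiff_mul_right (I := J) (n := ∞) (a := k)).mdifferentiable (by simp) 1) (one_mul k)
    exact (DFunLike.congr_fun h x).symm
  unfold InvariantForm.momentVector InvariantForm.sharp
  refine Finset.sum_congr rfl fun i _ => ?_
  congr 1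
  exact congrArg₂ (fun u v : ℝ => 1 / 2 * (u + v)) (h1 _) (h2 _)

variable [FiniteDimensional ℝ E] [J.Boundaryless]

/-- The derivative of `k ↦ f (k c k⁻¹)`: the factor `k` on the left contributes `x^R`, the factor
`k⁻¹` on the right `-x^L`. -/
lemma differential_conj (c : K) (x : GroupLieAlgebra J K) :
    differential J (fun k => f (k * c * k⁻¹)) 1 x = rightFun J f c x - leftFun J f c x := by
  have hs : ContMDiff (J.prod J) 𝓘(ℝ, ℝ) ∞ fun p : K × K => f (p.1 * c * p.2⁻¹) :=
    hf.comp ((contMDiff_fst.mul contMDiff_const).mul contMDiff_snd.inv)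
  have h := differential_diag (I := J) (m := 1) (hs.mdifferentiable (by simp) _)
  simp only [inv_one, mul_one, one_mul] at h
  rw [h, add_apply, differential_inv (f := fun k => f (c * k)) (hf.comp contMDiff_mul_left)]
  exact (sub_eq_add_neg _ _).symm

/-- By equivariance of the moment map, `x_M (f ∘ μ) = ((x^L - x^R) f) ∘ μ`. -/
lemma orbit_differential_moment (A : SmoothAction J K I M) {μ : M → K} (hμ : ContMDiff I J ∞ μ)
    (h : ∀ k m, μ (A.act k m) = k * μ m * k⁻¹) (m : M) :
    A.orbit m (differential I (fun p => f (μ p)) m) = leftFun J f (μ m) - rightFun J f (μ m) := by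
  ext x
  have h1 : A.orbit m (differential I (fun p => f (μ p)) m) x = _ :=
    A.differential_fundamental ((hf.comp hμ).mdifferentiable (by simp) m) x
  rw [h1]
  have e : (fun k => (f ∘ μ) (A.act k m)) = fun k => f (k * μ m * k⁻¹) :=
    funext fun k => congrArg f (h k m)
  rw [e, differential_conj hf, neg_sub]
  rfl

end MomentFunctional

section Slices

variable {E₁ H₁ K₁ E₂ H₂ K₂ : Type*}
  [NormedAddCommGroup E₁] [NormedSpace ℝ E₁] [TopologicalSpace H₁] {J₁ : ModelWithCorners ℝ E₁ H₁}
  [TopologicalSpace K₁] [ChartedSpace H₁ K₁] [Group K₁]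
  [NormedAddCommGroup E₂] [NormedSpace ℝ E₂] [TopologicalSpace H₂] {J₂ : ModelWithCorners ℝ E₂ H₂}
  [TopologicalSpace K₂] [ChartedSpace H₂ K₂] [Group K₂]
  {f : K₁ × K₂ → ℝ} (hf : ContMDiff (J₁.prod J₂) 𝓘(ℝ, ℝ) ∞ f)

include hf

lemma differential_lieInl (x : GroupLieAlgebra J₁ K₁) :
    differential (J₁.prod J₂) f 1 (lieInl K₁ K₂ J₁ J₂ x) =
      differential J₁ (fun g => f (g, 1)) 1 x := by
  have h := differential_comp_of_eq (I := J₁) (I' := J₁.prod J₂) (f := f)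
    (g := fun g => (g, (1 : K₂))) (m := 1) (m' := 1) (hf.mdifferentiable (by simp) _)
    (mdifferentiableAt_id.prodMk mdifferentiableAt_const) rfl
  rw [mfderiv_prod_left] at h
  exact (DFunLike.congr_fun h x).symm

lemma differential_lieInr (x : GroupLieAlgebra J₂ K₂) :
    differential (J₁.prod J₂) f 1 (lieInr K₁ K₂ J₁ J₂ x) =
      differential J₂ (fun g => f (1, g)) 1 x := by
  have h := differential_comp_of_eq (I := J₂) (I' := J₁.prod J₂) (f := f)
    (g := fun g => ((1 : K₁), g)) (m := 1) (m' := 1) (hf.mdifferentiable (by simp) _)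
    (mdifferentiableAt_const.prodMk mdifferentiableAt_id) rfl
  rw [mfderiv_prod_right] at h
  exact (DFunLike.congr_fun h x).symm

end Slices

section FusionMoment

variable {EG HG G EH HH H : Type*}
  [NormedAddCommGroup EG] [NormedSpace ℝ EG] [TopologicalSpace HG] {JG : ModelWithCorners ℝ EG HG}
  [TopologicalSpace G] [ChartedSpace HG G] [Group G]
  [NormedAddCommGroup EH] [NormedSpace ℝ EH] [TopologicalSpace HH] {JH : ModelWithCorners ℝ EH HH}
  [TopologicalSpace H] [ChartedSpace HH H] [Group H]
  {F H' M : Type*} [NormedAddCommGroup F] [NormedSpace ℝ F] [TopologicalSpace H']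
  {I : ModelWithCorners ℝ F H'} [TopologicalSpace M] [ChartedSpace H' M]

lemma lie_decomp (v : GroupLieAlgebra (JG.prod (JG.prod JH)) (G × G × H)) :
    v = lieIn₁ G H JG JH (lieFst v) + (lieIn₂ G H JG JH (lieFst (lieSnd v)) +
      lieIn₃ G H JG JH (lieSnd (lieSnd v))) := by
  have h1 : v = lieMk (lieFst v) (lieMk (lieFst (lieSnd v)) (lieSnd (lieSnd v))) := rfl
  rw [lieMk_eq_add, lieMk_eq_add, map_add] at h1
  exact h1

section

variable [LieGroup JG ∞ G] [LieGroup JH ∞ H] {f : G × H → ℝ}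
  (hf : ContMDiff (JG.prod JH) 𝓘(ℝ, ℝ) ∞ f)

variable (JG) in
/-- The derivative of `f(ab, h)` when `x` is inserted between `a` and `b`. -/
def middleFun (f : G × H → ℝ) (k : G × G × H) : GroupLieAlgebra JG G →ₗ[ℝ] ℝ :=
  (differential JG (fun g => f (k.1 * g * k.2.1, k.2.2)) 1).toLinearMap

/-- The multiplication `(a, b, h) ↦ (ab, h)`. -/
def fuseMul (k : G × G × H) : G × H := (k.1 * k.2.1, k.2.2)

omit [LieGroup JH ∞ H] in
lemma contMDiff_fuseMul : ContMDiff (JG.prod (JG.prod JH)) (JG.prod JH) ∞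
    (fuseMul : G × G × H → G × H) :=
  (contMDiff_fst.mul (contMDiff_fst.comp contMDiff_snd)).prodMk
    (contMDiff_snd.comp contMDiff_snd)

include hf

lemma leftFun_lieIn₁ (k : G × G × H) :
    leftFun (JG.prod (JG.prod JH)) (fun k => f (fuseMul k)) k ∘ₗ lieIn₁ G H JG JH =
      middleFun JG f k := by
  ext x
  refine (differential_lieInl (contMDiff_comp_left_mul (hf.comp contMDiff_fuseMul) k) x).trans ?_
  refine congrArg (fun φ : G → ℝ => differential JG φ 1 x) (funext fun g => ?_)
  simp [fuseMul]

lemma rightFun_lieIn₁ (k : G × G × H) :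
    rightFun (JG.prod (JG.prod JH)) (fun k => f (fuseMul k)) k ∘ₗ lieIn₁ G H JG JH =
      rightFun (JG.prod JH) f (fuseMul k) ∘ₗ lieInl G H JG JH := by
  ext x
  refine (differential_lieInl (contMDiff_comp_right_mul (hf.comp contMDiff_fuseMul) k) x).trans ?_
  refine Eq.trans ?_ (differential_lieInl (contMDiff_comp_right_mul hf (fuseMul k)) x).symm
  refine congrArg (fun φ : G → ℝ => differential JG φ 1 x) (funext fun g => ?_)
  simp [fuseMul, mul_assoc]

lemma leftFun_lieIn₂ (k : G × G × H) :
    leftFun (JG.prod (JG.prod JH)) (fun k => f (fuseMul k)) k ∘ₗ lieIn₂ G H JG JH =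
      leftFun (JG.prod JH) f (fuseMul k) ∘ₗ lieInl G H JG JH := by
  ext x
  have h := contMDiff_comp_left_mul (hf.comp contMDiff_fuseMul) k
  refine (differential_lieInr h _).trans ?_
  refine (differential_lieInl (h.comp (contMDiff_const.prodMk contMDiff_id)) x).trans ?_
  refine Eq.trans ?_ (differential_lieInl (contMDiff_comp_left_mul hf (fuseMul k)) x).symm
  refine congrArg (fun φ : G → ℝ => differential JG φ 1 x) (funext fun g => ?_)
  simp [fuseMul, mul_assoc]

lemma rightFun_lieIn₂ (k : G × G × H) :
    rightFun (JG.prod (JG.prod JH)) (fun k => f (fuseMul k)) k ∘ₗ lieIn₂ G H JG JH =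
      middleFun JG f k := by
  ext x
  have h := contMDiff_comp_right_mul (hf.comp contMDiff_fuseMul) k
  refine (differential_lieInr h _).trans ?_
  refine (differential_lieInl (h.comp (contMDiff_const.prodMk contMDiff_id)) x).trans ?_
  refine congrArg (fun φ : G → ℝ => differential JG φ 1 x) (funext fun g => ?_)
  simp [fuseMul, mul_assoc]

lemma leftFun_lieIn₃ (k : G × G × H) :
    leftFun (JG.prod (JG.prod JH)) (fun k => f (fuseMul k)) k ∘ₗ lieIn₃ G H JG JH =
      leftFun (JG.prod JH) f (fuseMul k) ∘ₗ lieInr G H JG JH := by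
  ext x
  have h := contMDiff_comp_left_mul (hf.comp contMDiff_fuseMul) k
  refine (differential_lieInr h _).trans ?_
  refine (differential_lieInr (h.comp (contMDiff_const.prodMk contMDiff_id)) x).trans ?_
  refine Eq.trans ?_ (differential_lieInr (contMDiff_comp_left_mul hf (fuseMul k)) x).symm
  refine congrArg (fun φ : H → ℝ => differential JH φ 1 x) (funext fun g => ?_)
  simp [fuseMul]

lemma rightFun_lieIn₃ (k : G × G × H) :
    rightFun (JG.prod (JG.prod JH)) (fun k => f (fuseMul k)) k ∘ₗ lieIn₃ G H JG JH =
      rightFun (JG.prod JH) f (fuseMul k) ∘ₗ lieInr G H JG JH := by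
  ext x
  have h := contMDiff_comp_right_mul (hf.comp contMDiff_fuseMul) k
  refine (differential_lieInr h _).trans ?_
  refine (differential_lieInr (h.comp (contMDiff_const.prodMk contMDiff_id)) x).trans ?_
  refine Eq.trans ?_ (differential_lieInr (contMDiff_comp_right_mul hf (fuseMul k)) x).symm
  refine congrArg (fun φ : H → ℝ => differential JH φ 1 x) (funext fun g => ?_)
  simp [fuseMul]

end

variable [FiniteDimensional ℝ EG] [LieGroup JG ∞ G] [LieGroup JH ∞ H] [JG.Boundaryless]
  [JH.Boundaryless] [FiniteDimensional ℝ EH] [IsManifold I ∞ M]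

/-- The moment map condition of the fused space `(M, P - ψ_M, (μ₁μ₂, μ₃))`. -/
theorem moment_condition_fuse (BG : InvariantForm JG G) (BH : InvariantForm JH H)
    {X : QPSpace (JG.prod (JG.prod JH)) (G × G × H) I M}
    (hX : X.IsHamiltonian (BG.prod (BG.prod BH))) (m : M)
    (ξ : Covector (JG.prod JH) ((X.fuse BG).moment m)) (α : Covector I m) :
    (X.fuse BG).bivector m ![ξ.comp (mfderiv I (JG.prod JH) (X.fuse BG).moment m), α] =
      α ((X.fuse BG).action.fundamental
        ((BG.prod BH).momentVector ((X.fuse BG).moment m) ξ) m) := by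
  have := isManifold_of_lieGroup (JG.prod JH) (G × H)
  have := t2Space_of_lieGroup (JG.prod JH) (G × H)
  obtain ⟨f, hf, rfl⟩ := exists_differential_eq ξ
  have hF : ContMDiff (JG.prod (JG.prod JH)) 𝓘(ℝ, ℝ) ∞ fun k => f (fuseMul k) :=
    hf.comp contMDiff_fuseMul
  have hμ : ContMDiff I (JG.prod JH) ∞ (X.fuse BG).moment :=
    contMDiff_fuseMul.comp hX.smooth_moment
  have e1 : (differential (JG.prod JH) f ((X.fuse BG).moment m)).comp
      (mfderiv I (JG.prod JH) (X.fuse BG).moment m) =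
      differential I (fun p => f (fuseMul (X.moment p))) m :=
    (differential_comp (f := f) (g := (X.fuse BG).moment) (hf.mdifferentiable (by simp) _)
      (hμ.mdifferentiable (by simp) m)).symm
  have e2 : differential I (fun p => f (fuseMul (X.moment p))) m =
      (differential (JG.prod (JG.prod JH)) (fun k => f (fuseMul k)) (X.moment m)).comp
      (mfderiv I (JG.prod (JG.prod JH)) X.moment m) :=
    differential_comp (f := fun k => f (fuseMul k)) (g := X.moment)
      (hF.mdifferentiable (by simp) _) (hX.smooth_moment.mdifferentiable (by simp) m)
  have hP := hX.moment_condition m (differential (JG.prod (JG.prod JH))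
    (fun k => f (fuseMul k)) (X.moment m)) α
  rw [momentVector_differential hF, ← e2] at hP
  rw [e1, momentVector_differential hf]
  have hψ := psiField_apply BG X.action m (differential I (fun p => f (fuseMul (X.moment p))) m) α
  -- on `μ`, the two copies of `𝔤` act through `x^L - x^R`; for `f (ab, h)` the right derivative in
  -- `b` and the left derivative in `a` are both the derivative in the middle
  rw [orbit_differential_moment hF X.action hX.smooth_moment hX.equivariant] at hψ
  rw [LinearMap.sub_comp, LinearMap.sub_comp, leftFun_lieIn₁ hf, rightFun_lieIn₁ hf,
    leftFun_lieIn₂ hf, rightFun_lieIn₂ hf] at hψ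
  change X.bivector m ![_, α] - psiField BG X.action m ![_, α] =
    X.action.fuse.orbit m α ((BG.prod BH).sharp ((1 / 2 : ℝ) •
      (leftFun (JG.prod JH) f (fuseMul (X.moment m)) +
        rightFun (JG.prod JH) f (fuseMul (X.moment m)))))
  rw [hP, hψ]
  set k := X.moment m
  set s := (BG.prod BH).sharp ((1 / 2 : ℝ) • (leftFun (JG.prod JH) f (fuseMul k) +
        rightFun (JG.prod JH) f (fuseMul k))) with hs
  set s' := (BG.prod (BG.prod BH)).sharp ((1 / 2 : ℝ) •
    (leftFun (JG.prod (JG.prod JH)) (fun k => f (fuseMul k)) k +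
      rightFun (JG.prod (JG.prod JH)) (fun k => f (fuseMul k)) k)) with hs'
  have h1 : lieFst s' = BG.sharp ((1 / 2 : ℝ) • (middleFun JG f k +
      rightFun (JG.prod JH) f (fuseMul k) ∘ₗ lieInl G H JG JH)) := by
    rw [hs', InvariantForm.lieFst_sharp_prod, ← leftFun_lieIn₁ hf, ← rightFun_lieIn₁ hf]
    rfl
  have h2 : lieFst (lieSnd s') = BG.sharp ((1 / 2 : ℝ) •
      (leftFun (JG.prod JH) f (fuseMul k) ∘ₗ lieInl G H JG JH + middleFun JG f k)) := by
    rw [hs', InvariantForm.lieSnd_sharp_prod, InvariantForm.lieFst_sharp_prod,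
      ← leftFun_lieIn₂ hf, ← rightFun_lieIn₂ hf]
    rfl
  have h3 : lieSnd (lieSnd s') = lieSnd s := by
    rw [hs', hs, InvariantForm.lieSnd_sharp_prod, InvariantForm.lieSnd_sharp_prod,
      InvariantForm.lieSnd_sharp_prod]
    congr 1
    have l := leftFun_lieIn₃ hf k
    have r := rightFun_lieIn₃ hf k
    change (1 / 2 : ℝ) • (leftFun _ _ k ∘ₗ lieIn₃ G H JG JH +
      rightFun _ _ k ∘ₗ lieIn₃ G H JG JH) = _
    rw [l, r]
    rfl
  have h4 : lieFst s = BG.sharp ((1 / 2 : ℝ) •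
      (leftFun (JG.prod JH) f (fuseMul k) ∘ₗ lieInl G H JG JH +
        rightFun (JG.prod JH) f (fuseMul k) ∘ₗ lieInl G H JG JH)) := by
    rw [hs, InvariantForm.lieFst_sharp_prod]
    rfl
  have d1 : X.action.fuse.orbit m α s = X.action.orbit m α (lieIn₁ G H JG JH (lieFst s)) +
      X.action.orbit m α (lieIn₂ G H JG JH (lieFst s)) +
      X.action.orbit m α (lieIn₃ G H JG JH (lieSnd s)) := by
    have a1 := LinearMap.congr_fun (X.action.orbit_fuse_lieInl m α) (lieFst s)
    have a2 := LinearMap.congr_fun (X.action.orbit_fuse_lieInr m α) (lieSnd s)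
    have hd : s = lieInl G H JG JH (lieFst s) + lieInr G H JG JH (lieSnd s) := lieMk_eq_add _ _
    conv_lhs => rw [hd, map_add]
    exact congrArg₂ (· + ·) a1 a2
  have d2 : α (X.action.fundamental s' m) = X.action.orbit m α (lieIn₁ G H JG JH (lieFst s')) +
      (X.action.orbit m α (lieIn₂ G H JG JH (lieFst (lieSnd s'))) +
      X.action.orbit m α (lieIn₃ G H JG JH (lieSnd (lieSnd s')))) := by
    rw [← map_add, ← map_add, ← lie_decomp]
    rfl
  rw [d1, d2, h3, h1, h2, h4, BG.form_sharp_right]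
  set b₁ := X.action.orbit m α ∘ₗ lieIn₁ G H JG JH with hb₁
  set b₂ := X.action.orbit m α ∘ₗ lieIn₂ G H JG JH with hb₂
  have c1 : ∀ x, X.action.orbit m α (lieIn₁ G H JG JH x) = b₁ x := fun x => rfl
  have c2 : ∀ x, X.action.orbit m α (lieIn₂ G H JG JH x) = b₂ x := fun x => rfl
  rw [c1, c1, c2, c2]
  set κ := middleFun JG f k
  set ρ := rightFun (JG.prod JH) f (fuseMul k) ∘ₗ lieInl G H JG JH
  set l := leftFun (JG.prod JH) f (fuseMul k) ∘ₗ lieInl G H JG JH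
  have hsub : ∀ a b : GroupLieAlgebra JG G →ₗ[ℝ] ℝ, BG.sharp (a - b) = BG.sharp a - BG.sharp b :=
    fun a b => by
      rw [sub_eq_add_neg, BG.sharp_add, ← neg_one_smul ℝ b, BG.sharp_smul, neg_one_smul,
        sub_eq_add_neg]
  -- in the first copy of `𝔤`, `½ (κ + ρ)` from `P` and `½ (l - κ)` from `-ψ_M` add up to
  -- `½ (l + ρ)`; in the second, `½ (l + κ)` and `-½ (κ - ρ)` do
  rw [BG.form_sharp]
  simp only [hsub, BG.sharp_add, BG.sharp_smul, map_sub, map_add, map_smul, smul_eq_mul]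
  ring

/-- Internal fusion of Hamiltonian quasi-Poisson manifolds. -/
theorem QPSpace.IsHamiltonian.fuse [FiniteDimensional ℝ F] [BoundarylessManifold I M]
    {BG : InvariantForm JG G} {BH : InvariantForm JH H}
    {X : QPSpace (JG.prod (JG.prod JH)) (G × G × H) I M}
    (hX : X.IsHamiltonian (BG.prod (BG.prod BH))) : (X.fuse BG).IsHamiltonian (BG.prod BH) where
  smooth_bivector := isSmoothField_two fun f g hf hg =>
    (hX.smooth_bivector.contMDiff_two hf hg).sub
      ((isSmoothField_psiField BG X.action).contMDiff_two hf hg)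
  invariant k m := by
    have h1 : X.bivector (X.action.fuse.act k m) =
        pushforward (mfderiv I I (X.action.fuse.act k) m) (X.bivector m) :=
      hX.invariant (k.1, k.1, k.2) m
    have h2 := psiField_invariant BG X.action k m
    exact (congrArg₂ (fun P P' : MultiVector I 2 (X.action.fuse.act k m) => P - P') h1 h2).trans
      (pushforward_sub _ _ _).symm
  quasi_jacobi := schouten_fuse BG X.action BH hX.smooth_bivector hX.invariant hX.quasi_jacobi
  smooth_moment := contMDiff_fuseMul.comp hX.smooth_moment
  equivariant k m := by
    change fuseMul (X.moment (X.action.act (k.1, k.1, k.2) m)) = k * fuseMul (X.moment m) * k⁻¹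
    rw [hX.equivariant]
    refine Prod.ext ?_ rfl
    change k.1 * _ * k.1⁻¹ * (k.1 * _ * k.1⁻¹) = k.1 * (_ * _) * k.1⁻¹
    group
  moment_condition := moment_condition_fuse BG BH hX

omit [FiniteDimensional ℝ EG] [JG.Boundaryless] [JH.Boundaryless] [FiniteDimensional ℝ EH]
  [IsManifold I ∞ M] in
lemma lieFuse_Ad (k : G × H) (v : GroupLieAlgebra (JG.prod (JG.prod JH)) (G × G × H)) :
    lieFuse (Ad (JG.prod (JG.prod JH)) (k.1, k.1, k.2) v) = Ad (JG.prod JH) k (lieFuse v) := by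
  rw [Ad_prod, Ad_prod, Ad_prod]
  refine Prod.ext ?_ rfl
  exact (map_add (Ad JG k.1) _ _).symm

omit [FiniteDimensional ℝ EG] [JG.Boundaryless] [JH.Boundaryless] [FiniteDimensional ℝ EH]
  [IsManifold I ∞ M] in
/-- The map `(x, y, z) ↦ (x + y, z)` is adjoint to the diagonal inclusion. -/
lemma form_lieFuse (BG : InvariantForm JG G) (BH : InvariantForm JH H)
    (v : GroupLieAlgebra (JG.prod (JG.prod JH)) (G × G × H))
    (x : GroupLieAlgebra (JG.prod JH) (G × H)) :
    (BG.prod BH).form (lieFuse v) x = (BG.prod (BG.prod BH)).form v (lieDiag x) := by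
  have h1 : (BG.prod BH).form (lieFuse v) x =
      BG.form (lieFst v + lieFst (lieSnd v)) (lieFst x) +
        BH.form (lieSnd (lieSnd v)) (lieSnd x) := rfl
  have h2 : (BG.prod (BG.prod BH)).form v (lieDiag x) = BG.form (lieFst v) (lieFst x) +
      (BG.form (lieFst (lieSnd v)) (lieFst x) + BH.form (lieSnd (lieSnd v)) (lieSnd x)) := rfl
  rw [h1, h2, map_add, LinearMap.add_apply, add_assoc]

omit [FiniteDimensional ℝ EG] [JG.Boundaryless] [JH.Boundaryless] [FiniteDimensional ℝ EH]
  [IsManifold I ∞ M] in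
/-- Internal fusion of Hamiltonian Poisson manifolds. -/
theorem PSpace.IsHamiltonian.fuse
    {BG : InvariantForm JG G} {BH : InvariantForm JH H}
    {Y : PSpace (JG.prod (JG.prod JH)) (G × G × H) I M}
    (hY : Y.IsHamiltonian (BG.prod (BG.prod BH))) : Y.fuse.IsHamiltonian (BG.prod BH) where
  smooth_bivector := hY.smooth_bivector
  invariant k m := hY.invariant (k.1, k.1, k.2) m
  jacobi := hY.jacobi
  smooth_moment := by
    let L : (EG × EG × EH) →L[ℝ] (EG × EH) :=
      (ContinuousLinearMap.fst ℝ EG (EG × EH) + (ContinuousLinearMap.fst ℝ EG EH).comp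
        (ContinuousLinearMap.snd ℝ EG (EG × EH))).prod
        ((ContinuousLinearMap.snd ℝ EG EH).comp (ContinuousLinearMap.snd ℝ EG (EG × EH)))
    exact (L.contMDiff (n := ∞)).comp hY.smooth_moment
  equivariant k m := by
    change lieFuse (Y.moment (Y.action.act (k.1, k.1, k.2) m)) = _
    rw [hY.equivariant, lieFuse_Ad]
    rfl
  moment_condition m x α := by
    have h := hY.moment_condition m (lieDiag x) α
    have e : (fun p => (BG.prod BH).form (Y.fuse.moment p) x) =
        fun p => (BG.prod (BG.prod BH)).form (Y.moment p) (lieDiag x) :=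
      funext fun p => form_lieFuse BG BH _ x
    rw [e]
    exact h.trans (congrArg α (Y.action.fuse_fundamental x m).symm)

end FusionMoment

/-! ### Smoothness of maps of deformation spaces -/

section Hadamard

variable {E E' : Type*} [NormedAddCommGroup E] [NormedSpace ℝ E] [FiniteDimensional ℝ E]
  [NormedAddCommGroup E'] [NormedSpace ℝ E'] [FiniteDimensional ℝ E']

open MeasureTheory in
/-- Averages of a smooth function over the segments from the origin are smooth. -/
lemma contDiff_integral_segment {f : E → E'} (hf : ContDiff ℝ ∞ f) :
    ContDiff ℝ ∞ fun x => ∫ s in (0 : ℝ)..1, f (s • x) := by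
  -- a cut-off in the variable of integration turns the average into a convolution
  let η : ContDiffBump (0 : ℝ) := ⟨2, 3, by norm_num, by norm_num⟩
  let g : E → ℝ → E' := fun x u => η u • f (-u • x)
  have hg : ContDiff ℝ ∞ (fun p : E × ℝ => g p.1 p.2) :=
    (η.contDiff.comp contDiff_snd).smul (hf.comp (contDiff_snd.neg.smul contDiff_fst))
  have h := contDiffOn_convolution_right_with_param_comp (μ := (volume : Measure ℝ))
    (ContinuousLinearMap.lsmul ℝ ℝ : ℝ →L[ℝ] E' →L[ℝ] E') (n := (⊤ : ℕ∞)) (s := (univ : Set E))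
    (v := fun _ => (0 : ℝ)) contDiffOn_const (f := (Set.Ioc (0 : ℝ) 1).indicator fun _ => (1 : ℝ))
    (g := g) (k := Metric.closedBall 0 3) isOpen_univ (isCompact_closedBall _ _)
    (fun p x _ hx => by
      have : η x = 0 := by
        by_contra h0
        refine hx (Metric.ball_subset_closedBall ?_)
        rw [← η.support_eq]
        exact h0
      simp [g, this])
    (((integrable_indicator_iff measurableSet_Ioc).2
      (integrableOn_const (by simp))).locallyIntegrable) hg.contDiffOn
  rw [contDiffOn_univ] at h
  convert h using 2 with x
  rw [convolution_def, intervalIntegral.integral_of_le zero_le_one,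
    ← integral_indicator measurableSet_Ioc]
  refine integral_congr_ae (Filter.Eventually.of_forall fun s => ?_)
  by_cases hs : s ∈ Set.Ioc (0 : ℝ) 1
  · have : η (-s) = 1 := by
      refine η.one_of_mem_closedBall ?_
      rw [mem_closedBall_zero_iff, norm_neg, Real.norm_of_nonneg hs.1.le]
      exact hs.2.trans (by norm_num [η])
    simp [hs, g, this]
  · simp [hs]

/-- Hadamard's lemma: a function vanishing at the origin is `x ↦ Φ(x) x` for a smooth `Φ`. -/
theorem exists_hadamard {φ : E → E'} {U : Set E} (hU : IsOpen U) (h0U : 0 ∈ U)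
    (hφ : ContDiffOn ℝ ∞ φ U) (h0 : φ 0 = 0) :
    ∃ Φ : E → E →L[ℝ] E', ContDiff ℝ ∞ Φ ∧ Φ 0 = fderiv ℝ φ 0 ∧ ∀ᶠ x in 𝓝 0, φ x = Φ x x := by
  obtain ⟨r, hr, hrU⟩ := Metric.isOpen_iff.1 hU 0 h0U
  -- a bump function extends `φ` from a neighbourhood of the origin to a smooth function on `E`
  let η : ContDiffBump (0 : E) := ⟨r / 3, r / 2, by positivity, by linarith⟩
  let g : E → E' := fun x => η x • φ x
  have hφr : ∀ x ∈ Metric.ball (0 : E) r, ContDiffAt ℝ ∞ φ x := fun x hx =>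
    (hφ.mono hrU).contDiffAt (Metric.isOpen_ball.mem_nhds hx)
  have hg : ContDiff ℝ ∞ g := by
    rw [contDiff_iff_contDiffAt]
    intro x
    by_cases hx : x ∈ Metric.ball (0 : E) r
    · exact η.contDiffAt.smul (hφr x hx)
    · have : g =ᶠ[𝓝 x] fun _ => 0 := by
        have hx' : x ∉ tsupport η := by
          rw [η.tsupport_eq]
          intro h
          refine hx (Metric.closedBall_subset_ball ?_ h)
          change r / 2 < r
          linarith
        filter_upwards [notMem_tsupport_iff_eventuallyEq.1 hx'] with y hy
        simp [g, hy]
      exact contDiffAt_const.congr_of_eventuallyEq this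
  have hgφ : g =ᶠ[𝓝 0] φ := by
    filter_upwards [η.eventuallyEq_one] with x hx
    simp [g, hx]
  have hg0 : g 0 = 0 := by simp [g, h0]
  have hDg : ContDiff ℝ ∞ (fderiv ℝ g) := hg.fderiv_right (m := ∞) (by simp)
  refine ⟨fun x => ∫ s in (0 : ℝ)..1, fderiv ℝ g (s • x), contDiff_integral_segment hDg, ?_, ?_⟩
  · simp [hgφ.fderiv_eq]
  · filter_upwards [hgφ] with x hx
    rw [← hx]
    have hd : ∀ s ∈ uIcc (0 : ℝ) 1,
        HasDerivAt (fun s : ℝ => g (s • x)) (fderiv ℝ g (s • x) x) s := by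
      intro s _
      have h1 : HasDerivAt (fun s : ℝ => s • x) x s := by
        simpa using (hasDerivAt_id s).smul_const x
      exact ((hg.differentiable (by simp)) _).hasFDerivAt.comp_hasDerivAt s h1
    have hc : Continuous fun s : ℝ => fderiv ℝ g (s • x) :=
      hDg.continuous.comp (continuous_id.smul continuous_const)
    have h1 := intervalIntegral.integral_eq_sub_of_hasDerivAt hd
      ((hc.clm_apply continuous_const).intervalIntegrable _ _)
    rw [one_smul, zero_smul, hg0, sub_zero] at h1
    rw [← h1, ContinuousLinearMap.intervalIntegral_apply (hc.intervalIntegrable _ _)]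

end Hadamard

namespace DefSpace

section Charts

variable {E H : Type*} [NormedAddCommGroup E] [NormedSpace ℝ E] [TopologicalSpace H]
  {J : ModelWithCorners ℝ E H} {K : Type*} [TopologicalSpace K] [ChartedSpace H K] [Group K]
  [J.Boundaryless] [IsManifold J ∞ K]
  {F H' Z : Type*} [NormedAddCommGroup F] [NormedSpace ℝ F] [TopologicalSpace H']
  {I : ModelWithCorners ℝ F H'} [TopologicalSpace Z] [ChartedSpace H' Z]

variable (J) in
/-- The chart `chartUnit k` as an open partial homeomorphism. -/
def homeoUnit (k : K) : OpenPartialHomeomorph (DefSpace J K) (E × ℝ) :=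
  (core J K).openPartialHomeomorph (chartUnit J k) (mem_insert_of_mem _ (mem_range_self k))

variable (J K) in
/-- The chart `chartLie` as an open partial homeomorphism. -/
def homeoLie : OpenPartialHomeomorph (DefSpace J K) (E × ℝ) :=
  (core J K).openPartialHomeomorph (chartLie J K) (mem_insert _ _)

lemma homeoUnit_mem (k : K) :
    homeoUnit J k ∈ IsManifold.maximalAtlas 𝓘(ℝ, E × ℝ) ∞ (DefSpace J K) :=
  IsManifold.chart_mem_maximalAtlas (I := 𝓘(ℝ, E × ℝ)) (n := ∞)
    (unit k 1 one_ne_zero : DefSpace J K)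

lemma homeoLie_mem :
    homeoLie J K ∈ IsManifold.maximalAtlas 𝓘(ℝ, E × ℝ) ∞ (DefSpace J K) :=
  IsManifold.chart_mem_maximalAtlas (I := 𝓘(ℝ, E × ℝ)) (n := ∞) (lie 0 : DefSpace J K)

lemma contMDiffAt_homeoUnit {k : K} {p : DefSpace J K} (hp : p ∈ (chartUnit J k).source) :
    ContMDiffAt 𝓘(ℝ, E × ℝ) 𝓘(ℝ, E × ℝ) ∞ (homeoUnit J k) p :=
  contMDiffAt_of_mem_maximalAtlas (homeoUnit_mem k) hp

lemma contMDiffAt_homeoLie {p : DefSpace J K} (hp : p ∈ (chartLie J K).source) :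
    ContMDiffAt 𝓘(ℝ, E × ℝ) 𝓘(ℝ, E × ℝ) ∞ (homeoLie J K) p :=
  contMDiffAt_of_mem_maximalAtlas homeoLie_mem hp

lemma contMDiffAt_homeoUnit_symm {k : K} {p : E × ℝ} (hp : p ∈ (chartUnit J k).target) :
    ContMDiffAt 𝓘(ℝ, E × ℝ) 𝓘(ℝ, E × ℝ) ∞ (homeoUnit J k).symm p :=
  contMDiffAt_symm_of_mem_maximalAtlas (homeoUnit_mem k) hp

lemma contMDiffAt_homeoLie_symm {p : E × ℝ} (hp : p ∈ (chartLie J K).target) :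
    ContMDiffAt 𝓘(ℝ, E × ℝ) 𝓘(ℝ, E × ℝ) ∞ (homeoLie J K).symm p :=
  contMDiffAt_symm_of_mem_maximalAtlas homeoLie_mem hp

lemma unit_mem_source (a : K) (t : ℝ) (ht : t ≠ 0) :
    (unit a t ht : DefSpace J K) ∈ (chartUnit J a).source :=
  ⟨a, t, ht, rfl, mem_extChartAt_source a⟩

lemma lie_mem_source (v : GroupLieAlgebra J K) :
    (lie v : DefSpace J K) ∈ (chartLie J K).source := by
  intro a t ht h
  cases h

variable (J K) in
/-- The projection `𝒦 → ℝ` is smooth. -/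
theorem contMDiff_proj : ContMDiff 𝓘(ℝ, E × ℝ) 𝓘(ℝ, ℝ) ∞ (proj : DefSpace J K → ℝ) := by
  rintro (⟨a, t, ht⟩ | v)
  · have h : ContMDiffAt 𝓘(ℝ, E × ℝ) 𝓘(ℝ, ℝ) ∞ (fun p => (homeoUnit J a p).2) (unit a t ht) :=
      contDiff_snd.contMDiff.contMDiffAt.comp _ (contMDiffAt_homeoUnit (unit_mem_source a t ht))
    refine h.congr_of_eventuallyEq ?_
    filter_upwards [(homeoUnit J a).open_source.mem_nhds (unit_mem_source a t ht)] with p hp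
    obtain ⟨b, s, hs, rfl, -⟩ := hp
    rfl
  · have h : ContMDiffAt 𝓘(ℝ, E × ℝ) 𝓘(ℝ, ℝ) ∞ (fun p => (homeoLie J K p).2) (lie v) :=
      contDiff_snd.contMDiff.contMDiffAt.comp _ (contMDiffAt_homeoLie (lie_mem_source v))
    refine h.congr_of_eventuallyEq (Filter.Eventually.of_forall ?_)
    rintro (⟨b, s, hs⟩ | w) <;> rfl

/-- The component in `K` of a point of `𝒦` over `t ≠ 0`; the value over `0` is irrelevant. -/
def groupPart : DefSpace J K → K
  | unit k _ _ => k
  | lie _ => 1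

lemma contMDiffAt_groupPart (a : K) (t : ℝ) (ht : t ≠ 0) :
    ContMDiffAt 𝓘(ℝ, E × ℝ) J ∞ (groupPart : DefSpace J K → K) (unit a t ht) := by
  have h1 : ContMDiffAt 𝓘(ℝ, E × ℝ) 𝓘(ℝ, E) ∞ (fun p => (homeoUnit J a p).1) (unit a t ht) :=
    contDiff_fst.contMDiff.contMDiffAt.comp _ (contMDiffAt_homeoUnit (unit_mem_source a t ht))
  have h2 : ContMDiffAt 𝓘(ℝ, E) J ∞ (extChartAt J a).symm (extChartAt J a a) :=
    (contMDiffOn_extChartAt_symm a).contMDiffAt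
      ((isOpen_extChartAt_target a).mem_nhds (mem_extChartAt_target a))
  have h3 : ContMDiffAt 𝓘(ℝ, E × ℝ) J ∞
      (fun p => (extChartAt J a).symm (homeoUnit J a p).1) (unit a t ht) :=
    ContMDiffAt.comp (I' := 𝓘(ℝ, E)) (unit a t ht) (g := (extChartAt J a).symm)
      (f := fun p => (homeoUnit J a p).1) h2 h1
  refine h3.congr_of_eventuallyEq ?_
  filter_upwards [(homeoUnit J a).open_source.mem_nhds (unit_mem_source a t ht)] with p hp
  obtain ⟨b, s, hs, rfl, hb⟩ := hp
  exact ((extChartAt J a).left_inv hb).symm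

/-- The point `(k, t)` of `𝒦` for `t ≠ 0`, continued by `0 ∈ 𝔨` to `t = 0`. -/
def mk (k : K) (t : ℝ) : DefSpace J K := if h : t ≠ 0 then unit k t h else lie 0

lemma mk_of_ne (k : K) {t : ℝ} (ht : t ≠ 0) : (mk k t : DefSpace J K) = unit k t ht := by
  simp only [mk, ne_eq, ht, not_false_eq_true, dite_true]

lemma contMDiffAt_mk {κ : Z → K} {τ : Z → ℝ} {z : Z} (hκ : ContMDiffAt I J ∞ κ z)
    (hτ : ContMDiffAt I 𝓘(ℝ, ℝ) ∞ τ z) (h0 : τ z ≠ 0) :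
    ContMDiffAt I 𝓘(ℝ, E × ℝ) ∞ (fun z => (mk (κ z) (τ z) : DefSpace J K)) z := by
  have h1 : ContMDiffAt I 𝓘(ℝ, E) ∞ (fun y => extChartAt J (κ z) (κ y)) z :=
    ContMDiffAt.comp (I' := J) z (g := extChartAt J (κ z)) (f := κ) contMDiffAt_extChartAt hκ
  have h2 : ContMDiffAt I 𝓘(ℝ, E × ℝ) ∞ (fun y => (extChartAt J (κ z) (κ y), τ y)) z :=
    h1.prodMk_space hτ
  have h3 : ContMDiffAt I 𝓘(ℝ, E × ℝ) ∞
      (fun y => (homeoUnit J (κ z)).symm (extChartAt J (κ z) (κ y), τ y)) z :=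
    ContMDiffAt.comp (I' := 𝓘(ℝ, E × ℝ)) z (g := (homeoUnit J (κ z)).symm)
      (f := fun y => (extChartAt J (κ z) (κ y), τ y))
      (contMDiffAt_homeoUnit_symm (k := κ z) ⟨mem_extChartAt_target (κ z), h0⟩) h2
  refine h3.congr_of_eventuallyEq ?_
  filter_upwards [hκ.continuousAt.preimage_mem_nhds (extChartAt_source_mem_nhds (I := J) (κ z)),
    hτ.continuousAt.eventually_ne h0] with y hy hy0
  change mk (κ y) (τ y) = (chartUnit J (κ z)).symm (extChartAt J (κ z) (κ y), τ y)
  simp only [chartUnit, PartialEquiv.coe_symm_mk, mk, ne_eq, hy0, not_false_eq_true, dite_true,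
    (extChartAt J (κ z)).left_inv hy]

end Charts

section Map

variable {E H : Type*} [NormedAddCommGroup E] [NormedSpace ℝ E] [TopologicalSpace H]
  {J : ModelWithCorners ℝ E H} {K : Type*} [TopologicalSpace K] [ChartedSpace H K] [Group K]
  [J.Boundaryless] [IsManifold J ∞ K] [FiniteDimensional ℝ E]
  {E' H' : Type*} [NormedAddCommGroup E'] [NormedSpace ℝ E'] [TopologicalSpace H']
  {J' : ModelWithCorners ℝ E' H'} {K' : Type*} [TopologicalSpace K'] [ChartedSpace H' K']
  [Group K'] [J'.Boundaryless] [IsManifold J' ∞ K'] [FiniteDimensional ℝ E']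

variable (J J') in
/-- The map `𝒟(K, 1) → 𝒟(K', 1)` induced by a map `p : K → K'` with `p 1 = 1`: it is `p` on `K` and
the differential of `p` at `1` on `𝔨`. -/
def map (p : K → K') : DefSpace J K → DefSpace J' K'
  | unit k t ht => unit (p k) t ht
  | lie v => lie (show E' from mfderiv J J' p 1 v)

/-- The map of deformation spaces induced by a smooth map is smooth. Over `t ≠ 0` this is clear;
near the fibre over `0` it is a consequence of Hadamard's lemma. -/
theorem contMDiff_map {p : K → K'} (hp : ContMDiff J J' ∞ p) (h1 : p 1 = 1) :
    ContMDiff 𝓘(ℝ, E × ℝ) 𝓘(ℝ, E' × ℝ) ∞ (map J J' p) := by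
  rintro (⟨a, t, ht⟩ | v)
  · have h : ContMDiffAt 𝓘(ℝ, E × ℝ) 𝓘(ℝ, E' × ℝ) ∞
        (fun y : DefSpace J K => (mk (p y.groupPart) y.proj : DefSpace J' K')) (unit a t ht) :=
      contMDiffAt_mk (ContMDiffAt.comp (I' := J) _ (hp _) (contMDiffAt_groupPart a t ht))
        (contMDiff_proj J K _) ht
    refine h.congr_of_eventuallyEq ?_
    filter_upwards [(homeoUnit J a).open_source.mem_nhds (unit_mem_source a t ht)] with y hy
    obtain ⟨b, s, hs, rfl, -⟩ := hy
    exact (mk_of_ne (p b) hs).symm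
  · -- `p` in the preferred charts at the identities, centred at the origin
    set χ := extChartAt J (1 : K) with hχ
    set χ' := extChartAt J' (1 : K') with hχ'
    let φ : E → E' := fun x => χ' (p (χ.symm (χ 1 + x))) - χ' 1
    let U : Set E := (fun x => χ 1 + x) ⁻¹' (χ.target ∩ χ.symm ⁻¹' (p ⁻¹' χ'.source))
    have hopen : IsOpen (χ.target ∩ χ.symm ⁻¹' (p ⁻¹' χ'.source)) :=
      (continuousOn_extChartAt_symm (1 : K)).isOpen_inter_preimage (isOpen_extChartAt_target 1)
        ((isOpen_extChartAt_source (1 : K')).preimage hp.continuous)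
    have hU : IsOpen U := hopen.preimage (continuous_const.add continuous_id)
    have h0U : (0 : E) ∈ U := by
      refine ⟨?_, ?_⟩
      · change χ 1 + 0 ∈ χ.target
        rw [add_zero]
        exact mem_extChartAt_target (I := J) (1 : K)
      · simp only [add_zero, mem_preimage]
        rw [hχ, extChartAt_to_inv, h1]
        exact mem_extChartAt_source (1 : K')
    have hφ : ContDiffOn ℝ ∞ φ U := by
      have hc : ContMDiffOn 𝓘(ℝ, E) 𝓘(ℝ, E') ∞ (fun x => χ' (p (χ.symm x)))
          (χ.target ∩ χ.symm ⁻¹' (p ⁻¹' χ'.source)) := by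
        have a1 : ContMDiffOn 𝓘(ℝ, E) J' ∞ (fun x => p (χ.symm x)) χ.target :=
          hp.comp_contMDiffOn (contMDiffOn_extChartAt_symm (1 : K))
        exact (contMDiffOn_extChartAt (x := (1 : K'))).comp (a1.mono inter_subset_left)
          (fun x hx => by
            have := hx.2
            simpa only [mem_preimage, hχ', extChartAt_source] using this)
      exact ((hc.contDiffOn.comp (contDiff_const.add contDiff_id).contDiffOn
        fun x hx => hx).sub contDiffOn_const)
    have hφ0 : φ 0 = 0 := by
      simp only [φ, add_zero]
      rw [hχ, extChartAt_to_inv, h1, sub_self]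
    obtain ⟨Φ, hΦ, hΦ0, hφΦ⟩ := exists_hadamard hU h0U hφ hφ0
    have hder : ∀ x : GroupLieAlgebra J K, Φ 0 x = mfderiv J J' p 1 x := by
      intro x
      rw [hΦ0]
      have hpd : MDifferentiableAt J J' p 1 := hp.mdifferentiable (by simp) 1
      have hw : writtenInExtChartAt J J' 1 p = fun x => χ' (p (χ.symm x)) := by
        ext y
        simp only [writtenInExtChartAt, Function.comp_apply, h1, hχ, hχ']
      have e : mfderiv J J' p 1 = fderiv ℝ (fun x => χ' (p (χ.symm x))) (χ 1) := by
        have e1 : mfderiv J J' p 1 =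
            fderivWithin ℝ (writtenInExtChartAt J J' 1 p) (range J) (χ 1) := hpd.mfderiv
        refine e1.trans ?_
        rw [J.range_eq_univ, fderivWithin_univ, hw]
      have e' : fderiv ℝ φ 0 = fderiv ℝ (fun x => χ' (p (χ.symm x))) (χ 1) := by
        change fderiv ℝ (fun x => χ' (p (χ.symm (χ 1 + x))) - χ' 1) 0 = _
        rw [fderiv_sub_const, fderiv_comp_add_left (f := fun x => χ' (p (χ.symm x))), add_zero]
      rw [e', e]
      rfl
    -- near the fibre over `0`, the map is `(x, t) ↦ (φ(tx) / t, t)` in the charts, continued to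
    -- `t = 0` by the differential; since `φ(x) = Φ(x) x`, this is `(x, t) ↦ (Φ(tx) x, t)`
    let c : E × ℝ → E' × ℝ := fun q => (Φ (q.2 • q.1) q.1, q.2)
    have hc : ContDiff ℝ ∞ c :=
      ((hΦ.comp (contDiff_snd.smul contDiff_fst)).clm_apply contDiff_fst).prodMk contDiff_snd
    have hs : ContMDiffAt 𝓘(ℝ, E × ℝ) 𝓘(ℝ, E' × ℝ) ∞
        (fun y => (homeoLie J' K').symm (c (homeoLie J K y))) (lie v) := by
      have b1 : ContMDiffAt 𝓘(ℝ, E × ℝ) 𝓘(ℝ, E' × ℝ) ∞ (fun y => c (homeoLie J K y)) (lie v) :=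
        hc.contMDiff.contMDiffAt.comp _ (contMDiffAt_homeoLie (lie_mem_source v))
      refine ContMDiffAt.comp (I' := 𝓘(ℝ, E' × ℝ)) _ (g := (homeoLie J' K').symm)
        (f := fun y => c (homeoLie J K y)) (contMDiffAt_homeoLie_symm ?_) b1
      change extChartAt J' (1 : K') 1 + (0 : ℝ) • _ ∈ (extChartAt J' (1 : K')).target
      rw [zero_smul, add_zero]
      exact mem_extChartAt_target (1 : K')
    refine hs.congr_of_eventuallyEq ?_
    have hcont : ContinuousAt (fun y => (homeoLie J K y).2 • (homeoLie J K y).1) (lie v) := by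
      have := (homeoLie J K).continuousAt (x := lie v) (lie_mem_source v)
      exact this.snd.smul this.fst
    have hlim : Filter.Tendsto (fun y => (homeoLie J K y).2 • (homeoLie J K y).1) (𝓝 (lie v))
        (𝓝 0) := by
      have h0 : (homeoLie J K (lie v)).2 • (homeoLie J K (lie v)).1 = 0 := zero_smul ℝ _
      have := hcont.tendsto
      rwa [h0] at this
    filter_upwards [hlim.eventually hφΦ, hlim.eventually (hU.mem_nhds h0U),
      (homeoLie J K).open_source.mem_nhds (lie_mem_source v)] with y hy hyU hys
    rcases y with ⟨a, t, ht⟩ | w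
    · have hcoord : homeoLie J K (unit a t ht) = (t⁻¹ • (χ a - χ 1), t) := rfl
      have ha : a ∈ χ.source := hys a t ht rfl
      rw [hcoord] at hy hyU ⊢
      simp only [smul_smul, mul_inv_cancel₀ ht, one_smul] at hy hyU
      have e1 : χ.symm (χ 1 + (χ a - χ 1)) = a := by
        rw [add_sub_cancel, χ.left_inv ha]
      have hpa : p a ∈ χ'.source := by
        have := hyU.2
        rwa [mem_preimage, mem_preimage, e1] at this
      have e2 : φ (χ a - χ 1) = χ' (p a) - χ' 1 := by simp only [φ, e1]
      have e3 : c (t⁻¹ • (χ a - χ 1), t) = (t⁻¹ • (χ' (p a) - χ' 1), t) := by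
        simp only [c, smul_smul, mul_inv_cancel₀ ht, one_smul, map_smul, ← hy, e2]
      rw [e3]
      exact ((homeoLie J' K').left_inv (x := unit (p a) t ht) (by
        intro b s hs hbs
        cases hbs
        exact hpa)).symm
    · have hcoord : homeoLie J K (lie w) = ((w : E), 0) := rfl
      rw [hcoord]
      have e3 : c ((w : E), 0) = ((show E' from mfderiv J J' p 1 w), 0) := by
        have h0 : (0 : ℝ) • (show E from w) = 0 := zero_smul ℝ _
        change (Φ ((0 : ℝ) • (show E from w)) w, (0 : ℝ)) = _
        rw [h0]
        exact congrArg (fun x : E' => (x, (0 : ℝ))) (hder w)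
      rw [e3]
      exact ((homeoLie J' K').left_inv (x := lie (show E' from mfderiv J J' p 1 w))
        (lie_mem_source _)).symm

end Map

end DefSpace

/-! ### Multiplication and products of deformation spaces -/

namespace DefSpace

section Fuse

variable {EG HG G EH HH H : Type*}
  [NormedAddCommGroup EG] [NormedSpace ℝ EG] [TopologicalSpace HG] {JG : ModelWithCorners ℝ EG HG}
  [TopologicalSpace G] [ChartedSpace HG G] [Group G] [LieGroup JG ∞ G]
  [NormedAddCommGroup EH] [NormedSpace ℝ EH] [TopologicalSpace HH] {JH : ModelWithCorners ℝ EH HH}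
  [TopologicalSpace H] [ChartedSpace HH H] [Group H]

/-- The differential of the multiplication of a Lie group at the identity is the addition. -/
lemma hasMFDerivAt_mul_one : HasMFDerivAt (JG.prod JG) JG (fun p : G × G => p.1 * p.2) (1 : G × G)
    (show EG × EG →L[ℝ] EG from
      ContinuousLinearMap.fst ℝ EG EG + ContinuousLinearMap.snd ℝ EG EG) := by
  have hm : ContMDiff (JG.prod JG) JG ∞ (fun p : G × G => p.1 * p.2) :=
    contMDiff_fst.mul contMDiff_snd
  have hd : MDifferentiableAt (JG.prod JG) JG (fun p : G × G => p.1 * p.2) (1 : G × G) :=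
    hm.mdifferentiable (by simp) 1
  refine hd.hasMFDerivAt.congr_mfderiv (ContinuousLinearMap.ext fun v => ?_)
  have e := mfderiv_prod_eq_add_apply (v := v) hd
  refine e.trans ?_
  have a1 : (fun z : G => z * (1 : G × G).2) = id := by ext z; simp
  have a2 : (fun z : G => (1 : G × G).1 * z) = id := by ext z; simp
  have b1 : mfderiv JG JG (fun z : G => z * (1 : G × G).2) (1 : G × G).1 =
      ContinuousLinearMap.id ℝ EG := by
    rw [a1]; exact mfderiv_id
  have b2 : mfderiv JG JG (fun z : G => (1 : G × G).1 * z) (1 : G × G).2 =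
      ContinuousLinearMap.id ℝ EG := by
    rw [a2]; exact mfderiv_id
  exact congrArg₂ (fun (L L' : EG →L[ℝ] EG) => L v.1 + L' v.2) b1 b2

lemma mfderiv_fuseMul (v : GroupLieAlgebra (JG.prod (JG.prod JH)) (G × G × H)) :
    mfderiv (JG.prod (JG.prod JH)) (JG.prod JH) (fuseMul : G × G × H → G × H) 1 v = lieFuse v := by
  have hf : HasMFDerivAt (JG.prod (JG.prod JH)) JG (Prod.fst : G × G × H → G) 1 _ :=
    hasMFDerivAt_fst 1
  have hs : HasMFDerivAt (JG.prod (JG.prod JH)) (JG.prod JH) (Prod.snd : G × G × H → G × H) 1 _ :=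
    hasMFDerivAt_snd 1
  have hf' : HasMFDerivAt (JG.prod JH) JG (Prod.fst : G × H → G) 1 _ :=
      hasMFDerivAt_fst 1
  have hs' : HasMFDerivAt (JG.prod JH) JH (Prod.snd : G × H → H) 1 _ :=
      hasMFDerivAt_snd 1
  have h1 := HasMFDerivAt.comp (I' := JG.prod JG) (1 : G × G × H)
    (g := fun p : G × G => p.1 * p.2) (f := fun k : G × G × H => (k.1, k.2.1))
    hasMFDerivAt_mul_one (hf.prodMk (hf'.comp (1 : G × G × H) hs))
  have h2 := h1.prodMk (hs'.comp (1 : G × G × H) hs)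
  exact DFunLike.congr_fun h2.mfderiv v

variable [JG.Boundaryless] [JH.Boundaryless] [LieGroup JH ∞ H] [FiniteDimensional ℝ EG]
  [FiniteDimensional ℝ EH]

lemma fuse_eq_map :
    (fuse : DefSpace (JG.prod (JG.prod JH)) (G × G × H) → DefSpace (JG.prod JH) (G × H)) =
    map (JG.prod (JG.prod JH)) (JG.prod JH) fuseMul := by
  ext p
  rcases p with ⟨k, t, ht⟩ | v
  · rfl
  · exact congrArg lie (mfderiv_fuseMul v).symm

/-- The map of deformation spaces that is multiplication over `t ≠ 0` and addition over `0` is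
smooth: it is induced by the multiplication, whose differential at the identity is the addition. -/
theorem contMDiff_fuse :
    ContMDiff 𝓘(ℝ, (EG × EG × EH) × ℝ) 𝓘(ℝ, (EG × EH) × ℝ) ∞
    (fuse : DefSpace (JG.prod (JG.prod JH)) (G × G × H) → DefSpace (JG.prod JH) (G × H)) := by
  rw [fuse_eq_map]
  exact contMDiff_map contMDiff_fuseMul (by simp [fuseMul])

omit [LieGroup JG ∞ G] [JG.Boundaryless] [JH.Boundaryless] [LieGroup JH ∞ H]
  [FiniteDimensional ℝ EG] [FiniteDimensional ℝ EH] in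
lemma proj_fuse (p : DefSpace (JG.prod (JG.prod JH)) (G × G × H)) : p.fuse.proj = p.proj := by
  rcases p with ⟨k, t, ht⟩ | v <;> rfl

omit [JG.Boundaryless] [JH.Boundaryless] [FiniteDimensional ℝ EG] [FiniteDimensional ℝ EH] in
lemma fuse_adjoint (k : G × H) (p : DefSpace (JG.prod (JG.prod JH)) (G × G × H)) :
    (p.adjoint (k.1, k.1, k.2)).fuse = p.fuse.adjoint k := by
  rcases p with ⟨a, t, ht⟩ | v
  · have e : (k.1 * a.1 * k.1⁻¹) * (k.1 * a.2.1 * k.1⁻¹) = k.1 * (a.1 * a.2.1) * k.1⁻¹ := by group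
    exact congrArg (fun x => (unit (x, k.2 * a.2.2 * k.2⁻¹) t ht : DefSpace (JG.prod JH) (G × H))) e
  · exact congrArg lie (lieFuse_Ad k v)

end Fuse

section Pair

variable {E₁ H₁ K₁ E₂ H₂ K₂ : Type*}
  [NormedAddCommGroup E₁] [NormedSpace ℝ E₁] [TopologicalSpace H₁] {J₁ : ModelWithCorners ℝ E₁ H₁}
  [TopologicalSpace K₁] [ChartedSpace H₁ K₁] [Group K₁]
  [NormedAddCommGroup E₂] [NormedSpace ℝ E₂] [TopologicalSpace H₂] {J₂ : ModelWithCorners ℝ E₂ H₂}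
  [TopologicalSpace K₂] [ChartedSpace H₂ K₂] [Group K₂]
  {F H' Z : Type*} [NormedAddCommGroup F] [NormedSpace ℝ F] [TopologicalSpace H']
  {I : ModelWithCorners ℝ F H'} [TopologicalSpace Z] [ChartedSpace H' Z]

/-- The identification of the fibre product of `𝒟(K₁, 1)` and `𝒟(K₂, 1)` over `ℝ` with
`𝒟(K₁ × K₂, 1)`. It is only meant for pairs of points with the same projection to `ℝ`. -/
def pair : DefSpace J₁ K₁ → DefSpace J₂ K₂ → DefSpace (J₁.prod J₂) (K₁ × K₂)
  | unit a t ht, q => unit (a, q.groupPart) t ht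
  | lie v, unit _ _ _ => lie (lieMk v 0)
  | lie v, lie w => lie (lieMk v w)

lemma proj_pair (p : DefSpace J₁ K₁) (q : DefSpace J₂ K₂) : (pair p q).proj = p.proj := by
  rcases p with ⟨a, t, ht⟩ | v <;> rcases q with ⟨b, s, hs⟩ | w <;> rfl

lemma pair_adjoint [LieGroup J₁ ∞ K₁] [LieGroup J₂ ∞ K₂] (k : K₁ × K₂) (p : DefSpace J₁ K₁)
    (q : DefSpace J₂ K₂) :
    pair (p.adjoint k.1) (q.adjoint k.2) = (pair p q).adjoint k := by
  rcases p with ⟨a, t, ht⟩ | v <;> rcases q with ⟨b, s, hs⟩ | w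
  · rfl
  · exact congrArg (fun x => (unit (k.1 * a * k.1⁻¹, x) t ht :
      DefSpace (J₁.prod J₂) (K₁ × K₂))) (show (1 : K₂) = k.2 * 1 * k.2⁻¹ by simp)
  · refine congrArg lie ?_
    rw [Ad_prod]
    exact congrArg (lieMk _) (map_zero (Ad J₂ k.2)).symm
  · exact congrArg lie (Ad_prod k (lieMk v w)).symm

variable [J₁.Boundaryless] [J₂.Boundaryless] [IsManifold J₁ ∞ K₁] [IsManifold J₂ ∞ K₂]

/-- A pair of smooth maps to deformation spaces over the same parameter is smooth as a map to the
deformation space of the product: near the fibre over `0`, the charts are compatible. -/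
theorem contMDiff_pair {f₁ : Z → DefSpace J₁ K₁} {f₂ : Z → DefSpace J₂ K₂}
    (h₁ : ContMDiff I 𝓘(ℝ, E₁ × ℝ) ∞ f₁) (h₂ : ContMDiff I 𝓘(ℝ, E₂ × ℝ) ∞ f₂)
    (h : ∀ z, (f₁ z).proj = (f₂ z).proj) :
    ContMDiff I 𝓘(ℝ, (E₁ × E₂) × ℝ) ∞ (fun z => pair (f₁ z) (f₂ z)) := by
  intro z
  have hτ : ContMDiff I 𝓘(ℝ, ℝ) ∞ (fun z => (f₁ z).proj) := (contMDiff_proj J₁ K₁).comp h₁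
  rcases hz₁ : f₁ z with ⟨a, t, ht⟩ | v <;> rcases hz₂ : f₂ z with ⟨b, s, hs⟩ | w
  · have g₁ : ContMDiffAt I J₁ ∞ (fun z => (f₁ z).groupPart) z :=
      ContMDiffAt.comp z (by rw [hz₁]; exact contMDiffAt_groupPart a t ht) (h₁ z)
    have g₂ : ContMDiffAt I J₂ ∞ (fun z => (f₂ z).groupPart) z :=
      ContMDiffAt.comp z (by rw [hz₂]; exact contMDiffAt_groupPart b s hs) (h₂ z)
    have h0 : (f₁ z).proj ≠ 0 := by rw [hz₁]; exact ht
    refine (contMDiffAt_mk (J := J₁.prod J₂) (g₁.prodMk g₂) (hτ z) h0).congr_of_eventuallyEq ?_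
    filter_upwards [(hτ z).continuousAt.eventually_ne h0] with y hy
    rcases hy₁ : f₁ y with ⟨a', t', ht'⟩ | v'
    · exact (mk_of_ne (J := J₁.prod J₂) (a', (f₂ y).groupPart) ht').symm
    · rw [hy₁] at hy
      exact absurd rfl hy
  · have := h z
    rw [hz₁, hz₂] at this
    exact absurd this ht
  · have := h z
    rw [hz₁, hz₂] at this
    exact absurd this.symm hs
  · have s₁ : f₁ z ∈ (homeoLie J₁ K₁).source := by rw [hz₁]; exact lie_mem_source v
    have s₂ : f₂ z ∈ (homeoLie J₂ K₂).source := by rw [hz₂]; exact lie_mem_source w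
    have c₁ : ContMDiffAt I 𝓘(ℝ, E₁ × ℝ) ∞ (fun z => homeoLie J₁ K₁ (f₁ z)) z :=
      (contMDiffAt_homeoLie s₁).comp z (h₁ z)
    have c₂ : ContMDiffAt I 𝓘(ℝ, E₂ × ℝ) ∞ (fun z => homeoLie J₂ K₂ (f₂ z)) z :=
      (contMDiffAt_homeoLie s₂).comp z (h₂ z)
    have c : ContMDiffAt I 𝓘(ℝ, (E₁ × E₂) × ℝ) ∞
        (fun z => (((homeoLie J₁ K₁ (f₁ z)).1, (homeoLie J₂ K₂ (f₂ z)).1), (f₁ z).proj)) z :=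
      ((contDiff_fst.contMDiff.contMDiffAt.comp z c₁).prodMk_space
        (contDiff_fst.contMDiff.contMDiffAt.comp z c₂)).prodMk_space (hτ z)
    have hs : ContMDiffAt I 𝓘(ℝ, (E₁ × E₂) × ℝ) ∞ (fun z => (homeoLie (J₁.prod J₂) (K₁ × K₂)).symm
        (((homeoLie J₁ K₁ (f₁ z)).1, (homeoLie J₂ K₂ (f₂ z)).1), (f₁ z).proj)) z := by
      refine ContMDiffAt.comp (I' := 𝓘(ℝ, (E₁ × E₂) × ℝ)) z
        (g := (homeoLie (J₁.prod J₂) (K₁ × K₂)).symm)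
        (f := fun z => (((homeoLie J₁ K₁ (f₁ z)).1, (homeoLie J₂ K₂ (f₂ z)).1), (f₁ z).proj))
        (contMDiffAt_homeoLie_symm ?_) c
      rw [hz₁]
      change extChartAt (J₁.prod J₂) (1 : K₁ × K₂) 1 + (0 : ℝ) • (_ : E₁ × E₂) ∈
        (extChartAt (J₁.prod J₂) (1 : K₁ × K₂)).target
      rw [zero_smul, add_zero]
      exact mem_extChartAt_target (1 : K₁ × K₂)
    refine hs.congr_of_eventuallyEq ?_
    filter_upwards [(h₁ z).continuousAt.preimage_mem_nhds
      ((homeoLie J₁ K₁).open_source.mem_nhds s₁), (h₂ z).continuousAt.preimage_mem_nhds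
      ((homeoLie J₂ K₂).open_source.mem_nhds s₂)] with y hy₁ hy₂
    have hy := h y
    simp only [mem_preimage] at hy₁ hy₂
    revert hy hy₁ hy₂
    rcases f₁ y with ⟨a, t, ht⟩ | v' <;> rcases f₂ y with ⟨b, s, hs⟩ | w' <;> intro hy hy₁ hy₂
    · obtain rfl : t = s := hy
      have m₁ : a ∈ (extChartAt J₁ (1 : K₁)).source := hy₁ a t ht rfl
      have m₂ : b ∈ (extChartAt J₂ (1 : K₂)).source := hy₂ b t hs rfl
      refine ((homeoLie (J₁.prod J₂) (K₁ × K₂)).left_inv (x := unit (a, b) t ht) ?_).symm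
      intro c r hr hc
      cases hc
      rw [extChartAt_prod]
      exact ⟨m₁, m₂⟩
    · exact absurd hy ht
    · exact absurd hy.symm hs
    · exact ((homeoLie (J₁.prod J₂) (K₁ × K₂)).left_inv (x := lie (lieMk v' w'))
        (lie_mem_source _)).symm

end Pair

section Regroup

variable {EG HG G E₁ HH₁ H₁ E₂ HH₂ H₂ : Type*}
  [NormedAddCommGroup EG] [NormedSpace ℝ EG] [TopologicalSpace HG] {JG : ModelWithCorners ℝ EG HG}
  [TopologicalSpace G] [ChartedSpace HG G] [Group G]
  [NormedAddCommGroup E₁] [NormedSpace ℝ E₁] [TopologicalSpace HH₁]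
  {J₁ : ModelWithCorners ℝ E₁ HH₁} [TopologicalSpace H₁] [ChartedSpace HH₁ H₁] [Group H₁]
  [NormedAddCommGroup E₂] [NormedSpace ℝ E₂] [TopologicalSpace HH₂]
  {J₂ : ModelWithCorners ℝ E₂ HH₂} [TopologicalSpace H₂] [ChartedSpace HH₂ H₂] [Group H₂]

/-- The reordering `((a, h₁), (b, h₂)) ↦ (a, b, h₁, h₂)` of the factors. -/
def regroup (k : (G × H₁) × (G × H₂)) : G × G × H₁ × H₂ :=
  (k.1.1, k.2.1, k.1.2, k.2.2)

lemma contMDiff_regroup : ContMDiff ((JG.prod J₁).prod (JG.prod J₂))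
    (JG.prod (JG.prod (J₁.prod J₂))) ∞ (regroup : (G × H₁) × (G × H₂) → G × G × H₁ × H₂) :=
  (contMDiff_fst.comp contMDiff_fst).prodMk ((contMDiff_fst.comp contMDiff_snd).prodMk
    ((contMDiff_snd.comp contMDiff_fst).prodMk (contMDiff_snd.comp contMDiff_snd)))

/-- The reordering of the summands of `(𝔤 ⊕ 𝔥₁) ⊕ (𝔤 ⊕ 𝔥₂)`. -/
def lieRegroup (v : GroupLieAlgebra (JG.prod J₁) (G × H₁))
    (w : GroupLieAlgebra (JG.prod J₂) (G × H₂)) :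
    GroupLieAlgebra (JG.prod (JG.prod (J₁.prod J₂))) (G × G × H₁ × H₂) :=
  lieMk (lieFst v) (lieMk (lieFst w) (lieMk (lieSnd v) (lieSnd w)))

lemma mfderiv_regroup (v : GroupLieAlgebra (JG.prod J₁) (G × H₁))
    (w : GroupLieAlgebra (JG.prod J₂) (G × H₂)) :
    mfderiv ((JG.prod J₁).prod (JG.prod J₂)) (JG.prod (JG.prod (J₁.prod J₂)))
      (regroup : (G × H₁) × (G × H₂) → G × G × H₁ × H₂) 1 (lieMk v w) = lieRegroup v w := by
  have hf : HasMFDerivAt ((JG.prod J₁).prod (JG.prod J₂)) (JG.prod J₁)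
    (Prod.fst : (G × H₁) × (G × H₂) → G × H₁) 1 _ :=
      hasMFDerivAt_fst 1
  have hs : HasMFDerivAt ((JG.prod J₁).prod (JG.prod J₂)) (JG.prod J₂)
    (Prod.snd : (G × H₁) × (G × H₂) → G × H₂) 1 _ :=
      hasMFDerivAt_snd 1
  have f₁ : HasMFDerivAt (JG.prod J₁) JG (Prod.fst : G × H₁ → G) 1 _ :=
      hasMFDerivAt_fst 1
  have s₁ : HasMFDerivAt (JG.prod J₁) J₁ (Prod.snd : G × H₁ → H₁) 1 _ :=
      hasMFDerivAt_snd 1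
  have f₂ : HasMFDerivAt (JG.prod J₂) JG (Prod.fst : G × H₂ → G) 1 _ :=
      hasMFDerivAt_fst 1
  have s₂ : HasMFDerivAt (JG.prod J₂) J₂ (Prod.snd : G × H₂ → H₂) 1 _ :=
      hasMFDerivAt_snd 1
  have h := (f₁.comp (1 : (G × H₁) × (G × H₂)) hf).prodMk
    ((f₂.comp (1 : (G × H₁) × (G × H₂)) hs).prodMk
      ((s₁.comp (1 : (G × H₁) × (G × H₂)) hf).prodMk (s₂.comp (1 : (G × H₁) × (G × H₂)) hs)))
  exact DFunLike.congr_fun h.mfderiv (lieMk v w)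

/-- The pair of two points, meant to have the same projection to `ℝ`, as a point of the deformation
space of the product with its factors reordered. -/
def combine (p : DefSpace (JG.prod J₁) (G × H₁)) (q : DefSpace (JG.prod J₂) (G × H₂)) :
    DefSpace (JG.prod (JG.prod (J₁.prod J₂))) (G × G × H₁ × H₂) :=
  map ((JG.prod J₁).prod (JG.prod J₂)) (JG.prod (JG.prod (J₁.prod J₂))) regroup (pair p q)

lemma combine_unit (a : G × H₁) (b : G × H₂) (t : ℝ) (ht : t ≠ 0) :
    combine (unit a t ht : DefSpace (JG.prod J₁) (G × H₁))
      (unit b t ht : DefSpace (JG.prod J₂) (G × H₂)) = unit (a.1, b.1, a.2, b.2) t ht := rfl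

lemma combine_lie (v : GroupLieAlgebra (JG.prod J₁) (G × H₁))
    (w : GroupLieAlgebra (JG.prod J₂) (G × H₂)) :
    combine (lie v) (lie w) = lie (lieRegroup v w) :=
  congrArg lie (mfderiv_regroup v w)

end Regroup

end DefSpace

/-! ### Internal fusion of deformations -/

section Invariant

variable {E H : Type*} [NormedAddCommGroup E] [NormedSpace ℝ E] [TopologicalSpace H]
  {J : ModelWithCorners ℝ E H} {K : Type*} [TopologicalSpace K] [ChartedSpace H K] [Group K]
  {F H' M : Type*} [NormedAddCommGroup F] [NormedSpace ℝ F] [TopologicalSpace H']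
  {I : ModelWithCorners ℝ F H'} [TopologicalSpace M] [ChartedSpace H' M]

/-- Fundamental vector fields annihilate invariant functions. -/
lemma SmoothAction.orbit_differential_of_invariant (A : SmoothAction J K I M) {f : M → ℝ}
    (hf : ContMDiff I 𝓘(ℝ, ℝ) ∞ f) (h : ∀ k m, f (A.act k m) = f m) (m : M) :
    A.orbit m (differential I f m) = 0 := by
  ext x
  refine (A.differential_fundamental (hf.mdifferentiable (by simp) m) x).trans ?_
  have e : (fun k => f (A.act k m)) = fun _ => f m := funext fun k => h k m
  rw [e, differential_const]
  exact neg_zero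

lemma IsSmoothField.smul {k : ℕ} {P : ∀ m : M, MultiVector I k m} (hP : IsSmoothField P)
    {f : M → ℝ} (hf : ContMDiff I 𝓘(ℝ, ℝ) ∞ f) : IsSmoothField fun m => f m • P m :=
  fun g hg => hf.mul (hP g hg)

lemma IsSmoothField.sub {k : ℕ} {P P' : ∀ m : M, MultiVector I k m} (hP : IsSmoothField P)
    (hP' : IsSmoothField P') : IsSmoothField fun m => P m - P' m :=
  fun g hg => (hP g hg).sub (hP' g hg)

variable [FiniteDimensional ℝ E] [LieGroup J ∞ K] [J.Boundaryless]

lemma InvariantForm.cartan_zero_left (B : InvariantForm J K)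
    (b c : GroupLieAlgebra J K →ₗ[ℝ] ℝ) : B.cartan 0 b c = 0 := by
  have h := B.cartan_add_left 0 0 b c
  rw [add_zero] at h
  linarith

lemma isSmoothField_cartanField [IsManifold I ∞ M] (B : InvariantForm J K)
    (A : SmoothAction J K I M) : IsSmoothField (cartanField B A) := by
  refine isSmoothField_three fun f g h hf hg hh => ?_
  have e : ∀ m, cartanField B A m
      ![differential I f m, differential I g m, differential I h m] =
      1 / 2 * ∑ i, ∑ j, ∑ k, B.form (lieBasis J K i) ⁅lieBasis J K j, lieBasis J K k⁆ *
        (A.lieDeriv (B.dualBasis i) f m * A.lieDeriv (B.dualBasis j) g m *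
          A.lieDeriv (B.dualBasis k) h m) := fun m => by
    rw [cartanField_apply, ← B.sum_form_lie]
    rfl
  refine ContMDiff.congr (contMDiff_const.mul (contMDiff_finsetSum fun i _ =>
    contMDiff_finsetSum fun j _ => contMDiff_finsetSum fun k _ => contMDiff_const.mul
      (((A.smooth_lieDeriv hf _).mul (A.smooth_lieDeriv hg _)).mul (A.smooth_lieDeriv hh _)))) e

end Invariant

section Deformation

variable {E H K : Type*} [NormedAddCommGroup E] [NormedSpace ℝ E] [TopologicalSpace H]
  {J : ModelWithCorners ℝ E H} [TopologicalSpace K] [ChartedSpace H K] [Group K]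
  {n : ℕ} {Q : Type*} [TopologicalSpace Q]
  {F₁ H₁ M : Type*} [NormedAddCommGroup F₁] [NormedSpace ℝ F₁] [TopologicalSpace H₁]
  {I₁ : ModelWithCorners ℝ F₁ H₁} [TopologicalSpace M] [ChartedSpace H₁ M]
  {F₂ H₂ N : Type*} [NormedAddCommGroup F₂] [NormedSpace ℝ F₂] [TopologicalSpace H₂]
  {I₂ : ModelWithCorners ℝ F₂ H₂} [TopologicalSpace N] [ChartedSpace H₂ N]
  [FiniteDimensional ℝ E] [J.Boundaryless] [LieGroup J ∞ K]
  [ChartedSpace (HalfSpace n) Q] {B : InvariantForm J K} {D : PoissonFamily J K n Q}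
  {X : QPSpace J K I₁ M} {Y : PSpace J K I₂ N}

lemma contMDiff_coe_proj {π : Q → Icc (0 : ℝ) 1}
    (h : ContMDiff (halfModel n) (𝓡∂ 1) ∞ π) :
    ContMDiff (halfModel n) 𝓘(ℝ, ℝ) ∞ (fun q => (π q : ℝ)) :=
  contMDiff_subtypeVal_Icc.comp h

lemma IsPoissonDeformation.contMDiff_proj [IsManifold (halfModel n) ∞ Q]
    (h : IsPoissonDeformation B D X Y) :
    ContMDiff (halfModel n) (𝓡∂ 1) ∞ D.proj :=
  h.submersion.contMDiff

lemma IsPoissonDeformation.contMDiff_coe_proj [IsManifold (halfModel n) ∞ Q]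
    (h : IsPoissonDeformation B D X Y) :
    ContMDiff (halfModel n) 𝓘(ℝ, ℝ) ∞ (fun q => (D.proj q : ℝ)) :=
  QuasiPoisson.contMDiff_coe_proj h.contMDiff_proj

/-- The fundamental vector fields of a deformation are tangent to the fibres. -/
lemma IsPoissonDeformation.orbit_differential_proj [IsManifold (halfModel n) ∞ Q]
    (h : IsPoissonDeformation B D X Y) (q : Q) :
    D.action.orbit q (differential (halfModel n) (fun p => (D.proj p : ℝ)) q) = 0 :=
  D.action.orbit_differential_of_invariant h.contMDiff_coe_proj
    (fun k q => congrArg Subtype.val (h.proj_invariant k q)) q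

end Deformation

section FuseDeformation

variable {EG HG G EH HH H : Type*}
  [NormedAddCommGroup EG] [NormedSpace ℝ EG] [TopologicalSpace HG] {JG : ModelWithCorners ℝ EG HG}
  [TopologicalSpace G] [ChartedSpace HG G] [Group G]
  [NormedAddCommGroup EH] [NormedSpace ℝ EH] [TopologicalSpace HH] {JH : ModelWithCorners ℝ EH HH}
  [TopologicalSpace H] [ChartedSpace HH H] [Group H]
  {n : ℕ} {Q : Type*} [TopologicalSpace Q]
  {F₁ H₁ M : Type*} [NormedAddCommGroup F₁] [NormedSpace ℝ F₁] [TopologicalSpace H₁]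
  {I₁ : ModelWithCorners ℝ F₁ H₁} [TopologicalSpace M] [ChartedSpace H₁ M]
  {F₂ H₂ N : Type*} [NormedAddCommGroup F₂] [NormedSpace ℝ F₂] [TopologicalSpace H₂]
  {I₂ : ModelWithCorners ℝ F₂ H₂} [TopologicalSpace N] [ChartedSpace H₂ N]
  [FiniteDimensional ℝ EG] [FiniteDimensional ℝ EH] [JG.Boundaryless] [JH.Boundaryless]
  [LieGroup JG ∞ G] [LieGroup JH ∞ H] [ChartedSpace (HalfSpace n) Q]

/-- Internal fusion of a Poisson deformation. -/
theorem IsPoissonDeformation.fuse [IsManifold (halfModel n) ∞ Q] [FiniteDimensional ℝ F₁]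
    [IsManifold I₁ ∞ M] [BoundarylessManifold I₁ M] [IsManifold I₂ ∞ N]
    {BG : InvariantForm JG G} {BH : InvariantForm JH H}
    {D : PoissonFamily (JG.prod (JG.prod JH)) (G × G × H) n Q}
    {X : QPSpace (JG.prod (JG.prod JH)) (G × G × H) I₁ M}
    {Y : PSpace (JG.prod (JG.prod JH)) (G × G × H) I₂ N}
    (h : IsPoissonDeformation (BG.prod (BG.prod BH)) D X Y) :
    IsPoissonDeformation (BG.prod BH) (D.fuse BG BH) (X.fuse BG) Y.fuse where
  source_hamiltonian := h.source_hamiltonian.fuse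
  target_hamiltonian := h.target_hamiltonian.fuse
  submersion := h.submersion
  interior := h.interior
  proj_invariant k q := h.proj_invariant (k.1, k.1, k.2) q
  smooth_moment := DefSpace.contMDiff_fuse.comp h.smooth_moment
  moment_equivariant k q :=
    (congrArg DefSpace.fuse (h.moment_equivariant (k.1, k.1, k.2) q)).trans
      (DefSpace.fuse_adjoint k (D.moment q))
  proj_moment q := (DefSpace.proj_fuse _).trans (h.proj_moment q)
  smooth_bivector := h.smooth_bivector.sub
    ((isSmoothField_psiField BG D.action).smul h.contMDiff_coe_proj)
  -- `ψ_Q` is built from fundamental vector fields, which are tangent to the fibres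
  bivector_vertical q α := by
    have e1 := h.bivector_vertical q α
    have e2 : psiField BG D.action q
        ![differential (halfModel n) (fun p => (D.proj p : ℝ)) q, α] = 0 := by
      rw [psiField_apply, h.orbit_differential_proj, LinearMap.zero_comp, BG.form_sharp,
        BG.form_sharp_right]
      simp
    refine (congrArg₂ (fun x y => x - (D.proj q : ℝ) * y) e1 e2).trans ?_
    rw [mul_zero, sub_zero]
  smooth_trivector := (isSmoothField_cartanField (BG.prod BH) D.action.fuse).smul
    (h.contMDiff_coe_proj.pow 2)
  trivector_vertical q α β := by
    have e : D.action.fuse.orbit q (differential (halfModel n) (fun p => (D.proj p : ℝ)) q) = 0 :=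
      D.action.fuse.orbit_differential_of_invariant h.contMDiff_coe_proj
        (fun k q => congrArg Subtype.val (h.proj_invariant (k.1, k.1, k.2) q)) q
    have e2 : cartanField (BG.prod BH) D.action.fuse q
        ![differential (halfModel n) (fun p => (D.proj p : ℝ)) q, α, β] = 0 := by
      rw [cartanField_apply, e, InvariantForm.cartan_zero_left, mul_zero]
    exact (congrArg (fun y => (D.proj q : ℝ) ^ 2 * y) e2).trans (mul_zero _)
  fibre t ht ht1 := by
    obtain ⟨Φ, hΦ, heq, hP, -, hμ⟩ := h.fibre t ht ht1
    have hπ : ∀ m, (D.proj (Φ m) : ℝ) = t := fun m => by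
      have : Φ m ∈ {q | (D.proj q : ℝ) = t} := hΦ.range_eq ▸ mem_range_self m
      exact this
    refine ⟨Φ, hΦ, fun k m => heq _ m, fun m => ?_, fun m => ?_, fun m => ?_⟩
    -- over `t`, the field `P̃ - t ψ_Q` corresponds to `t P - t ψ_M`
    · change D.bivector (Φ m) - (D.proj (Φ m) : ℝ) • psiField BG D.action (Φ m) = _
      rw [hP, hπ, psiField_of_equivariant BG X.action D.action hΦ.smooth heq]
      exact (smul_sub t (pushforward (mfderiv I₁ (halfModel n) Φ m) (X.bivector m)) _).symm
    · change (D.proj (Φ m) : ℝ) ^ 2 • cartanField (BG.prod BH) D.action.fuse (Φ m) = _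
      rw [hπ, cartanField_of_equivariant X.action.fuse D.action.fuse (BG.prod BH) hΦ.smooth
        fun k m => heq _ m]
      rfl
    · exact congrArg DefSpace.fuse (hμ m)
  fibre_zero := by
    obtain ⟨Φ, hΦ, heq, hP, hμ⟩ := h.fibre_zero
    have hπ : ∀ m, (D.proj (Φ m) : ℝ) = 0 := fun m => by
      have : Φ m ∈ {q | (D.proj q : ℝ) = 0} := hΦ.range_eq ▸ mem_range_self m
      exact this
    refine ⟨Φ, hΦ, fun k m => heq _ m, fun m => ?_, fun m => ?_⟩
    · change D.bivector (Φ m) - (D.proj (Φ m) : ℝ) • psiField BG D.action (Φ m) = _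
      rw [hP, hπ, zero_smul, sub_zero]
      rfl
    · exact congrArg DefSpace.fuse (hμ m)
  trivector_zero q hq := by
    change (D.proj q : ℝ) = 0 at hq
    change (D.proj q : ℝ) ^ 2 • cartanField (BG.prod BH) D.action.fuse q = 0
    rw [hq, zero_pow two_ne_zero, zero_smul]

end FuseDeformation

/-! ### Multivector fields in local coordinates -/

section Family

variable {E H M : Type*} [NormedAddCommGroup E] [NormedSpace ℝ E] [TopologicalSpace H]
  {I : ModelWithCorners ℝ E H} [TopologicalSpace M] [ChartedSpace H M] [IsManifold I ∞ M]
  {E' H' N : Type*} [NormedAddCommGroup E'] [NormedSpace ℝ E'] [TopologicalSpace H']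
  {J : ModelWithCorners ℝ E' H'} [TopologicalSpace N] [ChartedSpace H' N] [IsManifold J ∞ N]

variable (I) in
/-- The coordinate vector field with constant value `v` in the preferred chart at `m₀`. -/
def coordVector (m₀ m : M) (v : E) : TangentSpace I m :=
  (tangentBundleCore I M).coordChange (achart H m₀) (achart H m) m v

/-- The derivatives of a smooth family of functions along the coordinate vector fields of a chart
depend smoothly on all parameters. -/
lemma contMDiffAt_differential_coordChange {F : N → M → ℝ} {g : N → M} {y₀ : N}
    (hF : ContMDiffAt (J.prod I) 𝓘(ℝ, ℝ) ∞ (fun p : N × M => F p.1 p.2) (y₀, g y₀))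
    (hg : ContMDiffAt J I ∞ g y₀) (v : E) :
    ContMDiffAt J 𝓘(ℝ, ℝ) ∞ (fun y => differential I (F y) (g y)
      (coordVector I (g y₀) (g y) v)) y₀ := by
  have : IsManifold I 1 M := IsManifold.of_le (n := ∞) ENat.LEInfty.out
  have : IsManifold J 1 N := IsManifold.of_le (n := ∞) ENat.LEInfty.out
  have h := ContMDiffAt.mfderiv (n := ∞) (m := ∞) F g (x₀ := y₀) (I := I) (I' := 𝓘(ℝ, ℝ))
    hF hg (by simp)
  have h2 := h.clm_apply (contMDiffAt_const (c := v))
  refine h2.congr_of_eventuallyEq ?_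
  filter_upwards [hg.continuousAt.preimage_mem_nhds (chart_source_mem_nhds H (g y₀))] with y hy
  have e := inTangentCoordinates_eq (I := I) (I' := 𝓘(ℝ, ℝ)) g
    (fun x => F x (g x)) (fun x => mfderiv I 𝓘(ℝ, ℝ) (F x) (g x)) (x₀ := y₀) (x := y)
    hy (by rw [chartAt_self_eq]; exact mem_univ _)
  rw [tangentBundleCore_coordChange_model_space] at e
  exact (DFunLike.congr_fun e v).symm

variable [FiniteDimensional ℝ E] [T2Space M]

/-- Near a point, covectors are combinations of the differentials of finitely many smooth
functions, with the coordinate vector fields giving the coefficients. -/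
lemma exists_coordinates (m₀ : M) : ∃ (d : ℕ) (x : Fin d → M → ℝ) (b : Fin d → E),
    (∀ i, ContMDiff I 𝓘(ℝ, ℝ) ∞ (x i)) ∧ ∀ᶠ m in 𝓝 m₀, ∀ α : Covector I m,
      α = ∑ i, α (coordVector I m₀ m (b i)) • differential I (x i) m := by
  have : IsManifold I 1 M := IsManifold.of_le (n := ∞) ENat.LEInfty.out
  let b := Module.finBasis ℝ E
  let δ : ∀ _ : Fin (Module.finrank ℝ E), E →L[ℝ] ℝ :=
    fun i => LinearMap.toContinuousLinearMap (b.coord i)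
  have hex : ∀ i, ∃ f : M → ℝ, ContMDiff I 𝓘(ℝ, ℝ) ∞ f ∧
      f =ᶠ[𝓝 m₀] fun p => δ i (extChartAt I m₀ p) := fun i =>
    exists_contMDiff_eventuallyEq (chartAt H m₀).open_source (mem_chart_source H m₀)
      ((δ i).contMDiff.comp_contMDiffOn contMDiffOn_extChartAt)
  choose x hx hxe using hex
  refine ⟨Module.finrank ℝ E, x, b, hx, ?_⟩
  filter_upwards [chart_source_mem_nhds H m₀,
    Filter.eventually_all.2 fun i => (hxe i).eventuallyEq_nhds] with m hm he α
  have hd : ∀ i, differential I (x i) m =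
      (δ i).comp (show E →L[ℝ] E from tangentCoordChange I m m₀ m) := by
    intro i
    have hδ : ContMDiff 𝓘(ℝ, E) 𝓘(ℝ, ℝ) ∞ (δ i) := (δ i).contMDiff
    rw [differential_congr (he i), differential_comp (f := δ i) (g := extChartAt I m₀)
      (hδ.mdifferentiable (by simp) _) (mdifferentiableAt_extChartAt hm)]
    have h1 : differential 𝓘(ℝ, E) (δ i) (extChartAt I m₀ m) = δ i :=
      Eq.trans (mfderiv_eq_fderiv (f := δ i) (x := extChartAt I m₀ m)) (δ i).fderiv
    have h2 : mfderiv I 𝓘(ℝ, E) (extChartAt I m₀) m = tangentCoordChange I m m₀ m :=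
      (mdifferentiableAt_extChartAt hm).mfderiv
    rw [h1, h2]
    rfl
  have hm' : m ∈ (extChartAt I m₀).source := by rwa [extChartAt_source]
  have key : ∀ v : E, tangentCoordChange I m₀ m m (tangentCoordChange I m m₀ m v) = v := by
    intro v
    rw [tangentCoordChange_comp ⟨⟨mem_extChartAt_source m, hm'⟩, mem_extChartAt_source m⟩]
    exact tangentCoordChange_self (mem_extChartAt_source m)
  let a : E →L[ℝ] ℝ := α
  let T : E →L[ℝ] E := tangentCoordChange I m₀ m m
  let S : E →L[ℝ] E := tangentCoordChange I m m₀ m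
  have hfin : a = ∑ i, a (T (b i)) • (δ i).comp S := by
    ext v
    have e1 : a v = a (T (S v)) := congrArg a (key v).symm
    rw [e1]
    conv_lhs => rw [← b.sum_repr (S v)]
    simp only [map_sum, map_smul, smul_eq_mul, sum_apply, smul_apply,
      ContinuousLinearMap.comp_apply]
    refine Finset.sum_congr rfl fun i _ => ?_
    rw [mul_comm]
    rfl
  have hs : (∑ i, a (T (b i)) • (δ i).comp S) = ∑ i, a (T (b i)) • (differential I (x i) m) :=
    Finset.sum_congr rfl fun i _ => by rw [hd i]; rfl
  exact hfin.trans hs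

/-- A smooth bivector field, evaluated on smooth families of functions. -/
theorem IsSmoothField.contMDiffAt_family {P : ∀ m : M, MultiVector I 2 m} (hP : IsSmoothField P)
    {F G : N → M → ℝ} {g : N → M} {y₀ : N}
    (hF : ContMDiffAt (J.prod I) 𝓘(ℝ, ℝ) ∞ (fun p : N × M => F p.1 p.2) (y₀, g y₀))
    (hG : ContMDiffAt (J.prod I) 𝓘(ℝ, ℝ) ∞ (fun p : N × M => G p.1 p.2) (y₀, g y₀))
    (hg : ContMDiffAt J I ∞ g y₀) :
    ContMDiffAt J 𝓘(ℝ, ℝ) ∞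
      (fun y => P (g y) ![differential I (F y) (g y), differential I (G y) (g y)]) y₀ := by
  obtain ⟨d, x, b, hx, hxm⟩ := exists_coordinates (I := I) (g y₀)
  have hs : ContMDiffAt J 𝓘(ℝ, ℝ) ∞ (fun y => ∑ i, ∑ j,
      differential I (F y) (g y) (coordVector I (g y₀) (g y) (b i)) *
      (differential I (G y) (g y) (coordVector I (g y₀) (g y) (b j)) *
      bracket P (x i) (x j) (g y))) y₀ :=
    ContMDiffAt.sum fun i _ => ContMDiffAt.sum fun j _ =>
      (contMDiffAt_differential_coordChange hF hg (b i)).mul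
        ((contMDiffAt_differential_coordChange hG hg (b j)).mul
          ((hP.contMDiff_two (hx i) (hx j)).contMDiffAt.comp y₀ hg))
  refine hs.congr_of_eventuallyEq ?_
  filter_upwards [hg.continuousAt.eventually hxm] with y hy
  have hF' := hy (differential I (F y) (g y))
  have hG' := hy (differential I (G y) (g y))
  rw [← MultiVector.toBilin_apply]
  conv_lhs => rw [hF', hG']
  simp only [map_sum, map_smul, LinearMap.sum_apply, LinearMap.smul_apply, smul_eq_mul,
    MultiVector.toBilin_apply, Finset.mul_sum]
  exact Finset.sum_comm.trans (Finset.sum_congr rfl fun i _ => Finset.sum_congr rfl fun j _ =>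
    mul_left_comm _ _ _)

end Family

/-! ### Products of bivector fields -/

section ProdBivector

variable {F₁ B₁ M₁ F₂ B₂ M₂ : Type*}
  [NormedAddCommGroup F₁] [NormedSpace ℝ F₁] [TopologicalSpace B₁]
  {I₁ : ModelWithCorners ℝ F₁ B₁} [TopologicalSpace M₁] [ChartedSpace B₁ M₁]
  [NormedAddCommGroup F₂] [NormedSpace ℝ F₂] [TopologicalSpace B₂]
  {I₂ : ModelWithCorners ℝ F₂ B₂} [TopologicalSpace M₂] [ChartedSpace B₂ M₂]

section Slices

variable (I₁ I₂) in
/-- The inclusion of the tangent space of the first factor. -/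
def sliceFst (m : M₁ × M₂) : TangentSpace I₁ m.1 →L[ℝ] TangentSpace (I₁.prod I₂) m :=
  mfderiv I₁ (I₁.prod I₂) (fun x => (x, m.2)) m.1

variable (I₁ I₂) in
/-- The inclusion of the tangent space of the second factor. -/
def sliceSnd (m : M₁ × M₂) : TangentSpace I₂ m.2 →L[ℝ] TangentSpace (I₁.prod I₂) m :=
  mfderiv I₂ (I₁.prod I₂) (fun y => (m.1, y)) m.2

lemma sliceFst_apply (m : M₁ × M₂) (v : TangentSpace I₁ m.1) :
    sliceFst I₁ I₂ m v = ((v : F₁), (0 : F₂)) :=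
  DFunLike.congr_fun (mfderiv_prod_left (I := I₁) (I' := I₂) (x₀ := m.1) (y₀ := m.2)) v

lemma sliceSnd_apply (m : M₁ × M₂) (v : TangentSpace I₂ m.2) :
    sliceSnd I₁ I₂ m v = ((0 : F₁), (v : F₂)) :=
  DFunLike.congr_fun (mfderiv_prod_right (I := I₁) (I' := I₂) (x₀ := m.1) (y₀ := m.2)) v

lemma differential_comp_sliceFst {f : M₁ × M₂ → ℝ} {m : M₁ × M₂}
    (hf : MDifferentiableAt (I₁.prod I₂) 𝓘(ℝ, ℝ) f m) :
    (differential (I₁.prod I₂) f m).comp (sliceFst I₁ I₂ m) =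
      differential I₁ (fun x => f (x, m.2)) m.1 :=
  (differential_comp_of_eq (f := f) (g := fun x => (x, m.2)) hf
    (mdifferentiableAt_id.prodMk mdifferentiableAt_const) rfl).symm

lemma differential_comp_sliceSnd {f : M₁ × M₂ → ℝ} {m : M₁ × M₂}
    (hf : MDifferentiableAt (I₁.prod I₂) 𝓘(ℝ, ℝ) f m) :
    (differential (I₁.prod I₂) f m).comp (sliceSnd I₁ I₂ m) =
      differential I₂ (fun y => f (m.1, y)) m.2 :=
  (differential_comp_of_eq (f := f) (g := fun y => (m.1, y)) hf
    (mdifferentiableAt_const.prodMk mdifferentiableAt_id) rfl).symm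

end Slices

variable (P₁ : ∀ m : M₁, MultiVector I₁ 2 m) (P₂ : ∀ m : M₂, MultiVector I₂ 2 m)

lemma prodBivector_apply (m : M₁ × M₂) (α β : Covector (I₁.prod I₂) m) :
    prodBivector P₁ P₂ m ![α, β] =
      P₁ m.1 ![α.comp (sliceFst I₁ I₂ m), β.comp (sliceFst I₁ I₂ m)] +
        P₂ m.2 ![α.comp (sliceSnd I₁ I₂ m), β.comp (sliceSnd I₁ I₂ m)] := by
  refine congrArg₂ (fun x y : ℝ => x + y) ?_ ?_
  · exact pushforward_two_apply (m' := m) (sliceFst I₁ I₂ m) (P₁ m.1) α β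
  · exact pushforward_two_apply (m' := m) (sliceSnd I₁ I₂ m) (P₂ m.2) α β

lemma prodBivector_differential {f g : M₁ × M₂ → ℝ} {m : M₁ × M₂}
    (hf : MDifferentiableAt (I₁.prod I₂) 𝓘(ℝ, ℝ) f m)
    (hg : MDifferentiableAt (I₁.prod I₂) 𝓘(ℝ, ℝ) g m) :
    prodBivector P₁ P₂ m ![differential (I₁.prod I₂) f m, differential (I₁.prod I₂) g m] =
      bracket P₁ (fun x => f (x, m.2)) (fun x => g (x, m.2)) m.1 +
        bracket P₂ (fun y => f (m.1, y)) (fun y => g (m.1, y)) m.2 := by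
  rw [prodBivector_apply, differential_comp_sliceFst hf, differential_comp_sliceFst hg,
    differential_comp_sliceSnd hf, differential_comp_sliceSnd hg]
  rfl

/-- Products of bivector fields are natural. -/
lemma prodBivector_map {F₁' B₁' M₁' F₂' B₂' M₂' : Type*}
    [NormedAddCommGroup F₁'] [NormedSpace ℝ F₁'] [TopologicalSpace B₁']
    {I₁' : ModelWithCorners ℝ F₁' B₁'} [TopologicalSpace M₁'] [ChartedSpace B₁' M₁']
    [NormedAddCommGroup F₂'] [NormedSpace ℝ F₂'] [TopologicalSpace B₂']
    {I₂' : ModelWithCorners ℝ F₂' B₂'} [TopologicalSpace M₂'] [ChartedSpace B₂' M₂']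
    {P₁' : ∀ m : M₁', MultiVector I₁' 2 m} {P₂' : ∀ m : M₂', MultiVector I₂' 2 m}
    {Φ₁ : M₁ → M₁'} {Φ₂ : M₂ → M₂'} {m : M₁ × M₂} (c : ℝ)
    (h₁ : MDifferentiableAt I₁ I₁' Φ₁ m.1) (h₂ : MDifferentiableAt I₂ I₂' Φ₂ m.2)
    (e₁ : P₁' (Φ₁ m.1) = c • pushforward (mfderiv I₁ I₁' Φ₁ m.1) (P₁ m.1))
    (e₂ : P₂' (Φ₂ m.2) = c • pushforward (mfderiv I₂ I₂' Φ₂ m.2) (P₂ m.2)) :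
    prodBivector P₁' P₂' (Prod.map Φ₁ Φ₂ m) =
      c • pushforward (mfderiv (I₁.prod I₂) (I₁'.prod I₂') (Prod.map Φ₁ Φ₂) m)
        (prodBivector P₁ P₂ m) := by
  refine multiVector_two_ext fun α β => ?_
  have hD := mfderiv_prodMap (p := m) h₁ h₂
  have k₁ : ∀ α : Covector (I₁'.prod I₂') (Prod.map Φ₁ Φ₂ m),
      (α.comp (sliceFst I₁' I₂' (Prod.map Φ₁ Φ₂ m))).comp (mfderiv I₁ I₁' Φ₁ m.1) =
      (α.comp (mfderiv (I₁.prod I₂) (I₁'.prod I₂') (Prod.map Φ₁ Φ₂) m)).comp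
        (sliceFst I₁ I₂ m) := by
    intro α
    ext v
    refine congrArg α ?_
    refine (sliceFst_apply _ _).trans ((congrArg (fun w : F₁ × F₂ => (show F₁ × F₂ →L[ℝ] F₁' × F₂'
      from mfderiv (I₁.prod I₂) (I₁'.prod I₂') (Prod.map Φ₁ Φ₂) m) w)
      (sliceFst_apply m v)).trans ((DFunLike.congr_fun hD ((v : F₁), (0 : F₂))).trans ?_)).symm
    exact Prod.ext rfl (map_zero (mfderiv I₂ I₂' Φ₂ m.2))
  have k₂ : ∀ α : Covector (I₁'.prod I₂') (Prod.map Φ₁ Φ₂ m),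
      (α.comp (sliceSnd I₁' I₂' (Prod.map Φ₁ Φ₂ m))).comp (mfderiv I₂ I₂' Φ₂ m.2) =
      (α.comp (mfderiv (I₁.prod I₂) (I₁'.prod I₂') (Prod.map Φ₁ Φ₂) m)).comp
        (sliceSnd I₁ I₂ m) := by
    intro α
    ext v
    refine congrArg α ?_
    refine (sliceSnd_apply _ _).trans ((congrArg (fun w : F₁ × F₂ => (show F₁ × F₂ →L[ℝ] F₁' × F₂'
      from mfderiv (I₁.prod I₂) (I₁'.prod I₂') (Prod.map Φ₁ Φ₂) m) w)
      (sliceSnd_apply m v)).trans ((DFunLike.congr_fun hD ((0 : F₁), (v : F₂))).trans ?_)).symm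
    exact Prod.ext (map_zero (mfderiv I₁ I₁' Φ₁ m.1)) rfl
  have l₁ := congrArg (fun P : MultiVector I₁' 2 (Φ₁ m.1) =>
    P ![α.comp (sliceFst I₁' I₂' (Prod.map Φ₁ Φ₂ m)),
      β.comp (sliceFst I₁' I₂' (Prod.map Φ₁ Φ₂ m))]) e₁
  have l₂ := congrArg (fun P : MultiVector I₂' 2 (Φ₂ m.2) =>
    P ![α.comp (sliceSnd I₁' I₂' (Prod.map Φ₁ Φ₂ m)),
      β.comp (sliceSnd I₁' I₂' (Prod.map Φ₁ Φ₂ m))]) e₂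
  simp only [AlternatingMap.smul_apply, pushforward_two_apply, smul_eq_mul, k₁, k₂] at l₁ l₂
  rw [prodBivector_apply]
  refine (congrArg₂ (fun x y : ℝ => x + y) l₁ l₂).trans ?_
  rw [AlternatingMap.smul_apply, pushforward_two_apply, prodBivector_apply, smul_eq_mul, mul_add]

variable [FiniteDimensional ℝ F₁] [FiniteDimensional ℝ F₂] [IsManifold I₁ ∞ M₁]
  [IsManifold I₂ ∞ M₂] [T2Space M₁] [T2Space M₂] {P₁ P₂}

/-- A product of smooth bivector fields, pulled back along a smooth map and evaluated on functions
that are smooth near a point. -/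
lemma contMDiffAt_prodBivector {E H Z : Type*} [NormedAddCommGroup E] [NormedSpace ℝ E]
    [TopologicalSpace H] {J : ModelWithCorners ℝ E H} [TopologicalSpace Z] [ChartedSpace H Z]
    [IsManifold J ∞ Z] (h₁ : IsSmoothField P₁) (h₂ : IsSmoothField P₂) {u : Z → M₁ × M₂} {z : Z}
    (hu : ContMDiffAt J (I₁.prod I₂) ∞ u z) {f g : M₁ × M₂ → ℝ}
    (hf : ContMDiffAt (I₁.prod I₂) 𝓘(ℝ, ℝ) ∞ f (u z))
    (hg : ContMDiffAt (I₁.prod I₂) 𝓘(ℝ, ℝ) ∞ g (u z)) :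
    ContMDiffAt J 𝓘(ℝ, ℝ) ∞ (fun z =>
      bracket P₁ (fun x => f (x, (u z).2)) (fun x => g (x, (u z).2)) (u z).1 +
        bracket P₂ (fun y => f ((u z).1, y)) (fun y => g ((u z).1, y)) (u z).2) z := by
  have u₁ : ContMDiffAt J I₁ ∞ (fun z => (u z).1) z := contMDiffAt_fst.comp z hu
  have u₂ : ContMDiffAt J I₂ ∞ (fun z => (u z).2) z := contMDiffAt_snd.comp z hu
  have k₁ : ∀ f : M₁ × M₂ → ℝ, ContMDiffAt (I₁.prod I₂) 𝓘(ℝ, ℝ) ∞ f (u z) →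
      ContMDiffAt (J.prod I₁) 𝓘(ℝ, ℝ) ∞ (fun p : Z × M₁ => f (p.2, (u p.1).2)) (z, (u z).1) := by
    intro f hf
    exact ContMDiffAt.comp (I' := I₁.prod I₂) (z, (u z).1) (g := f)
      (f := fun p : Z × M₁ => (p.2, (u p.1).2)) hf (contMDiffAt_snd.prodMk
        (ContMDiffAt.comp (z, (u z).1) (g := fun z => (u z).2) (f := Prod.fst) u₂ contMDiffAt_fst))
  have k₂ : ∀ f : M₁ × M₂ → ℝ, ContMDiffAt (I₁.prod I₂) 𝓘(ℝ, ℝ) ∞ f (u z) →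
      ContMDiffAt (J.prod I₂) 𝓘(ℝ, ℝ) ∞ (fun p : Z × M₂ => f ((u p.1).1, p.2)) (z, (u z).2) := by
    intro f hf
    exact ContMDiffAt.comp (I' := I₁.prod I₂) (z, (u z).2) (g := f)
      (f := fun p : Z × M₂ => ((u p.1).1, p.2)) hf ((ContMDiffAt.comp (z, (u z).2)
        (g := fun z => (u z).1) (f := Prod.fst) u₁ contMDiffAt_fst).prodMk contMDiffAt_snd)
  exact (h₁.contMDiffAt_family (F := fun z x => f (x, (u z).2)) (G := fun z x => g (x, (u z).2))
    (k₁ f hf) (k₁ g hg) u₁).add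
    (h₂.contMDiffAt_family (F := fun z y => f ((u z).1, y)) (G := fun z y => g ((u z).1, y))
    (k₂ f hf) (k₂ g hg) u₂)

lemma isSmoothField_prodBivector (h₁ : IsSmoothField P₁) (h₂ : IsSmoothField P₂) :
    IsSmoothField (prodBivector P₁ P₂) :=
  isSmoothField_two fun f g hf hg m =>
    (contMDiffAt_prodBivector h₁ h₂ contMDiffAt_id (hf m) (hg m)).congr_of_eventuallyEq
      (Filter.Eventually.of_forall fun m => prodBivector_differential P₁ P₂
        (hf.mdifferentiable (by simp) m) (hg.mdifferentiable (by simp) m))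

end ProdBivector

/-! ### The Schouten square of a product -/

section ProdJacobi

variable {F₁ B₁ M₁ F₂ B₂ M₂ : Type*}
  [NormedAddCommGroup F₁] [NormedSpace ℝ F₁] [TopologicalSpace B₁]
  {I₁ : ModelWithCorners ℝ F₁ B₁} [TopologicalSpace M₁] [ChartedSpace B₁ M₁]
  [NormedAddCommGroup F₂] [NormedSpace ℝ F₂] [TopologicalSpace B₂]
  {I₂ : ModelWithCorners ℝ F₂ B₂} [TopologicalSpace M₂] [ChartedSpace B₂ M₂]
  [FiniteDimensional ℝ F₁] [FiniteDimensional ℝ F₂] [IsManifold I₁ ∞ M₁] [IsManifold I₂ ∞ M₂]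
  {P₁ : ∀ m : M₁, MultiVector I₁ 2 m} {P₂ : ∀ m : M₂, MultiVector I₂ 2 m}

section

variable {f g : M₁ × M₂ → ℝ} (hf : ContMDiff (I₁.prod I₂) 𝓘(ℝ, ℝ) ∞ f)
  (hg : ContMDiff (I₁.prod I₂) 𝓘(ℝ, ℝ) ∞ g)

include hf in
omit [FiniteDimensional ℝ F₁] [FiniteDimensional ℝ F₂] [IsManifold I₁ ∞ M₁] [IsManifold I₂ ∞ M₂] in
lemma contMDiff_slice_fst (y : M₂) : ContMDiff I₁ 𝓘(ℝ, ℝ) ∞ fun x => f (x, y) :=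
  hf.comp (contMDiff_id.prodMk contMDiff_const)

include hf in
omit [FiniteDimensional ℝ F₁] [FiniteDimensional ℝ F₂] [IsManifold I₁ ∞ M₁] [IsManifold I₂ ∞ M₂] in
lemma contMDiff_slice_snd (x : M₁) : ContMDiff I₂ 𝓘(ℝ, ℝ) ∞ fun y => f (x, y) :=
  hf.comp (contMDiff_const.prodMk contMDiff_id)

include hf hg

/-- The bracket in the first factor satisfies the Leibniz rule for derivatives in the direction of
the second factor. -/
lemma differential_bracket_slice (P₁ : ∀ m : M₁, MultiVector I₁ 2 m) {x : M₁} {y : M₂}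
    (hx : I₁.IsInteriorPoint x) (hy : I₂.IsInteriorPoint y) (w : TangentSpace I₂ y) :
    MDifferentiableAt I₂ 𝓘(ℝ, ℝ) (fun y => bracket P₁ (fun x => f (x, y)) (fun x => g (x, y)) x) y ∧
    differential I₂ (fun y => bracket P₁ (fun x => f (x, y)) (fun x => g (x, y)) x) y w =
      P₁ x ![differential I₁ (fun x => differential I₂ (fun y => f (x, y)) y w) x,
        differential I₁ (fun x => g (x, y)) x] +
      P₁ x ![differential I₁ (fun x => f (x, y)) x,
        differential I₁ (fun x => differential I₂ (fun y => g (x, y)) y w) x] := by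
  obtain ⟨d, v, c, -, hc⟩ := (P₁ x).exists_coeff
  have hs : ∀ {f : M₁ × M₂ → ℝ} (_ : ContMDiff (I₁.prod I₂) 𝓘(ℝ, ℝ) ∞ f) (v : TangentSpace I₁ x),
      MDifferentiableAt I₂ 𝓘(ℝ, ℝ) (fun y => differential I₁ (fun x => f (x, y)) x v) y :=
    fun hf v => (contMDiff_differential_fst hf x v).mdifferentiable (by simp) y
  have hp : ∀ i j, MDifferentiableAt I₂ 𝓘(ℝ, ℝ) (fun y =>
      differential I₁ (fun x => f (x, y)) x (v i) *
        differential I₁ (fun x => g (x, y)) x (v j)) y := fun i j => (hs hf _).mul (hs hg _)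
  have hq : ∀ i j, MDifferentiableAt I₂ 𝓘(ℝ, ℝ) (fun y => c i j *
      (differential I₁ (fun x => f (x, y)) x (v i) *
        differential I₁ (fun x => g (x, y)) x (v j))) y := fun i j =>
    mdifferentiableAt_const.mul (hp i j)
  simp only [bracket, hc]
  refine ⟨mdifferentiableAt_finset_sum _ fun i =>
    mdifferentiableAt_finset_sum _ fun j => hq i j, ?_⟩
  rw [differential_sum _ fun i => mdifferentiableAt_finset_sum _ fun j => hq i j, sum_apply,
    ← Finset.sum_add_distrib]
  refine Finset.sum_congr rfl fun i _ => ?_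
  rw [differential_sum _ fun j => hq i j, sum_apply, ← Finset.sum_add_distrib]
  refine Finset.sum_congr rfl fun j _ => ?_
  rw [differential_const_mul _ (hp i j), differential_mul (hs hf _) (hs hg _)]
  simp only [smul_apply, add_apply, smul_eq_mul]
  rw [differential_differential_comm hf hx hy (v i) w,
    differential_differential_comm hg hx hy (v j) w]
  ring

end

/-- The mixed terms in the Jacobi identity of a product cancel. With `c k l • w k ⊗ w l` summing to
the second bivector, `a i` and `b i k` stand for the differentials along the first factor of the
`i`-th function and of its derivative along `w k`, and `s i k` for the value of that derivative. -/
lemma mixed_jacobi {V ι : Type*} [AddCommGroup V] [Module ℝ V] [Fintype ι]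
    (B : V → V → ℝ) (hB : ∀ a b, B a b = -B b a) (c : ι → ι → ℝ) (hc : ∀ k l, c k l = -c l k)
    (a : Fin 3 → V) (b : Fin 3 → ι → V) (s : Fin 3 → ι → ℝ) :
    let T : Fin 3 → Fin 3 → Fin 3 → ℝ := fun i j p =>
      ∑ k, ∑ l, c k l * (s j k * B (a i) (b p l) + s p l * B (a i) (b j k)) +
      ∑ k, ∑ l, c k l * (s i k * (B (b j l) (a p) + B (a j) (b p l)))
    T 0 1 2 + T 1 2 0 + T 2 0 1 = 0 := by
  intro T
  have hT : ∀ i j p, T i j p = ∑ k, ∑ l, c k l * (s j k * B (a i) (b p l) -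
      s p k * B (a i) (b j l) + s i k * (B (b j l) (a p) + B (a j) (b p l))) := by
    intro i j p
    have h1 : ∑ k, ∑ l, c k l * (s p l * B (a i) (b j k)) =
        ∑ k, ∑ l, c k l * (-(s p k * B (a i) (b j l))) := by
      rw [Finset.sum_comm]
      refine Finset.sum_congr rfl fun k _ => Finset.sum_congr rfl fun l _ => ?_
      rw [hc l k]
      ring
    simp only [T, mul_add, Finset.sum_add_distrib] at h1 ⊢
    rw [h1]
    simp only [← Finset.sum_add_distrib]
    refine Finset.sum_congr rfl fun k _ => Finset.sum_congr rfl fun l _ => ?_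
    ring
  rw [hT, hT, hT, ← Finset.sum_add_distrib, ← Finset.sum_add_distrib]
  refine Finset.sum_eq_zero fun k _ => ?_
  rw [← Finset.sum_add_distrib, ← Finset.sum_add_distrib]
  refine Finset.sum_eq_zero fun l _ => ?_
  rw [hB (b 1 l) (a 2), hB (b 2 l) (a 0), hB (b 0 l) (a 1)]
  ring

variable [T2Space M₁] [T2Space M₂] [BoundarylessManifold I₁ M₁] [BoundarylessManifold I₂ M₂]

/-- The Schouten square of a product of bivector fields is the sum of the Schouten squares. -/
theorem IsSchoutenSquare.prod
    {T₁ : ∀ m : M₁, MultiVector I₁ 3 m} {T₂ : ∀ m : M₂, MultiVector I₂ 3 m}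
    {T : ∀ m : M₁ × M₂, MultiVector (I₁.prod I₂) 3 m}
    (hP₁ : IsSmoothField P₁) (hP₂ : IsSmoothField P₂)
    (h₁ : IsSchoutenSquare P₁ T₁) (h₂ : IsSchoutenSquare P₂ T₂)
    (hT : ∀ m (α β γ : Covector (I₁.prod I₂) m), T m ![α, β, γ] =
      T₁ m.1 ![α.comp (sliceFst I₁ I₂ m), β.comp (sliceFst I₁ I₂ m), γ.comp (sliceFst I₁ I₂ m)] +
      T₂ m.2 ![α.comp (sliceSnd I₁ I₂ m), β.comp (sliceSnd I₁ I₂ m), γ.comp (sliceSnd I₁ I₂ m)]) :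
    IsSchoutenSquare (prodBivector P₁ P₂) T := by
  intro f g h hf hg hh m
  have hd : ∀ {f : M₁ × M₂ → ℝ} (_ : ContMDiff (I₁.prod I₂) 𝓘(ℝ, ℝ) ∞ f) (m : M₁ × M₂),
      MDifferentiableAt (I₁.prod I₂) 𝓘(ℝ, ℝ) f m := fun hf m => hf.mdifferentiable (by simp) m
  rw [hT, differential_comp_sliceFst (hd hf m), differential_comp_sliceFst (hd hg m),
    differential_comp_sliceFst (hd hh m), differential_comp_sliceSnd (hd hf m),
    differential_comp_sliceSnd (hd hg m), differential_comp_sliceSnd (hd hh m),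
    h₁ _ _ _ (contMDiff_slice_fst hf m.2) (contMDiff_slice_fst hg m.2) (contMDiff_slice_fst hh m.2),
    h₂ _ _ _ (contMDiff_slice_snd hf m.1) (contMDiff_slice_snd hg m.1) (contMDiff_slice_snd hh m.1)]
  have hi₁ : I₁.IsInteriorPoint m.1 := BoundarylessManifold.isInteriorPoint
  have hi₂ : I₂.IsInteriorPoint m.2 := BoundarylessManifold.isInteriorPoint
  -- `P₂` at the second component is `∑ c k l • w k ⊗ w l`; `σ i k` is the derivative of the `i`-th
  -- function along `w k`, as a function on the first factor, and `s`, `b`, `a` collect its values,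
  -- its differential and the differential of the `i`-th function itself
  obtain ⟨d, w, c, hanti, hc⟩ := (P₂ m.2).exists_coeff
  let F : Fin 3 → M₁ × M₂ → ℝ := ![f, g, h]
  have hF : ∀ i, ContMDiff (I₁.prod I₂) 𝓘(ℝ, ℝ) ∞ (F i) := by
    intro i
    fin_cases i <;> assumption
  let a : Fin 3 → Covector I₁ m.1 := fun i => differential I₁ (fun x => F i (x, m.2)) m.1
  let σ : Fin 3 → Fin d → M₁ → ℝ := fun i k x => differential I₂ (fun y => F i (x, y)) m.2 (w k)
  have hσ : ∀ i k, MDifferentiableAt I₁ 𝓘(ℝ, ℝ) (σ i k) m.1 := fun i k =>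
    (contMDiff_differential_snd (hF i) m.2 (w k)).mdifferentiable (by simp) m.1
  let b : Fin 3 → Fin d → Covector I₁ m.1 := fun i k => differential I₁ (σ i k) m.1
  let s : Fin 3 → Fin d → ℝ := fun i k => σ i k m.1
  let B : Covector I₁ m.1 → Covector I₁ m.1 → ℝ := fun α β => P₁ m.1 ![α, β]
  have hmix := mixed_jacobi B (fun α β => (P₁ m.1).two_swap α β) c hanti a b s
  -- the double bracket of a product: the two double brackets in the factors and the mixed terms
  have key : ∀ i j p,
      bracket (prodBivector P₁ P₂) (F i) (bracket (prodBivector P₁ P₂) (F j) (F p)) m =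
      bracket P₁ (fun x => F i (x, m.2))
        (bracket P₁ (fun x => F j (x, m.2)) (fun x => F p (x, m.2))) m.1 +
      bracket P₂ (fun y => F i (m.1, y))
        (bracket P₂ (fun y => F j (m.1, y)) (fun y => F p (m.1, y))) m.2 +
      (∑ k, ∑ l, c k l * (s j k * B (a i) (b p l) + s p l * B (a i) (b j k)) +
        ∑ k, ∑ l, c k l * (s i k * (B (b j l) (a p) + B (a j) (b p l)))) := by
    intro i j p
    have hbr : bracket (prodBivector P₁ P₂) (F j) (F p) = fun m : M₁ × M₂ =>
        bracket P₁ (fun x => F j (x, m.2)) (fun x => F p (x, m.2)) m.1 +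
          bracket P₂ (fun y => F j (m.1, y)) (fun y => F p (m.1, y)) m.2 :=
      funext fun m => prodBivector_differential P₁ P₂ (hd (hF j) m) (hd (hF p) m)
    have hK : ContMDiff (I₁.prod I₂) 𝓘(ℝ, ℝ) ∞ (bracket (prodBivector P₁ P₂) (F j) (F p)) :=
      (isSmoothField_prodBivector hP₁ hP₂).contMDiff_two (hF j) (hF p)
    have e1 := prodBivector_differential P₁ P₂ (hd (hF i) m) (hd hK m)
    refine e1.trans ?_
    rw [hbr]
    have n₁ : MDifferentiableAt I₁ 𝓘(ℝ, ℝ)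
        (bracket P₁ (fun x => F j (x, m.2)) (fun x => F p (x, m.2))) m.1 :=
      (hP₁.contMDiff_two (contMDiff_slice_fst (hF j) m.2)
        (contMDiff_slice_fst (hF p) m.2)).mdifferentiable (by simp) _
    have n₂ : MDifferentiableAt I₂ 𝓘(ℝ, ℝ)
        (bracket P₂ (fun y => F j (m.1, y)) (fun y => F p (m.1, y))) m.2 :=
      (hP₂.contMDiff_two (contMDiff_slice_snd (hF j) m.1)
        (contMDiff_slice_snd (hF p) m.1)).mdifferentiable (by simp) _
    have n₃ := fun w => differential_bracket_slice (hF j) (hF p) P₁ hi₁ hi₂ w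
    have hq : ∀ k l, MDifferentiableAt I₁ 𝓘(ℝ, ℝ) (fun x => σ j k x * σ p l x) m.1 :=
      fun k l => (hσ j k).mul (hσ p l)
    have hq' : ∀ k l, MDifferentiableAt I₁ 𝓘(ℝ, ℝ) (fun x => c k l * (σ j k x * σ p l x)) m.1 :=
      fun k l => mdifferentiableAt_const.mul (hq k l)
    have n₄ : (fun x => bracket P₂ (fun y => F j (x, y)) (fun y => F p (x, y)) m.2) =
        fun x => ∑ k, ∑ l, c k l * (σ j k x * σ p l x) := funext fun x => hc _ _
    have d₄ : differential I₁ (fun x => ∑ k, ∑ l, c k l * (σ j k x * σ p l x)) m.1 =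
        ∑ k, ∑ l, c k l • (s j k • b p l + s p l • b j k) := by
      rw [differential_sum _ fun k => mdifferentiableAt_finset_sum _ fun l => hq' k l]
      refine Finset.sum_congr rfl fun k _ => ?_
      rw [differential_sum _ fun l => hq' k l]
      refine Finset.sum_congr rfl fun l _ => ?_
      rw [differential_const_mul _ (hq k l), differential_mul (hσ j k) (hσ p l)]
    have t₁ : bracket P₁ (fun x => F i (x, m.2)) (fun x =>
        bracket P₁ (fun x => F j (x, m.2)) (fun x => F p (x, m.2)) x +
          bracket P₂ (fun y => F j (x, y)) (fun y => F p (x, y)) m.2) m.1 =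
        bracket P₁ (fun x => F i (x, m.2))
          (bracket P₁ (fun x => F j (x, m.2)) (fun x => F p (x, m.2))) m.1 +
        ∑ k, ∑ l, c k l * (s j k * B (a i) (b p l) + s p l * B (a i) (b j k)) := by
      have n₅ : MDifferentiableAt I₁ 𝓘(ℝ, ℝ)
          (fun x => bracket P₂ (fun y => F j (x, y)) (fun y => F p (x, y)) m.2) m.1 := by
        rw [n₄]
        exact mdifferentiableAt_finset_sum _ fun k =>
          mdifferentiableAt_finset_sum _ fun l => hq' k l
      have e : differential I₁ (fun x =>
          bracket P₁ (fun x => F j (x, m.2)) (fun x => F p (x, m.2)) x +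
          bracket P₂ (fun y => F j (x, y)) (fun y => F p (x, y)) m.2) m.1 = _ :=
        differential_add n₁ n₅
      rw [bracket, e, MultiVector.two_add_right, n₄, d₄]
      refine congrArg₂ (fun x y : ℝ => x + y) rfl ?_
      rw [← MultiVector.toBilin_apply]
      simp only [map_sum, map_smul, map_add, smul_eq_mul, MultiVector.toBilin_apply]
      rfl
    have t₂ : bracket P₂ (fun y => F i (m.1, y)) (fun y =>
        bracket P₁ (fun x => F j (x, y)) (fun x => F p (x, y)) m.1 +
          bracket P₂ (fun y => F j (m.1, y)) (fun y => F p (m.1, y)) y) m.2 =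
        bracket P₂ (fun y => F i (m.1, y))
          (bracket P₂ (fun y => F j (m.1, y)) (fun y => F p (m.1, y))) m.2 +
        ∑ k, ∑ l, c k l * (s i k * (B (b j l) (a p) + B (a j) (b p l))) := by
      have e : differential I₂ (fun y =>
          bracket P₁ (fun x => F j (x, y)) (fun x => F p (x, y)) m.1 +
          bracket P₂ (fun y => F j (m.1, y)) (fun y => F p (m.1, y)) y) m.2 = _ :=
        differential_add (n₃ 0).1 n₂
      rw [bracket, e, MultiVector.two_add_right, add_comm]
      refine congrArg₂ (fun x y : ℝ => x + y) rfl ?_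
      rw [hc]
      refine Finset.sum_congr rfl fun k _ => Finset.sum_congr rfl fun l _ => ?_
      rw [(n₃ (w l)).2]
    refine (congrArg₂ (fun x y : ℝ => x + y) t₁ t₂).trans ?_
    ring
  have k1 := key 0 1 2
  have k2 := key 1 2 0
  have k3 := key 2 0 1
  change bracket (prodBivector P₁ P₂) f (bracket (prodBivector P₁ P₂) g h) m = _ at k1
  change bracket (prodBivector P₁ P₂) g (bracket (prodBivector P₁ P₂) h f) m = _ at k2
  change bracket (prodBivector P₁ P₂) h (bracket (prodBivector P₁ P₂) f g) m = _ at k3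
  rw [k1, k2, k3]
  simp only at hmix
  change _ = 2 * (bracket P₁ (fun x => f (x, m.2)) (bracket P₁ (fun x => g (x, m.2))
      (fun x => h (x, m.2))) m.1 + bracket P₂ (fun y => f (m.1, y)) (bracket P₂
      (fun y => g (m.1, y)) (fun y => h (m.1, y))) m.2 + _ +
    (bracket P₁ (fun x => g (x, m.2)) (bracket P₁ (fun x => h (x, m.2))
      (fun x => f (x, m.2))) m.1 + bracket P₂ (fun y => g (m.1, y)) (bracket P₂
      (fun y => h (m.1, y)) (fun y => f (m.1, y))) m.2 + _) +
    (bracket P₁ (fun x => h (x, m.2)) (bracket P₁ (fun x => f (x, m.2))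
      (fun x => g (x, m.2))) m.1 + bracket P₂ (fun y => h (m.1, y)) (bracket P₂
      (fun y => f (m.1, y)) (fun y => g (m.1, y))) m.2 + _))
  linear_combination (-2 : ℝ) * hmix

end ProdJacobi

/-! ### Products of Hamiltonian spaces -/

section ProductAction

open DefSpace

variable {EG HG G E₁ HH₁ H₁ E₂ HH₂ H₂ : Type*}
  [NormedAddCommGroup EG] [NormedSpace ℝ EG] [TopologicalSpace HG] {JG : ModelWithCorners ℝ EG HG}
  [TopologicalSpace G] [ChartedSpace HG G] [Group G]
  [NormedAddCommGroup E₁] [NormedSpace ℝ E₁] [TopologicalSpace HH₁]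
  {J₁ : ModelWithCorners ℝ E₁ HH₁} [TopologicalSpace H₁] [ChartedSpace HH₁ H₁] [Group H₁]
  [NormedAddCommGroup E₂] [NormedSpace ℝ E₂] [TopologicalSpace HH₂]
  {J₂ : ModelWithCorners ℝ E₂ HH₂} [TopologicalSpace H₂] [ChartedSpace HH₂ H₂] [Group H₂]

/-- The projection `𝔤 ⊕ 𝔤 ⊕ 𝔥₁ ⊕ 𝔥₂ → 𝔤 ⊕ 𝔥₁` onto the first and third summands. -/
def lieProj₁ (v : GroupLieAlgebra (JG.prod (JG.prod (J₁.prod J₂))) (G × G × H₁ × H₂)) :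
    GroupLieAlgebra (JG.prod J₁) (G × H₁) :=
  lieMk (lieFst v) (lieFst (lieSnd (lieSnd v)))

/-- The projection `𝔤 ⊕ 𝔤 ⊕ 𝔥₁ ⊕ 𝔥₂ → 𝔤 ⊕ 𝔥₂` onto the second and fourth summands. -/
def lieProj₂ (v : GroupLieAlgebra (JG.prod (JG.prod (J₁.prod J₂))) (G × G × H₁ × H₂)) :
    GroupLieAlgebra (JG.prod J₂) (G × H₂) :=
  lieMk (lieFst (lieSnd v)) (lieSnd (lieSnd (lieSnd v)))

variable (JG G J₁ H₁ J₂ H₂) in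
/-- The inclusion of `𝔤 ⊕ 𝔥₁` as the first and third summands of `𝔤 ⊕ 𝔤 ⊕ 𝔥₁ ⊕ 𝔥₂`. -/
def lieIncl₁ : GroupLieAlgebra (JG.prod J₁) (G × H₁) →ₗ[ℝ]
    GroupLieAlgebra (JG.prod (JG.prod (J₁.prod J₂))) (G × G × H₁ × H₂) :=
  (LinearMap.fst ℝ EG E₁).prod ((0 : EG × E₁ →ₗ[ℝ] EG).prod
    ((LinearMap.snd ℝ EG E₁).prod (0 : EG × E₁ →ₗ[ℝ] E₂)))

variable (JG G J₁ H₁ J₂ H₂) in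
/-- The inclusion of `𝔤 ⊕ 𝔥₂` as the second and fourth summands of `𝔤 ⊕ 𝔤 ⊕ 𝔥₁ ⊕ 𝔥₂`. -/
def lieIncl₂ : GroupLieAlgebra (JG.prod J₂) (G × H₂) →ₗ[ℝ]
    GroupLieAlgebra (JG.prod (JG.prod (J₁.prod J₂))) (G × G × H₁ × H₂) :=
  (0 : EG × E₂ →ₗ[ℝ] EG).prod ((LinearMap.fst ℝ EG E₂).prod
    ((0 : EG × E₂ →ₗ[ℝ] E₁).prod (LinearMap.snd ℝ EG E₂)))

lemma lieIncl_lieProj (v : GroupLieAlgebra (JG.prod (JG.prod (J₁.prod J₂))) (G × G × H₁ × H₂)) :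
    v = lieIncl₁ G H₁ H₂ JG J₁ J₂ (lieProj₁ v) + lieIncl₂ G H₁ H₂ JG J₁ J₂ (lieProj₂ v) := by
  obtain ⟨a, b, c, d⟩ : EG × EG × E₁ × E₂ := v
  exact (Prod.ext (add_zero a)
    (Prod.ext (zero_add b) (Prod.ext (add_zero c) (zero_add d)))).symm

lemma mfderiv_incl₁ (v : GroupLieAlgebra (JG.prod J₁) (G × H₁)) :
    mfderiv (JG.prod J₁) (JG.prod (JG.prod (J₁.prod J₂)))
      (fun k : G × H₁ => regroup (k, (1 : G × H₂))) 1 v = lieIncl₁ G H₁ H₂ JG J₁ J₂ v := by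
  have f : HasMFDerivAt (JG.prod J₁) JG (Prod.fst : G × H₁ → G) 1 _ := hasMFDerivAt_fst 1
  have s : HasMFDerivAt (JG.prod J₁) J₁ (Prod.snd : G × H₁ → H₁) 1 _ := hasMFDerivAt_snd 1
  have c : HasMFDerivAt (JG.prod J₁) JG (fun _ : G × H₁ => (1 : G)) 1 _ := hasMFDerivAt_const _ _
  have d : HasMFDerivAt (JG.prod J₁) J₂ (fun _ : G × H₁ => (1 : H₂)) 1 _ := hasMFDerivAt_const _ _
  exact DFunLike.congr_fun (f.prodMk (c.prodMk (s.prodMk d))).mfderiv v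

lemma mfderiv_incl₂ (v : GroupLieAlgebra (JG.prod J₂) (G × H₂)) :
    mfderiv (JG.prod J₂) (JG.prod (JG.prod (J₁.prod J₂)))
      (fun k : G × H₂ => regroup ((1 : G × H₁), k)) 1 v = lieIncl₂ G H₁ H₂ JG J₁ J₂ v := by
  have f : HasMFDerivAt (JG.prod J₂) JG (Prod.fst : G × H₂ → G) 1 _ := hasMFDerivAt_fst 1
  have s : HasMFDerivAt (JG.prod J₂) J₂ (Prod.snd : G × H₂ → H₂) 1 _ := hasMFDerivAt_snd 1
  have c : HasMFDerivAt (JG.prod J₂) JG (fun _ : G × H₂ => (1 : G)) 1 _ := hasMFDerivAt_const _ _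
  have d : HasMFDerivAt (JG.prod J₂) J₁ (fun _ : G × H₂ => (1 : H₁)) 1 _ := hasMFDerivAt_const _ _
  exact DFunLike.congr_fun (c.prodMk (f.prodMk (d.prodMk s))).mfderiv v

lemma contMDiff_incl₁ (b : G × H₂) : ContMDiff (JG.prod J₁) (JG.prod (JG.prod (J₁.prod J₂))) ∞
    (fun k : G × H₁ => regroup (k, b)) :=
  contMDiff_regroup.comp (contMDiff_id.prodMk contMDiff_const)

lemma contMDiff_incl₂ (a : G × H₁) : ContMDiff (JG.prod J₂) (JG.prod (JG.prod (J₁.prod J₂))) ∞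
    (fun k : G × H₂ => regroup (a, k)) :=
  contMDiff_regroup.comp (contMDiff_const.prodMk contMDiff_id)

lemma differential_lieIncl₁ {f : G × G × H₁ × H₂ → ℝ}
    (hf : ContMDiff (JG.prod (JG.prod (J₁.prod J₂))) 𝓘(ℝ, ℝ) ∞ f)
    (v : GroupLieAlgebra (JG.prod J₁) (G × H₁)) :
    differential (JG.prod (JG.prod (J₁.prod J₂))) f 1 (lieIncl₁ G H₁ H₂ JG J₁ J₂ v) =
      differential (JG.prod J₁) (fun k => f (regroup (k, 1))) 1 v := by
  rw [← mfderiv_incl₁]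
  exact (DFunLike.congr_fun (differential_comp_of_eq (f := f)
    (g := fun k : G × H₁ => regroup (k, (1 : G × H₂))) (m := 1) (m' := 1)
    (hf.mdifferentiable (by simp) 1) ((contMDiff_incl₁ 1).mdifferentiable (by simp) 1) rfl) v).symm

lemma differential_lieIncl₂ {f : G × G × H₁ × H₂ → ℝ}
    (hf : ContMDiff (JG.prod (JG.prod (J₁.prod J₂))) 𝓘(ℝ, ℝ) ∞ f)
    (v : GroupLieAlgebra (JG.prod J₂) (G × H₂)) :
    differential (JG.prod (JG.prod (J₁.prod J₂))) f 1 (lieIncl₂ G H₁ H₂ JG J₁ J₂ v) =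
      differential (JG.prod J₂) (fun k => f (regroup (1, k))) 1 v := by
  rw [← mfderiv_incl₂]
  exact (DFunLike.congr_fun (differential_comp_of_eq (f := f)
    (g := fun k : G × H₂ => regroup ((1 : G × H₁), k)) (m := 1) (m' := 1)
    (hf.mdifferentiable (by simp) 1) ((contMDiff_incl₂ 1).mdifferentiable (by simp) 1) rfl) v).symm

section Form

variable [LieGroup JG ∞ G] [LieGroup J₁ ∞ H₁] [LieGroup J₂ ∞ H₂]
  (BG : InvariantForm JG G) (B₁ : InvariantForm J₁ H₁) (B₂ : InvariantForm J₂ H₂)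

lemma form_lieProj (v w : GroupLieAlgebra (JG.prod (JG.prod (J₁.prod J₂))) (G × G × H₁ × H₂)) :
    (BG.prod (BG.prod (B₁.prod B₂))).form v w = (BG.prod B₁).form (lieProj₁ v) (lieProj₁ w) +
      (BG.prod B₂).form (lieProj₂ v) (lieProj₂ w) := by
  have h : (BG.prod (BG.prod (B₁.prod B₂))).form v w = BG.form (lieFst v) (lieFst w) +
      (BG.form (lieFst (lieSnd v)) (lieFst (lieSnd w)) +
        (B₁.form (lieFst (lieSnd (lieSnd v))) (lieFst (lieSnd (lieSnd w))) +
          B₂.form (lieSnd (lieSnd (lieSnd v))) (lieSnd (lieSnd (lieSnd w))))) := rfl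
  have h' : (BG.prod B₁).form (lieProj₁ v) (lieProj₁ w) +
      (BG.prod B₂).form (lieProj₂ v) (lieProj₂ w) = (BG.form (lieFst v) (lieFst w) +
        B₁.form (lieFst (lieSnd (lieSnd v))) (lieFst (lieSnd (lieSnd w)))) +
      (BG.form (lieFst (lieSnd v)) (lieFst (lieSnd w)) +
          B₂.form (lieSnd (lieSnd (lieSnd v))) (lieSnd (lieSnd (lieSnd w)))) := rfl
  rw [h, h']
  ring

variable [FiniteDimensional ℝ EG] [FiniteDimensional ℝ E₁] [FiniteDimensional ℝ E₂]
  (a b c : GroupLieAlgebra (JG.prod (JG.prod (J₁.prod J₂))) (G × G × H₁ × H₂) →ₗ[ℝ] ℝ)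

lemma lieProj₁_sharp : lieProj₁ ((BG.prod (BG.prod (B₁.prod B₂))).sharp a) =
    (BG.prod B₁).sharp (a ∘ₗ lieIncl₁ G H₁ H₂ JG J₁ J₂) := by
  refine (BG.prod B₁).eq_sharp fun z => ?_
  have h := (BG.prod (BG.prod (B₁.prod B₂))).form_sharp a (lieIncl₁ G H₁ H₂ JG J₁ J₂ z)
  have h0 : lieProj₂ (lieIncl₁ G H₁ H₂ JG J₁ J₂ z) = 0 := rfl
  rw [form_lieProj, h0, map_zero, add_zero] at h
  exact h

lemma lieProj₂_sharp : lieProj₂ ((BG.prod (BG.prod (B₁.prod B₂))).sharp a) =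
    (BG.prod B₂).sharp (a ∘ₗ lieIncl₂ G H₁ H₂ JG J₁ J₂) := by
  refine (BG.prod B₂).eq_sharp fun z => ?_
  have h := (BG.prod (BG.prod (B₁.prod B₂))).form_sharp a (lieIncl₂ G H₁ H₂ JG J₁ J₂ z)
  have h0 : lieProj₁ (lieIncl₂ G H₁ H₂ JG J₁ J₂ z) = 0 := rfl
  rw [form_lieProj, h0, map_zero, zero_add] at h
  exact h

lemma cartan_lieIncl [JG.Boundaryless] [J₁.Boundaryless] [J₂.Boundaryless] :
    (BG.prod (BG.prod (B₁.prod B₂))).cartan a b c =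
      (BG.prod B₁).cartan (a ∘ₗ lieIncl₁ G H₁ H₂ JG J₁ J₂) (b ∘ₗ lieIncl₁ G H₁ H₂ JG J₁ J₂)
        (c ∘ₗ lieIncl₁ G H₁ H₂ JG J₁ J₂) +
      (BG.prod B₂).cartan (a ∘ₗ lieIncl₂ G H₁ H₂ JG J₁ J₂) (b ∘ₗ lieIncl₂ G H₁ H₂ JG J₁ J₂)
        (c ∘ₗ lieIncl₂ G H₁ H₂ JG J₁ J₂) := by
  simp only [InvariantForm.cartan_prod]
  rw [← add_assoc]
  exact add_add_add_comm _ _ _ _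

end Form

section LeftRight

variable [LieGroup JG ∞ G] [LieGroup J₁ ∞ H₁] [LieGroup J₂ ∞ H₂] {f : G × G × H₁ × H₂ → ℝ}
  (hf : ContMDiff (JG.prod (JG.prod (J₁.prod J₂))) 𝓘(ℝ, ℝ) ∞ f) (a : G × H₁) (b : G × H₂)

include hf

lemma leftFun_lieIncl₁ :
    leftFun (JG.prod (JG.prod (J₁.prod J₂))) f (regroup (a, b)) ∘ₗ lieIncl₁ G H₁ H₂ JG J₁ J₂ =
      leftFun (JG.prod J₁) (fun k => f (regroup (k, b))) a := by
  ext v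
  refine (differential_lieIncl₁ (contMDiff_comp_left_mul hf _) v).trans ?_
  refine congrArg (fun φ : G × H₁ → ℝ => differential (JG.prod J₁) φ 1 v) (funext fun k => ?_)
  simp [regroup]

lemma rightFun_lieIncl₁ :
    rightFun (JG.prod (JG.prod (J₁.prod J₂))) f (regroup (a, b)) ∘ₗ lieIncl₁ G H₁ H₂ JG J₁ J₂ =
      rightFun (JG.prod J₁) (fun k => f (regroup (k, b))) a := by
  ext v
  refine (differential_lieIncl₁ (contMDiff_comp_right_mul hf _) v).trans ?_
  refine congrArg (fun φ : G × H₁ → ℝ => differential (JG.prod J₁) φ 1 v) (funext fun k => ?_)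
  simp [regroup]

lemma leftFun_lieIncl₂ :
    leftFun (JG.prod (JG.prod (J₁.prod J₂))) f (regroup (a, b)) ∘ₗ lieIncl₂ G H₁ H₂ JG J₁ J₂ =
      leftFun (JG.prod J₂) (fun k => f (regroup (a, k))) b := by
  ext v
  refine (differential_lieIncl₂ (contMDiff_comp_left_mul hf _) v).trans ?_
  refine congrArg (fun φ : G × H₂ → ℝ => differential (JG.prod J₂) φ 1 v) (funext fun k => ?_)
  simp [regroup]

lemma rightFun_lieIncl₂ :
    rightFun (JG.prod (JG.prod (J₁.prod J₂))) f (regroup (a, b)) ∘ₗ lieIncl₂ G H₁ H₂ JG J₁ J₂ =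
      rightFun (JG.prod J₂) (fun k => f (regroup (a, k))) b := by
  ext v
  refine (differential_lieIncl₂ (contMDiff_comp_right_mul hf _) v).trans ?_
  refine congrArg (fun φ : G × H₂ → ℝ => differential (JG.prod J₂) φ 1 v) (funext fun k => ?_)
  simp [regroup]

end LeftRight

variable {F₁ A₁' M₁ F₂ A₂' M₂ : Type*}
  [NormedAddCommGroup F₁] [NormedSpace ℝ F₁] [TopologicalSpace A₁']
  {I₁ : ModelWithCorners ℝ F₁ A₁'} [TopologicalSpace M₁] [ChartedSpace A₁' M₁]
  [NormedAddCommGroup F₂] [NormedSpace ℝ F₂] [TopologicalSpace A₂']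
  {I₂ : ModelWithCorners ℝ F₂ A₂'} [TopologicalSpace M₂] [ChartedSpace A₂' M₂]

namespace SmoothAction

variable (A₁ : SmoothAction (JG.prod J₁) (G × H₁) I₁ M₁)
  (A₂ : SmoothAction (JG.prod J₂) (G × H₂) I₂ M₂) (m : M₁ × M₂)
  (α β γ : Covector (I₁.prod I₂) m)

/-- On a product, the fundamental vector fields of the first group are those of the first factor. -/
lemma prod_fundamental_lieIncl₁ (x : GroupLieAlgebra (JG.prod J₁) (G × H₁)) :
    (A₁.prod A₂).fundamental (lieIncl₁ G H₁ H₂ JG J₁ J₂ x) m =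
      sliceFst I₁ I₂ m (A₁.fundamental x m.1) := by
  have h := mfderiv_comp_apply_model (J := JG.prod J₁) (I := JG.prod (JG.prod (J₁.prod J₂)))
    (I'' := I₁.prod I₂) (x := (1 : G × H₁)) (y := 1) (g := fun k => (A₁.prod A₂).act k m)
    (f := fun k : G × H₁ => regroup (k, (1 : G × H₂)))
    (((A₁.prod A₂).smooth_orbit m).mdifferentiable (by simp) 1)
    ((contMDiff_incl₁ 1).mdifferentiable (by simp) 1) rfl x
  rw [mfderiv_incl₁] at h
  have h' := mfderiv_comp_apply_model (J := JG.prod J₁) (I := I₁)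
    (I'' := I₁.prod I₂) (x := (1 : G × H₁)) (y := m.1) (g := fun y => (y, m.2))
    (f := fun k : G × H₁ => A₁.act k m.1) (mdifferentiableAt_id.prodMk mdifferentiableAt_const)
    ((A₁.smooth_orbit m.1).mdifferentiable (by simp) 1) (A₁.one_act _) x
  have e : (fun k : G × H₁ => (A₁.act k m.1, m.2)) =
      fun k : G × H₁ => (A₁.prod A₂).act (regroup (k, (1 : G × H₂))) m :=
    funext fun k => Prod.ext rfl (A₂.one_act m.2).symm
  rw [e] at h'
  refine (congrArg (fun v : F₁ × F₂ => -v) (h.symm.trans h')).trans ?_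
  exact (map_neg (show F₁ →L[ℝ] F₁ × F₂ from sliceFst I₁ I₂ m) _).symm

lemma prod_fundamental_lieIncl₂ (x : GroupLieAlgebra (JG.prod J₂) (G × H₂)) :
    (A₁.prod A₂).fundamental (lieIncl₂ G H₁ H₂ JG J₁ J₂ x) m =
      sliceSnd I₁ I₂ m (A₂.fundamental x m.2) := by
  have h := mfderiv_comp_apply_model (J := JG.prod J₂) (I := JG.prod (JG.prod (J₁.prod J₂)))
    (I'' := I₁.prod I₂) (x := (1 : G × H₂)) (y := 1) (g := fun k => (A₁.prod A₂).act k m)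
    (f := fun k : G × H₂ => regroup ((1 : G × H₁), k))
    (((A₁.prod A₂).smooth_orbit m).mdifferentiable (by simp) 1)
    ((contMDiff_incl₂ 1).mdifferentiable (by simp) 1) rfl x
  rw [mfderiv_incl₂] at h
  have h' := mfderiv_comp_apply_model (J := JG.prod J₂) (I := I₂)
    (I'' := I₁.prod I₂) (x := (1 : G × H₂)) (y := m.2) (g := fun y => (m.1, y))
    (f := fun k : G × H₂ => A₂.act k m.2) (mdifferentiableAt_const.prodMk mdifferentiableAt_id)
    ((A₂.smooth_orbit m.2).mdifferentiable (by simp) 1) (A₂.one_act _) x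
  have e : (fun k : G × H₂ => (m.1, A₂.act k m.2)) =
      fun k : G × H₂ => (A₁.prod A₂).act (regroup ((1 : G × H₁), k)) m :=
    funext fun k => Prod.ext (A₁.one_act m.1).symm rfl
  rw [e] at h'
  refine (congrArg (fun v : F₁ × F₂ => -v) (h.symm.trans h')).trans ?_
  exact (map_neg (show F₂ →L[ℝ] F₁ × F₂ from sliceSnd I₁ I₂ m) _).symm

lemma orbit_prod_lieIncl₁ : (A₁.prod A₂).orbit m α ∘ₗ lieIncl₁ G H₁ H₂ JG J₁ J₂ =
    A₁.orbit m.1 (α.comp (sliceFst I₁ I₂ m)) := by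
  ext x
  exact congrArg α (A₁.prod_fundamental_lieIncl₁ A₂ m x)

lemma orbit_prod_lieIncl₂ : (A₁.prod A₂).orbit m α ∘ₗ lieIncl₂ G H₁ H₂ JG J₁ J₂ =
    A₂.orbit m.2 (α.comp (sliceSnd I₁ I₂ m)) := by
  ext x
  exact congrArg α (A₁.prod_fundamental_lieIncl₂ A₂ m x)

lemma orbit_prod (v : GroupLieAlgebra (JG.prod (JG.prod (J₁.prod J₂))) (G × G × H₁ × H₂)) :
    (A₁.prod A₂).orbit m α v = A₁.orbit m.1 (α.comp (sliceFst I₁ I₂ m)) (lieProj₁ v) +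
      A₂.orbit m.2 (α.comp (sliceSnd I₁ I₂ m)) (lieProj₂ v) := by
  rw [← A₁.orbit_prod_lieIncl₁ A₂, ← A₁.orbit_prod_lieIncl₂ A₂]
  conv_lhs => rw [lieIncl_lieProj v, map_add]
  rfl

end SmoothAction

end ProductAction

section ProductHamiltonian

open DefSpace

variable {EG HG G E₁ HH₁ H₁ E₂ HH₂ H₂ : Type*}
  [NormedAddCommGroup EG] [NormedSpace ℝ EG] [TopologicalSpace HG] {JG : ModelWithCorners ℝ EG HG}
  [TopologicalSpace G] [ChartedSpace HG G] [Group G]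
  [NormedAddCommGroup E₁] [NormedSpace ℝ E₁] [TopologicalSpace HH₁]
  {J₁ : ModelWithCorners ℝ E₁ HH₁} [TopologicalSpace H₁] [ChartedSpace HH₁ H₁] [Group H₁]
  [NormedAddCommGroup E₂] [NormedSpace ℝ E₂] [TopologicalSpace HH₂]
  {J₂ : ModelWithCorners ℝ E₂ HH₂} [TopologicalSpace H₂] [ChartedSpace HH₂ H₂] [Group H₂]
  [FiniteDimensional ℝ EG] [FiniteDimensional ℝ E₁] [FiniteDimensional ℝ E₂]
  [JG.Boundaryless] [J₁.Boundaryless] [J₂.Boundaryless]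
  [LieGroup JG ∞ G] [LieGroup J₁ ∞ H₁] [LieGroup J₂ ∞ H₂]
  {BG : InvariantForm JG G} {B₁ : InvariantForm J₁ H₁} {B₂ : InvariantForm J₂ H₂}
  {F₁ A₁' M₁ F₂ A₂' M₂ : Type*}
  [NormedAddCommGroup F₁] [NormedSpace ℝ F₁] [TopologicalSpace A₁']
  {I₁ : ModelWithCorners ℝ F₁ A₁'} [TopologicalSpace M₁] [ChartedSpace A₁' M₁]
  [NormedAddCommGroup F₂] [NormedSpace ℝ F₂] [TopologicalSpace A₂']
  {I₂ : ModelWithCorners ℝ F₂ A₂'} [TopologicalSpace M₂] [ChartedSpace A₂' M₂]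

/-- The Cartan trivector field of a product is the sum of those of the factors. -/
lemma cartanField_prod (A₁ : SmoothAction (JG.prod J₁) (G × H₁) I₁ M₁)
    (A₂ : SmoothAction (JG.prod J₂) (G × H₂) I₂ M₂) (m : M₁ × M₂)
    (α β γ : Covector (I₁.prod I₂) m) :
    cartanField (BG.prod (BG.prod (B₁.prod B₂))) (A₁.prod A₂) m ![α, β, γ] =
      cartanField (BG.prod B₁) A₁ m.1 ![α.comp (sliceFst I₁ I₂ m), β.comp (sliceFst I₁ I₂ m),
        γ.comp (sliceFst I₁ I₂ m)] +
      cartanField (BG.prod B₂) A₂ m.2 ![α.comp (sliceSnd I₁ I₂ m), β.comp (sliceSnd I₁ I₂ m),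
        γ.comp (sliceSnd I₁ I₂ m)] := by
  rw [cartanField_apply, cartanField_apply, cartanField_apply, cartan_lieIncl]
  simp only [A₁.orbit_prod_lieIncl₁ A₂, A₁.orbit_prod_lieIncl₂ A₂]
  ring

lemma prodBivector_invariant {A₁ : SmoothAction (JG.prod J₁) (G × H₁) I₁ M₁}
    {A₂ : SmoothAction (JG.prod J₂) (G × H₂) I₂ M₂} {P₁ : ∀ m : M₁, MultiVector I₁ 2 m}
    {P₂ : ∀ m : M₂, MultiVector I₂ 2 m}
    (h₁ : ∀ k m, P₁ (A₁.act k m) = pushforward (mfderiv I₁ I₁ (A₁.act k) m) (P₁ m))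
    (h₂ : ∀ k m, P₂ (A₂.act k m) = pushforward (mfderiv I₂ I₂ (A₂.act k) m) (P₂ m))
    (k : G × G × H₁ × H₂) (m : M₁ × M₂) :
    prodBivector P₁ P₂ ((A₁.prod A₂).act k m) =
      pushforward (mfderiv (I₁.prod I₂) (I₁.prod I₂) ((A₁.prod A₂).act k) m)
        (prodBivector P₁ P₂ m) := by
  refine (prodBivector_map P₁ P₂ (P₁' := P₁) (P₂' := P₂) (Φ₁ := A₁.act (k.1, k.2.2.1))
    (Φ₂ := A₂.act (k.2.1, k.2.2.2)) (m := m) 1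
    ((A₁.smooth_act _).mdifferentiable (by simp) _) ((A₂.smooth_act _).mdifferentiable (by simp) _)
    ((h₁ _ _).trans (one_smul ℝ _).symm) ((h₂ _ _).trans (one_smul ℝ _).symm)).trans
    (one_smul ℝ _)

variable [FiniteDimensional ℝ F₁] [FiniteDimensional ℝ F₂] [IsManifold I₁ ∞ M₁]
  [IsManifold I₂ ∞ M₂] [T2Space M₁] [T2Space M₂] [BoundarylessManifold I₁ M₁]
  [BoundarylessManifold I₂ M₂]

/-- The product of two Hamiltonian quasi-Poisson manifolds, for the product of the groups with its
factors reordered. -/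
theorem QPSpace.IsHamiltonian.prod {X₁ : QPSpace (JG.prod J₁) (G × H₁) I₁ M₁}
    {X₂ : QPSpace (JG.prod J₂) (G × H₂) I₂ M₂} (h₁ : X₁.IsHamiltonian (BG.prod B₁))
    (h₂ : X₂.IsHamiltonian (BG.prod B₂)) :
    (X₁.prod X₂).IsHamiltonian (BG.prod (BG.prod (B₁.prod B₂))) where
  smooth_bivector := isSmoothField_prodBivector h₁.smooth_bivector h₂.smooth_bivector
  invariant := prodBivector_invariant h₁.invariant h₂.invariant
  quasi_jacobi := h₁.quasi_jacobi.prod h₁.smooth_bivector h₂.smooth_bivector h₂.quasi_jacobi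
    (cartanField_prod X₁.action X₂.action)
  smooth_moment := contMDiff_regroup.comp ((h₁.smooth_moment.comp contMDiff_fst).prodMk
    (h₂.smooth_moment.comp contMDiff_snd))
  equivariant k m := by
    have e₁ := h₁.equivariant (k.1, k.2.2.1) m.1
    have e₂ := h₂.equivariant (k.2.1, k.2.2.2) m.2
    exact congrArg₂ (fun a b => regroup (a, b)) e₁ e₂
  moment_condition m ξ α := by
    have := isManifold_of_lieGroup (JG.prod (JG.prod (J₁.prod J₂))) (G × G × H₁ × H₂)
    have := t2Space_of_lieGroup (JG.prod (JG.prod (J₁.prod J₂))) (G × G × H₁ × H₂)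
    obtain ⟨f, hf, rfl⟩ := exists_differential_eq ξ
    have hμ : ContMDiff (I₁.prod I₂) (JG.prod (JG.prod (J₁.prod J₂))) ∞ (X₁.prod X₂).moment :=
      contMDiff_regroup.comp ((h₁.smooth_moment.comp contMDiff_fst).prodMk
        (h₂.smooth_moment.comp contMDiff_snd))
    have hfμ : ContMDiff (I₁.prod I₂) 𝓘(ℝ, ℝ) ∞ fun p => f ((X₁.prod X₂).moment p) := hf.comp hμ
    have e : (differential (JG.prod (JG.prod (J₁.prod J₂))) f ((X₁.prod X₂).moment m)).comp
        (mfderiv (I₁.prod I₂) (JG.prod (JG.prod (J₁.prod J₂))) (X₁.prod X₂).moment m) =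
        differential (I₁.prod I₂) (fun p => f ((X₁.prod X₂).moment p)) m :=
      (differential_comp (f := f) (g := (X₁.prod X₂).moment) (hf.mdifferentiable (by simp) _)
        (hμ.mdifferentiable (by simp) m)).symm
    rw [e, momentVector_differential hf]
    refine (prodBivector_apply X₁.bivector X₂.bivector m _ α).trans ?_
    rw [differential_comp_sliceFst (hfμ.mdifferentiable (by simp) m),
      differential_comp_sliceSnd (hfμ.mdifferentiable (by simp) m)]
    have f₁ : ContMDiff (JG.prod J₁) 𝓘(ℝ, ℝ) ∞ fun k => f (regroup (k, X₂.moment m.2)) :=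
      hf.comp (contMDiff_incl₁ _)
    have f₂ : ContMDiff (JG.prod J₂) 𝓘(ℝ, ℝ) ∞ fun k => f (regroup (X₁.moment m.1, k)) :=
      hf.comp (contMDiff_incl₂ _)
    have d₁ : differential I₁ (fun x => f ((X₁.prod X₂).moment (x, m.2))) m.1 =
        (differential (JG.prod J₁) (fun k => f (regroup (k, X₂.moment m.2))) (X₁.moment m.1)).comp
          (mfderiv I₁ (JG.prod J₁) X₁.moment m.1) :=
      differential_comp (f := fun k => f (regroup (k, X₂.moment m.2))) (g := X₁.moment)
        (f₁.mdifferentiable (by simp) _) (h₁.smooth_moment.mdifferentiable (by simp) _)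
    have d₂ : differential I₂ (fun y => f ((X₁.prod X₂).moment (m.1, y))) m.2 =
        (differential (JG.prod J₂) (fun k => f (regroup (X₁.moment m.1, k))) (X₂.moment m.2)).comp
          (mfderiv I₂ (JG.prod J₂) X₂.moment m.2) :=
      differential_comp (f := fun k => f (regroup (X₁.moment m.1, k))) (g := X₂.moment)
        (f₂.mdifferentiable (by simp) _) (h₂.smooth_moment.mdifferentiable (by simp) _)
    rw [d₁, d₂, h₁.moment_condition, h₂.moment_condition, momentVector_differential f₁,
      momentVector_differential f₂]
    refine Eq.trans ?_ (X₁.action.orbit_prod X₂.action m α _).symm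
    rw [lieProj₁_sharp, lieProj₂_sharp]
    have l₁ := leftFun_lieIncl₁ hf (X₁.moment m.1) (X₂.moment m.2)
    have r₁ := rightFun_lieIncl₁ hf (X₁.moment m.1) (X₂.moment m.2)
    have l₂ := leftFun_lieIncl₂ hf (X₁.moment m.1) (X₂.moment m.2)
    have r₂ := rightFun_lieIncl₂ hf (X₁.moment m.1) (X₂.moment m.2)
    rw [← l₁, ← r₁, ← l₂, ← r₂]
    rfl

/-- The product of two Hamiltonian Poisson manifolds, for the product of the groups with its factors
reordered. -/
theorem PSpace.IsHamiltonian.prod {Y₁ : PSpace (JG.prod J₁) (G × H₁) I₁ M₁}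
    {Y₂ : PSpace (JG.prod J₂) (G × H₂) I₂ M₂} (h₁ : Y₁.IsHamiltonian (BG.prod B₁))
    (h₂ : Y₂.IsHamiltonian (BG.prod B₂)) :
    (Y₁.prod Y₂).IsHamiltonian (BG.prod (BG.prod (B₁.prod B₂))) where
  smooth_bivector := isSmoothField_prodBivector h₁.smooth_bivector h₂.smooth_bivector
  invariant := prodBivector_invariant h₁.invariant h₂.invariant
  jacobi := h₁.jacobi.prod h₁.smooth_bivector h₂.smooth_bivector h₂.jacobi
    fun _ _ _ _ => (add_zero (0 : ℝ)).symm
  smooth_moment := by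
    have k₁ : ContMDiff (I₁.prod I₂) 𝓘(ℝ, EG × E₁) ∞
        (show M₁ × M₂ → EG × E₁ from fun m => Y₁.moment m.1) :=
      h₁.smooth_moment.comp contMDiff_fst
    have k₂ : ContMDiff (I₁.prod I₂) 𝓘(ℝ, EG × E₂) ∞
        (show M₁ × M₂ → EG × E₂ from fun m => Y₂.moment m.2) :=
      h₂.smooth_moment.comp contMDiff_snd
    have c₁ := (contDiff_fst (𝕜 := ℝ) (E := EG) (F := E₁) (n := ∞)).contMDiff.comp k₁
    have c₂ := (contDiff_fst (𝕜 := ℝ) (E := EG) (F := E₂) (n := ∞)).contMDiff.comp k₂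
    have c₃ := (contDiff_snd (𝕜 := ℝ) (E := EG) (F := E₁) (n := ∞)).contMDiff.comp k₁
    have c₄ := (contDiff_snd (𝕜 := ℝ) (E := EG) (F := E₂) (n := ∞)).contMDiff.comp k₂
    exact c₁.prodMk_space (c₂.prodMk_space (c₃.prodMk_space c₄))
  equivariant k m := by
    have e₁ := h₁.equivariant (k.1, k.2.2.1) m.1
    have e₂ := h₂.equivariant (k.2.1, k.2.2.2) m.2
    refine (congrArg₂ lieRegroup e₁ e₂).trans ?_
    simp only [Ad_prod]
    rfl
  moment_condition m x α := by
    have e : (fun p => (BG.prod (BG.prod (B₁.prod B₂))).form ((Y₁.prod Y₂).moment p) x) =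
        fun p : M₁ × M₂ => (BG.prod B₁).form (Y₁.moment p.1) (lieProj₁ x) +
          (BG.prod B₂).form (Y₂.moment p.2) (lieProj₂ x) :=
      funext fun p => form_lieProj BG B₁ B₂ _ x
    have k₁ : ContMDiff I₁ 𝓘(ℝ, ℝ) ∞ fun p => (BG.prod B₁).form (Y₁.moment p) (lieProj₁ x) :=
      (LinearMap.toContinuousLinearMap
        ((BG.prod B₁).form.flip (lieProj₁ x) : EG × E₁ →ₗ[ℝ] ℝ)).contMDiff.comp h₁.smooth_moment
    have k₂ : ContMDiff I₂ 𝓘(ℝ, ℝ) ∞ fun p => (BG.prod B₂).form (Y₂.moment p) (lieProj₂ x) :=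
      (LinearMap.toContinuousLinearMap
        ((BG.prod B₂).form.flip (lieProj₂ x) : EG × E₂ →ₗ[ℝ] ℝ)).contMDiff.comp h₂.smooth_moment
    have hd : MDifferentiableAt (I₁.prod I₂) 𝓘(ℝ, ℝ) (fun p : M₁ × M₂ =>
        (BG.prod B₁).form (Y₁.moment p.1) (lieProj₁ x) +
          (BG.prod B₂).form (Y₂.moment p.2) (lieProj₂ x)) m :=
      ((k₁.comp contMDiff_fst).add (k₂.comp contMDiff_snd)).mdifferentiable (by simp) m
    rw [e]
    refine (prodBivector_apply Y₁.bivector Y₂.bivector m _ α).trans ?_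
    refine Eq.trans ?_ (Y₁.action.orbit_prod Y₂.action m α x).symm
    refine congrArg₂ (fun x y : ℝ => x + y) ?_ ?_
    · refine Eq.trans ?_ (h₁.moment_condition m.1 (lieProj₁ x) (α.comp (sliceFst I₁ I₂ m)))
      refine congrArg (fun β => Y₁.bivector m.1 ![β, α.comp (sliceFst I₁ I₂ m)]) ?_
      refine (differential_comp_sliceFst hd).trans ?_
      refine (differential_add
        (f := fun p => (BG.prod B₁).form (Y₁.moment p) (lieProj₁ x))
        (g := fun _ => (BG.prod B₂).form (Y₂.moment m.2) (lieProj₂ x)) (m := m.1)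
        (k₁.mdifferentiable (by simp) _) mdifferentiableAt_const).trans ?_
      rw [differential_const, add_zero]
    · refine Eq.trans ?_ (h₂.moment_condition m.2 (lieProj₂ x) (α.comp (sliceSnd I₁ I₂ m)))
      refine congrArg (fun β => Y₂.bivector m.2 ![β, α.comp (sliceSnd I₁ I₂ m)]) ?_
      refine (differential_comp_sliceSnd hd).trans ?_
      refine (differential_add (m := m.2)
        (f := fun _ => (BG.prod B₁).form (Y₁.moment m.1) (lieProj₁ x))
        (g := fun p => (BG.prod B₂).form (Y₂.moment p) (lieProj₂ x))
        mdifferentiableAt_const (k₂.mdifferentiable (by simp) _)).trans ?_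
      rw [differential_const, zero_add]

end ProductHamiltonian

/-! ### Charts adapted to a submersion onto the unit interval -/

section ModelMap

variable {E H : Type*} [NormedAddCommGroup E] [NormedSpace ℝ E] [TopologicalSpace H]
  (I : ModelWithCorners ℝ E H)

/-- A linear change of coordinates in a model with corners, between open sets that it matches. -/
def modelMap (L : E ≃L[ℝ] E) {U V : Set H} (hU : IsOpen U) (hV : IsOpen V)
    (hUV : ∀ u ∈ U, L (I u) ∈ range I ∧ I.symm (L (I u)) ∈ V)
    (hVU : ∀ v ∈ V, L.symm (I v) ∈ range I ∧ I.symm (L.symm (I v)) ∈ U) :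
    OpenPartialHomeomorph H H where
  toFun u := I.symm (L (I u))
  invFun v := I.symm (L.symm (I v))
  source := U
  target := V
  map_source' u hu := (hUV u hu).2
  map_target' v hv := (hVU v hv).2
  left_inv' u hu := by rw [I.right_inv (hUV u hu).1, L.symm_apply_apply, I.left_inv]
  right_inv' v hv := by rw [I.right_inv (hVU v hv).1, L.apply_symm_apply, I.left_inv]
  open_source := hU
  open_target := hV
  continuousOn_toFun := (I.continuous_symm.comp (L.continuous.comp I.continuous)).continuousOn
  continuousOn_invFun :=
    (I.continuous_symm.comp (L.symm.continuous.comp I.continuous)).continuousOn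

lemma modelMap_mem_contDiffGroupoid (L : E ≃L[ℝ] E) {U V : Set H} (hU : IsOpen U) (hV : IsOpen V)
    (hUV : ∀ u ∈ U, L (I u) ∈ range I ∧ I.symm (L (I u)) ∈ V)
    (hVU : ∀ v ∈ V, L.symm (I v) ∈ range I ∧ I.symm (L.symm (I v)) ∈ U) :
    modelMap I L hU hV hUV hVU ∈ contDiffGroupoid ∞ I := by
  rw [contDiffGroupoid, mem_groupoid_of_pregroupoid]
  constructor
  · refine L.contDiff.contDiffOn.congr fun x hx => ?_
    change I (I.symm (L (I (I.symm x)))) = L x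
    rw [I.right_inv (hUV _ hx.1).1, I.right_inv hx.2]
  · refine L.symm.contDiff.contDiffOn.congr fun x hx => ?_
    change I (I.symm (L.symm (I (I.symm x)))) = L.symm x
    rw [I.right_inv (hVU _ hx.1).1, I.right_inv hx.2]

variable {M : Type*} [TopologicalSpace M] [ChartedSpace H M] {I}

lemma trans_mem_maximalAtlas {e : OpenPartialHomeomorph M H} {g : OpenPartialHomeomorph H H}
    (he : e ∈ IsManifold.maximalAtlas I ∞ M) (hg : g ∈ contDiffGroupoid ∞ I) :
    e.trans g ∈ IsManifold.maximalAtlas I ∞ M := by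
  intro e' he'
  constructor
  · rw [OpenPartialHomeomorph.trans_symm_eq_symm_trans_symm, OpenPartialHomeomorph.trans_assoc]
    exact (contDiffGroupoid ∞ I).trans ((contDiffGroupoid ∞ I).symm hg) (he e' he').1
  · rw [← OpenPartialHomeomorph.trans_assoc]
    exact (contDiffGroupoid ∞ I).trans (he e' he').2 hg

/-- Interior points may be recognised in any chart of the maximal atlas, by invariance of the
boundary under diffeomorphisms. -/
lemma isInteriorPoint_iff_of_mem_maximalAtlas {e : OpenPartialHomeomorph M H}
    (he : e ∈ IsManifold.maximalAtlas I ∞ M) {x : M} (hx : x ∈ e.source) :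
    I.IsInteriorPoint x ↔ I (e x) ∈ interior (range I) := by
  let Φ : PartialDiffeomorph I I M H ∞ :=
    { e.toPartialEquiv with
      open_source := e.open_source
      open_target := e.open_target
      contMDiffOn_toFun := contMDiffOn_of_mem_maximalAtlas he
      contMDiffOn_invFun := contMDiffOn_symm_of_mem_maximalAtlas he }
  have h := (Φ.isLocalDiffeomorphAt I I ∞ hx).isInteriorPoint_iff (by simp)
  exact h.trans Iff.rfl

end ModelMap

section HalfModel

variable {n : ℕ}

lemma mem_range_halfModel {u : EuclideanSpace ℝ (Fin 1) × EuclideanSpace ℝ (Fin n)} :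
    u ∈ range (halfModel n) ↔ 0 ≤ u.1 0 := by
  rw [ModelWithCorners.range_prod, range_modelWithCornersEuclideanHalfSpace]
  simp

lemma mem_interior_range_halfModel {u : EuclideanSpace ℝ (Fin 1) × EuclideanSpace ℝ (Fin n)} :
    u ∈ interior (range (halfModel n)) ↔ 0 < u.1 0 := by
  rw [ModelWithCorners.range_prod, interior_prod_eq,
    interior_range_modelWithCornersEuclideanHalfSpace]
  simp

end HalfModel

section AdaptedChart

variable {n : ℕ} {Q : Type*} [TopologicalSpace Q] [ChartedSpace (HalfSpace n) Q]
  [IsManifold (halfModel n) ∞ Q]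

/-- The charts of `Q` in which `π` is the first coordinate, when `[0, 1]` is read in its preferred
chart at `t`. -/
structure IsAdaptedChart (π : Q → Icc (0 : ℝ) 1) (t : Icc (0 : ℝ) 1)
    (e : OpenPartialHomeomorph Q (HalfSpace n)) : Prop where
  mem_maximalAtlas : e ∈ IsManifold.maximalAtlas (halfModel n) ∞ Q
  proj_mem : ∀ p ∈ e.source, π p ∈ (chartAt (EuclideanHalfSpace 1) t).source
  apply_fst : ∀ p ∈ e.source, (e p).1 = chartAt (EuclideanHalfSpace 1) t (π p)

open Manifold in
/-- A nonzero linear functional that vanishes at a point of an open subset of the half space and is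
nonnegative on that subset is a positive multiple of the first coordinate. -/
lemma halfModel_functional {ρ : EuclideanSpace ℝ (Fin 1) × EuclideanSpace ℝ (Fin n) →L[ℝ] ℝ}
    {U : Set (HalfSpace n)} (hU : IsOpen U) {u₀ : HalfSpace n} (hu₀ : u₀ ∈ U)
    (h0 : ρ (halfModel n u₀) = 0) (hρ : ∀ u ∈ U, 0 ≤ ρ (halfModel n u)) (hne : ρ ≠ 0) :
    ∃ a : ℝ, 0 < a ∧ ∀ v, ρ v = a * v.1 0 := by
  have key : ∀ w : EuclideanSpace ℝ (Fin 1) × EuclideanSpace ℝ (Fin n), 0 ≤ w.1 0 → 0 ≤ ρ w := by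
    intro w hw
    have hc : ContinuousAt (fun ε : ℝ => (halfModel n).symm (halfModel n u₀ + ε • w)) 0 :=
      ((halfModel n).continuous_symm.comp
        (continuous_const.add (continuous_id.smul continuous_const))).continuousAt
    have hmem : ∀ᶠ ε : ℝ in 𝓝 0, (halfModel n).symm (halfModel n u₀ + ε • w) ∈ U := by
      refine hc.preimage_mem_nhds (hU.mem_nhds ?_)
      rwa [zero_smul, add_zero, (halfModel n).left_inv]
    obtain ⟨ε, hεU, hε⟩ := ((hmem.filter_mono nhdsWithin_le_nhds).and
      (self_mem_nhdsWithin (a := (0 : ℝ)) (s := Ioi 0))).exists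
    have hr : halfModel n u₀ + ε • w ∈ range (halfModel n) := by
      rw [mem_range_halfModel]
      have h1 : 0 ≤ (halfModel n u₀).1 0 := mem_range_halfModel.1 (mem_range_self u₀)
      exact add_nonneg h1 (mul_nonneg (le_of_lt hε) hw)
    have h := hρ _ hεU
    rw [(halfModel n).right_inv hr, map_add, h0, map_smul, zero_add, smul_eq_mul] at h
    exact nonneg_of_mul_nonneg_right h hε
  have hy : ∀ y : EuclideanSpace ℝ (Fin n), ρ (0, y) = 0 := by
    intro y
    refine le_antisymm ?_ (key _ le_rfl)
    have h := key (-(0, y)) (by simp)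
    rw [map_neg] at h
    linarith
  let e₀ : EuclideanSpace ℝ (Fin 1) := EuclideanSpace.single 0 1
  have hv : ∀ v, ρ v = ρ (e₀, 0) * v.1 0 := by
    rintro ⟨x, y⟩
    have hx : x = x 0 • e₀ := by
      ext i
      fin_cases i
      simp [e₀]
    have h : (x, y) = x 0 • (e₀, (0 : EuclideanSpace ℝ (Fin n))) + (0, y) := by
      refine Prod.ext ?_ ?_
      · simpa using hx
      · simp
    calc ρ (x, y) = ρ (x 0 • (e₀, (0 : EuclideanSpace ℝ (Fin n))) + (0, y)) := by rw [← h]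
      _ = _ := by rw [map_add, hy, add_zero, map_smul, smul_eq_mul, mul_comm]
  refine ⟨ρ (e₀, 0), lt_of_le_of_ne (key _ (by simp [e₀])) fun h => hne ?_, hv⟩
  refine ContinuousLinearMap.ext fun v => ?_
  rw [hv, ← h, zero_mul]
  rfl

variable {π : Q → Icc (0 : ℝ) 1}

/-- A submersion onto `[0, 1]` with all boundary points over `0` and `1` has adapted charts. The
definition of a submersion provides a chart in which `π` is a coordinate of some linear splitting of
the model space. Over an interior parameter, any linear change of coordinates that turns it into the
first coordinate will do. Over an end point of `[0, 1]` the boundary of the half space has to be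
preserved, and there the functional is already a positive multiple of the first coordinate. -/
theorem exists_isAdaptedChart (hπ : Manifold.IsSubmersion (halfModel n) (𝓡∂ 1) ∞ π)
    (hint : ∀ q, 0 < (π q : ℝ) → (π q : ℝ) < 1 → (halfModel n).IsInteriorPoint q) (q : Q) :
    ∃ e : OpenPartialHomeomorph Q (HalfSpace n), q ∈ e.source ∧ IsAdaptedChart π (π q) e := by
  have hq := hπ.isSubmersionAt q
  let c₀ := chartAt (EuclideanHalfSpace 1) (π q)
  set d := hq.domChart with hd
  set c := hq.codChart with hc
  have hdm : d ∈ IsManifold.maximalAtlas (halfModel n) ∞ Q := hq.domChart_mem_maximalAtlas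
  have hcm : c ∈ IsManifold.maximalAtlas (𝓡∂ 1) ∞ (Icc (0 : ℝ) 1) := hq.codChart_mem_maximalAtlas
  have hqd : q ∈ d.source := hq.mem_domChart_source
  have hsrc : d.source ⊆ π ⁻¹' c.source := hq.source_subset_preimage_source
  have hcπ : ∀ p ∈ d.source, (𝓡∂ 1) (c (π p)) = (hq.equiv (halfModel n (d p))).1 := by
    intro p hp
    have h := hq.writtenInCharts ((d.extend (halfModel n)).map_source (by simpa using hp))
    simp only [Function.comp_apply] at h
    rw [← hd, (d.extend (halfModel n)).left_inv (by simpa using hp)] at h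
    exact h
  -- in the chart of the submersion, a linear change of coordinates makes `π` the first coordinate
  obtain ⟨g, hg, hgq, hgfst⟩ : ∃ g ∈ contDiffGroupoid ∞ (halfModel n), d q ∈ g.source ∧
      ∀ u ∈ g.source, (𝓡∂ 1) (g u).1 = (hq.equiv (halfModel n u)).1 := by
    by_cases ht : 0 < (π q : ℝ) ∧ (π q : ℝ) < 1
    · have i₁ : 0 < (halfModel n (d q)).1 0 := mem_interior_range_halfModel.1
        ((isInteriorPoint_iff_of_mem_maximalAtlas hdm hqd).1 (hint q ht.1 ht.2))
      have i₂ : 0 < (hq.equiv (halfModel n (d q))).1 0 := by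
        rw [← hcπ q hqd]
        have h := (isInteriorPoint_iff_of_mem_maximalAtlas hcm (hsrc hqd)).1
          (Icc_isInteriorPoint_interior ht)
        rwa [interior_range_modelWithCornersEuclideanHalfSpace] at h
      have : FiniteDimensional ℝ (EuclideanSpace ℝ (Fin 1) × hq.complement) :=
        hq.equiv.toLinearEquiv.finiteDimensional
      have : FiniteDimensional ℝ hq.complement :=
        FiniteDimensional.of_surjective (LinearMap.snd ℝ (EuclideanSpace ℝ (Fin 1)) hq.complement)
          Prod.snd_surjective
      have hrank := hq.equiv.toLinearEquiv.finrank_eq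
      rw [Module.finrank_prod, Module.finrank_prod] at hrank
      let L := hq.equiv.trans ((ContinuousLinearEquiv.refl ℝ (EuclideanSpace ℝ (Fin 1))).prodCongr
        (ContinuousLinearEquiv.ofFinrankEq (Nat.add_left_cancel hrank).symm))
      have hL : Continuous fun u => L (halfModel n u) := L.continuous.comp (halfModel n).continuous
      have hL' : Continuous fun u => L.symm (halfModel n u) :=
        L.symm.continuous.comp (halfModel n).continuous
      let R := interior (range (halfModel n))
      refine ⟨modelMap (halfModel n) L (U := {u | halfModel n u ∈ R ∧ L (halfModel n u) ∈ R})
        (V := {u | halfModel n u ∈ R ∧ L.symm (halfModel n u) ∈ R})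
        ((isOpen_interior.preimage (halfModel n).continuous).inter (isOpen_interior.preimage hL))
        ((isOpen_interior.preimage (halfModel n).continuous).inter (isOpen_interior.preimage hL'))
        (fun u hu => ?_) (fun v hv => ?_), modelMap_mem_contDiffGroupoid _ _ _ _ _ _,
        ⟨mem_interior_range_halfModel.2 i₁, mem_interior_range_halfModel.2 i₂⟩, fun u hu => ?_⟩
      · have h := interior_subset hu.2
        simp only [mem_ofPred_eq, (halfModel n).right_inv h, L.symm_apply_apply]
        exact ⟨h, hu.2, hu.1⟩
      · have h := interior_subset hv.2
        simp only [mem_ofPred_eq, (halfModel n).right_inv h, L.apply_symm_apply]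
        exact ⟨h, hv.2, hv.1⟩
      · exact congrArg Prod.fst ((halfModel n).right_inv (interior_subset hu.2))
    · let ρ : EuclideanSpace ℝ (Fin 1) × EuclideanSpace ℝ (Fin n) →L[ℝ] ℝ :=
        (EuclideanSpace.proj (0 : Fin 1)).comp
          ((ContinuousLinearMap.fst ℝ _ _).comp hq.equiv.toContinuousLinearMap)
      have hne : ρ ≠ 0 := by
        intro h
        have h1 := DFunLike.congr_fun h (hq.equiv.symm (EuclideanSpace.single 0 1, 0))
        simp [ρ] at h1
      have hnn : ∀ u ∈ d.target, 0 ≤ ρ (halfModel n u) := by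
        intro u hu
        have h := hcπ _ (d.map_target hu)
        rw [d.right_inv hu] at h
        change 0 ≤ (hq.equiv (halfModel n u)).1 0
        rw [← h]
        exact (c (π (d.symm u))).2
      -- otherwise `π q` would be an interior point of `[0, 1]`
      have h0 : ρ (halfModel n (d q)) = 0 := by
        refine le_antisymm (not_lt.1 fun hpos => ht ?_) (hnn _ (d.map_source hqd))
        have h1 : (𝓡∂ 1).IsInteriorPoint (π q) := by
          rw [isInteriorPoint_iff_of_mem_maximalAtlas hcm (hsrc hqd), hcπ q hqd,
            interior_range_modelWithCornersEuclideanHalfSpace]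
          exact hpos
        have h2 : π q ∉ (𝓡∂ 1).boundary (Icc (0 : ℝ) 1) := fun hb =>
          ((𝓡∂ 1).isInteriorPoint_iff_not_isBoundaryPoint _).1 h1 hb
        rw [boundary_Icc] at h2
        simp only [mem_insert_iff, mem_singleton_iff, not_or] at h2
        exact ⟨lt_of_le_of_ne (π q).2.1 fun h => h2.1 (Subtype.ext h.symm),
          lt_of_le_of_ne (π q).2.2 fun h => h2.2 (Subtype.ext h)⟩
      obtain ⟨a, ha, hρ⟩ := halfModel_functional d.open_target (d.map_source hqd) h0 hnn hne
      let L : (EuclideanSpace ℝ (Fin 1) × EuclideanSpace ℝ (Fin n)) ≃L[ℝ] _ :=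
        (ContinuousLinearEquiv.smulLeft (Units.mk0 a ha.ne')).prodCongr
        (ContinuousLinearEquiv.refl ℝ (EuclideanSpace ℝ (Fin n)))
      have hL : ∀ u : HalfSpace n, L (halfModel n u) ∈ range (halfModel n) := fun u =>
        mem_range_halfModel.2 (mul_nonneg ha.le u.1.2)
      have hL' : ∀ u : HalfSpace n, L.symm (halfModel n u) ∈ range (halfModel n) := fun u =>
        mem_range_halfModel.2 (mul_nonneg (inv_nonneg.2 ha.le) u.1.2)
      refine ⟨modelMap (halfModel n) L (U := univ) (V := univ) isOpen_univ isOpen_univ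
        (fun u _ => ⟨hL u, trivial⟩) (fun v _ => ⟨hL' v, trivial⟩),
        modelMap_mem_contDiffGroupoid _ _ _ _ _ _, trivial, fun u hu => ?_⟩
      refine (congrArg Prod.fst ((halfModel n).right_inv (hL u))).trans ?_
      ext i
      fin_cases i
      exact (hρ (halfModel n u)).symm
  -- finally, the chart of `[0, 1]` is replaced by the preferred one
  have hτ := (contDiffGroupoid_prod (StructureGroupoid.compatible_of_mem_maximalAtlas hcm
    (IsManifold.chart_mem_maximalAtlas (I := 𝓡∂ 1) (n := ∞) (π q)))
    ((contDiffGroupoid ∞ (𝓡 n)).id_mem))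
  have hdg : ∀ p ∈ d.source ∩ d ⁻¹' g.source, (g (d p)).1 = c (π p) := by
    intro p hp
    refine (𝓡∂ 1).injective ?_
    rw [hgfst _ hp.2, hcπ p hp.1]
  have hmem := trans_mem_maximalAtlas (trans_mem_maximalAtlas hdm hg) hτ
  refine ⟨_, ?_, hmem, ?_, ?_⟩
  · refine ⟨⟨hqd, hgq⟩, ⟨?_, ?_⟩, trivial⟩
    · change (g (d q)).1 ∈ c.target
      rw [hdg q ⟨hqd, hgq⟩]
      exact c.map_source (hsrc hqd)
    · change c.symm (g (d q)).1 ∈ c₀.source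
      rw [hdg q ⟨hqd, hgq⟩, c.left_inv (hsrc hqd)]
      exact mem_chart_source _ (π q)
  · rintro p ⟨hp, ⟨-, h⟩, -⟩
    change c.symm (g (d p)).1 ∈ c₀.source at h
    rwa [hdg p hp, c.left_inv (hsrc hp.1)] at h
  · rintro p ⟨hp, -⟩
    change c₀ (c.symm (g (d p)).1) = _
    rw [hdg p hp, c.left_inv (hsrc hp.1)]

end AdaptedChart

/-! ### Fibre products over the unit interval -/

section HalfSpaceMaps

variable {n₁ n₂ : ℕ}

/-- The projection `[0, ∞) × ℝ^(n₁ + n₂) → [0, ∞) × ℝ^n₁`. -/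
def halfFst (u : HalfSpace (n₁ + n₂)) : HalfSpace n₁ :=
  (u.1, (EuclideanSpace.finAddEquivProd (𝕜 := ℝ) u.2).1)

/-- The projection `[0, ∞) × ℝ^(n₁ + n₂) → [0, ∞) × ℝ^n₂`. -/
def halfSnd (u : HalfSpace (n₁ + n₂)) : HalfSpace n₂ :=
  (u.1, (EuclideanSpace.finAddEquivProd (𝕜 := ℝ) u.2).2)

/-- The inverse of `(halfFst, halfSnd)` on pairs with the same first coordinate; on other pairs, the
first coordinate of the second point is ignored. -/
def halfGlue (u : HalfSpace n₁ × HalfSpace n₂) : HalfSpace (n₁ + n₂) :=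
  (u.1.1, (EuclideanSpace.finAddEquivProd (𝕜 := ℝ)).symm (u.1.2, u.2.2))

lemma halfFst_glue (u : HalfSpace n₁ × HalfSpace n₂) : halfFst (halfGlue u) = u.1 :=
  Prod.ext rfl (congrArg Prod.fst (EuclideanSpace.finAddEquivProd.apply_symm_apply (u.1.2, u.2.2)))

lemma halfSnd_glue {u : HalfSpace n₁ × HalfSpace n₂} (h : u.1.1 = u.2.1) :
    halfSnd (halfGlue u) = u.2 := by
  have h' := congrArg Prod.snd
    ((EuclideanSpace.finAddEquivProd (𝕜 := ℝ)).apply_symm_apply (u.1.2, u.2.2))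
  exact Prod.ext h h'

lemma halfGlue_fst_snd (u : HalfSpace (n₁ + n₂)) : halfGlue (halfFst u, halfSnd u) = u :=
  Prod.ext rfl (EuclideanSpace.finAddEquivProd.symm_apply_apply u.2)

lemma contMDiff_halfFst :
    ContMDiff (halfModel (n₁ + n₂)) (halfModel n₁) ∞ (halfFst (n₁ := n₁) (n₂ := n₂)) := by
  have h : ContDiff ℝ ∞ fun v : EuclideanSpace ℝ (Fin 1) × EuclideanSpace ℝ (Fin (n₁ + n₂)) =>
      (v.1, (EuclideanSpace.finAddEquivProd (𝕜 := ℝ) v.2).1) :=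
    contDiff_fst.prodMk (contDiff_fst.comp
      ((EuclideanSpace.finAddEquivProd (𝕜 := ℝ) (n := n₁) (m := n₂)).contDiff.comp contDiff_snd))
  refine ((halfModel n₁).contMDiffOn_symm.comp_contMDiff (h.contMDiff.comp
    (halfModel (n₁ + n₂)).contMDiff) fun u => ?_).congr fun u => ?_
  · exact mem_range_halfModel.2 u.1.2
  · exact ((halfModel n₁).left_inv (halfFst u)).symm

lemma contMDiff_halfSnd :
    ContMDiff (halfModel (n₁ + n₂)) (halfModel n₂) ∞ (halfSnd (n₁ := n₁) (n₂ := n₂)) := by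
  have h : ContDiff ℝ ∞ fun v : EuclideanSpace ℝ (Fin 1) × EuclideanSpace ℝ (Fin (n₁ + n₂)) =>
      (v.1, (EuclideanSpace.finAddEquivProd (𝕜 := ℝ) v.2).2) :=
    contDiff_fst.prodMk (contDiff_snd.comp
      ((EuclideanSpace.finAddEquivProd (𝕜 := ℝ) (n := n₁) (m := n₂)).contDiff.comp contDiff_snd))
  refine ((halfModel n₂).contMDiffOn_symm.comp_contMDiff (h.contMDiff.comp
    (halfModel (n₁ + n₂)).contMDiff) fun u => ?_).congr fun u => ?_
  · exact mem_range_halfModel.2 u.1.2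
  · exact ((halfModel n₂).left_inv (halfSnd u)).symm

lemma contMDiff_halfGlue : ContMDiff ((halfModel n₁).prod (halfModel n₂)) (halfModel (n₁ + n₂)) ∞
    (halfGlue : HalfSpace n₁ × HalfSpace n₂ → HalfSpace (n₁ + n₂)) := by
  have h : ContDiff ℝ ∞ fun v : (EuclideanSpace ℝ (Fin 1) × EuclideanSpace ℝ (Fin n₁)) ×
      (EuclideanSpace ℝ (Fin 1) × EuclideanSpace ℝ (Fin n₂)) =>
      (v.1.1, (EuclideanSpace.finAddEquivProd (𝕜 := ℝ)).symm (v.1.2, v.2.2)) :=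
    (contDiff_fst.comp contDiff_fst).prodMk
      ((EuclideanSpace.finAddEquivProd (𝕜 := ℝ) (n := n₁) (m := n₂)).symm.contDiff.comp
        ((contDiff_snd.comp contDiff_fst).prodMk (contDiff_snd.comp contDiff_snd)))
  refine ((halfModel (n₁ + n₂)).contMDiffOn_symm.comp_contMDiff (h.contMDiff.comp
    (((halfModel n₁).contMDiff.comp contMDiff_fst).prodMk_space
      ((halfModel n₂).contMDiff.comp contMDiff_snd))) fun u => ?_).congr fun u => ?_
  · exact mem_range_halfModel.2 u.1.1.2
  · exact ((halfModel (n₁ + n₂)).left_inv (halfGlue u)).symm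

end HalfSpaceMaps

section FibreProduct

variable {n₁ n₂ : ℕ} {Q₁ Q₂ : Type u} [TopologicalSpace Q₁] [ChartedSpace (HalfSpace n₁) Q₁]
  [TopologicalSpace Q₂] [ChartedSpace (HalfSpace n₂) Q₂]

/-- The fibre product of two spaces over the unit interval. -/
def FibreProduct (π₁ : Q₁ → Icc (0 : ℝ) 1) (π₂ : Q₂ → Icc (0 : ℝ) 1) : Type u :=
  {q : Q₁ × Q₂ // π₁ q.1 = π₂ q.2}

namespace FibreProduct

variable {π₁ : Q₁ → Icc (0 : ℝ) 1} {π₂ : Q₂ → Icc (0 : ℝ) 1}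

instance : TopologicalSpace (FibreProduct π₁ π₂) :=
  inferInstanceAs (TopologicalSpace {q : Q₁ × Q₂ // π₁ q.1 = π₂ q.2})

instance [T2Space Q₁] [T2Space Q₂] : T2Space (FibreProduct π₁ π₂) :=
  inferInstanceAs (T2Space {q : Q₁ × Q₂ // π₁ q.1 = π₂ q.2})

/-- The inclusion of the fibre product in the product. -/
def incl (q : FibreProduct π₁ π₂) : Q₁ × Q₂ := q.val

lemma incl_eq (q : FibreProduct π₁ π₂) : π₁ q.incl.1 = π₂ q.incl.2 := q.property

lemma ext_incl {q q' : FibreProduct π₁ π₂} (h : q.incl = q'.incl) : q = q' := Subtype.ext h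

lemma isEmbedding_incl : Topology.IsEmbedding (incl : FibreProduct π₁ π₂ → Q₁ × Q₂) :=
  Topology.IsEmbedding.subtypeVal

instance [SecondCountableTopology Q₁] [SecondCountableTopology Q₂] :
    SecondCountableTopology (FibreProduct π₁ π₂) :=
  isEmbedding_incl.secondCountableTopology

/-- The point of the fibre product given by a pair of points over the same parameter. -/
def mk (x : Q₁ × Q₂) (h : π₁ x.1 = π₂ x.2) : FibreProduct π₁ π₂ := ⟨x, h⟩

/-- The projection of the fibre product to the unit interval. -/
def proj (q : FibreProduct π₁ π₂) : Icc (0 : ℝ) 1 := π₁ q.incl.1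

open Classical in
/-- The point of the fibre product given by a pair, and a fixed point of the fibre product for the
pairs outside it. -/
def ofProd (a : FibreProduct π₁ π₂) (x : Q₁ × Q₂) : FibreProduct π₁ π₂ :=
  if h : π₁ x.1 = π₂ x.2 then mk x h else a

lemma incl_ofProd (a : FibreProduct π₁ π₂) {x : Q₁ × Q₂} (h : π₁ x.1 = π₂ x.2) :
    (ofProd a x).incl = x := by
  rw [ofProd, dif_pos h]
  rfl

lemma ofProd_incl (a q : FibreProduct π₁ π₂) : ofProd a q.incl = q :=
  ext_incl (incl_ofProd a q.incl_eq)

section Chart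

variable [IsManifold (halfModel n₁) ∞ Q₁] [IsManifold (halfModel n₂) ∞ Q₂]
  {t : Icc (0 : ℝ) 1} {e₁ : OpenPartialHomeomorph Q₁ (HalfSpace n₁)}
  {e₂ : OpenPartialHomeomorph Q₂ (HalfSpace n₂)}
  (h₁ : IsAdaptedChart π₁ t e₁) (h₂ : IsAdaptedChart π₂ t e₂)

include h₁ h₂ in
lemma apply_fst_eq {q : FibreProduct π₁ π₂} (hq₁ : q.incl.1 ∈ e₁.source)
    (hq₂ : q.incl.2 ∈ e₂.source) : (e₁ q.incl.1).1 = (e₂ q.incl.2).1 := by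
  rw [h₁.apply_fst _ hq₁, h₂.apply_fst _ hq₂, q.incl_eq]

include h₁ h₂ in
lemma symm_mem {u : HalfSpace (n₁ + n₂)} (hu₁ : halfFst u ∈ e₁.target)
    (hu₂ : halfSnd u ∈ e₂.target) : π₁ (e₁.symm (halfFst u)) = π₂ (e₂.symm (halfSnd u)) := by
  have m₁ := e₁.map_target hu₁
  have m₂ := e₂.map_target hu₂
  refine (chartAt (EuclideanHalfSpace 1) t).injOn (h₁.proj_mem _ m₁) (h₂.proj_mem _ m₂) ?_
  rw [← h₁.apply_fst _ m₁, ← h₂.apply_fst _ m₂, e₁.right_inv hu₁, e₂.right_inv hu₂]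
  rfl

/-- The chart of the fibre product given by adapted charts of the factors. -/
def chart (a : FibreProduct π₁ π₂) :
    OpenPartialHomeomorph (FibreProduct π₁ π₂) (HalfSpace (n₁ + n₂)) where
  toFun q := halfGlue (e₁ q.incl.1, e₂ q.incl.2)
  invFun u := ofProd a (e₁.symm (halfFst u), e₂.symm (halfSnd u))
  source := {q | q.incl.1 ∈ e₁.source ∧ q.incl.2 ∈ e₂.source}
  target := {u | halfFst u ∈ e₁.target ∧ halfSnd u ∈ e₂.target}
  map_source' q hq := by
    refine ⟨?_, ?_⟩
    · rw [halfFst_glue]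
      exact e₁.map_source hq.1
    · rw [halfSnd_glue (apply_fst_eq h₁ h₂ hq.1 hq.2)]
      exact e₂.map_source hq.2
  map_target' u hu := by
    have h := incl_ofProd a (x := (e₁.symm (halfFst u), e₂.symm (halfSnd u)))
      (symm_mem h₁ h₂ hu.1 hu.2)
    simp only [mem_ofPred_eq, h]
    exact ⟨e₁.map_target hu.1, e₂.map_target hu.2⟩
  left_inv' q hq := by
    rw [halfFst_glue, halfSnd_glue (apply_fst_eq h₁ h₂ hq.1 hq.2), e₁.left_inv hq.1,
      e₂.left_inv hq.2]
    exact ofProd_incl a q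
  right_inv' u hu := by
    rw [incl_ofProd a (symm_mem h₁ h₂ hu.1 hu.2), e₁.right_inv hu.1, e₂.right_inv hu.2,
      halfGlue_fst_snd]
  open_source := (e₁.open_source.preimage (continuous_fst.comp isEmbedding_incl.continuous)).inter
    (e₂.open_source.preimage (continuous_snd.comp isEmbedding_incl.continuous))
  open_target := (e₁.open_target.preimage contMDiff_halfFst.continuous).inter
    (e₂.open_target.preimage contMDiff_halfSnd.continuous)
  continuousOn_toFun := contMDiff_halfGlue.continuous.comp_continuousOn
    ((e₁.continuousOn.comp (continuous_fst.comp isEmbedding_incl.continuous).continuousOn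
      fun q hq => hq.1).prodMk (e₂.continuousOn.comp
        (continuous_snd.comp isEmbedding_incl.continuous).continuousOn fun q hq => hq.2))
  continuousOn_invFun := by
    rw [isEmbedding_incl.continuousOn_iff]
    refine ContinuousOn.congr (f := fun u => (e₁.symm (halfFst u), e₂.symm (halfSnd u))) ?_
      fun u hu => incl_ofProd a (symm_mem h₁ h₂ hu.1 hu.2)
    exact (e₁.continuousOn_symm.comp contMDiff_halfFst.continuous.continuousOn
      fun u hu => hu.1).prodMk (e₂.continuousOn_symm.comp
        contMDiff_halfSnd.continuous.continuousOn fun u hu => hu.2)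

variable {t' : Icc (0 : ℝ) 1} {e₁' : OpenPartialHomeomorph Q₁ (HalfSpace n₁)}
  {e₂' : OpenPartialHomeomorph Q₂ (HalfSpace n₂)}
  (h₁' : IsAdaptedChart π₁ t' e₁') (h₂' : IsAdaptedChart π₂ t' e₂')

lemma contMDiffOn_chart_change (a a' : FibreProduct π₁ π₂) :
    ContMDiffOn (halfModel (n₁ + n₂)) (halfModel (n₁ + n₂)) ∞
      ((chart h₁ h₂ a).symm.trans (chart h₁' h₂' a'))
      ((chart h₁ h₂ a).symm.trans (chart h₁' h₂' a')).source := by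
  have key : ∀ u ∈ ((chart h₁ h₂ a).symm.trans (chart h₁' h₂' a')).source,
      (ofProd a (e₁.symm (halfFst u), e₂.symm (halfSnd u))).incl =
        (e₁.symm (halfFst u), e₂.symm (halfSnd u)) := fun u hu =>
    incl_ofProd a (symm_mem h₁ h₂ hu.1.1 hu.1.2)
  have hs : ∀ u ∈ ((chart h₁ h₂ a).symm.trans (chart h₁' h₂' a')).source,
      e₁.symm (halfFst u) ∈ e₁'.source ∧ e₂.symm (halfSnd u) ∈ e₂'.source := by
    intro u hu
    have h := key u hu
    have h1 : (ofProd a (e₁.symm (halfFst u), e₂.symm (halfSnd u))).incl.1 ∈ e₁'.source ∧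
      (ofProd a (e₁.symm (halfFst u), e₂.symm (halfSnd u))).incl.2 ∈ e₂'.source := hu.2
    rwa [h] at h1
  refine ContMDiffOn.congr (f := fun u => halfGlue (e₁' (e₁.symm (halfFst u)),
    e₂' (e₂.symm (halfSnd u)))) (contMDiff_halfGlue.comp_contMDiffOn (ContMDiffOn.prodMk
      ((contMDiffOn_of_mem_maximalAtlas h₁'.mem_maximalAtlas).comp
        ((contMDiffOn_symm_of_mem_maximalAtlas h₁.mem_maximalAtlas).comp
          contMDiff_halfFst.contMDiffOn fun u hu => hu.1.1) fun u hu => (hs u hu).1)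
      ((contMDiffOn_of_mem_maximalAtlas h₂'.mem_maximalAtlas).comp
        ((contMDiffOn_symm_of_mem_maximalAtlas h₂.mem_maximalAtlas).comp
          contMDiff_halfSnd.contMDiffOn fun u hu => hu.1.2) fun u hu => (hs u hu).2))) ?_
  intro u hu
  exact congrArg (fun x : Q₁ × Q₂ => halfGlue (e₁' x.1, e₂' x.2)) (key u hu)

lemma chart_change_mem_contDiffGroupoid (a a' : FibreProduct π₁ π₂) :
    (chart h₁ h₂ a).symm.trans (chart h₁' h₂' a') ∈ contDiffGroupoid ∞ (halfModel (n₁ + n₂)) := by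
  have hm := OpenPartialHomeomorph.mem_maximalAtlas_of_contMDiffOn (I := halfModel (n₁ + n₂))
    (n := ∞) ((chart h₁ h₂ a).symm.trans (chart h₁' h₂' a'))
    (contMDiffOn_chart_change h₁ h₂ h₁' h₂' a a') (by
      rw [← OpenPartialHomeomorph.symm_source, OpenPartialHomeomorph.trans_symm_eq_symm_trans_symm,
        OpenPartialHomeomorph.symm_symm]
      exact contMDiffOn_chart_change h₁' h₂' h₁ h₂ a' a)
  have h := StructureGroupoid.compatible_of_mem_maximalAtlas
    ((contDiffGroupoid ∞ (halfModel (n₁ + n₂))).id_mem_maximalAtlas) hm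
  rwa [OpenPartialHomeomorph.refl_symm, OpenPartialHomeomorph.refl_trans] at h

end Chart

end FibreProduct

end FibreProduct

/-! ### The manifold structure of the fibre product -/

section HasAdaptedCharts

/-- Every point of `Q` has a chart adapted to `π`. This is a class because the charts of a fibre
product depend on it. -/
class HasAdaptedCharts (n : ℕ) {Q : Type*} [TopologicalSpace Q] [ChartedSpace (HalfSpace n) Q]
    [IsManifold (halfModel n) ∞ Q] (π : Q → Icc (0 : ℝ) 1) : Prop where
  exists_chart : ∀ q, ∃ e : OpenPartialHomeomorph Q (HalfSpace n),
    q ∈ e.source ∧ IsAdaptedChart π (π q) e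

namespace FibreProduct

variable {n₁ n₂ : ℕ} {Q₁ Q₂ : Type u} [TopologicalSpace Q₁] [ChartedSpace (HalfSpace n₁) Q₁]
  [TopologicalSpace Q₂] [ChartedSpace (HalfSpace n₂) Q₂] [IsManifold (halfModel n₁) ∞ Q₁]
  [IsManifold (halfModel n₂) ∞ Q₂] {π₁ : Q₁ → Icc (0 : ℝ) 1} {π₂ : Q₂ → Icc (0 : ℝ) 1}
  [HasAdaptedCharts n₁ π₁] [HasAdaptedCharts n₂ π₂]

variable (n₁ n₂) in
lemma exists_charts (q : FibreProduct π₁ π₂) :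
    ∃ (e₁ : OpenPartialHomeomorph Q₁ (HalfSpace n₁)) (e₂ : OpenPartialHomeomorph Q₂ (HalfSpace n₂)),
      IsAdaptedChart π₁ q.proj e₁ ∧ IsAdaptedChart π₂ q.proj e₂ ∧ q.incl.1 ∈ e₁.source ∧
        q.incl.2 ∈ e₂.source := by
  obtain ⟨e₁, m₁, h₁⟩ := HasAdaptedCharts.exists_chart (n := n₁) (π := π₁) q.incl.1
  obtain ⟨e₂, m₂, h₂⟩ := HasAdaptedCharts.exists_chart (n := n₂) (π := π₂) q.incl.2
  rw [← q.incl_eq] at h₂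
  exact ⟨e₁, e₂, h₁, h₂, m₁, m₂⟩

variable (n₁ n₂) in
/-- The adapted chart of the first factor used near a point of the fibre product. -/
def chartFst (q : FibreProduct π₁ π₂) : OpenPartialHomeomorph Q₁ (HalfSpace n₁) :=
  (q.exists_charts n₁ n₂).choose

variable (n₁ n₂) in
/-- The adapted chart of the second factor used near a point of the fibre product. -/
def chartSnd (q : FibreProduct π₁ π₂) : OpenPartialHomeomorph Q₂ (HalfSpace n₂) :=
  (q.exists_charts n₁ n₂).choose_spec.choose

variable (n₁ n₂) in
lemma chartFst_adapted (q : FibreProduct π₁ π₂) : IsAdaptedChart π₁ q.proj (q.chartFst n₁ n₂) :=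
  (q.exists_charts n₁ n₂).choose_spec.choose_spec.1

variable (n₁ n₂) in
lemma chartSnd_adapted (q : FibreProduct π₁ π₂) : IsAdaptedChart π₂ q.proj (q.chartSnd n₁ n₂) :=
  (q.exists_charts n₁ n₂).choose_spec.choose_spec.2.1

variable (n₁ n₂) in
lemma mem_chartFst_source (q : FibreProduct π₁ π₂) : q.incl.1 ∈ (q.chartFst n₁ n₂).source :=
  (q.exists_charts n₁ n₂).choose_spec.choose_spec.2.2.1

variable (n₁ n₂) in
lemma mem_chartSnd_source (q : FibreProduct π₁ π₂) : q.incl.2 ∈ (q.chartSnd n₁ n₂).source :=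
  (q.exists_charts n₁ n₂).choose_spec.choose_spec.2.2.2

instance : ChartedSpace (HalfSpace (n₁ + n₂)) (FibreProduct π₁ π₂) where
  atlas := range fun q => chart (q.chartFst_adapted n₁ n₂) (q.chartSnd_adapted n₁ n₂) q
  chartAt q := chart (q.chartFst_adapted n₁ n₂) (q.chartSnd_adapted n₁ n₂) q
  mem_chart_source q := ⟨(q.mem_chartFst_source n₁ n₂), (q.mem_chartSnd_source n₁ n₂)⟩
  chart_mem_atlas q := mem_range_self q

instance : IsManifold (halfModel (n₁ + n₂)) ∞ (FibreProduct π₁ π₂) where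
  compatible := by
    rintro _ _ ⟨q, rfl⟩ ⟨q', rfl⟩
    exact chart_change_mem_contDiffGroupoid _ _ _ _ _ _

lemma chart_mem_maximalAtlas (q : FibreProduct π₁ π₂) :
    chart (q.chartFst_adapted n₁ n₂) (q.chartSnd_adapted n₁ n₂) q ∈
      IsManifold.maximalAtlas (halfModel (n₁ + n₂)) ∞ (FibreProduct π₁ π₂) :=
  IsManifold.chart_mem_maximalAtlas q

theorem contMDiff_incl : ContMDiff (halfModel (n₁ + n₂)) ((halfModel n₁).prod (halfModel n₂)) ∞
    (incl : FibreProduct π₁ π₂ → Q₁ × Q₂) := by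
  intro q
  set c := chart (q.chartFst_adapted n₁ n₂) (q.chartSnd_adapted n₁ n₂) q with hc
  have hq : q ∈ c.source := ⟨(q.mem_chartFst_source n₁ n₂), (q.mem_chartSnd_source n₁ n₂)⟩
  have h₀ : ContMDiffAt (halfModel (n₁ + n₂)) (halfModel (n₁ + n₂)) ∞ c q :=
    contMDiffAt_of_mem_maximalAtlas q.chart_mem_maximalAtlas hq
  have hc' : c q ∈ c.target := c.map_source hq
  have h₁ := (contMDiffAt_symm_of_mem_maximalAtlas (q.chartFst_adapted n₁ n₂).mem_maximalAtlas
    hc'.1).comp q ((contMDiff_halfFst _).comp q h₀)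
  have h₂ := (contMDiffAt_symm_of_mem_maximalAtlas (q.chartSnd_adapted n₁ n₂).mem_maximalAtlas
    hc'.2).comp q ((contMDiff_halfSnd _).comp q h₀)
  refine (h₁.prodMk h₂).congr_of_eventuallyEq ?_
  filter_upwards [c.open_source.mem_nhds hq] with p hp
  have h := congrArg incl (c.left_inv hp)
  have hp' := c.map_source hp
  exact h.symm.trans
    (incl_ofProd q (symm_mem (q.chartFst_adapted n₁ n₂) (q.chartSnd_adapted n₁ n₂) hp'.1 hp'.2))

/-- The fibre product is a local retract of the product. -/
theorem exists_retraction (q : FibreProduct π₁ π₂) : ∃ r : Q₁ × Q₂ → FibreProduct π₁ π₂,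
    ContMDiffAt ((halfModel n₁).prod (halfModel n₂)) (halfModel (n₁ + n₂)) ∞ r q.incl ∧
      ∀ᶠ p in 𝓝 q, r p.incl = p := by
  set c := chart (q.chartFst_adapted n₁ n₂) (q.chartSnd_adapted n₁ n₂) q with hc
  have hq : q ∈ c.source := ⟨(q.mem_chartFst_source n₁ n₂), (q.mem_chartSnd_source n₁ n₂)⟩
  have h₁ : ContMDiffAt (halfModel n₁) (halfModel n₁) ∞ (q.chartFst n₁ n₂) q.incl.1 :=
    contMDiffAt_of_mem_maximalAtlas (q.chartFst_adapted n₁ n₂).mem_maximalAtlas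
      (q.mem_chartFst_source n₁ n₂)
  have h₂ : ContMDiffAt (halfModel n₂) (halfModel n₂) ∞ (q.chartSnd n₁ n₂) q.incl.2 :=
    contMDiffAt_of_mem_maximalAtlas (q.chartSnd_adapted n₁ n₂).mem_maximalAtlas
      (q.mem_chartSnd_source n₁ n₂)
  have hg : ContMDiffAt ((halfModel n₁).prod (halfModel n₂)) (halfModel (n₁ + n₂)) ∞
      (fun x : Q₁ × Q₂ => halfGlue (q.chartFst n₁ n₂ x.1, (q.chartSnd n₁ n₂) x.2)) q.incl :=
    (contMDiff_halfGlue _).comp q.incl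
      ((h₁.comp q.incl contMDiffAt_fst).prodMk (h₂.comp q.incl contMDiffAt_snd))
  refine ⟨fun x => c.symm (halfGlue (q.chartFst n₁ n₂ x.1, (q.chartSnd n₁ n₂) x.2)),
    ContMDiffAt.comp (I' := halfModel (n₁ + n₂)) q.incl (g := c.symm)
      (f := fun x : Q₁ × Q₂ => halfGlue (q.chartFst n₁ n₂ x.1, (q.chartSnd n₁ n₂) x.2))
      (contMDiffAt_symm_of_mem_maximalAtlas q.chart_mem_maximalAtlas (c.map_source hq)) hg, ?_⟩
  filter_upwards [c.open_source.mem_nhds hq] with p hp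
  exact c.left_inv hp

section Maps

variable {E H Z : Type*} [NormedAddCommGroup E] [NormedSpace ℝ E] [TopologicalSpace H]
  {J : ModelWithCorners ℝ E H} [TopologicalSpace Z] [ChartedSpace H Z]

/-- Smoothness of maps to the fibre product may be tested in the product. -/
theorem contMDiff_of_incl {f : Z → FibreProduct π₁ π₂}
    (hf : ContMDiff J ((halfModel n₁).prod (halfModel n₂)) ∞ fun z => (f z).incl) :
    ContMDiff J (halfModel (n₁ + n₂)) ∞ f := by
  intro z
  obtain ⟨r, hr, hri⟩ := exists_retraction (n₁ := n₁) (n₂ := n₂) (f z)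
  have hc : Continuous f := isEmbedding_incl.continuous_iff.2 hf.continuous
  refine (ContMDiffAt.comp (I' := (halfModel n₁).prod (halfModel n₂)) z (g := r)
    (f := fun z => (f z).incl) hr (hf z)).congr_of_eventuallyEq ?_
  filter_upwards [hc.continuousAt.eventually hri] with y hy
  exact hy.symm

end Maps

/-- The inclusion in the product is an immersion, since it has a smooth local retraction. -/
lemma mfderiv_incl_injective (q : FibreProduct π₁ π₂) : Function.Injective
    (mfderiv (halfModel (n₁ + n₂)) ((halfModel n₁).prod (halfModel n₂)) incl q) := by
  obtain ⟨r, hr, hri⟩ := exists_retraction (n₁ := n₁) (n₂ := n₂) q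
  have h := mfderiv_comp (I' := (halfModel n₁).prod (halfModel n₂)) q (g := r) (f := incl)
    (hr.mdifferentiableAt (by simp)) (contMDiff_incl.mdifferentiable (by simp) q)
  have hid : r ∘ incl =ᶠ[𝓝 q] id := hri
  rw [hid.mfderiv_eq, mfderiv_id] at h
  intro v w hvw
  have hv := DFunLike.congr_fun h v
  have hw := DFunLike.congr_fun h w
  refine hv.trans (Eq.trans ?_ hw.symm)
  exact congrArg (mfderiv ((halfModel n₁).prod (halfModel n₂)) (halfModel (n₁ + n₂)) r q.incl) hvw

lemma chart_apply_fst (q p : FibreProduct π₁ π₂)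
    (hp : p ∈ (chart (q.chartFst_adapted n₁ n₂) (q.chartSnd_adapted n₁ n₂) q).source) :
    (chart (q.chartFst_adapted n₁ n₂) (q.chartSnd_adapted n₁ n₂) q p).1 =
      chartAt (EuclideanHalfSpace 1) q.proj p.proj :=
  (q.chartFst_adapted n₁ n₂).apply_fst _ hp.1

theorem isSubmersion_proj : Manifold.IsSubmersion (halfModel (n₁ + n₂)) (𝓡∂ 1) ∞
    (proj : FibreProduct π₁ π₂ → Icc (0 : ℝ) 1) := by
  refine ⟨EuclideanSpace ℝ (Fin (n₁ + n₂)), inferInstance, inferInstance, fun q => ?_⟩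
  set c := chart (q.chartFst_adapted n₁ n₂) (q.chartSnd_adapted n₁ n₂) q with hc
  have hq : q ∈ c.source := ⟨q.mem_chartFst_source n₁ n₂, q.mem_chartSnd_source n₁ n₂⟩
  refine Manifold.IsSubmersionAtOfComplement.mk_of_charts (ContinuousLinearEquiv.refl ℝ _) c
    (chartAt (EuclideanHalfSpace 1) q.proj) hq (mem_chart_source _ q.proj)
    (chart_mem_maximalAtlas q) (IsManifold.chart_mem_maximalAtlas q.proj)
    (fun p hp => (q.chartFst_adapted n₁ n₂).proj_mem _ hp.1) ?_
  rintro v hv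
  rw [OpenPartialHomeomorph.extend_target] at hv
  have h := chart_apply_fst q (c.symm ((halfModel (n₁ + n₂)).symm v)) (c.map_target hv.1)
  refine (congrArg (𝓡∂ 1) h.symm).trans ?_
  have h' : c (c.symm ((halfModel (n₁ + n₂)).symm v)) = (halfModel (n₁ + n₂)).symm v :=
    c.right_inv hv.1
  refine (congrArg (fun w : HalfSpace (n₁ + n₂) => (𝓡∂ 1) w.1) h').trans ?_
  exact congrArg Prod.fst ((halfModel (n₁ + n₂)).right_inv hv.2)

/-- The boundary of the fibre product lies over the end points of the unit interval. -/
theorem isInteriorPoint (q : FibreProduct π₁ π₂) (h0 : 0 < (q.proj : ℝ)) (h1 : (q.proj : ℝ) < 1) :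
    (halfModel (n₁ + n₂)).IsInteriorPoint q := by
  set c := chart (q.chartFst_adapted n₁ n₂) (q.chartSnd_adapted n₁ n₂) q with hc
  have hq : q ∈ c.source := ⟨(q.mem_chartFst_source n₁ n₂), (q.mem_chartSnd_source n₁ n₂)⟩
  rw [isInteriorPoint_iff_of_mem_maximalAtlas q.chart_mem_maximalAtlas hq,
    mem_interior_range_halfModel]
  have h : (c q).1 = chartAt (EuclideanHalfSpace 1) q.proj q.proj := chart_apply_fst q q hq
  have h' : 0 < ((c q).1).1 0 := by
    rw [h, Icc_chartedSpaceChartAt_of_le_top h1, IccLeftChart_apply]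
    simpa using h0
  exact h'

end FibreProduct

end HasAdaptedCharts

/-! ### Moment maps and bivector fields on the fibre product -/

namespace DefSpace

section Combine

variable {EG HG G E₁ HH₁ H₁ E₂ HH₂ H₂ : Type*}
  [NormedAddCommGroup EG] [NormedSpace ℝ EG] [TopologicalSpace HG] {JG : ModelWithCorners ℝ EG HG}
  [TopologicalSpace G] [ChartedSpace HG G] [Group G]
  [NormedAddCommGroup E₁] [NormedSpace ℝ E₁] [TopologicalSpace HH₁]
  {J₁ : ModelWithCorners ℝ E₁ HH₁} [TopologicalSpace H₁] [ChartedSpace HH₁ H₁] [Group H₁]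
  [NormedAddCommGroup E₂] [NormedSpace ℝ E₂] [TopologicalSpace HH₂]
  {J₂ : ModelWithCorners ℝ E₂ HH₂} [TopologicalSpace H₂] [ChartedSpace HH₂ H₂] [Group H₂]
  {F H' Z : Type*} [NormedAddCommGroup F] [NormedSpace ℝ F] [TopologicalSpace H']
  {I : ModelWithCorners ℝ F H'} [TopologicalSpace Z] [ChartedSpace H' Z]

lemma proj_map {p : (G × H₁) × (G × H₂) → G × G × H₁ × H₂}
    (x : DefSpace ((JG.prod J₁).prod (JG.prod J₂)) ((G × H₁) × (G × H₂))) :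
    (map _ (JG.prod (JG.prod (J₁.prod J₂))) p x).proj = x.proj := by
  cases x <;> rfl

lemma proj_combine (p : DefSpace (JG.prod J₁) (G × H₁)) (q : DefSpace (JG.prod J₂) (G × H₂)) :
    (combine p q).proj = p.proj :=
  (proj_map _).trans (proj_pair p q)

variable [LieGroup JG ∞ G] [LieGroup J₁ ∞ H₁] [LieGroup J₂ ∞ H₂]

lemma lieRegroup_Ad (k : (G × H₁) × (G × H₂)) (v : GroupLieAlgebra (JG.prod J₁) (G × H₁))
    (w : GroupLieAlgebra (JG.prod J₂) (G × H₂)) :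
    lieRegroup (Ad (JG.prod J₁) k.1 v) (Ad (JG.prod J₂) k.2 w) =
      Ad (JG.prod (JG.prod (J₁.prod J₂))) (regroup k) (lieRegroup v w) := by
  rw [Ad_prod, Ad_prod, Ad_prod, Ad_prod, Ad_prod]
  rfl

lemma map_regroup_adjoint (k : (G × H₁) × (G × H₂))
    (x : DefSpace ((JG.prod J₁).prod (JG.prod J₂)) ((G × H₁) × (G × H₂))) :
    map _ (JG.prod (JG.prod (J₁.prod J₂))) regroup (x.adjoint k) =
      (map _ (JG.prod (JG.prod (J₁.prod J₂))) regroup x).adjoint (regroup k) := by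
  cases x with
  | unit a t ht => rfl
  | lie v =>
    have e : ∀ v : GroupLieAlgebra ((JG.prod J₁).prod (JG.prod J₂)) ((G × H₁) × (G × H₂)),
        map _ (JG.prod (JG.prod (J₁.prod J₂))) regroup (lie v) =
          lie (lieRegroup (lieFst v) (lieSnd v)) :=
      fun v => congrArg lie (mfderiv_regroup (lieFst v) (lieSnd v))
    refine (e (Ad _ k v)).trans ?_
    rw [Ad_prod]
    exact (congrArg lie (lieRegroup_Ad k (lieFst v) (lieSnd v))).trans
      (congrArg (adjoint (regroup k)) (e v)).symm

lemma combine_adjoint (k : G × G × H₁ × H₂) (p : DefSpace (JG.prod J₁) (G × H₁))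
    (q : DefSpace (JG.prod J₂) (G × H₂)) :
    combine (p.adjoint (k.1, k.2.2.1)) (q.adjoint (k.2.1, k.2.2.2)) = (combine p q).adjoint k :=
  (congrArg (map _ _ regroup) (pair_adjoint ((k.1, k.2.2.1), (k.2.1, k.2.2.2)) p q)).trans
    (map_regroup_adjoint ((k.1, k.2.2.1), (k.2.1, k.2.2.2)) (pair p q))

variable [FiniteDimensional ℝ EG] [FiniteDimensional ℝ E₁] [FiniteDimensional ℝ E₂]
  [JG.Boundaryless] [J₁.Boundaryless] [J₂.Boundaryless]

theorem contMDiff_combine {f₁ : Z → DefSpace (JG.prod J₁) (G × H₁)}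
    {f₂ : Z → DefSpace (JG.prod J₂) (G × H₂)}
    (h₁ : ContMDiff I 𝓘(ℝ, (EG × E₁) × ℝ) ∞ f₁) (h₂ : ContMDiff I 𝓘(ℝ, (EG × E₂) × ℝ) ∞ f₂)
    (h : ∀ z, (f₁ z).proj = (f₂ z).proj) :
    ContMDiff I 𝓘(ℝ, (EG × EG × E₁ × E₂) × ℝ) ∞ (fun z => combine (f₁ z) (f₂ z)) :=
  (contMDiff_map contMDiff_regroup rfl).comp (contMDiff_pair h₁ h₂ h)

end Combine

end DefSpace

section Restriction

namespace FibreProduct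

variable {n₁ n₂ : ℕ} {Q₁ Q₂ : Type u} [TopologicalSpace Q₁] [ChartedSpace (HalfSpace n₁) Q₁]
  [TopologicalSpace Q₂] [ChartedSpace (HalfSpace n₂) Q₂] [IsManifold (halfModel n₁) ∞ Q₁]
  [IsManifold (halfModel n₂) ∞ Q₂] {π₁ : Q₁ → Icc (0 : ℝ) 1} {π₂ : Q₂ → Icc (0 : ℝ) 1}
  [HasAdaptedCharts n₁ π₁] [HasAdaptedCharts n₂ π₂]

variable (n₁ n₂) in
/-- The inclusion of the tangent space of the fibre product into that of the product. -/
def tangentIncl (q : FibreProduct π₁ π₂) : TangentSpace (halfModel (n₁ + n₂)) q →L[ℝ]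
    TangentSpace ((halfModel n₁).prod (halfModel n₂)) q.incl :=
  mfderiv (halfModel (n₁ + n₂)) ((halfModel n₁).prod (halfModel n₂)) incl q

/-- A covector of the fibre product is the restriction of a covector of the product. -/
lemma exists_comp_tangentIncl (q : FibreProduct π₁ π₂) (α : Covector (halfModel (n₁ + n₂)) q) :
    ∃ α' : Covector ((halfModel n₁).prod (halfModel n₂)) q.incl,
      α'.comp (tangentIncl n₁ n₂ q) = α := by
  obtain ⟨g, hg⟩ := LinearMap.exists_leftInverse_of_injective (tangentIncl n₁ n₂ q).toLinearMap
    (LinearMap.ker_eq_bot.2 (mfderiv_incl_injective q))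
  refine ⟨α.comp (LinearMap.toContinuousLinearMap g), ?_⟩
  ext v
  exact congrArg α (DFunLike.congr_fun hg v)

lemma differential_comp_incl {f : Q₁ × Q₂ → ℝ} {q : FibreProduct π₁ π₂}
    (hf : MDifferentiableAt ((halfModel n₁).prod (halfModel n₂)) 𝓘(ℝ, ℝ) f q.incl) :
    differential (halfModel (n₁ + n₂)) (fun p : FibreProduct π₁ π₂ => f p.incl) q =
      (differential ((halfModel n₁).prod (halfModel n₂)) f q.incl).comp (tangentIncl n₁ n₂ q) :=
  differential_comp (f := f) (g := incl) hf (contMDiff_incl.mdifferentiable (by simp) q)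

variable {P₁ : ∀ q : Q₁, MultiVector (halfModel n₁) 2 q}
  {P₂ : ∀ q : Q₂, MultiVector (halfModel n₂) 2 q}
  {P : ∀ q : FibreProduct π₁ π₂, MultiVector (halfModel (n₁ + n₂)) 2 q}

/-- A bivector field on the fibre product that is the restriction of a product of smooth bivector
fields is smooth. -/
theorem isSmoothField_of_pushforward_incl [T2Space Q₁] [T2Space Q₂]
    (h₁ : IsSmoothField P₁) (h₂ : IsSmoothField P₂)
    (hP : ∀ q, pushforward (tangentIncl n₁ n₂ q) (P q) = prodBivector P₁ P₂ q.incl) :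
    IsSmoothField P := by
  refine isSmoothField_two fun f g hf hg q => ?_
  obtain ⟨r, hr, hri⟩ := exists_retraction (n₁ := n₁) (n₂ := n₂) q
  have hq : r q.incl = q := hri.self_of_nhds
  have key : ∀ {f : FibreProduct π₁ π₂ → ℝ}, ContMDiff (halfModel (n₁ + n₂)) 𝓘(ℝ, ℝ) ∞ f →
      ContMDiffAt ((halfModel n₁).prod (halfModel n₂)) 𝓘(ℝ, ℝ) ∞ (fun x => f (r x)) q.incl ∧
      ∀ᶠ p in 𝓝 q, MDifferentiableAt ((halfModel n₁).prod (halfModel n₂)) 𝓘(ℝ, ℝ)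
        (fun x => f (r x)) p.incl ∧ differential (halfModel (n₁ + n₂)) f p =
          (differential ((halfModel n₁).prod (halfModel n₂)) (fun x => f (r x)) p.incl).comp
            (tangentIncl n₁ n₂ p) := by
    intro f hf
    have h : ContMDiffAt ((halfModel n₁).prod (halfModel n₂)) 𝓘(ℝ, ℝ) ∞ (fun x => f (r x)) q.incl :=
      ContMDiffAt.comp (I' := halfModel (n₁ + n₂)) q.incl (g := f) (f := r) (hf _) hr
    refine ⟨h, ?_⟩
    have h1 := (contMDiffAt_iff_contMDiffAt_nhds (n := 1) (by simp)).1
      (h.of_le (ENat.LEInfty.out (m := 1)))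
    filter_upwards [isEmbedding_incl.continuous.continuousAt.eventually h1, hri.eventually_nhds]
      with p hp hpr
    have hd := hp.mdifferentiableAt one_ne_zero
    refine ⟨hd, Eq.trans ?_ (differential_comp_incl hd)⟩
    have e : f =ᶠ[𝓝 p] fun p => f (r p.incl) := hpr.mono fun y hy => (congrArg f hy).symm
    exact e.mfderiv_eq
  obtain ⟨kf, ef⟩ := key hf
  obtain ⟨kg, eg⟩ := key hg
  refine (contMDiffAt_prodBivector h₁ h₂ (contMDiff_incl q) kf kg).congr_of_eventuallyEq ?_
  filter_upwards [ef, eg] with p hf hg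
  rw [bracket, hf.2, hg.2, ← pushforward_two_apply, hP]
  exact prodBivector_differential P₁ P₂ hf.1 hg.1

/-- If `P₁` is a section of `⋀² ker dπ₁`, then the restriction to the fibre product of
`P₁ + P₂` is a section of `⋀² ker dπ`. -/
theorem vertical_of_pushforward_incl
    (hπ₁ : ContMDiff (halfModel n₁) 𝓘(ℝ, ℝ) ∞ (fun q => (π₁ q : ℝ)))
    (h₁ : ∀ q (α : Covector (halfModel n₁) q),
      P₁ q ![differential (halfModel n₁) (fun p => (π₁ p : ℝ)) q, α] = 0)
    (hP : ∀ q, pushforward (tangentIncl n₁ n₂ q) (P q) = prodBivector P₁ P₂ q.incl)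
    (q : FibreProduct π₁ π₂) (α : Covector (halfModel (n₁ + n₂)) q) :
    P q ![differential (halfModel (n₁ + n₂)) (fun p : FibreProduct π₁ π₂ => (p.proj : ℝ)) q, α]
      = 0 := by
  obtain ⟨α, rfl⟩ := exists_comp_tangentIncl q α
  have hd : MDifferentiableAt ((halfModel n₁).prod (halfModel n₂)) 𝓘(ℝ, ℝ)
      (fun x : Q₁ × Q₂ => (π₁ x.1 : ℝ)) q.incl :=
    (hπ₁.comp contMDiff_fst).mdifferentiable (by simp) _
  have e := differential_comp_incl (π₁ := π₁) (π₂ := π₂) hd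
  rw [show (fun p : FibreProduct π₁ π₂ => (p.proj : ℝ)) = fun p => (π₁ p.incl.1 : ℝ) from rfl, e,
    ← pushforward_two_apply, hP, prodBivector_apply, differential_comp_sliceFst hd,
    differential_comp_sliceSnd hd]
  have e₂ : differential (halfModel n₂) (fun _ : Q₂ => (π₁ q.incl.1 : ℝ)) q.incl.2 = 0 :=
    mfderiv_const
  refine (congrArg₂ (fun x y : ℝ => x + y) (h₁ q.incl.1 _) ?_).trans (add_zero 0)
  rw [e₂]
  exact (P₂ q.incl.2).map_coord_zero 0 rfl

end FibreProduct

end Restriction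

section FibreMap

namespace FibreProduct

variable {n₁ n₂ : ℕ} {Q₁ Q₂ : Type u} [TopologicalSpace Q₁] [ChartedSpace (HalfSpace n₁) Q₁]
  [TopologicalSpace Q₂] [ChartedSpace (HalfSpace n₂) Q₂] [IsManifold (halfModel n₁) ∞ Q₁]
  [IsManifold (halfModel n₂) ∞ Q₂] {π₁ : Q₁ → Icc (0 : ℝ) 1} {π₂ : Q₂ → Icc (0 : ℝ) 1}
  [HasAdaptedCharts n₁ π₁] [HasAdaptedCharts n₂ π₂]
  {F₁ B₁ M₁ F₂ B₂ M₂ : Type*} [NormedAddCommGroup F₁] [NormedSpace ℝ F₁] [TopologicalSpace B₁]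
  {I₁ : ModelWithCorners ℝ F₁ B₁} [TopologicalSpace M₁] [ChartedSpace B₁ M₁]
  [NormedAddCommGroup F₂] [NormedSpace ℝ F₂] [TopologicalSpace B₂]
  {I₂ : ModelWithCorners ℝ F₂ B₂} [TopologicalSpace M₂] [ChartedSpace B₂ M₂]
  {Φ₁ : M₁ → Q₁} {Φ₂ : M₂ → Q₂} {t : ℝ}

lemma _root_.QuasiPoisson.IsFibreDiffeo.proj_eq (h₁ : IsFibreDiffeo I₁ n₁ π₁ t Φ₁) (m : M₁) :
    (π₁ (Φ₁ m) : ℝ) = t := by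
  have : Φ₁ m ∈ {q | (π₁ q : ℝ) = t} := h₁.range_eq ▸ mem_range_self m
  exact this

/-- The map to a fibre of the fibre product given by maps to the fibres of the factors. -/
def fibreMap (h₁ : IsFibreDiffeo I₁ n₁ π₁ t Φ₁) (h₂ : IsFibreDiffeo I₂ n₂ π₂ t Φ₂)
    (m : M₁ × M₂) : FibreProduct π₁ π₂ :=
  mk (Prod.map Φ₁ Φ₂ m) (Subtype.ext ((h₁.proj_eq m.1).trans (h₂.proj_eq m.2).symm))

variable (h₁ : IsFibreDiffeo I₁ n₁ π₁ t Φ₁) (h₂ : IsFibreDiffeo I₂ n₂ π₂ t Φ₂)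

lemma exists_fibreMap_eq (q : FibreProduct π₁ π₂) (hq : (q.proj : ℝ) = t) :
    ∃ m, fibreMap h₁ h₂ m = q := by
  obtain ⟨m₁, e₁⟩ : q.incl.1 ∈ range Φ₁ := h₁.range_eq ▸ hq
  obtain ⟨m₂, e₂⟩ : q.incl.2 ∈ range Φ₂ :=
    h₂.range_eq ▸ (congrArg Subtype.val q.incl_eq.symm).trans hq
  exact ⟨(m₁, m₂), ext_incl (Prod.ext e₁ e₂)⟩

lemma contMDiff_fibreMap : ContMDiff (I₁.prod I₂) (halfModel (n₁ + n₂)) ∞ (fibreMap h₁ h₂) :=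
  contMDiff_of_incl (n₁ := n₁) (n₂ := n₂) (h₁.smooth.prodMap h₂.smooth)

lemma tangentIncl_comp_mfderiv_fibreMap (m : M₁ × M₂) :
    (tangentIncl n₁ n₂ (fibreMap h₁ h₂ m)).comp
      (mfderiv (I₁.prod I₂) (halfModel (n₁ + n₂)) (fibreMap h₁ h₂) m) =
    mfderiv (I₁.prod I₂) ((halfModel n₁).prod (halfModel n₂)) (Prod.map Φ₁ Φ₂) m :=
  (mfderiv_comp (I' := halfModel (n₁ + n₂)) m (g := incl) (f := fibreMap h₁ h₂)
    (contMDiff_incl.mdifferentiable (by simp) _)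
    ((contMDiff_fibreMap h₁ h₂).mdifferentiable (by simp) m)).symm

theorem isFibreDiffeo_fibreMap : IsFibreDiffeo (I₁.prod I₂) (n₁ + n₂)
    (proj : FibreProduct π₁ π₂ → Icc (0 : ℝ) 1) t (fibreMap h₁ h₂) where
  smooth := contMDiff_fibreMap h₁ h₂
  isEmbedding := Topology.IsEmbedding.of_comp (contMDiff_fibreMap h₁ h₂).continuous
    isEmbedding_incl.continuous (h₁.isEmbedding.prodMap h₂.isEmbedding)
  immersion m := by
    have hd := mfderiv_prodMap (p := m) (h₁.smooth.mdifferentiable (by simp) m.1)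
      (h₂.smooth.mdifferentiable (by simp) m.2)
    have hi : Function.Injective (mfderiv (I₁.prod I₂) ((halfModel n₁).prod (halfModel n₂))
        (Prod.map Φ₁ Φ₂) m) := by
      rw [hd]
      exact (h₁.immersion m.1).prodMap (h₂.immersion m.2)
    rw [← tangentIncl_comp_mfderiv_fibreMap h₁ h₂] at hi
    exact Function.Injective.of_comp hi
  range_eq := by
    refine Subset.antisymm ?_ fun q hq => exists_fibreMap_eq h₁ h₂ q hq
    rintro _ ⟨m, rfl⟩
    exact h₁.proj_eq m.1

/-- On a fibre, the product of fibrewise bivector fields is tangent to the fibre product. -/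
theorem prodBivector_fibreMap {P₁ : ∀ q : Q₁, MultiVector (halfModel n₁) 2 q}
    {P₂ : ∀ q : Q₂, MultiVector (halfModel n₂) 2 q} {R₁ : ∀ m : M₁, MultiVector I₁ 2 m}
    {R₂ : ∀ m : M₂, MultiVector I₂ 2 m} (c : ℝ)
    (e₁ : ∀ m, P₁ (Φ₁ m) = c • pushforward (mfderiv I₁ (halfModel n₁) Φ₁ m) (R₁ m))
    (e₂ : ∀ m, P₂ (Φ₂ m) = c • pushforward (mfderiv I₂ (halfModel n₂) Φ₂ m) (R₂ m))
    (m : M₁ × M₂) :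
    pushforward (tangentIncl n₁ n₂ (fibreMap h₁ h₂ m))
      (c • pushforward (mfderiv (I₁.prod I₂) (halfModel (n₁ + n₂)) (fibreMap h₁ h₂) m)
        (prodBivector R₁ R₂ m)) = prodBivector P₁ P₂ (fibreMap h₁ h₂ m).incl := by
  rw [pushforward_smul, pushforward_comp, tangentIncl_comp_mfderiv_fibreMap]
  exact (prodBivector_map R₁ R₂ c (h₁.smooth.mdifferentiable (by simp) m.1)
    (h₂.smooth.mdifferentiable (by simp) m.2) (e₁ m.1) (e₂ m.2)).symm

end FibreProduct

end FibreMap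

/-! ### The product of two deformations -/

section ProductDeformation

open DefSpace

lemma IsPoissonDeformation.hasAdaptedCharts {E H K : Type*} [NormedAddCommGroup E]
    [NormedSpace ℝ E] [TopologicalSpace H] {J : ModelWithCorners ℝ E H} [TopologicalSpace K]
    [ChartedSpace H K] [Group K] [FiniteDimensional ℝ E] [J.Boundaryless] [LieGroup J ∞ K]
    {n : ℕ} {Q : Type*} [TopologicalSpace Q] [ChartedSpace (HalfSpace n) Q]
    [IsManifold (halfModel n) ∞ Q]
    {F₁ H₁ M : Type*} [NormedAddCommGroup F₁] [NormedSpace ℝ F₁] [TopologicalSpace H₁]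
    {I₁ : ModelWithCorners ℝ F₁ H₁} [TopologicalSpace M] [ChartedSpace H₁ M]
    {F₂ H₂ N : Type*} [NormedAddCommGroup F₂] [NormedSpace ℝ F₂] [TopologicalSpace H₂]
    {I₂ : ModelWithCorners ℝ F₂ H₂} [TopologicalSpace N] [ChartedSpace H₂ N]
    {B : InvariantForm J K} {D : PoissonFamily J K n Q}
    {X : QPSpace J K I₁ M} {Y : PSpace J K I₂ N} (h : IsPoissonDeformation B D X Y) :
    HasAdaptedCharts n D.proj :=
  ⟨exists_isAdaptedChart h.submersion h.interior⟩

variable {EG HG G E₁ HH₁ H₁ E₂ HH₂ H₂ : Type*}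
  [NormedAddCommGroup EG] [NormedSpace ℝ EG] [TopologicalSpace HG] {JG : ModelWithCorners ℝ EG HG}
  [TopologicalSpace G] [ChartedSpace HG G] [Group G]
  [NormedAddCommGroup E₁] [NormedSpace ℝ E₁] [TopologicalSpace HH₁]
  {J₁ : ModelWithCorners ℝ E₁ HH₁} [TopologicalSpace H₁] [ChartedSpace HH₁ H₁] [Group H₁]
  [NormedAddCommGroup E₂] [NormedSpace ℝ E₂] [TopologicalSpace HH₂]
  {J₂ : ModelWithCorners ℝ E₂ HH₂} [TopologicalSpace H₂] [ChartedSpace HH₂ H₂] [Group H₂]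
  {n₁ n₂ : ℕ} {Q₁ Q₂ : Type u} [TopologicalSpace Q₁] [ChartedSpace (HalfSpace n₁) Q₁]
  [TopologicalSpace Q₂] [ChartedSpace (HalfSpace n₂) Q₂] [IsManifold (halfModel n₁) ∞ Q₁]
  [IsManifold (halfModel n₂) ∞ Q₂]

/-- The action on the fibre product of two spaces over `[0, 1]` induced by actions on the factors
that preserve the projections. -/
def SmoothAction.fibreProduct {π₁ : Q₁ → Icc (0 : ℝ) 1} {π₂ : Q₂ → Icc (0 : ℝ) 1}
    [HasAdaptedCharts n₁ π₁] [HasAdaptedCharts n₂ π₂]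
    (A₁ : SmoothAction (JG.prod J₁) (G × H₁) (halfModel n₁) Q₁)
    (A₂ : SmoothAction (JG.prod J₂) (G × H₂) (halfModel n₂) Q₂)
    (h₁ : ∀ k q, π₁ (A₁.act k q) = π₁ q) (h₂ : ∀ k q, π₂ (A₂.act k q) = π₂ q) :
    SmoothAction (JG.prod (JG.prod (J₁.prod J₂))) (G × G × H₁ × H₂) (halfModel (n₁ + n₂))
      (FibreProduct π₁ π₂) where
  act k q := FibreProduct.mk ((A₁.prod A₂).act k q.incl)
    ((h₁ _ _).trans (q.incl_eq.trans (h₂ _ _).symm))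
  one_act q := FibreProduct.ext_incl ((A₁.prod A₂).one_act q.incl)
  mul_act k l q := FibreProduct.ext_incl ((A₁.prod A₂).mul_act k l q.incl)
  smooth := FibreProduct.contMDiff_of_incl (n₁ := n₁) (n₂ := n₂) <|
    (A₁.prod A₂).smooth.comp (contMDiff_id.prodMap FibreProduct.contMDiff_incl)

variable [FiniteDimensional ℝ EG] [FiniteDimensional ℝ E₁] [FiniteDimensional ℝ E₂]
  [JG.Boundaryless] [J₁.Boundaryless] [J₂.Boundaryless]
  [LieGroup JG ∞ G] [LieGroup J₁ ∞ H₁] [LieGroup J₂ ∞ H₂]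

/-- The fibre product of two families, with the product action, `P̃` a given bivector field,
`φ̃ = π² φ_Q` and the moment map with components those of the moment maps of the factors. -/
def PoissonFamily.fibreProduct (B : InvariantForm (JG.prod (JG.prod (J₁.prod J₂)))
      (G × G × H₁ × H₂))
    (D₁ : PoissonFamily (JG.prod J₁) (G × H₁) n₁ Q₁)
    (D₂ : PoissonFamily (JG.prod J₂) (G × H₂) n₂ Q₂)
    [HasAdaptedCharts n₁ D₁.proj] [HasAdaptedCharts n₂ D₂.proj]
    (h₁ : ∀ k q, D₁.proj (D₁.action.act k q) = D₁.proj q)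
    (h₂ : ∀ k q, D₂.proj (D₂.action.act k q) = D₂.proj q)
    (P : ∀ q : FibreProduct D₁.proj D₂.proj, MultiVector (halfModel (n₁ + n₂)) 2 q) :
    PoissonFamily (JG.prod (JG.prod (J₁.prod J₂))) (G × G × H₁ × H₂) (n₁ + n₂)
      (FibreProduct D₁.proj D₂.proj) where
  action := D₁.action.fibreProduct D₂.action h₁ h₂
  proj := FibreProduct.proj
  bivector := P
  trivector q := ((q.proj : ℝ) ^ 2) • cartanField B (D₁.action.fibreProduct D₂.action h₁ h₂) q
  moment q := combine (D₁.moment q.incl.1) (D₂.moment q.incl.2)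

variable {BG : InvariantForm JG G} {B₁ : InvariantForm J₁ H₁} {B₂ : InvariantForm J₂ H₂}
  {F₁ A₁ M₁ F₂ A₂ M₂ F₁' A₁' N₁ F₂' A₂' N₂ : Type*}
  [NormedAddCommGroup F₁] [NormedSpace ℝ F₁] [TopologicalSpace A₁]
  {I₁ : ModelWithCorners ℝ F₁ A₁} [TopologicalSpace M₁] [ChartedSpace A₁ M₁]
  [NormedAddCommGroup F₂] [NormedSpace ℝ F₂] [TopologicalSpace A₂]
  {I₂ : ModelWithCorners ℝ F₂ A₂} [TopologicalSpace M₂] [ChartedSpace A₂ M₂]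
  [NormedAddCommGroup F₁'] [NormedSpace ℝ F₁'] [TopologicalSpace A₁']
  {I₁' : ModelWithCorners ℝ F₁' A₁'} [TopologicalSpace N₁] [ChartedSpace A₁' N₁]
  [NormedAddCommGroup F₂'] [NormedSpace ℝ F₂'] [TopologicalSpace A₂']
  {I₂' : ModelWithCorners ℝ F₂' A₂'} [TopologicalSpace N₂] [ChartedSpace A₂' N₂]
  {D₁ : PoissonFamily (JG.prod J₁) (G × H₁) n₁ Q₁} {D₂ : PoissonFamily (JG.prod J₂) (G × H₂) n₂ Q₂}
  {X₁ : QPSpace (JG.prod J₁) (G × H₁) I₁ M₁} {X₂ : QPSpace (JG.prod J₂) (G × H₂) I₂ M₂}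
  {Y₁ : PSpace (JG.prod J₁) (G × H₁) I₁' N₁} {Y₂ : PSpace (JG.prod J₂) (G × H₂) I₂' N₂}

/-- The sum of the bivector fields of two Poisson deformations is tangent to their fibre product:
this may be checked on the fibres. -/
lemma IsPoissonDeformation.exists_bivector
    [HasAdaptedCharts n₁ D₁.proj] [HasAdaptedCharts n₂ D₂.proj]
    (h₁ : IsPoissonDeformation (BG.prod B₁) D₁ X₁ Y₁)
    (h₂ : IsPoissonDeformation (BG.prod B₂) D₂ X₂ Y₂) (q : FibreProduct D₁.proj D₂.proj) :
    ∃ P : MultiVector (halfModel (n₁ + n₂)) 2 q,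
      pushforward (FibreProduct.tangentIncl n₁ n₂ q) P =
        prodBivector D₁.bivector D₂.bivector q.incl := by
  rcases q.proj.2.1.eq_or_lt' with h0 | h0
  · obtain ⟨Φ₁, hΦ₁, -, e₁, -⟩ := h₁.fibre_zero
    obtain ⟨Φ₂, hΦ₂, -, e₂, -⟩ := h₂.fibre_zero
    obtain ⟨m, rfl⟩ := FibreProduct.exists_fibreMap_eq hΦ₁ hΦ₂ q h0
    exact ⟨_, FibreProduct.prodBivector_fibreMap hΦ₁ hΦ₂ 1
      (fun m => (e₁ m).trans (one_smul ℝ _).symm)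
      (fun m => (e₂ m).trans (one_smul ℝ _).symm) m⟩
  · obtain ⟨Φ₁, hΦ₁, -, e₁, -⟩ := h₁.fibre _ h0 q.proj.2.2
    obtain ⟨Φ₂, hΦ₂, -, e₂, -⟩ := h₂.fibre _ h0 q.proj.2.2
    obtain ⟨m, hm⟩ := FibreProduct.exists_fibreMap_eq hΦ₁ hΦ₂ q rfl
    rw [← hm]
    exact ⟨_, FibreProduct.prodBivector_fibreMap hΦ₁ hΦ₂ _ e₁ e₂ m⟩

variable [FiniteDimensional ℝ F₁] [FiniteDimensional ℝ F₂] [IsManifold I₁ ∞ M₁]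
  [IsManifold I₂ ∞ M₂] [T2Space M₁] [T2Space M₂] [BoundarylessManifold I₁ M₁]
  [BoundarylessManifold I₂ M₂]
  [FiniteDimensional ℝ F₁'] [FiniteDimensional ℝ F₂'] [IsManifold I₁' ∞ N₁]
  [IsManifold I₂' ∞ N₂] [T2Space N₁] [T2Space N₂] [BoundarylessManifold I₁' N₁]
  [BoundarylessManifold I₂' N₂] [T2Space Q₁] [T2Space Q₂]

/-- The fibre product of two Poisson deformations, with a bivector field restricting their sum, is a
Poisson deformation of the product of the quasi-Poisson manifolds. -/
theorem IsPoissonDeformation.fibreProduct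
    [HasAdaptedCharts n₁ D₁.proj] [HasAdaptedCharts n₂ D₂.proj]
    (h₁ : IsPoissonDeformation (BG.prod B₁) D₁ X₁ Y₁)
    (h₂ : IsPoissonDeformation (BG.prod B₂) D₂ X₂ Y₂)
    {P : ∀ q : FibreProduct D₁.proj D₂.proj, MultiVector (halfModel (n₁ + n₂)) 2 q}
    (hP : ∀ q, pushforward (FibreProduct.tangentIncl n₁ n₂ q) (P q) =
      prodBivector D₁.bivector D₂.bivector q.incl) :
    IsPoissonDeformation (BG.prod (BG.prod (B₁.prod B₂)))
      (PoissonFamily.fibreProduct (BG.prod (BG.prod (B₁.prod B₂))) D₁ D₂ h₁.proj_invariant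
        h₂.proj_invariant P) (X₁.prod X₂) (Y₁.prod Y₂) where
  source_hamiltonian := h₁.source_hamiltonian.prod h₂.source_hamiltonian
  target_hamiltonian := h₁.target_hamiltonian.prod h₂.target_hamiltonian
  submersion := FibreProduct.isSubmersion_proj
  interior := FibreProduct.isInteriorPoint
  proj_invariant k q := h₁.proj_invariant (k.1, k.2.2.1) q.incl.1
  smooth_moment := contMDiff_combine
    (h₁.smooth_moment.comp (contMDiff_fst.comp FibreProduct.contMDiff_incl))
    (h₂.smooth_moment.comp (contMDiff_snd.comp FibreProduct.contMDiff_incl))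
    fun q => (h₁.proj_moment _).trans
      ((congrArg Subtype.val q.incl_eq).trans (h₂.proj_moment _).symm)
  moment_equivariant k q :=
    (congrArg₂ combine (h₁.moment_equivariant (k.1, k.2.2.1) q.incl.1)
      (h₂.moment_equivariant (k.2.1, k.2.2.2) q.incl.2)).trans (combine_adjoint k _ _)
  proj_moment q := (proj_combine _ _).trans (h₁.proj_moment q.incl.1)
  smooth_bivector := FibreProduct.isSmoothField_of_pushforward_incl h₁.smooth_bivector
    h₂.smooth_bivector hP
  bivector_vertical := FibreProduct.vertical_of_pushforward_incl h₁.contMDiff_coe_proj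
    h₁.bivector_vertical hP
  smooth_trivector := (isSmoothField_cartanField _ _).smul
    ((h₁.contMDiff_coe_proj.comp (contMDiff_fst.comp FibreProduct.contMDiff_incl)).pow 2)
  trivector_vertical q α β := by
    have hs : ContMDiff (halfModel (n₁ + n₂)) 𝓘(ℝ, ℝ) ∞
        (fun q : FibreProduct D₁.proj D₂.proj => (q.proj : ℝ)) :=
      h₁.contMDiff_coe_proj.comp (contMDiff_fst.comp FibreProduct.contMDiff_incl)
    have e := (D₁.action.fibreProduct D₂.action h₁.proj_invariant
      h₂.proj_invariant).orbit_differential_of_invariant hs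
        (fun k q => congrArg Subtype.val (h₁.proj_invariant (k.1, k.2.2.1) q.incl.1)) q
    have e2 : cartanField (BG.prod (BG.prod (B₁.prod B₂))) (D₁.action.fibreProduct D₂.action
        h₁.proj_invariant h₂.proj_invariant) q ![differential (halfModel (n₁ + n₂))
          (fun p : FibreProduct D₁.proj D₂.proj => (p.proj : ℝ)) q, α, β] = 0 := by
      rw [cartanField_apply, e, InvariantForm.cartan_zero_left, mul_zero]
    exact (congrArg (fun y => (q.proj : ℝ) ^ 2 * y) e2).trans (mul_zero _)
  fibre t ht ht1 := by
    obtain ⟨Φ₁, hΦ₁, k₁, e₁, -, μ₁⟩ := h₁.fibre t ht ht1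
    obtain ⟨Φ₂, hΦ₂, k₂, e₂, -, μ₂⟩ := h₂.fibre t ht ht1
    have heq : ∀ k m, FibreProduct.fibreMap hΦ₁ hΦ₂ ((X₁.action.prod X₂.action).act k m) =
        (D₁.action.fibreProduct D₂.action h₁.proj_invariant h₂.proj_invariant).act k
          (FibreProduct.fibreMap hΦ₁ hΦ₂ m) :=
      fun k m => FibreProduct.ext_incl (Prod.ext (k₁ _ _) (k₂ _ _))
    refine ⟨FibreProduct.fibreMap hΦ₁ hΦ₂, FibreProduct.isFibreDiffeo_fibreMap hΦ₁ hΦ₂, heq,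
      fun m => ?_, fun m => ?_, fun m => ?_⟩
    · exact pushforward_injective (FibreProduct.mfderiv_incl_injective _)
        ((hP _).trans (FibreProduct.prodBivector_fibreMap hΦ₁ hΦ₂ t e₁ e₂ m).symm)
    · refine (congrArg₂ (fun (c : ℝ) T => c ^ 2 • T) (hΦ₁.proj_eq m.1)
        (cartanField_of_equivariant (X₁.action.prod X₂.action) _ (BG.prod (BG.prod (B₁.prod B₂)))
          (FibreProduct.contMDiff_fibreMap hΦ₁ hΦ₂) heq m))
    · exact (congrArg₂ combine (μ₁ m.1) (μ₂ m.2)).trans (combine_unit _ _ _ _)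
  fibre_zero := by
    obtain ⟨Φ₁, hΦ₁, k₁, e₁, μ₁⟩ := h₁.fibre_zero
    obtain ⟨Φ₂, hΦ₂, k₂, e₂, μ₂⟩ := h₂.fibre_zero
    refine ⟨FibreProduct.fibreMap hΦ₁ hΦ₂, FibreProduct.isFibreDiffeo_fibreMap hΦ₁ hΦ₂,
      fun k m => FibreProduct.ext_incl (Prod.ext (k₁ _ _) (k₂ _ _)), fun m => ?_, fun m => ?_⟩
    · refine (pushforward_injective (FibreProduct.mfderiv_incl_injective _)
        ((hP _).trans (FibreProduct.prodBivector_fibreMap hΦ₁ hΦ₂ 1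
          (fun m => (e₁ m).trans (one_smul ℝ _).symm)
          (fun m => (e₂ m).trans (one_smul ℝ _).symm) m).symm)).trans (one_smul ℝ _)
    · exact (congrArg₂ combine (μ₁ m.1) (μ₂ m.2)).trans (combine_lie _ _)
  trivector_zero q hq := by
    change (q.proj : ℝ) = 0 at hq
    change (q.proj : ℝ) ^ 2 • cartanField _ _ q = 0
    rw [hq, zero_pow two_ne_zero, zero_smul]

end ProductDeformation

/-- The fusion product of two quasi-Poisson manifolds admits a Poisson deformation: the internal
fusion of the fibre product over `[0, 1]` of the deformations of the factors. -/
theorem AdmitsPoissonDeformation.fusionProduct {EG HG G E₁ HH₁ H₁ E₂ HH₂ H₂ : Type*}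
    [NormedAddCommGroup EG] [NormedSpace ℝ EG] [TopologicalSpace HG]
    {JG : ModelWithCorners ℝ EG HG} [TopologicalSpace G] [ChartedSpace HG G] [Group G]
    [NormedAddCommGroup E₁] [NormedSpace ℝ E₁] [TopologicalSpace HH₁]
    {J₁ : ModelWithCorners ℝ E₁ HH₁} [TopologicalSpace H₁] [ChartedSpace HH₁ H₁] [Group H₁]
    [NormedAddCommGroup E₂] [NormedSpace ℝ E₂] [TopologicalSpace HH₂]
    {J₂ : ModelWithCorners ℝ E₂ HH₂} [TopologicalSpace H₂] [ChartedSpace HH₂ H₂] [Group H₂]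
    [FiniteDimensional ℝ EG] [FiniteDimensional ℝ E₁] [FiniteDimensional ℝ E₂]
    [JG.Boundaryless] [J₁.Boundaryless] [J₂.Boundaryless]
    [LieGroup JG ∞ G] [LieGroup J₁ ∞ H₁] [LieGroup J₂ ∞ H₂]
    {BG : InvariantForm JG G} {B₁ : InvariantForm J₁ H₁} {B₂ : InvariantForm J₂ H₂}
    {F₁ A₁ F₂ A₂ F₁' A₁' F₂' A₂' : Type*} {M₁ M₂ N₁ N₂ : Type u}
    [NormedAddCommGroup F₁] [NormedSpace ℝ F₁] [TopologicalSpace A₁]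
    {I₁ : ModelWithCorners ℝ F₁ A₁} [TopologicalSpace M₁] [ChartedSpace A₁ M₁]
    [NormedAddCommGroup F₂] [NormedSpace ℝ F₂] [TopologicalSpace A₂]
    {I₂ : ModelWithCorners ℝ F₂ A₂} [TopologicalSpace M₂] [ChartedSpace A₂ M₂]
    [NormedAddCommGroup F₁'] [NormedSpace ℝ F₁'] [TopologicalSpace A₁']
    {I₁' : ModelWithCorners ℝ F₁' A₁'} [TopologicalSpace N₁] [ChartedSpace A₁' N₁]
    [NormedAddCommGroup F₂'] [NormedSpace ℝ F₂'] [TopologicalSpace A₂']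
    {I₂' : ModelWithCorners ℝ F₂' A₂'} [TopologicalSpace N₂] [ChartedSpace A₂' N₂]
    [FiniteDimensional ℝ F₁] [FiniteDimensional ℝ F₂] [IsManifold I₁ ∞ M₁]
    [IsManifold I₂ ∞ M₂] [T2Space M₁] [T2Space M₂] [BoundarylessManifold I₁ M₁]
    [BoundarylessManifold I₂ M₂]
    [FiniteDimensional ℝ F₁'] [FiniteDimensional ℝ F₂'] [IsManifold I₁' ∞ N₁]
    [IsManifold I₂' ∞ N₂] [T2Space N₁] [T2Space N₂] [BoundarylessManifold I₁' N₁]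
    [BoundarylessManifold I₂' N₂]
    {X₁ : QPSpace (JG.prod J₁) (G × H₁) I₁ M₁} {X₂ : QPSpace (JG.prod J₂) (G × H₂) I₂ M₂}
    {Y₁ : PSpace (JG.prod J₁) (G × H₁) I₁' N₁} {Y₂ : PSpace (JG.prod J₂) (G × H₂) I₂' N₂}
    (h₁ : AdmitsPoissonDeformation (BG.prod B₁) X₁ Y₁)
    (h₂ : AdmitsPoissonDeformation (BG.prod B₂) X₂ Y₂) :
    AdmitsPoissonDeformation (BG.prod (B₁.prod B₂)) (X₁.fusionProduct BG X₂)
      (Y₁.diagonalProduct Y₂) := by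
  obtain ⟨n₁, Q₁, _, _, _, _, _, D₁, h₁⟩ := h₁
  obtain ⟨n₂, Q₂, _, _, _, _, _, D₂, h₂⟩ := h₂
  have := h₁.hasAdaptedCharts
  have := h₂.hasAdaptedCharts
  choose P hP using h₁.exists_bivector h₂
  exact ⟨n₁ + n₂, FibreProduct D₁.proj D₂.proj, inferInstance, inferInstance, inferInstance,
    inferInstance, inferInstance, _, (h₁.fibreProduct h₂ hP).fuse⟩

end QuasiPoisson

end

theorem mainTheorem6
    {EG HG G : Type*} [NormedAddCommGroup EG] [NormedSpace ℝ EG] [FiniteDimensional ℝ EG]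
    [TopologicalSpace HG] {JG : ModelWithCorners ℝ EG HG} [JG.Boundaryless]
    [TopologicalSpace G] [ChartedSpace HG G] [Group G] [LieGroup JG ∞ G] [CompactSpace G]
    (BG : QuasiPoisson.InvariantForm JG G) :
    (∀ {EH HH H : Type*} [NormedAddCommGroup EH] [NormedSpace ℝ EH] [FiniteDimensional ℝ EH]
      [TopologicalSpace HH] {JH : ModelWithCorners ℝ EH HH} [JH.Boundaryless]
      [TopologicalSpace H] [ChartedSpace HH H] [Group H] [LieGroup JH ∞ H] [CompactSpace H]
      (BH : QuasiPoisson.InvariantForm JH H)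
      {F A M : Type*} [NormedAddCommGroup F] [NormedSpace ℝ F] [FiniteDimensional ℝ F]
      [TopologicalSpace A] {I : ModelWithCorners ℝ F A}
      [TopologicalSpace M] [T2Space M] [SecondCountableTopology M] [ChartedSpace A M]
      [IsManifold I ∞ M] [BoundarylessManifold I M]
      {F' A' N : Type*} [NormedAddCommGroup F'] [NormedSpace ℝ F'] [FiniteDimensional ℝ F']
      [TopologicalSpace A'] {I' : ModelWithCorners ℝ F' A'}
      [TopologicalSpace N] [T2Space N] [SecondCountableTopology N] [ChartedSpace A' N]
      [IsManifold I' ∞ N] [BoundarylessManifold I' N]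
      {n : ℕ} {Q : Type*} [TopologicalSpace Q] [T2Space Q] [SecondCountableTopology Q]
      [ChartedSpace (QuasiPoisson.HalfSpace n) Q] [IsManifold (QuasiPoisson.halfModel n) ∞ Q]
      (X : QuasiPoisson.QPSpace (JG.prod (JG.prod JH)) (G × G × H) I M)
      (Y : QuasiPoisson.PSpace (JG.prod (JG.prod JH)) (G × G × H) I' N)
      (D : QuasiPoisson.PoissonFamily (JG.prod (JG.prod JH)) (G × G × H) n Q),
      QuasiPoisson.IsPoissonDeformation (BG.prod (BG.prod BH)) D X Y →
      QuasiPoisson.IsPoissonDeformation (BG.prod BH) (D.fuse BG BH) (X.fuse BG) Y.fuse) ∧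
    (∀ {E₁ HH₁ H₁ : Type*} [NormedAddCommGroup E₁] [NormedSpace ℝ E₁] [FiniteDimensional ℝ E₁]
      [TopologicalSpace HH₁] {J₁ : ModelWithCorners ℝ E₁ HH₁} [J₁.Boundaryless]
      [TopologicalSpace H₁] [ChartedSpace HH₁ H₁] [Group H₁] [LieGroup J₁ ∞ H₁] [CompactSpace H₁]
      (B₁ : QuasiPoisson.InvariantForm J₁ H₁)
      {E₂ HH₂ H₂ : Type*} [NormedAddCommGroup E₂] [NormedSpace ℝ E₂] [FiniteDimensional ℝ E₂]
      [TopologicalSpace HH₂] {J₂ : ModelWithCorners ℝ E₂ HH₂} [J₂.Boundaryless]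
      [TopologicalSpace H₂] [ChartedSpace HH₂ H₂] [Group H₂] [LieGroup J₂ ∞ H₂] [CompactSpace H₂]
      (B₂ : QuasiPoisson.InvariantForm J₂ H₂)
      {F₁ A₁ F₂ A₂ F₁' A₁' F₂' A₂' : Type*} {M₁ M₂ N₁ N₂ : Type u}
      [NormedAddCommGroup F₁] [NormedSpace ℝ F₁] [FiniteDimensional ℝ F₁]
      [TopologicalSpace A₁] {I₁ : ModelWithCorners ℝ F₁ A₁}
      [TopologicalSpace M₁] [T2Space M₁] [SecondCountableTopology M₁] [ChartedSpace A₁ M₁]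
      [IsManifold I₁ ∞ M₁] [BoundarylessManifold I₁ M₁]
      [NormedAddCommGroup F₂] [NormedSpace ℝ F₂] [FiniteDimensional ℝ F₂]
      [TopologicalSpace A₂] {I₂ : ModelWithCorners ℝ F₂ A₂}
      [TopologicalSpace M₂] [T2Space M₂] [SecondCountableTopology M₂] [ChartedSpace A₂ M₂]
      [IsManifold I₂ ∞ M₂] [BoundarylessManifold I₂ M₂]
      [NormedAddCommGroup F₁'] [NormedSpace ℝ F₁'] [FiniteDimensional ℝ F₁']
      [TopologicalSpace A₁'] {I₁' : ModelWithCorners ℝ F₁' A₁'}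
      [TopologicalSpace N₁] [T2Space N₁] [SecondCountableTopology N₁] [ChartedSpace A₁' N₁]
      [IsManifold I₁' ∞ N₁] [BoundarylessManifold I₁' N₁]
      [NormedAddCommGroup F₂'] [NormedSpace ℝ F₂'] [FiniteDimensional ℝ F₂']
      [TopologicalSpace A₂'] {I₂' : ModelWithCorners ℝ F₂' A₂'}
      [TopologicalSpace N₂] [T2Space N₂] [SecondCountableTopology N₂] [ChartedSpace A₂' N₂]
      [IsManifold I₂' ∞ N₂] [BoundarylessManifold I₂' N₂]
      (X₁ : QuasiPoisson.QPSpace (JG.prod J₁) (G × H₁) I₁ M₁)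
      (X₂ : QuasiPoisson.QPSpace (JG.prod J₂) (G × H₂) I₂ M₂)
      (Y₁ : QuasiPoisson.PSpace (JG.prod J₁) (G × H₁) I₁' N₁)
      (Y₂ : QuasiPoisson.PSpace (JG.prod J₂) (G × H₂) I₂' N₂),
      QuasiPoisson.AdmitsPoissonDeformation (BG.prod B₁) X₁ Y₁ →
      QuasiPoisson.AdmitsPoissonDeformation (BG.prod B₂) X₂ Y₂ →
      QuasiPoisson.AdmitsPoissonDeformation (BG.prod (B₁.prod B₂))
        (X₁.fusionProduct BG X₂) (Y₁.diagonalProduct Y₂)) := by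
  refine ⟨?_, ?_⟩
  · intros
    exact QuasiPoisson.IsPoissonDeformation.fuse ‹_›
  · intros
    exact QuasiPoisson.AdmitsPoissonDeformation.fusionProduct ‹_› ‹_›
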